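/- **Setting.** Let $(\Omega,\mathcal F,(\mathcal F_t)_{t\ge 0},P)$ be a filtered probability space, let $V_0,\dots,V_{d_1}:\mathbb R^N\to\mathbb R^N$ and $h_1,\dots,h_{d_2}:\mathbb R^N\to\mathbb R$ be $C_b^\infty$ (smooth and bounded, with bounded derivatives of all orders), and let $B$ and $Y$ be standard $(\mathcal F_t)$-Brownian motions of dimensions $d_1$ and $d_2$. For every $x\in\mathbb R^N$ let $X^x$ be a continuous adapted solution of the Stratonovich equation $dX_t=V_0(X_t)\,dt+\sum_{i=1}^{d_1}V_i(X_t)\circ dB^i_t$, $X_0=x$ (equivalently, of the Itô equation with drift $V_0+\frac12\sum_i DV_i\,V_i$). Put $P_t\varphi(x)=\mathbb E[\varphi(X_t^x)]$ and $A=V_0+\frac12\sum_{i=1}^{d_1}V_i^2$, where a vector field $W$ acts on functions by $W\varphi(x)=D\varphi(x)\,W(x)$. **Notation.** A *word* is a finite sequence with entries in $\{1,\dots,d_2\}$; $|w|$ is its length and $*$ is concatenation. For a word $\bar\imath=(i_1,\dots,i_m)$ and $s\le t$ let $$R^{m,\bar\imath}_{s,t}(\varphi)(x)=\int_s^t\int_s^{t_m}\!\!\cdots\int_s^{t_2}P_{t_1-s}\bigl(h_{i_1}P_{t_2-t_1}(\cdots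 h_{i_m}P_{t-t_m}\varphi)\bigr)(x)\,dY^{i_1}_{t_1}\cdots dY^{i_m}_{t_m}$$ (iterated Itô integrals), and let $q^{\bar\imath}_{s,t}(Y)=\int_s^t\int_s^{t_m}\cdots\int_s^{t_2}dY^{i_1}_{t_1}\cdots dY^{i_m}_{t_m}$, in the version that is continuous in $t$. For $k,p\ge1$ let $\Theta_k(p)$ be the real linear span of the products $\prod_{l=1}^r q^{w_l}_{s,t_{\sigma(l)}}(Y)$, regarded as functions of $s$, $(t_1,\dots,t_k)$ and $\omega$, where $\sigma(l)\in\{1,\dots,k\}$ and $w_1,\dots,w_r$ are non-empty words with $\sum_l|w_l|=p$ (elements of degree $p$). For a word $w=(w_1,\dots,w_n)$ let $h_w=h_{w_1}\cdots h_{w_n}$, $$\Phi_w\varphi=h_w\varphi,\qquad \Psi_w\varphi=A(h_w)\,\varphi+\sum_{i=1}^{d_1}V_i(h_w)\,V_i\varphi,$$ and let $\Gamma_w$ be the set consisting of $\Phi_w$, $\Psi_w$ and all $\Psi_u\Phi_v$ with $u,v$ non-empty and $u*v=w$. Let $\Delta^k_{s,t}=\{s<t_1<\dots<t_k<t\}$.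 **Proposition.** Let $m\ge1$ and let $\bar\imath=(i_1,\dots,i_m)$ be a word of length $m$. The iterated integrals $q^w_{s,t}(Y)$ exist for all words $w$, with continuous paths in $t$. For every decomposition $\mathbf j$: $\bar\imath=\bar j_1*\dots*\bar j_k$ of $\bar\imath$ into non-empty words ($1\le k\le m$) there are finite index sets $M_{\mathbf j}$, $M'_{\mathbf j}$ and * for each $\nu\in M_{\mathbf j}$: operators $\bar\Phi^\nu_p\in\Gamma_{\bar j_p}$ $(1\le p\le k)$ and $a^{\mathbf j,\nu}\in\Theta_1(p_\nu)$, $b^{\mathbf j,\nu}\in\Theta_k(p'_\nu)$ with $p_\nu,p'_\nu\ge1$, $p_\nu+p'_\nu=m$; * for each $\nu\in M'_{\mathbf j}$: operators $\hat\Phi^\nu_p\in\Gamma_{\bar j_p}$ $(1\le p\le k)$ and $c^{\mathbf j,\nu}\in\Theta_k(m)$, none of which depends on $\varphi,x,s,t$, such that for all $\varphi\in C_b^\infty(\mathbb R^N)$, $x\in\mathbb R^N$ and $0\le s\le t$ the multiple Itô integral $R^{m,\bar\imath}_{s,t}(\varphi)(x)$ exists and, almost surely, all the Riemann (Lebesgue)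 integrals below converge absolutely and $$\begin{aligned}R^{m,\bar\imath}_{s,t}(\varphi)(x)={}&P_{t-s}(h_{i_1}\cdots h_{i_m}\varphi)(x)\,q^{\bar\imath}_{s,t}(Y)\\&+\sum_{\mathbf j}\sum_{\nu\in M_{\mathbf j}}a^{\mathbf j,\nu}_{(s,t)}(Y)\int_{\Delta^k_{s,t}}b^{\mathbf j,\nu}_{(s,t_1,\dots,t_k)}(Y)\,\bar R^{\mathbf j,\nu}_{(s,t_1,\dots,t_k,t)}(\varphi)(x)\,dt_1\cdots dt_k\\&+\sum_{\mathbf j}\sum_{\nu\in M'_{\mathbf j}}\int_{\Delta^k_{s,t}}c^{\mathbf j,\nu}_{(s,t_1,\dots,t_k)}(Y)\,\hat R^{\mathbf j,\nu}_{(s,t_1,\dots,t_k,t)}(\varphi)(x)\,dt_1\cdots dt_k,\end{aligned}$$ where $$\bar R^{\mathbf j,\nu}_{(s,t_1,\dots,t_k,t)}(\varphi)=P_{t_1-s}\bigl(\bar\Phi^\nu_1P_{t_2-t_1}(\cdots\bar\Phi^\nu_kP_{t-t_k}\varphi)\bigr),$$ and $\hat R^{\mathbf j,\nu}$ is defined in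 the same way with $\hat\Phi^\nu_p$ in place of $\bar\Phi^\nu_p$. -/

import Mathlib

open MeasureTheory ProbabilityTheory Filter Topology
open scoped NNReal ENNReal

noncomputable section

/-! ### Test functions, vector fields and the generator -/

/-- The class `C_b^∞`: smooth, bounded, with bounded derivatives of all orders. -/
def IsCbSmooth {E F : Type*} [NormedAddCommGroup E] [NormedSpace ℝ E]
    [NormedAddCommGroup F] [NormedSpace ℝ F] (f : E → F) : Prop :=
  ContDiff ℝ (⊤ : ℕ∞) f ∧ ∀ n : ℕ, ∃ C : ℝ, ∀ x, ‖iteratedFDeriv ℝ n f x‖ ≤ C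

/-- The state space `ℝ^N`. -/
abbrev StateSpace (N : ℕ) : Type := EuclideanSpace ℝ (Fin N)

/-- A vector field `W` acting on functions as a first order differential operator. -/
def vectorFieldDeriv {N : ℕ} (W : StateSpace N → StateSpace N) (f : StateSpace N → ℝ) :
    StateSpace N → ℝ :=
  fun x => fderiv ℝ f x (W x)

/-- The generator `A = V₀ + ½ ∑ Vᵢ²`. -/
def signalGenerator {N d₁ : ℕ} (V₀ : StateSpace N → StateSpace N)
    (V : Fin d₁ → StateSpace N → StateSpace N) (f : StateSpace N → ℝ) : StateSpace N → ℝ :=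
  fun x => vectorFieldDeriv V₀ f x +
    (1 / 2) * ∑ i, vectorFieldDeriv (V i) (vectorFieldDeriv (V i) f) x

/-! ### Brownian motion and the Itô integral -/

/-- `B` is a standard `d`-dimensional Brownian motion with respect to the filtration `𝓕`. -/
structure IsFiltrationBrownian {Ω : Type*} {mΩ : MeasurableSpace Ω} (μ : Measure Ω)
    (𝓕 : Filtration ℝ≥0 mΩ) {d : ℕ} (B : Fin d → ℝ≥0 → Ω → ℝ) : Prop where
  brownian : ∀ i, IsBrownianReal (B i) μ
  indep_coord : iIndepFun (fun i ω (t : ℝ≥0) => B i t ω) μ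
  adapted : ∀ i, StronglyAdapted 𝓕 (B i)
  indep_past : ∀ s t : ℝ≥0, s ≤ t →
    Indep (MeasurableSpace.comap (fun ω (i : Fin d) => B i t ω - B i s ω) inferInstance)
      (𝓕 s) μ

/-- A bounded simple `𝓕`-adapted process on `(a, b]`: a subdivision
`a = t₀ ≤ t₁ ≤ … ≤ tₙ = b` and bounded `𝓕 tₖ`-measurable coefficients `ξₖ`. -/
structure SimpleIntegrand {Ω : Type*} {mΩ : MeasurableSpace Ω} (𝓕 : Filtration ℝ≥0 mΩ)
    (a b : ℝ≥0) where
  n : ℕ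
  time : ℕ → ℝ≥0
  mono : Monotone time
  time_zero : time 0 = a
  time_last : time n = b
  coeff : ℕ → Ω → ℝ
  measurable_coeff : ∀ k, StronglyMeasurable[𝓕 (time k)] (coeff k)
  bounded_coeff : ∃ C : ℝ, ∀ k ω, |coeff k ω| ≤ C

/-- The process `∑ ξₖ 1_{(tₖ, tₖ₊₁]}`. -/
def SimpleIntegrand.value {Ω : Type*} {mΩ : MeasurableSpace Ω} {𝓕 : Filtration ℝ≥0 mΩ}
    {a b : ℝ≥0} (S : SimpleIntegrand 𝓕 a b) (r : ℝ≥0) (ω : Ω) : ℝ :=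
  ∑ k ∈ Finset.range S.n,
    (Set.Ioc (S.time k) (S.time (k + 1))).indicator (fun _ => S.coeff k ω) r

/-- The elementary stochastic integral `∑ ξₖ (W_{tₖ₊₁} - W_{tₖ})`. -/
def SimpleIntegrand.integral {Ω : Type*} {mΩ : MeasurableSpace Ω} {𝓕 : Filtration ℝ≥0 mΩ}
    {a b : ℝ≥0} (S : SimpleIntegrand 𝓕 a b) (W : ℝ≥0 → Ω → ℝ) (ω : Ω) : ℝ :=
  ∑ k ∈ Finset.range S.n, S.coeff k ω * (W (S.time (k + 1)) ω - W (S.time k) ω)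

/-- `I` is (a version of) the Itô integral `∫_a^b H dW`: the `L²`-limit of the elementary
integrals of simple processes that converge to `H` in `L²(dr ⊗ μ)` on `(a, b]`. -/
def IsItoIntegral {Ω : Type*} {mΩ : MeasurableSpace Ω} (μ : Measure Ω)
    (𝓕 : Filtration ℝ≥0 mΩ) (W H : ℝ≥0 → Ω → ℝ) (a b : ℝ≥0) (I : Ω → ℝ) : Prop :=
  MemLp I 2 μ ∧ ∃ S : ℕ → SimpleIntegrand 𝓕 a b,
    Tendsto (fun n => ∫⁻ r in Set.Ioc (a : ℝ) b,
        ∫⁻ ω, ‖(S n).value r.toNNReal ω - H r.toNNReal ω‖ₑ ^ 2 ∂μ) atTop (𝓝 0) ∧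
    Tendsto (fun n => eLpNorm (fun ω => (S n).integral W ω - I ω) 2 μ) atTop (𝓝 0)

open scoped Classical in
/-- The Itô integral `∫_a^b H dW` as a random variable (defined up to null sets). -/
def itoIntegral {Ω : Type*} {mΩ : MeasurableSpace Ω} (μ : Measure Ω)
    (𝓕 : Filtration ℝ≥0 mΩ) (W H : ℝ≥0 → Ω → ℝ) (a b : ℝ≥0) : Ω → ℝ :=
  if hI : ∃ I, IsItoIntegral μ 𝓕 W H a b I then hI.choose else 0

/-- `J` is a version of the Itô integral process `t ↦ ∫_a^t H dW`, `t ≥ a`, all of whose paths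
are continuous. -/
def IsItoProcess {Ω : Type*} {mΩ : MeasurableSpace Ω} (μ : Measure Ω)
    (𝓕 : Filtration ℝ≥0 mΩ) (W H : ℝ≥0 → Ω → ℝ) (a : ℝ≥0) (J : ℝ≥0 → Ω → ℝ) : Prop :=
  (∀ ω, Continuous fun t => J t ω) ∧ ∀ t, a ≤ t → IsItoIntegral μ 𝓕 W H a t (J t)

open scoped Classical in
/-- The continuous Itô integral process `t ↦ ∫_a^t H dW` (defined up to indistinguishability
on `[a, ∞)`). -/
def itoProcess {Ω : Type*} {mΩ : MeasurableSpace Ω} (μ : Measure Ω)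
    (𝓕 : Filtration ℝ≥0 mΩ) (W H : ℝ≥0 → Ω → ℝ) (a : ℝ≥0) : ℝ≥0 → Ω → ℝ :=
  if hJ : ∃ J, IsItoProcess μ 𝓕 W H a J then hJ.choose else 0

/-! ### The signal and its semigroup -/

/-- The drift `V₀ + ½ ∑ DVᵢ Vᵢ` of the Itô form of the Stratonovich equation
`dX = V₀(X) dt + ∑ Vᵢ(X) ∘ dBⁱ`. -/
def itoDrift {N d₁ : ℕ} (V₀ : StateSpace N → StateSpace N)
    (V : Fin d₁ → StateSpace N → StateSpace N) (x : StateSpace N) : StateSpace N :=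
  V₀ x + (1 / 2 : ℝ) • ∑ i, fderiv ℝ (V i) x (V i x)

/-- For every starting point `x`, the process `X x` is an adapted continuous solution of
`dX = V₀(X) dt + ∑ Vᵢ(X) ∘ dBⁱ`, `X₀ = x`, written in Itô form and in coordinates. -/
structure IsSignal {Ω : Type*} {mΩ : MeasurableSpace Ω} (μ : Measure Ω)
    (𝓕 : Filtration ℝ≥0 mΩ) {N d₁ : ℕ} (V₀ : StateSpace N → StateSpace N)
    (V : Fin d₁ → StateSpace N → StateSpace N) (B : Fin d₁ → ℝ≥0 → Ω → ℝ)
    (X : StateSpace N → ℝ≥0 → Ω → StateSpace N) : Prop where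
  adapted : ∀ x, StronglyAdapted 𝓕 (X x)
  continuous : ∀ x, ∀ᵐ ω ∂μ, Continuous fun t => X x t ω
  equation : ∀ x t (l : Fin N), ∀ᵐ ω ∂μ,
    X x t ω l = x l + (∫ r in (0 : ℝ)..t, itoDrift V₀ V (X x r.toNNReal ω) l) +
      ∑ i, itoIntegral μ 𝓕 (B i) (fun r ω' => V i (X x r ω') l) 0 t ω

/-- The semigroup `P_t φ (x) = E[φ(X_t^x)]`. -/
def signalSemigroup {Ω : Type*} {mΩ : MeasurableSpace Ω} (μ : Measure Ω) {N : ℕ}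
    (X : StateSpace N → ℝ≥0 → Ω → StateSpace N) (t : ℝ≥0) (φ : StateSpace N → ℝ) :
    StateSpace N → ℝ :=
  fun x => ∫ ω, φ (X x t ω) ∂μ

/-! ### The operators `Φ`, `Ψ` and the kernels -/

/-- Operators acting on functions on `ℝ^N`. -/
abbrev FunOp (N : ℕ) : Type := (StateSpace N → ℝ) → StateSpace N → ℝ

/-- The product `h_{i₁} ⋯ h_{iₖ}` along the word `w = (i₁, …, iₖ)`. -/
def wordProd {N d₂ : ℕ} (h : Fin d₂ → StateSpace N → ℝ) (w : List (Fin d₂)) :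
    StateSpace N → ℝ :=
  fun x => (w.map fun i => h i x).prod

/-- `Φ_w φ = h_{i₁} ⋯ h_{iₖ} φ`. -/
def opPhi {N d₂ : ℕ} (h : Fin d₂ → StateSpace N → ℝ) (w : List (Fin d₂)) : FunOp N :=
  fun φ x => wordProd h w x * φ x

/-- `Ψ_w φ = A(h_{i₁} ⋯ h_{iₖ}) φ + ∑ᵢ Vᵢ(h_{i₁} ⋯ h_{iₖ}) Vᵢ φ`. -/
def opPsi {N d₁ d₂ : ℕ} (V₀ : StateSpace N → StateSpace N)
    (V : Fin d₁ → StateSpace N → StateSpace N) (h : Fin d₂ → StateSpace N → ℝ)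
    (w : List (Fin d₂)) : FunOp N :=
  fun φ x => signalGenerator V₀ V (wordProd h w) x * φ x +
    ∑ i, vectorFieldDeriv (V i) (wordProd h w) x * vectorFieldDeriv (V i) φ x

/-- The set `Γ_w`: the operators `Φ_w`, `Ψ_w`, and `Ψ_u Φ_v` for the splittings `w = u * v` into
two non-empty words. -/
def opGamma {N d₁ d₂ : ℕ} (V₀ : StateSpace N → StateSpace N)
    (V : Fin d₁ → StateSpace N → StateSpace N) (h : Fin d₂ → StateSpace N → ℝ)
    (w : List (Fin d₂)) : Set (FunOp N) :=
  {opPhi h w, opPsi V₀ V h w} ∪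
    {T | ∃ u v : List (Fin d₂), u ≠ [] ∧ v ≠ [] ∧ u ++ v = w ∧
      T = opPsi V₀ V h u ∘ opPhi h v}

/-- The kernel `P_{τ₁-s} Θ₁ P_{τ₂-τ₁} Θ₂ ⋯ Θₖ P_{t-τₖ} φ`. -/
def kernelOp {N : ℕ} (P : ℝ≥0 → FunOp N) (s : ℝ≥0) :
    (k : ℕ) → (Fin k → FunOp N) → (Fin k → ℝ≥0) → ℝ≥0 → FunOp N
  | 0, _, _, t => P (t - s)
  | k + 1, T, τ, t => fun φ =>
      kernelOp P s k (Fin.init T) (Fin.init τ) (τ (Fin.last k))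
        (T (Fin.last k) (P (t - τ (Fin.last k)) φ))

/-! ### Iterated Itô integrals -/

/-- The iterated Itô integral of a deterministic kernel `K(t₁, …, tₘ)`,
`∫_s^t ∫_s^{tₘ} ⋯ ∫_s^{t₂} K(t₁, …, tₘ) dY^{i₁}_{t₁} ⋯ dY^{iₘ}_{tₘ}`. -/
def iteratedIto {Ω : Type*} {mΩ : MeasurableSpace Ω} (μ : Measure Ω) (𝓕 : Filtration ℝ≥0 mΩ)
    {d₂ : ℕ} (Y : Fin d₂ → ℝ≥0 → Ω → ℝ) (s : ℝ≥0) :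
    (m : ℕ) → (Fin m → Fin d₂) → ((Fin m → ℝ≥0) → ℝ) → ℝ≥0 → Ω → ℝ
  | 0, _, K, _ => fun _ => K ![]
  | m + 1, ι, K, t =>
      itoIntegral μ 𝓕 (Y (ι (Fin.last m)))
        (fun r => iteratedIto μ 𝓕 Y s m (Fin.init ι)
          (fun τ => K (Fin.snoc (α := fun _ => ℝ≥0) τ r)) r) s t

/-- All the Itô integrals that occur in `iteratedIto` exist. -/
def IteratedItoExists {Ω : Type*} {mΩ : MeasurableSpace Ω} (μ : Measure Ω)
    (𝓕 : Filtration ℝ≥0 mΩ) {d₂ : ℕ} (Y : Fin d₂ → ℝ≥0 → Ω → ℝ) (s : ℝ≥0) :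
    (m : ℕ) → (Fin m → Fin d₂) → ((Fin m → ℝ≥0) → ℝ) → ℝ≥0 → Prop
  | 0, _, _, _ => True
  | m + 1, ι, K, t =>
      (∀ r, s ≤ r → r ≤ t → IteratedItoExists μ 𝓕 Y s m (Fin.init ι)
          (fun τ => K (Fin.snoc (α := fun _ => ℝ≥0) τ r)) r) ∧
      IsItoIntegral μ 𝓕 (Y (ι (Fin.last m)))
        (fun r => iteratedIto μ 𝓕 Y s m (Fin.init ι)
          (fun τ => K (Fin.snoc (α := fun _ => ℝ≥0) τ r)) r) s t
        (iteratedIto μ 𝓕 Y s (m + 1) ι K t)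

/-- The iterated Itô integrals `q_{s,t}^{(i₁,…,iₘ)}(Y) = ∫_s^t ⋯ ∫_s^{t₂} dY^{i₁} ⋯ dY^{iₘ}`,
in the version that is continuous in `t`, so that they can be integrated pathwise. -/
def iterQ {Ω : Type*} {mΩ : MeasurableSpace Ω} (μ : Measure Ω) (𝓕 : Filtration ℝ≥0 mΩ)
    {d₂ : ℕ} (Y : Fin d₂ → ℝ≥0 → Ω → ℝ) (s : ℝ≥0) :
    (m : ℕ) → (Fin m → Fin d₂) → ℝ≥0 → Ω → ℝ
  | 0, _ => fun _ _ => 1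
  | m + 1, ι =>
      itoProcess μ 𝓕 (Y (ι (Fin.last m))) (iterQ μ 𝓕 Y s m (Fin.init ι)) s

/-- The kernel `R_{(s,t₁,…,tₘ,t),ι}(φ)(x) = P_{t₁-s}(h_{i₁} P_{t₂-t₁}( ⋯ h_{iₘ} P_{t-tₘ} φ))(x)`
as a function of `t₁, …, tₘ`. -/
def multipleKernel {N d₂ : ℕ} (P : ℝ≥0 → FunOp N) (h : Fin d₂ → StateSpace N → ℝ) {m : ℕ}
    (ι : Fin m → Fin d₂) (s t : ℝ≥0) (φ : StateSpace N → ℝ) (x : StateSpace N)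
    (τ : Fin m → ℝ≥0) : ℝ :=
  kernelOp P s m (fun p ψ y => h (ι p) y * ψ y) τ t φ x

/-- The multiple stochastic integral `R^{m,ι}_{s,t}(φ)(x)`, that is
`∫_s^t ∫_s^{tₘ} ⋯ ∫_s^{t₂} R_{(s,t₁,…,tₘ,t),ι}(φ)(x) dY^{i₁}_{t₁} ⋯ dY^{iₘ}_{tₘ}`. -/
def multipleR {Ω : Type*} {mΩ : MeasurableSpace Ω} (μ : Measure Ω) (𝓕 : Filtration ℝ≥0 mΩ)
    {N d₂ : ℕ} (Y : Fin d₂ → ℝ≥0 → Ω → ℝ) (P : ℝ≥0 → FunOp N)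
    (h : Fin d₂ → StateSpace N → ℝ) {m : ℕ} (ι : Fin m → Fin d₂) (s t : ℝ≥0)
    (φ : StateSpace N → ℝ) (x : StateSpace N) : Ω → ℝ :=
  iteratedIto μ 𝓕 Y s m ι (multipleKernel P h ι s t φ x) t

/-- The space `Θ(deg)` of iterated-integral polynomials of degree `deg`, as functions of the
base point `s`, of times `τ₁, …, τₖ` and of `ω`: the linear span of the products
`∏ᵢ q_{s, τ_{σ(i)}}^{wᵢ}(Y)` with non-empty words `wᵢ` of total length `deg`. -/
def thetaSpace {Ω : Type*} {mΩ : MeasurableSpace Ω} (μ : Measure Ω) (𝓕 : Filtration ℝ≥0 mΩ)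
    {d₂ : ℕ} (Y : Fin d₂ → ℝ≥0 → Ω → ℝ) (k deg : ℕ) :
    Submodule ℝ (ℝ≥0 → (Fin k → ℝ≥0) → Ω → ℝ) :=
  Submodule.span ℝ
    {f | ∃ (r : ℕ) (n : Fin r → ℕ) (w : ∀ i, Fin (n i) → Fin d₂) (σ : Fin r → Fin k),
      (∀ i, 0 < n i) ∧ ∑ i, n i = deg ∧
      f = fun s τ ω => ∏ i, iterQ μ 𝓕 Y s (n i) (w i) (τ (σ i)) ω}

/-! ### Decompositions of a word and Riemann integrals over simplices -/

/-- The `p`-th word `j_p` of the decomposition `ι = j₁ * ⋯ * jₖ` into non-empty words that is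
given by the composition `c` of the length of `ι`. -/
def wordBlock {d₂ m : ℕ} (ι : Fin m → Fin d₂) (c : Composition m) (p : Fin c.length) :
    List (Fin d₂) :=
  List.ofFn fun l => ι (c.embedding p l)

/-- The simplex `s < t₁ < ⋯ < tₖ < t`. -/
def openSimplex (k : ℕ) (s t : ℝ≥0) : Set (Fin k → ℝ) :=
  {τ | StrictMono τ ∧ ∀ i, (s : ℝ) < τ i ∧ τ i < t}

/-- Integrability over the simplex. -/
def SimplexIntegrable (k : ℕ) (s t : ℝ≥0) (f : (Fin k → ℝ≥0) → ℝ) : Prop :=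
  IntegrableOn (fun τ : Fin k → ℝ => f fun i => (τ i).toNNReal) (openSimplex k s t) volume

/-- The integral of `f(t₁, …, tₖ)` over the simplex `s < t₁ < ⋯ < tₖ < t`. -/
def simplexIntegral (k : ℕ) (s t : ℝ≥0) (f : (Fin k → ℝ≥0) → ℝ) : ℝ :=
  ∫ τ in openSimplex k s t, f fun i => (τ i).toNNReal

end

/-!
The representation rests on one formula. If `g` is a product of sensor functions, then
`A (g ψ) = g A ψ + Ψ ψ` with a first order operator `Ψ` (`signalGenerator_mul`), hence
`r ↦ P_{r-a} (g P_{t-r} φ)` is differentiable with derivative `P_{r-a} Ψ P_{t-r} φ`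
(`CbSemigroup.sub_eq_integral`). So a multiplication operator can be moved along the evolution at the
price of a Riemann integral.

Induction on the length of the word. The outermost stochastic integral of `R^{m+1}_{s,t}(φ)` has the
integrand `r ↦ R^m_{s,r}(h_i P_{t-r} φ)`, which by induction is a finite sum of products `Q_r Z_r`,
where `Q` is an iterated integral of `Y` and `Z` has paths of bounded variation. If `J = ∫ Q dY`,
integration by parts gives `∫ Q Z dY = J_t Z_t - ∫ J dZ` (`itoIntegral_ae_eq_sum`). Only pathwise
bounds of `Z` matter here, neither adaptedness nor moments: Riemann sums are summed by parts, and
they converge almost surely along a common subsequence. For the leading term,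
`Z_r = P_{r-s} (h_w P_{t-r} φ)`, and one new term with the operator `Ψ_w` appears (`leadTerm`). For a
term whose `Z_r` is a simplex integral up to time `r`, the factor `h_i` is moved from time `r` to the
last time of the simplex. There it is absorbed by the last operator, which stays in the sets `Γ`, or
it leaves a new operator `Ψ_i` at a new last time (`RepTerm.IsValid.simplexIntegral_mul`). Together
with the two parts of the integration by parts formula these are four terms (`RepTerm.children`),
each of the required form; `exists_representation` is the resulting statement. Coefficients are
polynomials in iterated integrals, so that all integrands over the simplices are continuous and all
Riemann integrals converge. Finally the terms are sorted by the decomposition of the word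
(`exists_composition_wordBlock`) and by whether an iterated integral stands in front.

Two analytic facts are needed. The first is that `P_t` maps `C_b^∞` to itself, locally boundedly in
`t` for every `C^k`-norm, with generator `A` (`cbSemigroup_of_isDiffusion`). It is obtained without
differentiating the flow. The operator `f ↦ ∑ⱼ pⱼ f(x + ε Vⱼ(x) + ε² b(x))` with directions `Vⱼ` of
mean zero approximates the evolution over a time `ε²` up to an error of order `ε³`
(`exists_one_step`, `exists_stepOp_expansion`). Derivatives of its iterates satisfy a recursion with
matrices `1 + ε Lⱼ + ε² Rⱼ`, where `∑ⱼ pⱼ Lⱼ = 0`; hence one step increases the squared `C^k`-norm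
at most by a factor `1 + C ε²` (`exists_jetSq_vecStep_le`), and the iterates are bounded in `C^k` over
bounded times (`exists_bddBy_stepIter`). So they converge to `P_t φ` (`exists_scheme_error`), and the
limit inherits the bounds (`UnifCb.lim`).

The second is a theory of the Itô integral. The integrals of elementary integrands form an isometric
graph between `L²(dt; L²(μ))` and `L²(μ)`, and `itoGraph` is its closure. Integrands that are continuous
as functions with values in `L²(μ)` belong to its domain, their integrals have continuous versions by
Doob's maximal inequality (`exists_isItoProcess`), and they are again such integrands, so that
iterated integrals exist (`exists_isIntegrand_iterQ`, `iterSpec`).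
-/


set_option linter.unusedSectionVars false

/-! ### Partial derivatives and bounded smooth functions -/

section Calculus

variable {N : ℕ}

/-- The `i`-th partial derivative. -/
noncomputable def pd (i : Fin N) (f : StateSpace N → ℝ) : StateSpace N → ℝ :=
  fun x => fderiv ℝ f x (EuclideanSpace.single i 1)

/-- `f` and all its iterated partial derivatives up to order `k` are bounded by `M`. -/
def BddBy : ℕ → ℝ → (StateSpace N → ℝ) → Prop
  | 0, M, f => ∀ x, |f x| ≤ M
  | k + 1, M, f => (∀ x, |f x| ≤ M) ∧ ∀ i, BddBy k M (pd i f)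

/-- Real-valued `C_b^∞` functions, described through iterated partial derivatives. -/
def CbFun (f : StateSpace N → ℝ) : Prop :=
  ContDiff ℝ (⊤ : ℕ∞) f ∧ ∀ k, ∃ M, BddBy k M f

/-- A family of smooth functions that is bounded in every `C^k`-seminorm. -/
def UnifCb {α : Type*} (f : α → StateSpace N → ℝ) : Prop :=
  (∀ a, ContDiff ℝ (⊤ : ℕ∞) (f a)) ∧ ∀ k, ∃ M, ∀ a, BddBy k M (f a)

/-- The `ℓ¹`-norm of a vector. -/
def l1 (v : StateSpace N) : ℝ := ∑ i, |v i|

theorem l1_nonneg (v : StateSpace N) : 0 ≤ l1 v := Finset.sum_nonneg fun _ _ => abs_nonneg _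

theorem l1_smul (c : ℝ) (v : StateSpace N) : l1 (c • v) = |c| * l1 v := by
  simp [l1, abs_mul, Finset.mul_sum]

theorem l1_add_le (v w : StateSpace N) : l1 (v + w) ≤ l1 v + l1 w := by
  simp only [l1, ← Finset.sum_add_distrib]
  exact Finset.sum_le_sum fun i _ => by simpa using abs_add_le (v i) (w i)

theorem fderiv_eq_sum_pd (f : StateSpace N → ℝ) (x v : StateSpace N) :
    fderiv ℝ f x v = ∑ i, v i * pd i f x := by
  have hv : v = ∑ i, v i • (EuclideanSpace.single i (1 : ℝ) : StateSpace N) := by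
    ext j
    simp [Finset.sum_apply, Pi.single_apply]
  conv_lhs => rw [hv]
  simp [pd]

theorem BddBy.abs_le {k : ℕ} {M : ℝ} {f : StateSpace N → ℝ} (hf : BddBy k M f)
    (x : StateSpace N) : |f x| ≤ M := by
  cases k with
  | zero => exact hf x
  | succ k => exact hf.1 x

theorem BddBy.nonneg {k : ℕ} {M : ℝ} {f : StateSpace N → ℝ} (hf : BddBy k M f) : 0 ≤ M :=
  (abs_nonneg _).trans (hf.abs_le 0)

theorem BddBy.mono {k : ℕ} {M M' : ℝ} {f : StateSpace N → ℝ} (hf : BddBy k M f) (hM : M ≤ M') :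
    BddBy k M' f := by
  induction k generalizing f with
  | zero => exact fun x => (hf x).trans hM
  | succ k ih => exact ⟨fun x => (hf.1 x).trans hM, fun i => ih (hf.2 i)⟩

theorem BddBy.of_succ {k : ℕ} {M : ℝ} {f : StateSpace N → ℝ} (hf : BddBy (k + 1) M f) :
    BddBy k M f := by
  induction k generalizing f with
  | zero => exact hf.1
  | succ k ih => exact ⟨hf.1, fun i => ih (hf.2 i)⟩

theorem BddBy.of_le {k l : ℕ} {M : ℝ} {f : StateSpace N → ℝ} (hf : BddBy l M f) (hkl : k ≤ l) :
    BddBy k M f := by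
  induction l, hkl using Nat.le_induction with
  | base => exact hf
  | succ l _ ih => exact ih hf.of_succ

section Smooth

variable {f g : StateSpace N → ℝ}

theorem contDiff_pd (hf : ContDiff ℝ (⊤ : ℕ∞) f) (i : Fin N) : ContDiff ℝ (⊤ : ℕ∞) (pd i f) := by
  have h1 : ContDiff ℝ (⊤ : ℕ∞) (fderiv ℝ f) := hf.fderiv_right (by simp)
  exact h1.clm_apply contDiff_const

theorem smooth_differentiable (hf : ContDiff ℝ (⊤ : ℕ∞) f) : Differentiable ℝ f :=
  hf.differentiable (by simp)

theorem pd_add (hf : ContDiff ℝ (⊤ : ℕ∞) f) (hg : ContDiff ℝ (⊤ : ℕ∞) g) (i : Fin N) :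
    pd i (fun x => f x + g x) = fun x => pd i f x + pd i g x := by
  funext x
  have := fderiv_fun_add (smooth_differentiable hf x) (smooth_differentiable hg x)
  simp [pd, this]

theorem pd_const_mul (hf : ContDiff ℝ (⊤ : ℕ∞) f) (c : ℝ) (i : Fin N) :
    pd i (fun x => c * f x) = fun x => c * pd i f x := by
  funext x
  have := fderiv_const_mul (smooth_differentiable hf x) c
  simp [pd, this]

theorem pd_mul (hf : ContDiff ℝ (⊤ : ℕ∞) f) (hg : ContDiff ℝ (⊤ : ℕ∞) g) (i : Fin N) :
    pd i (fun x => f x * g x) = fun x => pd i f x * g x + f x * pd i g x := by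
  funext x
  have := fderiv_fun_mul (smooth_differentiable hf x) (smooth_differentiable hg x)
  simp [pd, this]
  ring

theorem pd_const (c : ℝ) (i : Fin N) : pd i (fun _ => c) = fun _ => 0 := by
  funext x
  simp [pd]

theorem pd_sum {α : Type*} {s : Finset α} {f : α → StateSpace N → ℝ}
    (hf : ∀ a ∈ s, ContDiff ℝ (⊤ : ℕ∞) (f a)) (i : Fin N) :
    pd i (fun x => ∑ a ∈ s, f a x) = fun x => ∑ a ∈ s, pd i (f a) x := by
  funext x
  have := fderiv_fun_sum (u := s) (A := f) (x := x)
    fun a ha => smooth_differentiable (hf a ha) x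
  simp [pd, this]

theorem BddBy.const (k : ℕ) (c : ℝ) : BddBy k |c| (fun _ : StateSpace N => c) := by
  induction k generalizing c with
  | zero => exact fun _ => le_rfl
  | succ k ih =>
    refine ⟨fun _ => le_rfl, fun i => ?_⟩
    rw [pd_const]
    exact (ih 0).mono (by simp)

theorem BddBy.add {k : ℕ} {M M' : ℝ} (hf : ContDiff ℝ (⊤ : ℕ∞) f) (hg : ContDiff ℝ (⊤ : ℕ∞) g)
    (h : BddBy k M f) (h' : BddBy k M' g) : BddBy k (M + M') (fun x => f x + g x) := by
  induction k generalizing f g with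
  | zero => exact fun x => (abs_add_le _ _).trans (add_le_add (h x) (h' x))
  | succ k ih =>
    refine ⟨fun x => (abs_add_le _ _).trans (add_le_add (h.1 x) (h'.1 x)), fun i => ?_⟩
    rw [pd_add hf hg]
    exact ih (contDiff_pd hf i) (contDiff_pd hg i) (h.2 i) (h'.2 i)

theorem BddBy.const_mul {k : ℕ} {M : ℝ} (hf : ContDiff ℝ (⊤ : ℕ∞) f)
    (h : BddBy k M f) (c : ℝ) : BddBy k (|c| * M) (fun x => c * f x) := by
  induction k generalizing f with
  | zero => exact fun x => by rw [abs_mul]; gcongr; exact h x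
  | succ k ih =>
    refine ⟨fun x => by rw [abs_mul]; gcongr; exact h.1 x, fun i => ?_⟩
    rw [pd_const_mul hf]
    exact ih (contDiff_pd hf i) (h.2 i)

theorem BddBy.sub {k : ℕ} {M M' : ℝ} (hf : ContDiff ℝ (⊤ : ℕ∞) f) (hg : ContDiff ℝ (⊤ : ℕ∞) g)
    (h : BddBy k M f) (h' : BddBy k M' g) : BddBy k (M + M') (fun x => f x - g x) := by
  have := BddBy.add hf (contDiff_const.mul hg) h (h'.const_mul hg (-1))
  simpa [sub_eq_add_neg] using this

theorem BddBy.mul {k : ℕ} {M M' : ℝ} (hf : ContDiff ℝ (⊤ : ℕ∞) f) (hg : ContDiff ℝ (⊤ : ℕ∞) g)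
    (h : BddBy k M f) (h' : BddBy k M' g) :
    BddBy k (2 ^ k * (M * M')) (fun x => f x * g x) := by
  induction k generalizing f g with
  | zero =>
    intro x
    rw [abs_mul, pow_zero, one_mul]
    exact mul_le_mul (h x) (h' x) (abs_nonneg _) h.nonneg
  | succ k ih =>
    have h0 : 0 ≤ M * M' := mul_nonneg h.nonneg h'.nonneg
    refine ⟨fun x => ?_, fun i => ?_⟩
    · rw [abs_mul]
      refine (mul_le_mul (h.1 x) (h'.1 x) (abs_nonneg _) h.nonneg).trans ?_
      exact le_mul_of_one_le_left h0 (one_le_pow₀ (by norm_num))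
    · rw [pd_mul hf hg]
      have := BddBy.add ((contDiff_pd hf i).mul hg) (hf.mul (contDiff_pd hg i))
        (ih (contDiff_pd hf i) hg (h.2 i) h'.of_succ) (ih hf (contDiff_pd hg i) h.of_succ (h'.2 i))
      exact this.mono (le_of_eq (by ring))

end Smooth

/-! ### Families bounded in every seminorm -/

namespace UnifCb

variable {α : Type*} {f g : α → StateSpace N → ℝ}

theorem add (hf : UnifCb f) (hg : UnifCb g) : UnifCb fun a x => f a x + g a x := by
  refine ⟨fun a => (hf.1 a).add (hg.1 a), fun k => ?_⟩
  obtain ⟨M, hM⟩ := hf.2 k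
  obtain ⟨M', hM'⟩ := hg.2 k
  exact ⟨M + M', fun a => (hM a).add (hf.1 a) (hg.1 a) (hM' a)⟩

theorem sub (hf : UnifCb f) (hg : UnifCb g) : UnifCb fun a x => f a x - g a x := by
  refine ⟨fun a => (hf.1 a).sub (hg.1 a), fun k => ?_⟩
  obtain ⟨M, hM⟩ := hf.2 k
  obtain ⟨M', hM'⟩ := hg.2 k
  exact ⟨M + M', fun a => (hM a).sub (hf.1 a) (hg.1 a) (hM' a)⟩

theorem mul (hf : UnifCb f) (hg : UnifCb g) : UnifCb fun a x => f a x * g a x := by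
  refine ⟨fun a => (hf.1 a).mul (hg.1 a), fun k => ?_⟩
  obtain ⟨M, hM⟩ := hf.2 k
  obtain ⟨M', hM'⟩ := hg.2 k
  exact ⟨2 ^ k * (M * M'), fun a => (hM a).mul (hf.1 a) (hg.1 a) (hM' a)⟩

theorem const {c : α → ℝ} {C : ℝ} (hc : ∀ a, |c a| ≤ C) :
    UnifCb (fun a (_ : StateSpace N) => c a) :=
  ⟨fun _ => contDiff_const, fun k => ⟨C, fun a => (BddBy.const k (c a)).mono (hc a)⟩⟩

theorem pderiv (hf : UnifCb f) (i : Fin N) : UnifCb fun a => pd i (f a) := by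
  refine ⟨fun a => contDiff_pd (hf.1 a) i, fun k => ?_⟩
  obtain ⟨M, hM⟩ := hf.2 (k + 1)
  exact ⟨M, fun a => (hM a).2 i⟩

theorem sum {β : Type*} {s : Finset β} {f : β → α → StateSpace N → ℝ}
    (hf : ∀ b ∈ s, UnifCb (f b)) : UnifCb fun a x => ∑ b ∈ s, f b a x := by
  classical
  induction s using Finset.induction_on with
  | empty => simpa using const (α := α) (N := N) (c := fun _ => 0) (C := 0) (by simp)
  | insert b s hb ih =>
    simp only [Finset.sum_insert hb]
    exact (hf b (by simp)).add (ih fun b' hb' => hf b' (by simp [hb']))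

theorem cbFun (hf : UnifCb f) (a : α) : CbFun (f a) :=
  ⟨hf.1 a, fun k => (hf.2 k).imp fun _ hM => hM a⟩

end UnifCb

theorem CbFun.unifCb {f : StateSpace N → ℝ} (hf : CbFun f) (α : Type*) :
    UnifCb (fun _ : α => f) :=
  ⟨fun _ => hf.1, fun k => (hf.2 k).imp fun _ hM _ => hM⟩

namespace CbFun

variable {f g : StateSpace N → ℝ}

theorem add (hf : CbFun f) (hg : CbFun g) : CbFun fun x => f x + g x :=
  ((hf.unifCb Unit).add (hg.unifCb Unit)).cbFun ()

theorem sub (hf : CbFun f) (hg : CbFun g) : CbFun fun x => f x - g x :=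
  ((hf.unifCb Unit).sub (hg.unifCb Unit)).cbFun ()

theorem mul (hf : CbFun f) (hg : CbFun g) : CbFun fun x => f x * g x :=
  ((hf.unifCb Unit).mul (hg.unifCb Unit)).cbFun ()

theorem const (c : ℝ) : CbFun (fun _ : StateSpace N => c) :=
  (UnifCb.const (α := Unit) (c := fun _ => c) (C := |c|) fun _ => le_rfl).cbFun ()

theorem const_mul (hf : CbFun f) (c : ℝ) : CbFun fun x => c * f x := (CbFun.const c).mul hf

theorem pderiv (hf : CbFun f) (i : Fin N) : CbFun (pd i f) :=
  ((hf.unifCb Unit).pderiv i).cbFun ()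

theorem sum {β : Type*} {s : Finset β} {f : β → StateSpace N → ℝ}
    (hf : ∀ b ∈ s, CbFun (f b)) : CbFun fun x => ∑ b ∈ s, f b x :=
  (UnifCb.sum (α := Unit) fun b hb => (hf b hb).unifCb Unit).cbFun ()

end CbFun

theorem IsCbSmooth.comp_clm {E F G : Type*} [NormedAddCommGroup E] [NormedSpace ℝ E]
    [NormedAddCommGroup F] [NormedSpace ℝ F] [NormedAddCommGroup G] [NormedSpace ℝ G]
    {f : E → F} (hf : IsCbSmooth f) (L : F →L[ℝ] G) : IsCbSmooth fun x => L (f x) := by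
  refine ⟨L.contDiff.comp hf.1, fun n => ?_⟩
  obtain ⟨C, hC⟩ := hf.2 n
  refine ⟨‖L‖ * C, fun x => ?_⟩
  have := L.norm_iteratedFDeriv_comp_left (f := f) (x := x) (N := (⊤ : ℕ∞)) (n := n)
    hf.1.contDiffAt (by exact_mod_cast le_top)
  exact this.trans (by gcongr; exact hC x)

theorem IsCbSmooth.pderiv {f : StateSpace N → ℝ} (hf : IsCbSmooth f) (i : Fin N) :
    IsCbSmooth (pd i f) := by
  have h1 : IsCbSmooth (fderiv ℝ f) := by
    refine ⟨hf.1.fderiv_right (by simp), fun n => ?_⟩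
    obtain ⟨C, hC⟩ := hf.2 (n + 1)
    exact ⟨C, fun x => by rw [norm_iteratedFDeriv_fderiv]; exact hC x⟩
  exact h1.comp_clm (ContinuousLinearMap.apply ℝ ℝ (EuclideanSpace.single i (1 : ℝ)))

theorem IsCbSmooth.cbFun {f : StateSpace N → ℝ} (hf : IsCbSmooth f) : CbFun f := by
  refine ⟨hf.1, fun k => ?_⟩
  induction k generalizing f with
  | zero =>
    obtain ⟨C, hC⟩ := hf.2 0
    exact ⟨C, fun x => by simpa using hC x⟩
  | succ k ih =>
    obtain ⟨C, hC⟩ := hf.2 0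
    choose M hM using fun i => ih (hf.pderiv i)
    refine ⟨|C| + ∑ i, |M i|, fun x => ?_, fun i => ?_⟩
    · have h1 : |f x| ≤ C := by simpa using hC x
      have h2 : 0 ≤ ∑ i, |M i| := Finset.sum_nonneg fun _ _ => abs_nonneg _
      linarith [le_abs_self C]
    · refine (hM i).mono ?_
      have h2 : |M i| ≤ ∑ i, |M i| :=
        Finset.single_le_sum (f := fun i => |M i|) (fun _ _ => abs_nonneg _) (Finset.mem_univ i)
      linarith [le_abs_self (M i), abs_nonneg C]

theorem IsCbSmooth.cbFun_apply {W : StateSpace N → StateSpace N} (hW : IsCbSmooth W)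
    (l : Fin N) : CbFun fun x => W x l :=
  (hW.comp_clm (EuclideanSpace.proj l : StateSpace N →L[ℝ] ℝ)).cbFun

/-! ### Taylor expansion along segments -/

theorem hasDerivAt_segment {f : StateSpace N → ℝ} (hf : Differentiable ℝ f)
    (x v : StateSpace N) (θ : ℝ) :
    HasDerivAt (fun θ : ℝ => f (x + θ • v)) (∑ i, v i * pd i f (x + θ • v)) θ := by
  have h1 : HasDerivAt (fun θ : ℝ => x + θ • v) v θ := by
    simpa using ((hasDerivAt_id θ).smul_const v).const_add x
  have := (hf (x + θ • v)).hasFDerivAt.comp_hasDerivAt θ h1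
  rwa [fderiv_eq_sum_pd] at this

theorem abs_sum_mul_le (v : StateSpace N) {c : Fin N → ℝ} {C : ℝ} (hc : ∀ i, |c i| ≤ C) :
    |∑ i, v i * c i| ≤ l1 v * C := by
  rw [l1, Finset.sum_mul]
  refine (Finset.abs_sum_le_sum_abs _ _).trans (Finset.sum_le_sum fun i _ => ?_)
  rw [abs_mul]
  gcongr
  exact hc i

theorem abs_sub_le_of_deriv_le {g g' : ℝ → ℝ} {C : ℝ}
    (hg : ∀ θ, HasDerivAt g (g' θ) θ) (hC : ∀ θ ∈ Set.Icc (0 : ℝ) 1, |g' θ| ≤ C) :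
    |g 1 - g 0| ≤ C := by
  have := Convex.norm_image_sub_le_of_norm_hasDerivWithin_le (f := g) (f' := g') (C := C)
    (s := Set.Icc (0 : ℝ) 1) (x := 0) (y := 1) (fun θ _ => (hg θ).hasDerivWithinAt) hC
    (convex_Icc 0 1) (by simp) (by simp)
  simpa using this

theorem taylor_one {f : StateSpace N → ℝ} (hf : ContDiff ℝ (⊤ : ℕ∞) f) {M : ℝ}
    (hM : BddBy 1 M f) (x v : StateSpace N) : |f (x + v) - f x| ≤ l1 v * M := by
  have := abs_sub_le_of_deriv_le (hasDerivAt_segment (smooth_differentiable hf) x v)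
    (C := l1 v * M) fun θ _ => abs_sum_mul_le v fun i => (hM.2 i).abs_le _
  simpa using this

theorem taylor_two {f : StateSpace N → ℝ} (hf : ContDiff ℝ (⊤ : ℕ∞) f) {M : ℝ}
    (hM : BddBy 2 M f) (x v : StateSpace N) :
    |f (x + v) - f x - ∑ i, v i * pd i f x| ≤ l1 v ^ 2 * M := by
  have := abs_sub_le_of_deriv_le (g := fun θ => f (x + θ • v) - θ * ∑ i, v i * pd i f x)
    (g' := fun θ => ∑ i, v i * (pd i f (x + θ • v) - pd i f x)) (C := l1 v ^ 2 * M)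
    (fun θ => ?_) fun θ hθ => ?_
  · simp only [one_smul, zero_smul, add_zero, one_mul, zero_mul, sub_zero] at this
    rwa [sub_right_comm]
  · refine ((hasDerivAt_segment (smooth_differentiable hf) x v θ).sub
      ((hasDerivAt_id θ).mul_const (∑ i, v i * pd i f x))).congr_deriv ?_
    simp [mul_sub, Finset.sum_sub_distrib]
  · rw [pow_two, mul_assoc]
    refine abs_sum_mul_le v fun i => (taylor_one (contDiff_pd hf i) (hM.2 i) x (θ • v)).trans ?_
    rw [l1_smul, abs_of_nonneg hθ.1]
    have := l1_nonneg v
    have h0 := hM.nonneg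
    gcongr
    exact mul_le_of_le_one_left this hθ.2

theorem taylor_three {f : StateSpace N → ℝ} (hf : ContDiff ℝ (⊤ : ℕ∞) f) {M : ℝ}
    (hM : BddBy 3 M f) (x v : StateSpace N) :
    |f (x + v) - f x - ∑ i, v i * pd i f x - 1 / 2 * ∑ i, v i * ∑ j, v j * pd j (pd i f) x| ≤
      l1 v ^ 3 * M := by
  have := abs_sub_le_of_deriv_le (g := fun θ => f (x + θ • v) - θ * ∑ i, v i * pd i f x -
      1 / 2 * θ ^ 2 * ∑ i, v i * ∑ j, v j * pd j (pd i f) x)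
    (g' := fun θ => ∑ i, v i * (pd i f (x + θ • v) - pd i f x -
      ∑ j, (θ • v) j * pd j (pd i f) x)) (C := l1 v ^ 3 * M)
    (fun θ => ?_) fun θ hθ => ?_
  · simp only [one_smul, zero_smul, add_zero, one_mul, zero_mul, sub_zero, one_pow, mul_one,
      mul_zero, ne_eq, OfNat.ofNat_ne_zero, not_false_eq_true, zero_pow] at this
    convert this using 2
    ring
  · refine (((hasDerivAt_segment (smooth_differentiable hf) x v θ).sub
      ((hasDerivAt_id θ).mul_const (∑ i, v i * pd i f x))).sub
      (((hasDerivAt_pow 2 θ).const_mul (1 / 2)).mul_const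
        (∑ i, v i * ∑ j, v j * pd j (pd i f) x))).congr_deriv ?_
    simp only [mul_sub, Finset.sum_sub_distrib, one_mul, PiLp.smul_apply, smul_eq_mul,
      Finset.mul_sum]
    congr 1
    refine Finset.sum_congr rfl fun i _ => Finset.sum_congr rfl fun j _ => ?_
    push_cast
    ring
  · rw [pow_succ' (l1 v) 2, mul_assoc]
    refine abs_sum_mul_le v fun i => (taylor_two (contDiff_pd hf i) (hM.2 i) x (θ • v)).trans ?_
    rw [l1_smul, abs_of_nonneg hθ.1]
    have := l1_nonneg v
    have h0 := hM.nonneg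
    have hθ0 := hθ.1
    gcongr
    exact mul_le_of_le_one_left this hθ.2

/-! ### Pointwise limits of uniformly smooth families -/

/-- The first partial derivatives of a pointwise convergent, uniformly smooth sequence form
pointwise Cauchy sequences: they are compared with difference quotients of small step. -/
theorem UnifCb.cauchySeq_pd {f : ℕ → StateSpace N → ℝ} {g : StateSpace N → ℝ} (hf : UnifCb f)
    (hg : ∀ x, Tendsto (fun n => f n x) atTop (𝓝 (g x))) (i : Fin N) (x : StateSpace N) :
    CauchySeq fun n => pd i (f n) x := by
  obtain ⟨M, hM⟩ := hf.2 2
  have hM0 : 0 ≤ M := (hM 0).nonneg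
  rw [Metric.cauchySeq_iff]
  intro ε hε
  set η : ℝ := ε / (4 * (M + 1)) with hη
  have hη0 : 0 < η := by positivity
  set v : StateSpace N := EuclideanSpace.single i η with hv
  have hl : l1 v = η := by
    simp [l1, hv, apply_ite abs, abs_of_pos hη0]
  have key : ∀ n, |f n (x + v) - f n x - η * pd i (f n) x| ≤ η ^ 2 * M := fun n => by
    have := taylor_two (hf.1 n) (hM n) x v
    rw [hl] at this
    simpa [hv, Pi.single_apply] using this
  have hc : CauchySeq fun n => f n (x + v) - f n x :=
    ((hg (x + v)).sub (hg x)).cauchySeq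
  obtain ⟨n₀, hn₀⟩ := Metric.cauchySeq_iff.1 hc (ε * η / 4) (by positivity)
  refine ⟨n₀, fun m hm n hn => ?_⟩
  have h1 := hn₀ m hm n hn
  rw [Real.dist_eq] at h1 ⊢
  have hηM : η ^ 2 * M ≤ η * (ε / 4) := by
    have : η * M ≤ ε / 4 := by
      rw [hη, div_mul_eq_mul_div, div_le_div_iff₀ (by positivity) (by positivity)]
      nlinarith
    nlinarith
  have h2 := abs_lt.1 h1
  have h3 := abs_le.1 (key m)
  have h4 := abs_le.1 (key n)
  have h5 : |η * (pd i (f m) x - pd i (f n) x)| < η * ε := by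
    rw [abs_lt]
    constructor <;> nlinarith
  rw [abs_mul, abs_of_pos hη0] at h5
  exact lt_of_mul_lt_mul_left h5 hη0.le

theorem UnifCb.hasFDerivAt_lim {f : ℕ → StateSpace N → ℝ} {g : StateSpace N → ℝ}
    (hf : UnifCb f) (hg : ∀ x, Tendsto (fun n => f n x) atTop (𝓝 (g x)))
    {g' : Fin N → StateSpace N → ℝ}
    (hg' : ∀ i x, Tendsto (fun n => pd i (f n) x) atTop (𝓝 (g' i x))) (x : StateSpace N) :
    HasFDerivAt g (∑ i, g' i x • (EuclideanSpace.proj i : StateSpace N →L[ℝ] ℝ)) x := by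
  obtain ⟨M, hM⟩ := hf.2 2
  have key : ∀ v : StateSpace N, |g (x + v) - g x - ∑ i, v i * g' i x| ≤ l1 v ^ 2 * M := fun v =>
    le_of_tendsto ((((hg (x + v)).sub (hg x)).sub
      (tendsto_finsetSum _ fun i _ => (hg' i x).const_mul (v i))).abs)
      (Eventually.of_forall fun n => taylor_two (hf.1 n) (hM n) x v)
  have hl : ∀ v : StateSpace N, l1 v ≤ N * ‖v‖ := fun v => by
    refine (Finset.sum_le_sum fun i _ => PiLp.norm_apply_le v i).trans ?_
    simp
  rw [hasFDerivAt_iff_isLittleO_nhds_zero]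
  refine Asymptotics.IsBigO.trans_isLittleO (g := fun v : StateSpace N => ‖v‖ ^ 2) ?_ ?_
  · refine Asymptotics.IsBigO.of_bound (N ^ 2 * M) (Eventually.of_forall fun v => ?_)
    have h1 := key v
    have h2 : l1 v ^ 2 ≤ (N * ‖v‖) ^ 2 := pow_le_pow_left₀ (l1_nonneg v) (hl v) 2
    have h3 : (∑ i, g' i x • (EuclideanSpace.proj i : StateSpace N →L[ℝ] ℝ)) v =
        ∑ i, v i * g' i x := by
      simp [mul_comm]
    rw [h3, Real.norm_eq_abs, norm_pow, norm_norm]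
    nlinarith [(hM 0).nonneg]
  · exact Asymptotics.isLittleO_norm_pow_id one_lt_two

/-- A pointwise limit of a sequence that is bounded in every `C^k`-seminorm is smooth, and the
partial derivatives converge pointwise as well. -/
theorem UnifCb.lim {f : ℕ → StateSpace N → ℝ} {g : StateSpace N → ℝ} (hf : UnifCb f)
    (hg : ∀ x, Tendsto (fun n => f n x) atTop (𝓝 (g x))) :
    ContDiff ℝ (⊤ : ℕ∞) g ∧
      ∀ i x, Tendsto (fun n => pd i (f n) x) atTop (𝓝 (pd i g x)) := by
  have main : ∀ {f : ℕ → StateSpace N → ℝ} {g : StateSpace N → ℝ}, UnifCb f →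
      (∀ x, Tendsto (fun n => f n x) atTop (𝓝 (g x))) →
      (∀ x, HasFDerivAt g
        (∑ i, pd i g x • (EuclideanSpace.proj i : StateSpace N →L[ℝ] ℝ)) x) ∧
      ∀ i x, Tendsto (fun n => pd i (f n) x) atTop (𝓝 (pd i g x)) := by
    intro f g hf hg
    choose g' hg' using fun i x => cauchySeq_tendsto_of_complete (hf.cauchySeq_pd hg i x)
    have hd := hf.hasFDerivAt_lim hg hg'
    have hpd : ∀ i x, pd i g x = g' i x := fun i x => by
      simp [pd, (hd x).fderiv]
    simp only [hpd]
    exact ⟨hd, hg'⟩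
  refine ⟨?_, (main hf hg).2⟩
  rw [contDiff_infty]
  intro n
  induction n generalizing f g with
  | zero =>
    rw [Nat.cast_zero, contDiff_zero]
    exact (show Differentiable ℝ g from
      fun x => ((main hf hg).1 x).differentiableAt).continuous
  | succ n ih =>
    obtain ⟨hd, hp⟩ := main hf hg
    rw [Nat.cast_succ, contDiff_succ_iff_fderiv]
    refine ⟨fun x => (hd x).differentiableAt, by simp, ?_⟩
    have : fderiv ℝ g = fun x =>
        ∑ i, pd i g x • (EuclideanSpace.proj i : StateSpace N →L[ℝ] ℝ) :=
      funext fun x => (hd x).fderiv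
    rw [this]
    exact ContDiff.sum fun i _ => (ih (hf.pderiv i) (hp i)).smul contDiff_const

theorem UnifCb.bddBy_lim {f : ℕ → StateSpace N → ℝ} {g : StateSpace N → ℝ} (hf : UnifCb f)
    (hg : ∀ x, Tendsto (fun n => f n x) atTop (𝓝 (g x))) {k : ℕ} {M : ℝ}
    (hM : ∀ n, BddBy k M (f n)) : BddBy k M g := by
  induction k generalizing f g with
  | zero =>
    exact fun x => le_of_tendsto (hg x).abs (Eventually.of_forall fun n => hM n x)
  | succ k ih =>
    exact ⟨fun x => le_of_tendsto (hg x).abs (Eventually.of_forall fun n => (hM n).1 x),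
      fun i => ih (hf.pderiv i) ((hf.lim hg).2 i) fun n => (hM n).2 i⟩

end Calculus

/-! ### Stability of one-step averaging schemes in `C^k` -/

section Scheme

variable {N : ℕ}

/-- A vector of functions together with all its first partial derivatives. -/
noncomputable def jetExt {κ : Type} (g : κ → StateSpace N → ℝ) :
    κ × Option (Fin N) → StateSpace N → ℝ
  | (a, none) => g a
  | (a, some i) => pd i (g a)

/-- The sum of the squares of the iterated partial derivatives up to order `k` (each one counted
with the multiplicity with which it occurs in the `k`-fold iteration of `jetExt`). -/
noncomputable def jetSq : (k : ℕ) → {κ : Type} → [Fintype κ] → (κ → StateSpace N → ℝ) →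
    StateSpace N → ℝ
  | 0, _, _, g => fun x => ∑ a, g a x ^ 2
  | k + 1, _, _, g => jetSq k (jetExt g)

theorem jetSq_le_of_bddBy (k : ℕ) {κ : Type} [Fintype κ] {g : κ → StateSpace N → ℝ} {M : ℝ}
    (hg : ∀ a, BddBy k M (g a)) (x : StateSpace N) :
    jetSq k g x ≤ Fintype.card κ * (N + 1) ^ k * M ^ 2 := by
  induction k generalizing κ with
  | zero =>
    calc jetSq 0 g x ≤ ∑ _a : κ, M ^ 2 := Finset.sum_le_sum fun a _ => by
          rw [← sq_abs]
          exact pow_le_pow_left₀ (abs_nonneg _) (hg a x) 2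
      _ = _ := by simp
  | succ k ih =>
    have := ih (κ := κ × Option (Fin N)) (g := jetExt g) (by
      rintro ⟨a, _ | i⟩
      · exact (hg a).of_succ
      · exact (hg a).2 i)
    refine this.trans (le_of_eq ?_)
    simp only [Fintype.card_prod, Fintype.card_option, Fintype.card_fin]
    push_cast
    ring

theorem bddBy_of_jetSq_le (k : ℕ) {κ : Type} [Fintype κ] {g : κ → StateSpace N → ℝ} {G : ℝ}
    (hG : 0 ≤ G) (hg : ∀ x, jetSq k g x ≤ G ^ 2) (a : κ) : BddBy k G (g a) := by
  induction k generalizing κ with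
  | zero =>
    refine fun x => abs_le_of_sq_le_sq ((Finset.single_le_sum (f := fun a => g a x ^ 2)
      (fun _ _ => sq_nonneg _) (Finset.mem_univ a)).trans (hg x)) hG
  | succ k ih =>
    have h := ih (g := jetExt g) hg
    exact ⟨(h (a, none)).abs_le, fun i => h (a, some i)⟩

theorem exists_common_bddBy {α β : Type*} [Fintype β] {f : β → α → StateSpace N → ℝ}
    (hf : ∀ b, UnifCb (f b)) (k : ℕ) : ∃ M, 0 ≤ M ∧ ∀ b a, BddBy k M (f b a) := by
  choose M hM using fun b => (hf b).2 k
  refine ⟨∑ b, |M b|, Finset.sum_nonneg fun _ _ => abs_nonneg _, fun b a => (hM b a).mono ?_⟩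
  exact (le_abs_self _).trans
    (Finset.single_le_sum (f := fun b => |M b|) (fun _ _ => abs_nonneg _) (Finset.mem_univ b))

variable {J : Type} (V : J → Fin N → StateSpace N → ℝ) (b : Fin N → StateSpace N → ℝ)

/-- The map `x ↦ x + ε V_j(x) + ε² b(x)`. -/
noncomputable def stepMap (ε : ℝ) (j : J) (x : StateSpace N) : StateSpace N :=
  x + WithLp.toLp 2 fun l => ε * V j l x + ε ^ 2 * b l x

/-- The matrix `1 + ε L_j(x) + ε² R_j(ε, x)`. -/
def stepMatrix {κ : Type} [DecidableEq κ] (L : J → κ → κ → StateSpace N → ℝ)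
    (R : J → κ → κ → ℝ → StateSpace N → ℝ) (ε : ℝ) (j : J) (a l : κ) (x : StateSpace N) : ℝ :=
  (if a = l then 1 else 0) + ε * L j a l x + ε ^ 2 * R j a l ε x

variable {V b}

theorem contDiff_stepMap (hV : ∀ j l, CbFun (V j l)) (hb : ∀ l, CbFun (b l)) (ε : ℝ) (j : J) :
    ContDiff ℝ (⊤ : ℕ∞) (stepMap V b ε j) := by
  refine contDiff_id.add ?_
  rw [contDiff_piLp]
  intro l
  exact (contDiff_const.mul (hV j l).1).add (contDiff_const.mul (hb l).1)

theorem pd_comp_stepMap (hV : ∀ j l, CbFun (V j l)) (hb : ∀ l, CbFun (b l)) (ε : ℝ) (j : J)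
    {f : StateSpace N → ℝ} (hf : ContDiff ℝ (⊤ : ℕ∞) f) (i : Fin N) (x : StateSpace N) :
    pd i (fun x => f (stepMap V b ε j x)) x = ∑ q, ((if q = i then 1 else 0) +
      ε * pd i (V j q) x + ε ^ 2 * pd i (b q) x) * pd q f (stepMap V b ε j x) := by
  have hF := contDiff_stepMap hV hb ε j
  have hFd : DifferentiableAt ℝ (stepMap V b ε j) x := (hF.differentiable (by simp)) x
  have h1 : fderiv ℝ (fun x => f (stepMap V b ε j x)) x =
      (fderiv ℝ f (stepMap V b ε j x)).comp (fderiv ℝ (stepMap V b ε j) x) :=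
    fderiv_comp x (smooth_differentiable hf _) hFd
  rw [pd, h1, ContinuousLinearMap.comp_apply, fderiv_eq_sum_pd]
  refine Finset.sum_congr rfl fun q _ => ?_
  congr 1
  have h2 : (fderiv ℝ (stepMap V b ε j) x (EuclideanSpace.single i 1)) q =
      pd i (fun x => stepMap V b ε j x q) x := by
    have := ((EuclideanSpace.proj q : StateSpace N →L[ℝ] ℝ).hasFDerivAt.comp x
      hFd.hasFDerivAt).fderiv
    rw [pd]
    simp only [Function.comp_def, EuclideanSpace.coe_proj] at this
    rw [this]
    rfl
  rw [h2]
  have h3 : (fun x => stepMap V b ε j x q) = fun x =>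
      (EuclideanSpace.proj q : StateSpace N →L[ℝ] ℝ) x +
        (ε * V j q x + ε ^ 2 * b q x) := rfl
  have hc1 : ContDiff ℝ (⊤ : ℕ∞) fun x => ε * V j q x := contDiff_const.mul (hV j q).1
  have hc2 : ContDiff ℝ (⊤ : ℕ∞) fun x => ε ^ 2 * b q x := contDiff_const.mul (hb q).1
  rw [h3, pd_add (ContinuousLinearMap.contDiff _) (hc1.add hc2), pd_add hc1 hc2,
    pd_const_mul (hV j q).1, pd_const_mul (hb q).1]
  have h4 : pd i (fun x => (EuclideanSpace.proj q : StateSpace N →L[ℝ] ℝ) x) x =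
      if q = i then 1 else 0 := by
    rw [pd, ContinuousLinearMap.fderiv]
    simp
  simp only [h4, add_assoc]

theorem contDiff_stepMatrix {κ : Type} [DecidableEq κ] {L : J → κ → κ → StateSpace N → ℝ}
    {R : J → κ → κ → ℝ → StateSpace N → ℝ} (hL : ∀ j a l, CbFun (L j a l))
    (hR : ∀ j a l, UnifCb fun ε : Set.Icc (0 : ℝ) 1 => R j a l ε) {ε : ℝ}
    (hε : ε ∈ Set.Icc (0 : ℝ) 1) (j : J) (a l : κ) :
    ContDiff ℝ (⊤ : ℕ∞) (stepMatrix L R ε j a l) :=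
  (contDiff_const.add (contDiff_const.mul (hL j a l).1)).add
    (contDiff_const.mul ((hR j a l).1 ⟨ε, hε⟩))

theorem pd_stepMatrix {κ : Type} [DecidableEq κ] {L : J → κ → κ → StateSpace N → ℝ}
    {R : J → κ → κ → ℝ → StateSpace N → ℝ} (hL : ∀ j a l, CbFun (L j a l))
    (hR : ∀ j a l, UnifCb fun ε : Set.Icc (0 : ℝ) 1 => R j a l ε) {ε : ℝ}
    (hε : ε ∈ Set.Icc (0 : ℝ) 1) (j : J) (a l : κ) (i : Fin N) (x : StateSpace N) :
    pd i (stepMatrix L R ε j a l) x = ε * pd i (L j a l) x + ε ^ 2 * pd i (R j a l ε) x := by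
  have hRε := (hR j a l).1 ⟨ε, hε⟩
  have hc1 : ContDiff ℝ (⊤ : ℕ∞) fun x => ε * L j a l x := contDiff_const.mul (hL j a l).1
  have hc2 : ContDiff ℝ (⊤ : ℕ∞) fun x => ε ^ 2 * R j a l ε x := contDiff_const.mul hRε
  have h : stepMatrix L R ε j a l = fun x =>
    ((if a = l then (1 : ℝ) else 0) + ε * L j a l x) + ε ^ 2 * R j a l ε x := rfl
  rw [h, pd_add (contDiff_const.add hc1) hc2, pd_add contDiff_const hc1, pd_const,
    pd_const_mul (hL j a l).1, pd_const_mul hRε]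
  simp

variable (V b) [Fintype J] (p : J → ℝ)

/-- The averaging operator `f ↦ ∑ⱼ pⱼ f(x + ε Vⱼ(x) + ε² b(x))`. -/
noncomputable def stepOp (ε : ℝ) (f : StateSpace N → ℝ) (x : StateSpace N) : ℝ :=
  ∑ j, p j * f (stepMap V b ε j x)

/-- The averaging operator on vectors of functions, twisted by matrices. -/
noncomputable def vecStep {κ : Type} [Fintype κ] [DecidableEq κ]
    (L : J → κ → κ → StateSpace N → ℝ)
    (R : J → κ → κ → ℝ → StateSpace N → ℝ) (ε : ℝ) (g : κ → StateSpace N → ℝ) (a : κ)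
    (x : StateSpace N) : ℝ :=
  ∑ j, p j * ∑ l, stepMatrix L R ε j a l x * g l (stepMap V b ε j x)

variable {V b p}

/-- The pointwise bound behind the stability of the scheme. For `y = ∑ⱼ pⱼ Mⱼ gⱼ` one tests `y`
against itself and moves the matrices to the fixed vector `y`: there the terms of first order in
`ε` average out. -/
theorem sum_sq_average_le {κ : Type} [Fintype κ] [DecidableEq κ] (hp : ∀ j, 0 ≤ p j)
    (hp1 : ∑ j, p j = 1) {L R : J → κ → κ → ℝ} (hL0 : ∀ a l, ∑ j, p j * L j a l = 0) {K : ℝ}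
    (hL : ∀ j a l, |L j a l| ≤ K) (hR : ∀ j a l, |R j a l| ≤ K) (hK : 0 ≤ K)
    {ε : ℝ} (hε : 0 ≤ ε) (hε1 : ε ≤ 1) {g : J → κ → ℝ} {G : ℝ} (hG : ∀ j, ∑ l, g j l ^ 2 ≤ G) :
    ∑ a, (∑ j, p j * ∑ l, ((if a = l then 1 else 0) + ε * L j a l + ε ^ 2 * R j a l) *
      g j l) ^ 2 ≤ (1 + (Fintype.card κ) ^ 2 * (2 * K + 4 * K ^ 2) * ε ^ 2) * G := by
  set y : κ → ℝ := fun a => ∑ j, p j * ∑ l, ((if a = l then 1 else 0) + ε * L j a l +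
    ε ^ 2 * R j a l) * g j l with hy
  set n : ℝ := (Fintype.card κ : ℝ) with hn
  set S : ℝ := ∑ a, y a ^ 2 with hS
  set Y : ℝ := ∑ a, |y a| with hY
  set D : ℝ := 1 + n ^ 2 * (2 * K + 4 * K ^ 2) * ε ^ 2 with hD
  have hD1 : 1 ≤ D := by
    have : 0 ≤ n ^ 2 * (2 * K + 4 * K ^ 2) * ε ^ 2 := by positivity
    linarith
  have hY2 : Y ^ 2 ≤ n * S := by
    have := sq_sum_le_card_mul_sum_sq (s := Finset.univ) (f := fun a => |y a|)
    simpa [hS, hY, hn] using this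
  have hY0 : 0 ≤ Y := Finset.sum_nonneg fun _ _ => abs_nonneg _
  -- `u`, `w` and `z` are the transposed matrices applied to `y`, so that `|y|² = ∑ⱼ pⱼ ⟨zⱼ, gⱼ⟩`
  set u : J → κ → ℝ := fun j l => ∑ a, y a * L j a l with hu
  set w : J → κ → ℝ := fun j l => ∑ a, y a * R j a l with hw
  have hub : ∀ j l, |u j l| ≤ K * Y := fun j l => by
    rw [hu, hY, Finset.mul_sum]
    refine (Finset.abs_sum_le_sum_abs _ _).trans (Finset.sum_le_sum fun a _ => ?_)
    rw [abs_mul, mul_comm]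
    exact mul_le_mul_of_nonneg_right (hL j a l) (abs_nonneg _)
  have hwb : ∀ j l, |w j l| ≤ K * Y := fun j l => by
    rw [hw, hY, Finset.mul_sum]
    refine (Finset.abs_sum_le_sum_abs _ _).trans (Finset.sum_le_sum fun a _ => ?_)
    rw [abs_mul, mul_comm]
    exact mul_le_mul_of_nonneg_right (hR j a l) (abs_nonneg _)
  have hyb : ∀ l, |y l| ≤ Y := fun l =>
    Finset.single_le_sum (f := fun a => |y a|) (fun _ _ => abs_nonneg _) (Finset.mem_univ l)
  set z : J → κ → ℝ := fun j l => y l + ε * u j l + ε ^ 2 * w j l with hz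
  have hz2 : ∀ j l, z j l ^ 2 ≤ y l ^ 2 + 2 * ε * (y l * u j l) +
      ε ^ 2 * (2 * K + 4 * K ^ 2) * Y ^ 2 := fun j l => by
    have h1 : y l * w j l ≤ K * Y ^ 2 := by
      refine (le_abs_self _).trans ?_
      rw [abs_mul]
      calc |y l| * |w j l| ≤ Y * (K * Y) :=
            mul_le_mul (hyb l) (hwb j l) (abs_nonneg _) hY0
        _ = K * Y ^ 2 := by ring
    have h2 : (u j l + ε * w j l) ^ 2 ≤ 4 * K ^ 2 * Y ^ 2 := by
      have h3 : |u j l + ε * w j l| ≤ 2 * (K * Y) := by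
        refine (abs_add_le _ _).trans ?_
        rw [abs_mul, abs_of_nonneg hε]
        have := mul_le_mul hε1 (hwb j l) (abs_nonneg _) zero_le_one
        linarith [hub j l]
      rw [← sq_abs]
      calc |u j l + ε * w j l| ^ 2 ≤ (2 * (K * Y)) ^ 2 :=
            pow_le_pow_left₀ (abs_nonneg _) h3 2
        _ = 4 * K ^ 2 * Y ^ 2 := by ring
    have h4 : z j l ^ 2 = y l ^ 2 + 2 * ε * (y l * u j l) + ε ^ 2 * (2 * (y l * w j l)) +
        ε ^ 2 * (u j l + ε * w j l) ^ 2 := by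
      simp only [hz]; ring
    have hε2 : 0 ≤ ε ^ 2 := sq_nonneg ε
    rw [h4]
    nlinarith [mul_le_mul_of_nonneg_left h1 hε2, mul_le_mul_of_nonneg_left h2 hε2]
  -- the first order part has mean zero, so that only terms of order `ε²` remain
  have hu0 : ∀ l, ∑ j, p j * u j l = 0 := fun l => by
    simp only [hu, Finset.mul_sum]
    rw [Finset.sum_comm]
    refine Finset.sum_eq_zero fun a _ => ?_
    have : ∑ j, p j * (y a * L j a l) = y a * ∑ j, p j * L j a l := by
      rw [Finset.mul_sum]
      exact Finset.sum_congr rfl fun j _ => by ring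
    rw [this, hL0, mul_zero]
  have hZ : ∑ j, p j * ∑ l, z j l ^ 2 ≤ D * S := by
    calc ∑ j, p j * ∑ l, z j l ^ 2
        ≤ ∑ j, p j * ∑ l, (y l ^ 2 + 2 * ε * (y l * u j l) +
          ε ^ 2 * (2 * K + 4 * K ^ 2) * Y ^ 2) :=
          Finset.sum_le_sum fun j _ => mul_le_mul_of_nonneg_left
            (Finset.sum_le_sum fun l _ => hz2 j l) (hp j)
      _ = (∑ j, p j) * S + 2 * ε * ∑ l, y l * ∑ j, p j * u j l +
          (∑ j, p j) * (n * (ε ^ 2 * (2 * K + 4 * K ^ 2) * Y ^ 2)) := by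
          simp only [Finset.sum_add_distrib, mul_add, Finset.sum_const, Finset.card_univ,
            nsmul_eq_mul, ← hn, ← hS, Finset.sum_mul]
          congr 2
          simp only [Finset.mul_sum]
          rw [Finset.sum_comm]
          exact Finset.sum_congr rfl fun l _ => Finset.sum_congr rfl fun j _ => by ring
      _ = S + n * (ε ^ 2 * (2 * K + 4 * K ^ 2) * Y ^ 2) := by
          simp [hp1, hu0]
      _ ≤ S + n * (ε ^ 2 * (2 * K + 4 * K ^ 2) * (n * S)) := by gcongr
      _ = D * S := by rw [hD]; ring
  have hSz : S = ∑ j, p j * ∑ l, z j l * g j l := by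
    have h1 : S = ∑ a, y a * ∑ j, p j * ∑ l, ((if a = l then 1 else 0) + ε * L j a l +
        ε ^ 2 * R j a l) * g j l := Finset.sum_congr rfl fun a _ => pow_two (y a)
    rw [h1]
    simp only [Finset.mul_sum]
    rw [Finset.sum_comm]
    refine Finset.sum_congr rfl fun j _ => ?_
    rw [Finset.sum_comm]
    refine Finset.sum_congr rfl fun l _ => ?_
    have h2 : z j l = ∑ a, y a * ((if a = l then 1 else 0) + ε * L j a l + ε ^ 2 * R j a l) := by
      simp only [hz, hu, hw, mul_add, Finset.sum_add_distrib, Finset.mul_sum, mul_ite, mul_one,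
        mul_zero, Finset.sum_ite_eq', Finset.mem_univ, if_true]
      congr 1
      · congr 1
        exact Finset.sum_congr rfl fun a _ => by ring
      · exact Finset.sum_congr rfl fun a _ => by ring
    rw [h2, Finset.sum_mul, Finset.mul_sum]
    exact Finset.sum_congr rfl fun a _ => by ring
  have hfin : S ≤ 1 / 2 * (D⁻¹ * (D * S) + D * G) := by
    have hD0 : 0 < D := by linarith
    calc S = ∑ j, p j * ∑ l, z j l * g j l := hSz
      _ ≤ ∑ j, p j * (1 / 2 * (D⁻¹ * ∑ l, z j l ^ 2 + D * G)) := by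
          refine Finset.sum_le_sum fun j _ => mul_le_mul_of_nonneg_left ?_ (hp j)
          calc ∑ l, z j l * g j l ≤ ∑ l, 1 / 2 * (D⁻¹ * z j l ^ 2 + D * g j l ^ 2) := by
                refine Finset.sum_le_sum fun l _ => ?_
                have : 0 ≤ D⁻¹ * (z j l - D * g j l) ^ 2 := by positivity
                have h3 : D⁻¹ * (z j l - D * g j l) ^ 2 =
                    D⁻¹ * z j l ^ 2 + D * g j l ^ 2 - 2 * (z j l * g j l) := by
                  field_simp; ring
                linarith
            _ = 1 / 2 * (D⁻¹ * ∑ l, z j l ^ 2 + D * ∑ l, g j l ^ 2) := by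
                rw [← Finset.mul_sum, Finset.sum_add_distrib, Finset.mul_sum, Finset.mul_sum]
            _ ≤ _ := by gcongr; exact hG j
      _ = 1 / 2 * (D⁻¹ * ∑ j, p j * ∑ l, z j l ^ 2 + (∑ j, p j) * (D * G)) := by
          rw [Finset.mul_sum, Finset.sum_mul, ← Finset.sum_add_distrib, Finset.mul_sum]
          exact Finset.sum_congr rfl fun j _ => by ring
      _ ≤ _ := by
          rw [hp1, one_mul]
          gcongr
  have hD0 : D ≠ 0 := by linarith
  rw [inv_mul_cancel_left₀ hD0] at hfin
  linarith

/-- First order part of the matrices that act on `jetExt g`. -/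
noncomputable def jetL {κ : Type} [DecidableEq κ] (V : J → Fin N → StateSpace N → ℝ)
    (L : J → κ → κ → StateSpace N → ℝ) :
    J → κ × Option (Fin N) → κ × Option (Fin N) → StateSpace N → ℝ
  | j, (a, none), (l, none) => L j a l
  | _, (_, none), (_, some _) => fun _ => 0
  | j, (a, some i), (l, none) => pd i (L j a l)
  | j, (a, some i), (l, some q) => fun x =>
      L j a l x * (if q = i then 1 else 0) + (if a = l then 1 else 0) * pd i (V j q) x

/-- Higher order part of the matrices that act on `jetExt g`. -/
noncomputable def jetR {κ : Type} [DecidableEq κ] (V : J → Fin N → StateSpace N → ℝ)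
    (b : Fin N → StateSpace N → ℝ) (L : J → κ → κ → StateSpace N → ℝ)
    (R : J → κ → κ → ℝ → StateSpace N → ℝ) :
    J → κ × Option (Fin N) → κ × Option (Fin N) → ℝ → StateSpace N → ℝ
  | j, (a, none), (l, none) => R j a l
  | _, (_, none), (_, some _) => fun _ _ => 0
  | j, (a, some i), (l, none) => fun ε => pd i (R j a l ε)
  | j, (a, some i), (l, some q) => fun ε x =>
      R j a l ε x * (if q = i then 1 else 0) + (if a = l then 1 else 0) * pd i (b q) x +
        L j a l x * pd i (V j q) x + ε * (L j a l x * pd i (b q) x) +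
        ε * (R j a l ε x * pd i (V j q) x) + ε * (ε * (R j a l ε x * pd i (b q) x))

theorem jetExt_vecStep {κ : Type} [Fintype κ] [DecidableEq κ]
    (hV : ∀ j l, CbFun (V j l)) (hb : ∀ l, CbFun (b l)) {L : J → κ → κ → StateSpace N → ℝ}
    {R : J → κ → κ → ℝ → StateSpace N → ℝ} (hL : ∀ j a l, CbFun (L j a l))
    (hR : ∀ j a l, UnifCb fun ε : Set.Icc (0 : ℝ) 1 => R j a l ε) {ε : ℝ}
    (hε : ε ∈ Set.Icc (0 : ℝ) 1) {g : κ → StateSpace N → ℝ}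
    (hg : ∀ a, ContDiff ℝ (⊤ : ℕ∞) (g a)) :
    jetExt (vecStep V b p L R ε g) =
      vecStep V b p (jetL V L) (jetR V b L R) ε (jetExt g) := by
  funext q x
  obtain ⟨a, _ | i⟩ := q
  · simp only [jetExt, vecStep, stepMatrix, jetL, jetR, Fintype.sum_prod_type,
      Fintype.sum_option]
    refine Finset.sum_congr rfl fun j _ => ?_
    congr 1
    refine Finset.sum_congr rfl fun l _ => ?_
    simp
  · have hM : ∀ j l, ContDiff ℝ (⊤ : ℕ∞) (stepMatrix L R ε j a l) := fun j l =>
      contDiff_stepMatrix hL hR hε j a l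
    have hgF : ∀ j l, ContDiff ℝ (⊤ : ℕ∞) fun x => g l (stepMap V b ε j x) := fun j l =>
      (hg l).comp (contDiff_stepMap hV hb ε j)
    have h1 : jetExt (vecStep V b p L R ε g) (a, some i) x = ∑ j, p j * ∑ l,
        (pd i (stepMatrix L R ε j a l) x * g l (stepMap V b ε j x) +
          stepMatrix L R ε j a l x * pd i (fun x => g l (stepMap V b ε j x)) x) := by
      have h2 : jetExt (vecStep V b p L R ε g) (a, some i) = pd i (fun x => ∑ j, p j *
        ∑ l, stepMatrix L R ε j a l x * g l (stepMap V b ε j x)) := rfl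
      rw [h2, pd_sum fun j _ => contDiff_const.mul
        (ContDiff.sum fun l _ => (hM j l).mul (hgF j l))]
      refine Finset.sum_congr rfl fun j _ => ?_
      rw [pd_const_mul (ContDiff.sum fun l _ => (hM j l).mul (hgF j l)),
        pd_sum fun l _ => (hM j l).mul (hgF j l)]
      exact congrArg (p j * ·)
        (Finset.sum_congr rfl fun l _ => congrFun (pd_mul (hM j l) (hgF j l) i) x)
    rw [h1]
    simp only [vecStep, Fintype.sum_prod_type, Fintype.sum_option]
    refine Finset.sum_congr rfl fun j _ => ?_
    congr 1
    refine Finset.sum_congr rfl fun l _ => ?_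
    rw [pd_stepMatrix hL hR hε, pd_comp_stepMap hV hb ε j (hg l), Finset.mul_sum]
    congr 1
    · simp [stepMatrix, jetL, jetR, jetExt]
    · refine Finset.sum_congr rfl fun q _ => ?_
      have h3 : (if ((a, some i) : κ × Option (Fin N)) = (l, some q) then (1 : ℝ) else 0) =
          (if a = l then 1 else 0) * (if q = i then 1 else 0) := by
        by_cases h : a = l <;> by_cases h' : q = i <;> simp [h, h', eq_comm]
        exact fun h'' => h' h''.symm
      simp only [stepMatrix, jetL, jetR, jetExt, h3]
      ring

/-- One step of the scheme increases the squared `C^k`-norm at most by a factor `1 + C ε²`. -/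
theorem exists_jetSq_vecStep_le (hp : ∀ j, 0 ≤ p j) (hp1 : ∑ j, p j = 1)
    (hV : ∀ j l, CbFun (V j l)) (hb : ∀ l, CbFun (b l))
    (hV0 : ∀ l x, ∑ j, p j * V j l x = 0) (k : ℕ) :
    ∀ {κ : Type} [Fintype κ] [DecidableEq κ] {L : J → κ → κ → StateSpace N → ℝ}
      {R : J → κ → κ → ℝ → StateSpace N → ℝ}, (∀ j a l, CbFun (L j a l)) →
      (∀ a l x, ∑ j, p j * L j a l x = 0) →
      (∀ j a l, UnifCb fun ε : Set.Icc (0 : ℝ) 1 => R j a l ε) →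
      ∃ C : ℝ, 0 ≤ C ∧ ∀ ε ∈ Set.Icc (0 : ℝ) 1, ∀ g : κ → StateSpace N → ℝ,
        (∀ a, ContDiff ℝ (⊤ : ℕ∞) (g a)) → ∀ G : ℝ, (∀ x, jetSq k g x ≤ G) →
        ∀ x, jetSq k (vecStep V b p L R ε g) x ≤ (1 + C * ε ^ 2) * G := by
  induction k with
  | zero =>
    intro κ _ _ L R hL hL0 hR
    obtain ⟨K₁, hK₁, hLK⟩ := exists_common_bddBy (β := J × κ × κ) (α := Unit)
      (f := fun q _ => L q.1 q.2.1 q.2.2) (fun q => (hL q.1 q.2.1 q.2.2).unifCb Unit) 0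
    obtain ⟨K₂, hK₂, hRK⟩ := exists_common_bddBy (β := J × κ × κ)
      (f := fun q (ε : Set.Icc (0 : ℝ) 1) => R q.1 q.2.1 q.2.2 ε)
      (fun q => hR q.1 q.2.1 q.2.2) 0
    refine ⟨(Fintype.card κ) ^ 2 * (2 * (K₁ + K₂) + 4 * (K₁ + K₂) ^ 2), by positivity,
      fun ε hε g hg G hG x => ?_⟩
    exact sum_sq_average_le (p := p) hp hp1 (L := fun j a l => L j a l x)
      (R := fun j a l => R j a l ε x) (fun a l => hL0 a l x) (K := K₁ + K₂)
      (fun j a l => (hLK (j, a, l) () x).trans (by linarith))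
      (fun j a l => (hRK (j, a, l) ⟨ε, hε⟩ x).trans (by linarith)) (by positivity)
      hε.1 hε.2 (g := fun j l => g l (stepMap V b ε j x)) fun j => hG _
  | succ k ih =>
    intro κ _ _ L R hL hL0 hR
    have hε1 : ∀ ε : Set.Icc (0 : ℝ) 1, |(ε : ℝ)| ≤ 1 := fun ε => by
      rw [abs_of_nonneg ε.2.1]; exact ε.2.2
    obtain ⟨C, hC, h⟩ := ih (κ := κ × Option (Fin N)) (L := jetL V L) (R := jetR V b L R)
      (by
        rintro j ⟨a, _ | i⟩ ⟨l, _ | q⟩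
        · exact hL j a l
        · exact CbFun.const 0
        · exact (hL j a l).pderiv i
        · exact ((hL j a l).mul (CbFun.const _)).add ((CbFun.const _).mul ((hV j q).pderiv i)))
      (by
        rintro ⟨a, _ | i⟩ ⟨l, _ | q⟩ x
        · exact hL0 a l x
        · simp [jetL]
        · have := pd_sum (s := Finset.univ) (f := fun j x => p j * L j a l x)
            (fun j _ => contDiff_const.mul (hL j a l).1) i
          simp only [hL0, pd_const] at this
          have h2 := congrFun this x
          simp only [pd_const_mul (hL _ a l).1] at h2
          exact h2.symm
        · have := pd_sum (s := Finset.univ) (f := fun j x => p j * V j q x)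
            (fun j _ => contDiff_const.mul (hV j q).1) i
          simp only [hV0, pd_const] at this
          have h2 := congrFun this x
          simp only [pd_const_mul (hV _ q).1] at h2
          simp only [jetL, mul_add, Finset.sum_add_distrib, ← mul_assoc, ← Finset.sum_mul, hL0,
            zero_mul, zero_add]
          rw [Finset.sum_congr rfl fun j _ => mul_right_comm (p j) _ _, ← Finset.sum_mul, ← h2,
            zero_mul])
      (by
        rintro j ⟨a, _ | i⟩ ⟨l, _ | q⟩
        · exact hR j a l
        · exact UnifCb.const (c := fun _ => 0) (C := 0) (by simp)
        · exact (hR j a l).pderiv i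
        · have cL := (hL j a l).unifCb (Set.Icc (0 : ℝ) 1)
          have cV := ((hV j q).pderiv i).unifCb (Set.Icc (0 : ℝ) 1)
          have cb := ((hb q).pderiv i).unifCb (Set.Icc (0 : ℝ) 1)
          have cε := UnifCb.const (N := N) hε1
          have cc : ∀ c : ℝ, UnifCb fun (_ : Set.Icc (0 : ℝ) 1) (_ : StateSpace N) => c :=
            fun c => UnifCb.const (C := |c|) fun _ => le_rfl
          exact ((((((hR j a l).mul (cc _)).add ((cc _).mul cb)).add (cL.mul cV)).add
            (cε.mul (cL.mul cb))).add (cε.mul ((hR j a l).mul cV))).add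
            (cε.mul (cε.mul ((hR j a l).mul cb))))
    refine ⟨C, hC, fun ε hε g hg G hG x => ?_⟩
    have hj : jetSq (k + 1) (vecStep V b p L R ε g) =
      jetSq k (jetExt (vecStep V b p L R ε g)) := rfl
    rw [hj, jetExt_vecStep hV hb hL hR hε hg]
    refine h ε hε (jetExt g) ?_ G hG x
    rintro ⟨a, _ | i⟩
    · exact hg a
    · exact contDiff_pd (hg a) i

variable (V b p)

/-- The composition of the averaging operators with the steps `ε₁, …, εₙ`. -/
noncomputable def stepIter (l : List ℝ) (f : StateSpace N → ℝ) : StateSpace N → ℝ :=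
  l.foldr (fun ε f => stepOp V b p ε f) f

variable {V b p}

theorem contDiff_stepOp (hV : ∀ j l, CbFun (V j l)) (hb : ∀ l, CbFun (b l)) (ε : ℝ)
    {f : StateSpace N → ℝ} (hf : ContDiff ℝ (⊤ : ℕ∞) f) :
    ContDiff ℝ (⊤ : ℕ∞) (stepOp V b p ε f) :=
  ContDiff.sum fun j _ => contDiff_const.mul (hf.comp (contDiff_stepMap hV hb ε j))

theorem contDiff_stepIter (hV : ∀ j l, CbFun (V j l)) (hb : ∀ l, CbFun (b l)) (l : List ℝ)
    {f : StateSpace N → ℝ} (hf : ContDiff ℝ (⊤ : ℕ∞) f) :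
    ContDiff ℝ (⊤ : ℕ∞) (stepIter V b p l f) := by
  induction l with
  | nil => exact hf
  | cons ε l ih => exact contDiff_stepOp hV hb ε ih

/-- Iterations of the scheme over a bounded time `∑ εᵢ²` are bounded in `C^k`, uniformly in the
number and the size of the steps. -/
theorem exists_bddBy_stepIter (hp : ∀ j, 0 ≤ p j) (hp1 : ∑ j, p j = 1)
    (hV : ∀ j l, CbFun (V j l)) (hb : ∀ l, CbFun (b l))
    (hV0 : ∀ l x, ∑ j, p j * V j l x = 0) (k : ℕ) (T : ℝ) :
    ∃ C : ℝ, 0 ≤ C ∧ ∀ l : List ℝ, (∀ ε ∈ l, ε ∈ Set.Icc (0 : ℝ) 1) →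
      (l.map (· ^ 2)).sum ≤ T → ∀ f : StateSpace N → ℝ, ContDiff ℝ (⊤ : ℕ∞) f →
      ∀ M, BddBy k M f → BddBy k (C * M) (stepIter V b p l f) := by
  obtain ⟨C, hC, h⟩ := exists_jetSq_vecStep_le hp hp1 hV hb hV0 k (κ := Unit)
    (L := fun _ _ _ _ => 0) (R := fun _ _ _ _ _ => 0) (fun _ _ _ => CbFun.const 0)
    (fun _ _ _ => by simp) (fun _ _ _ => UnifCb.const (c := fun _ => 0) (C := 0) (by simp))
  have hstep : ∀ ε (f : StateSpace N → ℝ), vecStep V b p (κ := Unit) (fun _ _ _ _ => 0)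
      (fun _ _ _ _ _ => 0) ε (fun _ => f) = fun _ => stepOp V b p ε f := fun ε f => by
    funext a x
    simp [vecStep, stepMatrix, stepOp]
  have hiter : ∀ l : List ℝ, (∀ ε ∈ l, ε ∈ Set.Icc (0 : ℝ) 1) → ∀ f : StateSpace N → ℝ,
      ContDiff ℝ (⊤ : ℕ∞) f → ∀ G : ℝ, 0 ≤ G → (∀ x, jetSq k (fun _ : Unit => f) x ≤ G) →
      ∀ x, jetSq k (fun _ : Unit => stepIter V b p l f) x ≤
        Real.exp (C * (l.map (· ^ 2)).sum) * G := by
    intro l hl f hf G hG hfG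
    induction l with
    | nil => simpa [stepIter] using hfG
    | cons ε l ih =>
      intro x
      have h1 := h ε (hl ε (by simp)) (fun _ => stepIter V b p l f)
        (fun _ => contDiff_stepIter hV hb l hf) _
        (ih fun ε' hε' => hl ε' (by simp [hε'])) x
      rw [hstep] at h1
      refine h1.trans ?_
      rw [List.map_cons, List.sum_cons, mul_add, Real.exp_add, mul_assoc]
      refine mul_le_mul_of_nonneg_right ?_ (by positivity)
      rw [add_comm]
      exact Real.add_one_le_exp _
  set A : ℝ := (N + 1) ^ k * Real.exp (C * T) with hA
  have hA0 : 0 ≤ A := by positivity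
  refine ⟨√A, Real.sqrt_nonneg _, fun l hl hlT f hf M hM => ?_⟩
  have hM0 := hM.nonneg
  refine bddBy_of_jetSq_le k (g := fun _ : Unit => stepIter V b p l f) (by positivity)
    (fun x => ?_) ()
  refine (hiter l hl f hf ((N + 1) ^ k * M ^ 2) (by positivity) (fun x => ?_) x).trans ?_
  · simpa using jetSq_le_of_bddBy k (g := fun _ : Unit => f) (fun _ => hM) x
  · rw [mul_pow, Real.sq_sqrt hA0, hA]
    calc Real.exp (C * (l.map (· ^ 2)).sum) * ((N + 1) ^ k * M ^ 2)
        ≤ Real.exp (C * T) * ((N + 1) ^ k * M ^ 2) := by gcongr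
      _ = _ := by ring

end Scheme

/-! ### The Itô isometry -/

section Ito

variable {Ω : Type*} {mΩ : MeasurableSpace Ω} {μ : Measure Ω} {𝓕 : Filtration ℝ≥0 mΩ}

/-- The properties of a scalar Brownian motion with respect to a filtration that the construction
of the Itô integral uses. -/
structure IsDriver (μ : Measure Ω) (𝓕 : Filtration ℝ≥0 mΩ) (W : ℝ≥0 → Ω → ℝ) : Prop where
  adapted : ∀ t, StronglyMeasurable[𝓕 t] (W t)
  memLp : ∀ t, MemLp (W t) 2 μ
  indep : ∀ s t, s ≤ t → Indep (𝓕 s) (MeasurableSpace.comap (fun ω => W t ω - W s ω) inferInstance) μ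
  mean : ∀ s t, ∫ ω, (W t ω - W s ω) ∂μ = 0
  variance : ∀ s t, s ≤ t → ∫ ω, (W t ω - W s ω) ^ 2 ∂μ = (t : ℝ) - s
  cont : ∀ᵐ ω ∂μ, Continuous fun t => W t ω

theorem IsFiltrationBrownian.isDriver [IsProbabilityMeasure μ] {d : ℕ} {B : Fin d → ℝ≥0 → Ω → ℝ}
    (hB : IsFiltrationBrownian μ 𝓕 B) (i : Fin d) : IsDriver μ 𝓕 (B i) where
  adapted t := hB.adapted i t
  memLp t := ((hB.brownian i).hasLaw_eval t).hasGaussianLaw.memLp_two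
  indep s t hst := by
    refine (indep_of_indep_of_le_left (hB.indep_past s t hst) ?_).symm
    rw [← measurable_iff_comap_le]
    exact (measurable_pi_apply i).comp (comap_measurable fun ω (i : Fin d) => B i t ω - B i s ω)
  mean s t := by
    rw [integral_sub ((hB.brownian i).integrable_eval t) ((hB.brownian i).integrable_eval s),
      (hB.brownian i).integral_eval, (hB.brownian i).integral_eval, sub_zero]
  variance s t hst := by
    have h := (hB.brownian i).hasLaw_sub t s
    have h1 : ∫ ω, (B i t ω - B i s ω) ^ 2 ∂μ =
        ∫ x, x ^ 2 ∂(gaussianReal 0 (nndist (t : ℝ) s)) :=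
      h.integral_comp (f := fun x : ℝ => x ^ 2) (by fun_prop)
    rw [h1]
    have h2 := variance_id_gaussianReal (μ := 0) (v := nndist (t : ℝ) s)
    rw [variance_eq_integral (by fun_prop)] at h2
    simp only [id, integral_id_gaussianReal, sub_zero] at h2
    rw [h2, coe_nndist, Real.dist_eq, abs_of_nonneg (sub_nonneg.2 (by exact_mod_cast hst))]
  cont := (hB.brownian i).cont

namespace IsDriver

variable {W : ℝ≥0 → Ω → ℝ}

theorem memLp_incr (hW : IsDriver μ 𝓕 W) (s t : ℝ≥0) : MemLp (fun ω => W t ω - W s ω) 2 μ :=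
  (hW.memLp t).sub (hW.memLp s)

theorem indepFun (hW : IsDriver μ 𝓕 W) {s t : ℝ≥0} (hst : s ≤ t) {g : Ω → ℝ}
    (hg : AEStronglyMeasurable[𝓕 s] g μ) {φ : ℝ → ℝ} (hφ : Measurable φ) :
    IndepFun g (fun ω => φ (W t ω - W s ω)) μ := by
  obtain ⟨g', hg', hgg'⟩ := hg
  have h : IndepFun g' (fun ω => φ (W t ω - W s ω)) μ := by
    have h1 := indep_of_indep_of_le_left (hW.indep s t hst)
      (measurable_iff_comap_le.1 hg'.measurable)
    exact indep_of_indep_of_le_right h1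
      (measurable_iff_comap_le.1 (hφ.comp (comap_measurable _)))
  exact h.congr hgg'.symm EventuallyEq.rfl

theorem integrable_mul_incr [IsProbabilityMeasure μ] (hW : IsDriver μ 𝓕 W) {s t : ℝ≥0} (hst : s ≤ t) {g : Ω → ℝ}
    (hg : AEStronglyMeasurable[𝓕 s] g μ) (hgi : Integrable g μ) :
    Integrable (fun ω => g ω * (W t ω - W s ω)) μ :=
  (hW.indepFun hst hg measurable_id).integrable_mul hgi
    ((hW.memLp_incr s t).integrable one_le_two)

theorem integral_mul_incr (hW : IsDriver μ 𝓕 W) {s t : ℝ≥0} (hst : s ≤ t) {g : Ω → ℝ}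
    (hg : AEStronglyMeasurable[𝓕 s] g μ) : ∫ ω, g ω * (W t ω - W s ω) ∂μ = 0 := by
  have h := (hW.indepFun hst hg measurable_id).integral_fun_mul_eq_mul_integral
    (hg.mono (𝓕.le s)) (hW.memLp_incr s t).1
  simp only [id] at h
  rw [h, hW.mean, mul_zero]

theorem integrable_mul_incr_sq (hW : IsDriver μ 𝓕 W) {s t : ℝ≥0} (hst : s ≤ t) {g : Ω → ℝ}
    (hg : AEStronglyMeasurable[𝓕 s] g μ) (hgi : Integrable g μ) :
    Integrable (fun ω => g ω * (W t ω - W s ω) ^ 2) μ :=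
  (hW.indepFun hst hg (φ := fun x => x ^ 2) (by fun_prop)).integrable_mul hgi
    (hW.memLp_incr s t).integrable_sq

theorem integral_mul_incr_sq (hW : IsDriver μ 𝓕 W) {s t : ℝ≥0} (hst : s ≤ t) {g : Ω → ℝ}
    (hg : AEStronglyMeasurable[𝓕 s] g μ) :
    ∫ ω, g ω * (W t ω - W s ω) ^ 2 ∂μ = ((t : ℝ) - s) * ∫ ω, g ω ∂μ := by
  have h := (hW.indepFun hst hg (φ := fun x => x ^ 2)
    (by fun_prop)).integral_fun_mul_eq_mul_integral
    (hg.mono (𝓕.le s)) (hW.memLp_incr s t).integrable_sq.1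
  rw [h, hW.variance s t hst, mul_comm]

theorem aesm_incr (hW : IsDriver μ 𝓕 W) {s t v : ℝ≥0} (hsv : s ≤ v) (htv : t ≤ v) :
    AEStronglyMeasurable[𝓕 v] (fun ω => W t ω - W s ω) μ :=
  (((hW.adapted t).mono (𝓕.mono htv)).sub
    ((hW.adapted s).mono (𝓕.mono hsv))).aestronglyMeasurable

theorem memLp_piece (hW : IsDriver μ 𝓕 W) {s t : ℝ≥0} (hst : s ≤ t) {ξ : Ω → ℝ}
    (hξ : AEStronglyMeasurable[𝓕 s] ξ μ) (hξ2 : MemLp ξ 2 μ) :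
    MemLp (fun ω => ξ ω * (W t ω - W s ω)) 2 μ := by
  have hm : AEStronglyMeasurable (fun ω => ξ ω * (W t ω - W s ω)) μ :=
    (hξ.mono (𝓕.le s)).mul (hW.memLp_incr s t).1
  rw [memLp_two_iff_integrable_sq hm]
  simp only [mul_pow]
  exact hW.integrable_mul_incr_sq hst (g := fun ω => ξ ω ^ 2) (hξ.pow 2) hξ2.integrable_sq

variable [IsProbabilityMeasure μ]

/-- The covariance of two elementary stochastic integrals whose intervals of integration begin
at the same time. -/
theorem integral_mul_incr_mul_incr (hW : IsDriver μ 𝓕 W) {a b c : ℝ≥0} (hab : a ≤ b)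
    (hac : a ≤ c) {g : Ω → ℝ} (hg : AEStronglyMeasurable[𝓕 a] g μ) (hgi : Integrable g μ) :
    ∫ ω, g ω * ((W b ω - W a ω) * (W c ω - W a ω)) ∂μ =
      (((min b c : ℝ≥0) : ℝ) - a) * ∫ ω, g ω ∂μ := by
  wlog hbc : b ≤ c generalizing b c
  · rw [min_comm, ← this hac hab (le_of_not_ge hbc)]
    exact integral_congr_ae (ae_of_all _ fun ω => by simp only []; ring)
  have hgb : AEStronglyMeasurable[𝓕 b] (fun ω => g ω * (W b ω - W a ω)) μ :=
    (hg.mono (𝓕.mono hab)).mul (hW.aesm_incr hab le_rfl)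
  have h1 : ∀ ω, g ω * ((W b ω - W a ω) * (W c ω - W a ω)) =
      g ω * (W b ω - W a ω) ^ 2 + g ω * (W b ω - W a ω) * (W c ω - W b ω) := fun ω => by ring
  have hi := hW.integrable_mul_incr hab hg hgi
  simp only [h1]
  rw [integral_add (hW.integrable_mul_incr_sq hab hg hgi) (hW.integrable_mul_incr hbc hgb hi),
    hW.integral_mul_incr_sq hab hg, hW.integral_mul_incr hbc hgb, add_zero, min_eq_left hbc]

/-- The covariance of two elementary stochastic integrals. -/
theorem integral_piece_mul_piece (hW : IsDriver μ 𝓕 W) {a b a' b' : ℝ≥0} (hab : a ≤ b)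
    (hab' : a' ≤ b') {ξ ξ' : Ω → ℝ} (hξ : AEStronglyMeasurable[𝓕 a] ξ μ)
    (hξ' : AEStronglyMeasurable[𝓕 a'] ξ' μ) (h2 : MemLp ξ 2 μ) (h2' : MemLp ξ' 2 μ) :
    ∫ ω, ξ ω * (W b ω - W a ω) * (ξ' ω * (W b' ω - W a' ω)) ∂μ =
      volume.real (Set.Ioc (a : ℝ) b ∩ Set.Ioc (a' : ℝ) b') * ∫ ω, ξ ω * ξ' ω ∂μ := by
  wlog haa : a ≤ a' generalizing a b a' b' ξ ξ'
  · have := this hab' hab hξ' hξ h2' h2 (le_of_not_ge haa)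
    rw [Set.inter_comm]
    convert this using 2
    · funext ω; ring
    · exact congrArg _ (funext fun ω => mul_comm _ _)
  have hξm := hξ.mono (𝓕.mono haa)
  have hvol : volume.real (Set.Ioc (a : ℝ) b ∩ Set.Ioc (a' : ℝ) b') =
      max 0 (((min b b' : ℝ≥0) : ℝ) - a') := by
    rw [Set.Ioc_inter_Ioc, Measure.real, Real.volume_Ioc, ENNReal.toReal_ofReal', max_comm,
      sup_eq_right.2 (show (a : ℝ) ≤ a' by exact_mod_cast haa)]
    simp
  rw [hvol]
  have key : ∀ c : ℝ≥0, a ≤ c → c ≤ a' →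
      ∫ ω, ξ ω * (W c ω - W a ω) * (ξ' ω * (W b' ω - W a' ω)) ∂μ = 0 := fun c hac hca => by
    have hm := (hξm.mul (hW.aesm_incr haa hca)).mul hξ'
    have := hW.integral_mul_incr hab' hm
    rw [← this]
    exact integral_congr_ae (ae_of_all _ fun ω => by simp only [Pi.mul_apply]; ring)
  rcases le_total b a' with hba | hba
  · rw [key b hab hba, max_eq_left, zero_mul]
    have : min b b' ≤ a' := (min_le_left _ _).trans hba
    have : ((min b b' : ℝ≥0) : ℝ) ≤ a' := by exact_mod_cast this
    linarith
  · have hmin : a' ≤ min b b' := le_min hba hab'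
    have hmin' : (a' : ℝ) ≤ ((min b b' : ℝ≥0) : ℝ) := by exact_mod_cast hmin
    rw [max_eq_right (by linarith), ← hW.integral_mul_incr_mul_incr (g := fun ω => ξ ω * ξ' ω)
      hba hab' (hξm.mul hξ') (h2.integrable_mul h2')]
    have h3 : ∀ ω, ξ ω * (W b ω - W a ω) * (ξ' ω * (W b' ω - W a' ω)) =
        ξ ω * (W a' ω - W a ω) * (ξ' ω * (W b' ω - W a' ω)) +
        ξ ω * (W b ω - W a' ω) * (ξ' ω * (W b' ω - W a' ω)) := fun ω => by ring
    have hp := hW.memLp_piece hab' hξ' h2'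
    simp only [h3]
    have i1 : Integrable (fun ω => ξ ω * (W a' ω - W a ω) * (ξ' ω * (W b' ω - W a' ω))) μ :=
      (hW.memLp_piece haa hξ h2).integrable_mul hp
    have i2 : Integrable (fun ω => ξ ω * (W b ω - W a' ω) * (ξ' ω * (W b' ω - W a' ω))) μ :=
      (hW.memLp_piece hba hξm h2).integrable_mul hp
    rw [integral_add i1 i2, key a' haa le_rfl, zero_add]
    exact integral_congr_ae (ae_of_all _ fun ω => by simp only []; ring)

end IsDriver

/-- The elementary pairs on `(a, b]`: an integrand `ξ 1_{(u,v]}` with `ξ ∈ L²` measurable with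
respect to `𝓕 u`, regarded as a function with values in `L²(μ)`, together with its stochastic
integral `ξ (W_v - W_u)`. -/
def itoPieces (μ : Measure Ω) (𝓕 : Filtration ℝ≥0 mΩ) (W : ℝ≥0 → Ω → ℝ) (a b : ℝ≥0) :
    Set (Lp (Lp ℝ 2 μ) 2 (volume : Measure ℝ) × Lp ℝ 2 μ) :=
  {p | ∃ (u v : ℝ≥0) (ξ : Lp ℝ 2 μ), a ≤ u ∧ u ≤ v ∧ v ≤ b ∧ AEStronglyMeasurable[𝓕 u] ξ μ ∧
    p.1 = indicatorConstLp 2 (measurableSet_Ioc (a := (u : ℝ)) (b := v))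
      (by simp [Real.volume_Ioc]) ξ ∧
    p.2 =ᵐ[μ] fun ω => ξ ω * (W v ω - W u ω)}

/-- The graph of the Itô integral on `(a, b]`: the closed linear span of the elementary pairs. -/
noncomputable def itoGraph (μ : Measure Ω) (𝓕 : Filtration ℝ≥0 mΩ) (W : ℝ≥0 → Ω → ℝ)
    (a b : ℝ≥0) : Submodule ℝ (Lp (Lp ℝ 2 μ) 2 (volume : Measure ℝ) × Lp ℝ 2 μ) :=
  (Submodule.span ℝ (itoPieces μ 𝓕 W a b)).topologicalClosure

variable {W : ℝ≥0 → Ω → ℝ} {a b c : ℝ≥0}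

theorem itoGraph_mono {a' b' : ℝ≥0} (ha : a' ≤ a) (hb : b ≤ b') :
    itoGraph μ 𝓕 W a b ≤ itoGraph μ 𝓕 W a' b' := by
  refine Submodule.topologicalClosure_mono (Submodule.span_mono ?_)
  rintro p ⟨u, v, ξ, h1, h2, h3, h4⟩
  exact ⟨u, v, ξ, ha.trans h1, h2, h3.trans hb, h4⟩

/-- A closed linear condition that holds for the elementary pairs holds on the whole graph. -/
theorem itoGraph_le_of_isClosed {S : Submodule ℝ (Lp (Lp ℝ 2 μ) 2 (volume : Measure ℝ) × Lp ℝ 2 μ)}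
    (hS : IsClosed (S : Set (Lp (Lp ℝ 2 μ) 2 (volume : Measure ℝ) × Lp ℝ 2 μ)))
    (h : itoPieces μ 𝓕 W a b ⊆ S) : itoGraph μ 𝓕 W a b ≤ S :=
  Submodule.topologicalClosure_minimal _ (Submodule.span_le.2 h) hS

variable [IsProbabilityMeasure μ]

/-- The Itô isometry. -/
theorem itoGraph_norm (hW : IsDriver μ 𝓕 W)
    {p : Lp (Lp ℝ 2 μ) 2 (volume : Measure ℝ) × Lp ℝ 2 μ} (hp : p ∈ itoGraph μ 𝓕 W a b) :
    ‖p.2‖ = ‖p.1‖ := by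
  have hin : ∀ p ∈ Submodule.span ℝ (itoPieces μ 𝓕 W a b),
      ∀ q ∈ Submodule.span ℝ (itoPieces μ 𝓕 W a b), inner ℝ p.1 q.1 = inner ℝ p.2 q.2 := by
    intro p hp q hq
    induction hp, hq using Submodule.span_induction₂ with
    | mem_mem p q hp hq =>
      obtain ⟨u, v, ξ, -, huv, -, hξ, hp1, hp2⟩ := hp
      obtain ⟨u', v', ξ', -, huv', -, hξ', hq1, hq2⟩ := hq
      rw [hp1, hq1, L2.inner_indicatorConstLp_indicatorConstLp _ _ (by simp) (by simp), L2.inner_def, L2.inner_def]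
      have h1 : ∫ ω, inner ℝ (p.2 ω) (q.2 ω) ∂μ =
          ∫ ω, ξ ω * (W v ω - W u ω) * (ξ' ω * (W v' ω - W u' ω)) ∂μ := by
        refine integral_congr_ae ?_
        filter_upwards [hp2, hq2] with ω h h'
        rw [h, h']
        simp only [RCLike.inner_apply, conj_trivial]
        ring
      rw [h1, hW.integral_piece_mul_piece huv huv' hξ hξ' (Lp.memLp ξ) (Lp.memLp ξ'), smul_eq_mul]
      congr 1
      refine integral_congr_ae (ae_of_all _ fun ω => ?_)
      simp only [RCLike.inner_apply, conj_trivial]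
      ring
    | zero_left => simp
    | zero_right => simp
    | add_left x y z _ _ _ h1 h2 => simp [inner_add_left, h1, h2]
    | add_right x y z _ _ _ h1 h2 => simp [inner_add_right, h1, h2]
    | smul_left r x y _ _ h => simp [inner_smul_left, h]
    | smul_right r x y _ _ h => simp [inner_smul_right, h]
  have hcl : IsClosed {p : Lp (Lp ℝ 2 μ) 2 (volume : Measure ℝ) × Lp ℝ 2 μ | ‖p.2‖ = ‖p.1‖} :=
    isClosed_eq (by fun_prop) (by fun_prop)
  refine closure_minimal (t := {p | ‖p.2‖ = ‖p.1‖}) (fun p hp => ?_) hcl hp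
  have := hin p hp p hp
  rw [real_inner_self_eq_norm_sq, real_inner_self_eq_norm_sq] at this
  exact ((pow_left_inj₀ (norm_nonneg _) (norm_nonneg _) two_ne_zero).1 this).symm

/-- Stochastic integrals over `(a, b]` are measurable with respect to `𝓕 b`. -/
theorem itoGraph_aesm (hW : IsDriver μ 𝓕 W)
    {p : Lp (Lp ℝ 2 μ) 2 (volume : Measure ℝ) × Lp ℝ 2 μ} (hp : p ∈ itoGraph μ 𝓕 W a b) :
    AEStronglyMeasurable[𝓕 b] p.2 μ := by
  have hcl : IsClosed {p : Lp (Lp ℝ 2 μ) 2 (volume : Measure ℝ) × Lp ℝ 2 μ |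
      AEStronglyMeasurable[𝓕 b] p.2 μ} :=
    (isClosed_aestronglyMeasurable (F := ℝ) (p := 2) (μ := μ) (𝓕.le b)).preimage continuous_snd
  have hle := itoGraph_le_of_isClosed (μ := μ) (𝓕 := 𝓕) (W := W) (a := a) (b := b)
    (S := (lpMeas ℝ ℝ (𝓕 b) 2 μ).comap (LinearMap.snd ℝ _ _))
    (by
      convert hcl using 1
      ext p
      simp [mem_lpMeas_iff_aestronglyMeasurable])
    (by
      rintro p ⟨u, v, ξ, -, huv, hvb, hξ, -, hp2⟩
      simp only [SetLike.mem_coe, Submodule.mem_comap, LinearMap.snd_apply,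
        mem_lpMeas_iff_aestronglyMeasurable]
      exact ((hξ.mono (𝓕.mono (huv.trans hvb))).mul (hW.aesm_incr (huv.trans hvb) hvb)).congr
        hp2.symm)
  have := hle hp
  simpa [mem_lpMeas_iff_aestronglyMeasurable] using this

/-- Stochastic integrals over `(a, b]` are orthogonal to all random variables that are measurable
with respect to `𝓕 a`. -/
theorem itoGraph_orth (hW : IsDriver μ 𝓕 W)
    {p : Lp (Lp ℝ 2 μ) 2 (volume : Measure ℝ) × Lp ℝ 2 μ} (hp : p ∈ itoGraph μ 𝓕 W a b)
    {g : Ω → ℝ} (hg : AEStronglyMeasurable[𝓕 a] g μ) (hg2 : MemLp g 2 μ) :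
    ∫ ω, g ω * p.2 ω ∂μ = 0 := by
  set g' := hg2.toLp g with hg'
  have hgg : g' =ᵐ[μ] g := hg2.coeFn_toLp
  have hle := itoGraph_le_of_isClosed (μ := μ) (𝓕 := 𝓕) (W := W) (a := a) (b := b)
    (S := LinearMap.ker ((innerSL ℝ g').toLinearMap ∘ₗ (LinearMap.snd ℝ _ _)))
    (by
      have : IsClosed {p : Lp (Lp ℝ 2 μ) 2 (volume : Measure ℝ) × Lp ℝ 2 μ |
        innerSL ℝ g' p.2 = 0} := isClosed_eq (by fun_prop) continuous_const
      exact this)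
    (by
      rintro p ⟨u, v, ξ, hau, huv, -, hξ, -, hp2⟩
      simp only [SetLike.mem_coe, LinearMap.mem_ker, LinearMap.coe_comp, Function.comp_apply,
        LinearMap.snd_apply, ContinuousLinearMap.coe_coe, innerSL_apply_apply, L2.inner_def]
      have hm := (hg.mono (𝓕.mono hau)).mul hξ
      rw [← hW.integral_mul_incr huv hm]
      refine integral_congr_ae ?_
      filter_upwards [hp2, hgg] with ω h1 h2
      rw [h1, h2]
      simp only [RCLike.inner_apply, conj_trivial, Pi.mul_apply]
      ring)
  have h := hle hp
  simp only [LinearMap.mem_ker, LinearMap.coe_comp, Function.comp_apply,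
    LinearMap.snd_apply, ContinuousLinearMap.coe_coe, innerSL_apply_apply, L2.inner_def] at h
  rw [← h]
  refine integral_congr_ae ?_
  filter_upwards [hgg] with ω h2
  rw [h2]
  simp only [RCLike.inner_apply, conj_trivial]
  ring

end Ito

/-! ### Stochastic integrals of `L²`-valued integrands -/

section ItoRel

variable {Ω : Type*} {mΩ : MeasurableSpace Ω} {μ : Measure Ω} {𝓕 : Filtration ℝ≥0 mΩ}
  {W : ℝ≥0 → Ω → ℝ} {a b c : ℝ≥0}

theorem norm_eq_of_mem_itoGraph [IsProbabilityMeasure μ] (hW : IsDriver μ 𝓕 W)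
    {x : Lp (Lp ℝ 2 μ) 2 (volume : Measure ℝ)} {I : Lp ℝ 2 μ}
    (h : (x, I) ∈ itoGraph μ 𝓕 W a b) : ‖I‖ = ‖x‖ := by
  generalize hp : (x, I) = p at h
  have h2 := itoGraph_norm hW h
  have e1 : p.1 = x := by rw [← hp]
  have e2 : p.2 = I := by rw [← hp]
  rwa [e1, e2] at h2

theorem norm_sub_eq_of_mem_itoGraph [IsProbabilityMeasure μ] (hW : IsDriver μ 𝓕 W)
    {x x' : Lp (Lp ℝ 2 μ) 2 (volume : Measure ℝ)} {I I' : Lp ℝ 2 μ}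
    (h : (x, I) ∈ itoGraph μ 𝓕 W a b) (h' : (x', I') ∈ itoGraph μ 𝓕 W a b) :
    ‖I - I'‖ = ‖x - x'‖ :=
  norm_eq_of_mem_itoGraph hW (Submodule.sub_mem _ h h')

/-- `I = ∫_a^b H dW` for an integrand `H` with values in `L²(μ)`. -/
def ItoRel (μ : Measure Ω) (𝓕 : Filtration ℝ≥0 mΩ) (W : ℝ≥0 → Ω → ℝ) (a b : ℝ≥0)
    (H : ℝ≥0 → Lp ℝ 2 μ) (I : Lp ℝ 2 μ) : Prop :=
  ∃ x : Lp (Lp ℝ 2 μ) 2 (volume : Measure ℝ),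
    x =ᵐ[volume] (Set.Ioc (a : ℝ) b).indicator (fun r => H r.toNNReal) ∧
    (x, I) ∈ itoGraph μ 𝓕 W a b

theorem toNNReal_mem_Ioc {r : ℝ} (hr : r ∈ Set.Ioc (a : ℝ) b) : r.toNNReal ∈ Set.Ioc a b := by
  have h0 : 0 ≤ r := a.2.trans hr.1.le
  constructor
  · rw [← NNReal.coe_lt_coe, Real.coe_toNNReal _ h0]; exact hr.1
  · rw [← NNReal.coe_le_coe, Real.coe_toNNReal _ h0]; exact hr.2

theorem norm_sq_le_of_indicator (hab : a ≤ b) {x : Lp (Lp ℝ 2 μ) 2 (volume : Measure ℝ)}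
    {H : ℝ≥0 → Lp ℝ 2 μ}
    (hx : x =ᵐ[volume] (Set.Ioc (a : ℝ) b).indicator (fun r => H r.toNNReal)) {C : ℝ}
    (hC : ∀ r ∈ Set.Ioc a b, ‖H r‖ ≤ C) : ‖x‖ ^ 2 ≤ C ^ 2 * ((b : ℝ) - a) := by
  have h1 : ‖x‖ ^ 2 = ∫ r in Set.Ioc (a : ℝ) b, ‖H r.toNNReal‖ ^ 2 := by
    rw [← real_inner_self_eq_norm_sq, L2.inner_def, ← integral_indicator measurableSet_Ioc]
    refine integral_congr_ae ?_
    filter_upwards [hx] with r hr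
    rw [hr, real_inner_self_eq_norm_sq]
    by_cases h : r ∈ Set.Ioc (a : ℝ) b <;> simp [h]
  have h2 := norm_setIntegral_le_of_norm_le_const (μ := volume) (s := Set.Ioc (a : ℝ) b)
    (f := fun r => ‖H r.toNNReal‖ ^ 2) (C := C ^ 2) (by simp) fun r hr => by
      rw [norm_pow, norm_norm]
      exact pow_le_pow_left₀ (norm_nonneg _) (hC _ (toNNReal_mem_Ioc hr)) 2
  rw [h1]
  refine (le_abs_self _).trans (h2.trans (le_of_eq ?_))
  rw [Measure.real, Real.volume_Ioc, ENNReal.toReal_ofReal (sub_nonneg.2 (by exact_mod_cast hab))]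

theorem lintegral_enorm_sq_eq {α E : Type*} {m : MeasurableSpace α} {ν : Measure α}
    [NormedAddCommGroup E] (F : Lp E 2 ν) {f : α → E} (hf : F =ᵐ[ν] f) :
    ∫⁻ ω, ‖f ω‖ₑ ^ 2 ∂ν = ‖F‖ₑ ^ 2 := by
  rw [Lp.enorm_def, eLpNorm_congr_ae hf, eLpNorm_eq_lintegral_rpow_enorm_toReal (by simp) (by simp),
    ← ENNReal.rpow_natCast _ 2, ← ENNReal.rpow_mul]
  simp

namespace ItoRel

variable {H H' : ℝ≥0 → Lp ℝ 2 μ} {I I' : Lp ℝ 2 μ}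

theorem congr (h : ItoRel μ 𝓕 W a b H I) (hH : ∀ r ∈ Set.Ioc a b, H r = H' r) :
    ItoRel μ 𝓕 W a b H' I := by
  obtain ⟨x, hx, hm⟩ := h
  refine ⟨x, hx.trans (Eventually.of_forall fun r => ?_), hm⟩
  by_cases hr : r ∈ Set.Ioc (a : ℝ) b
  · simp [hr, hH _ (toNNReal_mem_Ioc hr)]
  · simp [hr]

theorem add (h : ItoRel μ 𝓕 W a b H I) (h' : ItoRel μ 𝓕 W a b H' I') :
    ItoRel μ 𝓕 W a b (fun r => H r + H' r) (I + I') := by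
  obtain ⟨x, hx, hm⟩ := h
  obtain ⟨x', hx', hm'⟩ := h'
  refine ⟨x + x', ?_, add_mem hm hm'⟩
  filter_upwards [hx, hx', Lp.coeFn_add x x'] with r h1 h2 h3
  rw [h3, Pi.add_apply, h1, h2]
  by_cases hr : r ∈ Set.Ioc (a : ℝ) b <;> simp [hr]

theorem smul (h : ItoRel μ 𝓕 W a b H I) (t : ℝ) :
    ItoRel μ 𝓕 W a b (fun r => t • H r) (t • I) := by
  obtain ⟨x, hx, hm⟩ := h
  refine ⟨t • x, ?_, Submodule.smul_mem _ t hm⟩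
  filter_upwards [hx, Lp.coeFn_smul t x] with r h1 h3
  rw [h3, Pi.smul_apply, h1]
  by_cases hr : r ∈ Set.Ioc (a : ℝ) b <;> simp [hr]

theorem sub (h : ItoRel μ 𝓕 W a b H I) (h' : ItoRel μ 𝓕 W a b H' I') :
    ItoRel μ 𝓕 W a b (fun r => H r - H' r) (I - I') := by
  have := h.add (h'.smul (-1))
  simpa [sub_eq_add_neg] using this

theorem concat (h : ItoRel μ 𝓕 W a b H I) (h' : ItoRel μ 𝓕 W b c H I') (hab : a ≤ b)
    (hbc : b ≤ c) : ItoRel μ 𝓕 W a c H (I + I') := by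
  obtain ⟨x, hx, hm⟩ := h
  obtain ⟨x', hx', hm'⟩ := h'
  refine ⟨x + x', ?_, add_mem (itoGraph_mono le_rfl hbc hm) (itoGraph_mono hab le_rfl hm')⟩
  filter_upwards [hx, hx', Lp.coeFn_add x x'] with r h1 h2 h3
  rw [h3, Pi.add_apply, h1, h2]
  have hab' : (a : ℝ) ≤ b := by exact_mod_cast hab
  have hbc' : (b : ℝ) ≤ c := by exact_mod_cast hbc
  simp only [Set.indicator_apply, Set.mem_Ioc]
  by_cases h1 : (a : ℝ) < r <;> by_cases h2 : r ≤ (b : ℝ) <;> by_cases h3 : r ≤ (c : ℝ)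
  all_goals first
    | (exfalso; linarith)
    | (have hb : (b : ℝ) < r := lt_of_not_ge h2; simp [h1, h2, h3, hb])
    | (have hb : ¬ (b : ℝ) < r := not_lt.2 h2; simp [h1, h2, h3, hb])

theorem piece {ξ : Lp ℝ 2 μ} (hab : a ≤ b) (hξ : AEStronglyMeasurable[𝓕 a] ξ μ)
    (hI : I =ᵐ[μ] fun ω => ξ ω * (W b ω - W a ω)) : ItoRel μ 𝓕 W a b (fun _ => ξ) I :=
  ⟨indicatorConstLp 2 (measurableSet_Ioc (a := (a : ℝ)) (b := b)) (by simp [Real.volume_Ioc]) ξ,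
    indicatorConstLp_coeFn, subset_closure (Submodule.subset_span
      ⟨a, b, ξ, le_rfl, hab, le_rfl, hξ, rfl, hI⟩)⟩

theorem refl_zero : ItoRel μ 𝓕 W a a H 0 := by
  refine ⟨0, ?_, zero_mem _⟩
  rw [Set.Ioc_self, Set.indicator_empty]
  exact Lp.coeFn_zero _ _ _

/-- The elementary stochastic integral of a step process. -/
theorem sum_pieces {t : ℕ → ℝ≥0} (ht : Monotone t) {ξ J : ℕ → Lp ℝ 2 μ} {n : ℕ}
    (hξ : ∀ k < n, AEStronglyMeasurable[𝓕 (t k)] (ξ k) μ)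
    (hJ : ∀ k < n, J k =ᵐ[μ] fun ω => ξ k ω * (W (t (k + 1)) ω - W (t k) ω))
    (hH : ∀ k < n, ∀ r ∈ Set.Ioc (t k) (t (k + 1)), H r = ξ k) :
    ItoRel μ 𝓕 W (t 0) (t n) H (∑ k ∈ Finset.range n, J k) := by
  induction n with
  | zero => exact refl_zero
  | succ n ih =>
    rw [Finset.sum_range_succ]
    refine (ih (fun k hk => hξ k (by omega)) (fun k hk => hJ k (by omega))
      (fun k hk => hH k (by omega))).concat ?_ (ht (Nat.zero_le n)) (ht (Nat.le_succ n))
    exact (piece (ht (Nat.le_succ n)) (hξ n (by omega)) (hJ n (by omega))).congr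
      fun r hr => (hH n (by omega) r hr).symm

variable [IsProbabilityMeasure μ]

theorem aesm (hW : IsDriver μ 𝓕 W) (h : ItoRel μ 𝓕 W a b H I) :
    AEStronglyMeasurable[𝓕 b] I μ := by
  obtain ⟨x, hx, hm⟩ := h
  exact itoGraph_aesm hW hm

theorem orth (hW : IsDriver μ 𝓕 W) (h : ItoRel μ 𝓕 W a b H I) {g : Ω → ℝ}
    (hg : AEStronglyMeasurable[𝓕 a] g μ) (hg2 : MemLp g 2 μ) : ∫ ω, g ω * I ω ∂μ = 0 := by
  obtain ⟨x, hx, hm⟩ := h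
  exact itoGraph_orth hW hm hg hg2

theorem norm_sq_le (hW : IsDriver μ 𝓕 W) (h : ItoRel μ 𝓕 W a b H I) (hab : a ≤ b) {C : ℝ}
    (hC : ∀ r ∈ Set.Ioc a b, ‖H r‖ ≤ C) : ‖I‖ ^ 2 ≤ C ^ 2 * ((b : ℝ) - a) := by
  obtain ⟨x, hx, hm⟩ := h
  exact (congrArg (· ^ 2) (norm_eq_of_mem_itoGraph hW hm)).trans_le
    (norm_sq_le_of_indicator hab hx hC)

theorem norm_le (hW : IsDriver μ 𝓕 W) (h : ItoRel μ 𝓕 W a b H I) (hab : a ≤ b) {C : ℝ}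
    (hC0 : 0 ≤ C) (hC : ∀ r ∈ Set.Ioc a b, ‖H r‖ ≤ C) : ‖I‖ ≤ C * √((b : ℝ) - a) := by
  have h0 : 0 ≤ (b : ℝ) - a := sub_nonneg.2 (by exact_mod_cast hab)
  refine (pow_le_pow_iff_left₀ (norm_nonneg _) (by positivity) two_ne_zero).1 ?_
  rw [mul_pow, Real.sq_sqrt h0]
  exact h.norm_sq_le hW hab hC

theorem unique (hW : IsDriver μ 𝓕 W) (h : ItoRel μ 𝓕 W a b H I) (h' : ItoRel μ 𝓕 W a b H I') :
    I = I' := by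
  obtain ⟨x, hx, hm⟩ := h
  obtain ⟨x', hx', hm'⟩ := h'
  have hxx : x = x' := Lp.ext (hx.trans hx'.symm)
  subst hxx
  have := itoGraph_norm hW (sub_mem hm hm')
  simp only [Prod.mk_sub_mk, sub_self, norm_zero, norm_eq_zero] at this
  exact sub_eq_zero.1 this

end ItoRel

/-- The `L²`-valued function `H` is a continuous adapted version of the process `Hf` on
`[a, b]`. -/
structure IsIntegrand (μ : Measure Ω) (𝓕 : Filtration ℝ≥0 mΩ) (a b : ℝ≥0) (Hf : ℝ≥0 → Ω → ℝ)
    (H : ℝ≥0 → Lp ℝ 2 μ) : Prop where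
  cont : ContinuousOn H (Set.Icc a b)
  adapted : ∀ r ∈ Set.Icc a b, AEStronglyMeasurable[𝓕 r] (H r) μ
  rep : ∀ r ∈ Set.Icc a b, H r =ᵐ[μ] Hf r

theorem IsIntegrand.mono {Hf : ℝ≥0 → Ω → ℝ} {H : ℝ≥0 → Lp ℝ 2 μ} {a' b' : ℝ≥0}
    (h : IsIntegrand μ 𝓕 a b Hf H) (ha : a ≤ a') (hb : b' ≤ b) : IsIntegrand μ 𝓕 a' b' Hf H :=
  have hs : Set.Icc a' b' ⊆ Set.Icc a b := Set.Icc_subset_Icc ha hb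
  ⟨h.cont.mono hs, fun r hr => h.adapted r (hs hr), fun r hr => h.rep r (hs hr)⟩

theorem memLp_indicator {H : ℝ≥0 → Lp ℝ 2 μ} (hH : ContinuousOn H (Set.Icc a b)) :
    MemLp ((Set.Ioc (a : ℝ) b).indicator fun r => H r.toNNReal) 2 (volume : Measure ℝ) := by
  rw [memLp_indicator_iff_restrict measurableSet_Ioc]
  have hc : ContinuousOn (fun r : ℝ => H r.toNNReal) (Set.Icc (a : ℝ) b) := by
    refine hH.comp continuous_real_toNNReal.continuousOn fun r hr => ?_
    have h0 : 0 ≤ r := a.2.trans hr.1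
    constructor
    · rw [← NNReal.coe_le_coe, Real.coe_toNNReal _ h0]; exact hr.1
    · rw [← NNReal.coe_le_coe, Real.coe_toNNReal _ h0]; exact hr.2
  obtain ⟨C, hC⟩ := isCompact_Icc.exists_bound_of_continuousOn hc
  have : IsFiniteMeasure (volume.restrict (Set.Ioc (a : ℝ) b)) := ⟨by simp⟩
  refine MemLp.of_bound ((hc.mono Set.Ioc_subset_Icc_self).aestronglyMeasurable
    measurableSet_Ioc) C ?_
  filter_upwards [ae_restrict_mem measurableSet_Ioc] with r hr
  exact hC r (Set.Ioc_subset_Icc_self hr)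

/-- The uniform grid with `n` cells on `[a, b]`. -/
noncomputable def grid (a b : ℝ≥0) (n k : ℕ) : ℝ≥0 := a + k * ((b - a) / n)

theorem grid_zero (n : ℕ) : grid a b n 0 = a := by simp [grid]

theorem grid_self (hab : a ≤ b) {n : ℕ} (hn : n ≠ 0) : grid a b n n = b := by
  have : (n : ℝ≥0) ≠ 0 := by exact_mod_cast hn
  rw [grid, mul_div_cancel₀ _ this, add_tsub_cancel_of_le hab]

theorem grid_mono (n : ℕ) : Monotone (grid a b n) := fun k l hkl => by
  unfold grid
  gcongr

theorem grid_succ (n k : ℕ) : grid a b n (k + 1) = grid a b n k + (b - a) / n := by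
  simp [grid, add_mul, add_assoc]

theorem grid_mem (hab : a ≤ b) {n k : ℕ} (hk : k ≤ n) : grid a b n k ∈ Set.Icc a b := by
  refine ⟨by simp [grid], ?_⟩
  rcases Nat.eq_zero_or_pos n with rfl | hn
  · simpa [grid] using hab
  · exact (grid_mono n hk).trans (grid_self hab hn.ne').le

theorem exists_grid_cell (hab : a ≤ b) {n : ℕ} (hn : n ≠ 0) {r : ℝ≥0} (hr : r ∈ Set.Ioc a b) :
    ∃ k < n, r ∈ Set.Ioc (grid a b n k) (grid a b n (k + 1)) := by
  classical
  have hex : ∃ k, r ≤ grid a b n k := ⟨n, by rw [grid_self hab hn]; exact hr.2⟩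
  have h0 : Nat.find hex ≠ 0 := fun h => by
    have := Nat.find_spec hex
    rw [h, grid_zero] at this
    exact absurd hr.1 (not_lt.2 this)
  obtain ⟨k, hk⟩ := Nat.exists_eq_succ_of_ne_zero h0
  refine ⟨k, ?_, ?_, ?_⟩
  · have := Nat.find_min' hex (show r ≤ grid a b n n by rw [grid_self hab hn]; exact hr.2)
    omega
  · exact not_le.1 (Nat.find_min hex (by omega))
  · have := Nat.find_spec hex
    rwa [hk] at this

/-- Step functions on uniform grids approximate a continuous function uniformly. -/
theorem exists_grid_modulus {E : Type*} [PseudoMetricSpace E] {H : ℝ≥0 → E}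
    (hH : ContinuousOn H (Set.Icc a b)) (hab : a ≤ b) {ε : ℝ} (hε : 0 < ε) :
    ∃ n₀ : ℕ, ∀ n ≥ n₀, n ≠ 0 → ∀ k < n, ∀ r ∈ Set.Icc (grid a b n k) (grid a b n (k + 1)),
      dist (H (grid a b n k)) (H r) < ε := by
  have huc := isCompact_Icc.uniformContinuousOn_of_continuous hH
  rw [Metric.uniformContinuousOn_iff] at huc
  obtain ⟨δ, hδ, h⟩ := huc ε hε
  obtain ⟨n₀, hn₀⟩ := exists_nat_gt (((b - a : ℝ≥0) : ℝ) / δ)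
  refine ⟨n₀, fun n hn hn0 k hk r hr => h _ (grid_mem hab hk.le) _
    ⟨(grid_mem hab hk.le).1.trans hr.1, hr.2.trans (grid_mem hab hk).2⟩ ?_⟩
  have hnpos : (0 : ℝ) < n := by exact_mod_cast Nat.pos_of_ne_zero hn0
  have h1 : (r : ℝ) - grid a b n k ≤ ((b - a : ℝ≥0) : ℝ) / n := by
    have : (r : ℝ) ≤ grid a b n (k + 1) := by exact_mod_cast hr.2
    rw [grid_succ] at this
    push_cast at this ⊢
    linarith
  have h2 : (grid a b n k : ℝ) ≤ r := by exact_mod_cast hr.1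
  rw [dist_comm, NNReal.dist_eq, abs_of_nonneg (sub_nonneg.2 h2)]
  refine h1.trans_lt ?_
  have h3 : (n₀ : ℝ) ≤ n := by exact_mod_cast hn
  rw [div_lt_iff₀ hnpos]
  rw [div_lt_iff₀ hδ] at hn₀
  nlinarith

/-! ### Existence of the Itô integral -/

section Existence

variable [IsProbabilityMeasure μ] {H : ℝ≥0 → Lp ℝ 2 μ}

/-- The graph of the Itô integral is closed under uniform approximation of the integrand. -/
theorem exists_itoRel_of_approx (hW : IsDriver μ 𝓕 W) (hab : a ≤ b)
    (hH : ContinuousOn H (Set.Icc a b)) {K : ℕ → ℝ≥0 → Lp ℝ 2 μ} {J : ℕ → Lp ℝ 2 μ}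
    (hK : ∀ n, ItoRel μ 𝓕 W a b (K n) (J n)) {ε : ℕ → ℝ} (hε : Tendsto ε atTop (𝓝 0))
    (hε0 : ∀ n, 0 ≤ ε n)
    (hKH : ∀ n, ∀ r ∈ Set.Ioc a b, ‖K n r - H r‖ ≤ ε n) :
    ∃ I, ItoRel μ 𝓕 W a b H I ∧ Tendsto J atTop (𝓝 I) := by
  choose x hx hm using hK
  set y := (memLp_indicator hH).toLp _ with hy
  have hy' : y =ᵐ[volume] (Set.Ioc (a : ℝ) b).indicator fun r => H r.toNNReal :=
    (memLp_indicator hH).coeFn_toLp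
  have hxy : Tendsto x atTop (𝓝 y) := by
    rw [tendsto_iff_norm_sub_tendsto_zero]
    refine squeeze_zero (g := fun n => ε n * √((b : ℝ) - a)) (fun _ => norm_nonneg _)
      (fun n => ?_) (by simpa using hε.mul_const _)
    have h0 : 0 ≤ (b : ℝ) - a := sub_nonneg.2 (by exact_mod_cast hab)
    refine (pow_le_pow_iff_left₀ (norm_nonneg _) (mul_nonneg (hε0 n) (Real.sqrt_nonneg _))
      two_ne_zero).1 ?_
    rw [mul_pow, Real.sq_sqrt h0]
    refine norm_sq_le_of_indicator (H := fun r => K n r - H r) hab ?_ (hKH n)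
    filter_upwards [hx n, hy', Lp.coeFn_sub (x n) y] with r h1 h2 h3
    rw [h3, Pi.sub_apply, h1, h2]
    by_cases hr : r ∈ Set.Ioc (a : ℝ) b <;> simp [hr]
  have hJ : CauchySeq J := by
    have hc := hxy.cauchySeq
    rw [Metric.cauchySeq_iff] at hc ⊢
    intro δ hδ
    obtain ⟨n₀, h⟩ := hc δ hδ
    refine ⟨n₀, fun m hm' n hn => ?_⟩
    refine lt_of_eq_of_lt ?_ (h m hm' n hn)
    rw [dist_eq_norm, dist_eq_norm]
    exact norm_sub_eq_of_mem_itoGraph hW (hm m) (hm n)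
  obtain ⟨I, hI⟩ := cauchySeq_tendsto_of_complete hJ
  refine ⟨I, ⟨y, hy', ?_⟩, hI⟩
  exact (Submodule.isClosed_topologicalClosure _).mem_of_tendsto (hxy.prodMk_nhds hI)
    (Eventually.of_forall hm)

theorem exists_bounded_approx {m : MeasurableSpace Ω} (hm : m ≤ mΩ) {ξ : Lp ℝ 2 μ}
    (hξ : AEStronglyMeasurable[m] ξ μ) {ε : ℝ} (hε : 0 < ε) :
    ∃ g : Ω → ℝ, StronglyMeasurable[m] g ∧ (∃ C : ℝ, ∀ ω, |g ω| ≤ C) ∧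
      ∃ G : Lp ℝ 2 μ, G =ᵐ[μ] g ∧ ‖G - ξ‖ ≤ ε := by
  obtain ⟨ξ', hξ', hξξ'⟩ := hξ
  have hmem : MemLp ξ' 2 (μ.trim hm) :=
    ⟨hξ'.aestronglyMeasurable, by
      rw [eLpNorm_trim hm hξ', ← eLpNorm_congr_ae hξξ']
      exact (Lp.memLp ξ).2⟩
  obtain ⟨g, hg, hg2⟩ := hmem.exists_simpleFunc_eLpNorm_sub_lt (by simp)
    (ε := ENNReal.ofReal ε) (by simpa using hε)
  have hgm : StronglyMeasurable[m] g := g.stronglyMeasurable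
  have hg2' : MemLp g 2 μ := memLp_of_memLp_trim hm hg2
  obtain ⟨C, hC⟩ := g.exists_forall_norm_le
  refine ⟨g, hgm, ⟨C, hC⟩, hg2'.toLp _, hg2'.coeFn_toLp, ?_⟩
  rw [eLpNorm_trim hm (hξ'.sub hgm)] at hg
  rw [Lp.norm_def, eLpNorm_congr_ae (g := fun ω => g ω - ξ' ω)]
  · refine ENNReal.toReal_le_of_le_ofReal hε.le ?_
    have : (fun ω => g ω - ξ' ω) = -(ξ' - ⇑g) := by
      funext ω; simp
    rw [this, eLpNorm_neg]
    exact hg.le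
  · filter_upwards [Lp.coeFn_sub (hg2'.toLp _) ξ, hg2'.coeFn_toLp, hξξ'] with ω h1 h2 h3
    rw [h1, Pi.sub_apply, h2, h3]

end Existence

end ItoRel

/-! ### Simple integrands and Riemann sums -/

section ItoIntegral

variable {Ω : Type*} {mΩ : MeasurableSpace Ω} {μ : Measure Ω} {𝓕 : Filtration ℝ≥0 mΩ}
  {W : ℝ≥0 → Ω → ℝ} {a b c : ℝ≥0}

theorem sum_indicator_Ioc_eq {E : Type*} [AddCommMonoid E] {t : ℕ → ℝ≥0} (ht : Monotone t) {n : ℕ}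
    (ξ : ℕ → E) {k : ℕ} (hk : k < n) {r : ℝ≥0} (hr : r ∈ Set.Ioc (t k) (t (k + 1))) :
    ∑ l ∈ Finset.range n, (Set.Ioc (t l) (t (l + 1))).indicator (fun _ => ξ l) r = ξ k := by
  rw [Finset.sum_eq_single_of_mem k (Finset.mem_range.2 hk), Set.indicator_of_mem hr]
  intro l _ hl
  refine Set.indicator_of_notMem (fun h => ?_) _
  rcases lt_or_gt_of_ne hl with h' | h'
  · exact absurd (hr.1.trans_le h.2) (not_lt.2 (ht h'))
  · exact absurd (h.1.trans_le hr.2) (not_lt.2 (ht h'))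

theorem IsItoIntegral.congr {Hf : ℝ≥0 → Ω → ℝ} {I I' : Ω → ℝ}
    (h : IsItoIntegral μ 𝓕 W Hf a b I) (hI : I =ᵐ[μ] I') : IsItoIntegral μ 𝓕 W Hf a b I' := by
  obtain ⟨hm, S, h1, h2⟩ := h
  refine ⟨(memLp_congr_ae hI).1 hm, S, h1, ?_⟩
  refine h2.congr fun n => eLpNorm_congr_ae ?_
  filter_upwards [hI] with ω hω
  rw [hω]

variable [IsProbabilityMeasure μ]

theorem SimpleIntegrand.memLp_coeff (S : SimpleIntegrand 𝓕 a b) (k : ℕ) :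
    MemLp (S.coeff k) 2 μ := by
  obtain ⟨C, hC⟩ := S.bounded_coeff
  exact MemLp.of_bound ((S.measurable_coeff k).mono (𝓕.le _)).aestronglyMeasurable C
    (ae_of_all _ fun ω => hC k ω)

/-- The elementary integral of a simple process is its integral in the sense of `ItoRel`. -/
theorem SimpleIntegrand.exists_itoRel (hW : IsDriver μ 𝓕 W) (S : SimpleIntegrand 𝓕 a b) :
    ∃ (K : ℝ≥0 → Lp ℝ 2 μ) (J : Lp ℝ 2 μ), (∀ r, K r =ᵐ[μ] S.value r) ∧
      J =ᵐ[μ] S.integral W ∧ ItoRel μ 𝓕 W a b K J := by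
  have hv : ∀ r, MemLp (S.value r) 2 μ := fun r => by
    refine memLp_finsetSum (f := fun k ω => (Set.Ioc (S.time k) (S.time (k + 1))).indicator
      (fun _ => S.coeff k ω) r) _ fun k _ => ?_
    by_cases hr : r ∈ Set.Ioc (S.time k) (S.time (k + 1))
    · simpa [hr] using S.memLp_coeff k
    · simp [hr]
  have hp : ∀ k, MemLp (fun ω => S.coeff k ω * (W (S.time (k + 1)) ω - W (S.time k) ω)) 2 μ :=
    fun k => hW.memLp_piece (S.mono (Nat.le_succ k))
      (S.measurable_coeff k).aestronglyMeasurable (S.memLp_coeff k)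
  refine ⟨fun r => (hv r).toLp _, ∑ k ∈ Finset.range S.n, (hp k).toLp _,
    fun r => (hv r).coeFn_toLp, ?_, ?_⟩
  · refine (Lp.coeFn_finsetSum _ _).trans ?_
    have := ae_all_iff.2 fun k => (hp k).coeFn_toLp
    filter_upwards [this] with ω hω
    simp only [Finset.sum_apply, hω, SimpleIntegrand.integral]
  · have := ItoRel.sum_pieces (μ := μ) (𝓕 := 𝓕) (W := W) S.mono (n := S.n)
      (ξ := fun k => (S.memLp_coeff k).toLp _) (J := fun k => (hp k).toLp _)
      (H := fun r => (hv r).toLp _) (fun k _ => ?_) (fun k _ => ?_) fun k hk r hr => ?_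
    · rwa [S.time_zero, S.time_last] at this
    · exact (S.measurable_coeff k).aestronglyMeasurable.congr
        ((S.memLp_coeff k).coeFn_toLp).symm
    · filter_upwards [(hp k).coeFn_toLp, (S.memLp_coeff k).coeFn_toLp (μ := μ)] with ω h1 h2
      rw [h1, h2]
    · refine MemLp.toLp_congr _ _ (ae_of_all _ fun ω => ?_)
      exact sum_indicator_Ioc_eq S.mono (fun k => S.coeff k ω) hk hr

theorem lintegral_enorm_sub_sq_eq {Hf Kf : ℝ≥0 → Ω → ℝ} {H K : ℝ≥0 → Lp ℝ 2 μ}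
    (hK : ∀ r ∈ Set.Icc a b, K r =ᵐ[μ] Kf r) (hH : ∀ r ∈ Set.Icc a b, H r =ᵐ[μ] Hf r) :
    ∫⁻ r in Set.Ioc (a : ℝ) b, ∫⁻ ω, ‖Kf r.toNNReal ω - Hf r.toNNReal ω‖ₑ ^ 2 ∂μ =
      ∫⁻ r in Set.Ioc (a : ℝ) b, ‖K r.toNNReal - H r.toNNReal‖ₑ ^ 2 := by
  refine setLIntegral_congr_fun measurableSet_Ioc fun r hr => ?_
  have hr' := Set.Ioc_subset_Icc_self (toNNReal_mem_Ioc hr)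
  refine lintegral_enorm_sq_eq (K r.toNNReal - H r.toNNReal) ?_
  filter_upwards [Lp.coeFn_sub (K r.toNNReal) (H r.toNNReal), hK _ hr', hH _ hr'] with ω h1 h2 h3
  rw [h1, Pi.sub_apply, h2, h3]

variable {Hf : ℝ≥0 → Ω → ℝ} {H : ℝ≥0 → Lp ℝ 2 μ}

theorem IsItoIntegral.exists_itoRel (hW : IsDriver μ 𝓕 W) (hH : IsIntegrand μ 𝓕 a b Hf H)
    {I : Ω → ℝ} (h : IsItoIntegral μ 𝓕 W Hf a b I) :
    ∃ I' : Lp ℝ 2 μ, I' =ᵐ[μ] I ∧ ItoRel μ 𝓕 W a b H I' := by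
  obtain ⟨hI, S, h1, h2⟩ := h
  choose K J hK hJ hrel using fun n => (S n).exists_itoRel (μ := μ) hW
  choose x hx hm using hrel
  set y := (memLp_indicator hH.cont).toLp _ with hy
  have hy' : y =ᵐ[volume] (Set.Ioc (a : ℝ) b).indicator fun r => H r.toNNReal :=
    (memLp_indicator hH.cont).coeFn_toLp
  have hnorm : ∀ n, ‖x n - y‖ₑ ^ 2 = ∫⁻ r in Set.Ioc (a : ℝ) b,
        ∫⁻ ω, ‖(S n).value r.toNNReal ω - Hf r.toNNReal ω‖ₑ ^ 2 ∂μ := fun n => by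
    rw [lintegral_enorm_sub_sq_eq (fun r _ => hK n r) hH.rep,
      ← lintegral_indicator measurableSet_Ioc, ← lintegral_enorm_sq_eq (x n - y)
        (f := (Set.Ioc (a : ℝ) b).indicator fun r => K n r.toNNReal - H r.toNNReal)]
    · refine lintegral_congr fun r => ?_
      by_cases hr : r ∈ Set.Ioc (a : ℝ) b <;> simp [hr]
    · filter_upwards [hx n, hy', Lp.coeFn_sub (x n) y] with r h1 h2 h3
      rw [h3, Pi.sub_apply, h1, h2]
      by_cases hr : r ∈ Set.Ioc (a : ℝ) b <;> simp [hr]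
  have hxy : Tendsto x atTop (𝓝 y) := by
    simp only [← hnorm] at h1
    rw [tendsto_iff_edist_tendsto_0]
    have h3 := h1.ennrpow_const (1 / 2)
    simp only [← ENNReal.rpow_natCast, ← ENNReal.rpow_mul] at h3
    simpa [edist_eq_enorm_sub] using h3
  have hJI : Tendsto J atTop (𝓝 (hI.toLp I)) := by
    rw [Lp.tendsto_Lp_iff_tendsto_eLpNorm']
    refine h2.congr fun n => eLpNorm_congr_ae ?_
    filter_upwards [hJ n, hI.coeFn_toLp] with ω h3 h4
    rw [Pi.sub_apply, h3, h4]
  exact ⟨hI.toLp I, hI.coeFn_toLp, y, hy', (Submodule.isClosed_topologicalClosure _).mem_of_tendsto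
    (hxy.prodMk_nhds hJI) (Eventually.of_forall hm)⟩

/-- A continuous adapted integrand is uniformly approximated by bounded simple processes. -/
theorem IsIntegrand.exists_simple (hH : IsIntegrand μ 𝓕 a b Hf H) (hab : a ≤ b) {ε : ℝ}
    (hε : 0 < ε) : ∃ S : SimpleIntegrand 𝓕 a b, ∀ r ∈ Set.Ioc a b, ∀ K : Lp ℝ 2 μ,
      K =ᵐ[μ] S.value r → ‖K - H r‖ ≤ ε := by
  obtain ⟨n₀, hn₀⟩ := exists_grid_modulus hH.cont hab (half_pos hε)
  set n := n₀ + 1 with hn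
  have hap : ∀ k, ∃ g : Ω → ℝ, StronglyMeasurable[𝓕 (grid a b n k)] g ∧
      (∃ C : ℝ, ∀ ω, |g ω| ≤ C) ∧ (k < n → ∃ G : Lp ℝ 2 μ, G =ᵐ[μ] g ∧
        ‖G - H (grid a b n k)‖ ≤ ε / 2) := fun k => by
    by_cases hk : k < n
    · obtain ⟨g, h1, h2, h3⟩ := exists_bounded_approx (𝓕.le _)
        (hH.adapted _ (grid_mem hab hk.le)) (half_pos hε)
      exact ⟨g, h1, h2, fun _ => h3⟩
    · exact ⟨fun _ => 0, stronglyMeasurable_const, ⟨0, by simp⟩, fun h => absurd h hk⟩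
  choose g hg hgb hG using hap
  choose C hC using hgb
  have hC0 : ∀ k, k < n → C k ≤ ∑ l ∈ Finset.range n, |C l| := fun k hk =>
    (le_abs_self _).trans (Finset.single_le_sum (f := fun l => |C l|) (fun _ _ => abs_nonneg _)
      (Finset.mem_range.2 hk))
  let S : SimpleIntegrand 𝓕 a b :=
    { n := n
      time := grid a b n
      mono := grid_mono n
      time_zero := grid_zero n
      time_last := grid_self hab (by omega)
      coeff := fun k => if k < n then g k else fun _ => 0
      measurable_coeff := fun k => by
        split_ifs
        · exact hg k
        · exact stronglyMeasurable_const
      bounded_coeff := ⟨∑ l ∈ Finset.range n, |C l|, fun k ω => by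
        split_ifs with hk
        · exact (hC k ω).trans (hC0 k hk)
        · simpa using Finset.sum_nonneg fun _ _ => abs_nonneg _⟩ }
  refine ⟨S, fun r hr K hK => ?_⟩
  obtain ⟨k, hk, hrk⟩ := exists_grid_cell hab (n := n) (by omega) hr
  obtain ⟨G, hG1, hG2⟩ := hG k hk
  have hKG : K = G := by
    refine Lp.ext (hK.trans (EventuallyEq.trans (ae_of_all _ fun ω => ?_) hG1.symm))
    have := sum_indicator_Ioc_eq S.mono (fun k => S.coeff k ω) (n := n) hk hrk
    refine this.trans ?_
    simp [S, hk]
  have h1 := hn₀ n (by omega) (by omega) k hk r (Set.Ioc_subset_Icc_self hrk)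
  rw [dist_eq_norm] at h1
  rw [hKG]
  calc ‖G - H r‖ = ‖(G - H (grid a b n k)) + (H (grid a b n k) - H r)‖ := by congr 1; abel
    _ ≤ ε / 2 + ε / 2 := (norm_add_le _ _).trans (add_le_add hG2 h1.le)
    _ = ε := by ring

theorem IsIntegrand.exists_isItoIntegral (hW : IsDriver μ 𝓕 W) (hH : IsIntegrand μ 𝓕 a b Hf H)
    (hab : a ≤ b) : ∃ I, IsItoIntegral μ 𝓕 W Hf a b I := by
  have hpos : ∀ n : ℕ, (0 : ℝ) < 1 / ((n : ℝ) + 1) := fun n => by positivity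
  choose S hS using fun n : ℕ => hH.exists_simple hab (hpos n)
  choose K J hK hJ hrel using fun n => (S n).exists_itoRel (μ := μ) hW
  have hKH : ∀ n, ∀ r ∈ Set.Ioc a b, ‖K n r - H r‖ ≤ 1 / ((n : ℝ) + 1) := fun n r hr =>
    hS n r hr _ (hK n r)
  have hlim := tendsto_one_div_add_atTop_nhds_zero_nat (𝕜 := ℝ)
  obtain ⟨I, -, hJI⟩ := exists_itoRel_of_approx hW hab hH.cont hrel hlim
    (fun n => (hpos n).le) hKH
  refine ⟨I, Lp.memLp I, S, ?_, ?_⟩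
  · simp only [fun n => lintegral_enorm_sub_sq_eq (a := a) (b := b) (fun r _ => hK n r) hH.rep]
    refine tendsto_of_tendsto_of_tendsto_of_le_of_le tendsto_const_nhds
      (h := fun n : ℕ => ENNReal.ofReal (1 / ((n : ℝ) + 1)) ^ 2 * volume (Set.Ioc (a : ℝ) b)) ?_
      (fun _ => zero_le) fun n => ?_
    · have h1 : Tendsto (fun n : ℕ => ENNReal.ofReal (1 / ((n : ℝ) + 1)) ^ 2) atTop (𝓝 0) := by
        have h2 := ENNReal.tendsto_ofReal hlim
        rw [ENNReal.ofReal_zero] at h2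
        simpa using ENNReal.Tendsto.pow (n := 2) h2
      simpa using ENNReal.Tendsto.mul_const h1 (Or.inr (by simp))
    · simp only []
      rw [← setLIntegral_const]
      refine setLIntegral_mono measurable_const fun r hr => ?_
      gcongr
      rw [← ofReal_norm]
      exact ENNReal.ofReal_le_ofReal (hKH n _ (toNNReal_mem_Ioc hr))
  · rw [Lp.tendsto_Lp_iff_tendsto_eLpNorm'] at hJI
    refine hJI.congr fun n => eLpNorm_congr_ae ?_
    filter_upwards [hJ n] with ω h3
    rw [Pi.sub_apply, h3]

/-- The Itô integral of a continuous adapted integrand exists. -/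
theorem IsIntegrand.isItoIntegral (hW : IsDriver μ 𝓕 W) (hH : IsIntegrand μ 𝓕 a b Hf H)
    (hab : a ≤ b) : IsItoIntegral μ 𝓕 W Hf a b (itoIntegral μ 𝓕 W Hf a b) := by
  have h := hH.exists_isItoIntegral hW hab
  rw [itoIntegral, dif_pos h]
  exact h.choose_spec

theorem IsIntegrand.exists_itoRel (hW : IsDriver μ 𝓕 W) (hH : IsIntegrand μ 𝓕 a b Hf H)
    (hab : a ≤ b) : ∃ I : Lp ℝ 2 μ, I =ᵐ[μ] itoIntegral μ 𝓕 W Hf a b ∧ ItoRel μ 𝓕 W a b H I :=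
  (hH.isItoIntegral hW hab).exists_itoRel hW hH

theorem ItoRel.isItoIntegral (hW : IsDriver μ 𝓕 W) (hH : IsIntegrand μ 𝓕 a b Hf H)
    (hab : a ≤ b) {I : Lp ℝ 2 μ} (h : ItoRel μ 𝓕 W a b H I) {f : Ω → ℝ} (hf : I =ᵐ[μ] f) :
    IsItoIntegral μ 𝓕 W Hf a b f := by
  obtain ⟨I', h1, h2⟩ := hH.exists_itoRel hW hab
  rw [h.unique hW h2] at hf
  exact (hH.isItoIntegral hW hab).congr (h1.symm.trans hf)

/-- Left-point Riemann sums approximate the stochastic integral, uniformly over the upper limits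
of integration in the grid. -/
theorem IsIntegrand.riemann_sum (hW : IsDriver μ 𝓕 W) (hH : IsIntegrand μ 𝓕 a b Hf H)
    (hab : a ≤ b) {ε : ℝ} (hε : 0 < ε) : ∃ n₀ : ℕ, ∀ n ≥ n₀, n ≠ 0 → ∀ i ≤ n, ∀ J : Lp ℝ 2 μ,
      ItoRel μ 𝓕 W a (grid a b n i) H J → ∃ R : Lp ℝ 2 μ,
        (R =ᵐ[μ] fun ω => ∑ k ∈ Finset.range i, Hf (grid a b n k) ω *
          (W (grid a b n (k + 1)) ω - W (grid a b n k) ω)) ∧ ‖R - J‖ ≤ ε := by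
  have hs : 0 < √((b : ℝ) - a) + 1 := by positivity
  set η := ε / (√((b : ℝ) - a) + 1) with hη
  have hη0 : 0 < η := by positivity
  obtain ⟨n₀, hn₀⟩ := exists_grid_modulus hH.cont hab hη0
  refine ⟨n₀, fun n hn hn0 i hi J hJ => ?_⟩
  have hp : ∀ k, ∃ P : Lp ℝ 2 μ, k < i → P =ᵐ[μ] fun ω => H (grid a b n k) ω *
      (W (grid a b n (k + 1)) ω - W (grid a b n k) ω) := fun k => by
    by_cases hk : k < i
    · have := hW.memLp_piece (grid_mono (a := a) (b := b) n (Nat.le_succ k))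
        (hH.adapted _ (grid_mem hab (hk.le.trans hi))) (Lp.memLp _)
      exact ⟨this.toLp _, fun _ => this.coeFn_toLp⟩
    · exact ⟨0, fun h => absurd h hk⟩
  choose P hP using hp
  have hrel := ItoRel.sum_pieces (μ := μ) (𝓕 := 𝓕) (W := W) (grid_mono (a := a) (b := b) n)
    (n := i) (ξ := fun k => H (grid a b n k)) (J := P)
    (H := fun r => ∑ l ∈ Finset.range i,
      (Set.Ioc (grid a b n l) (grid a b n (l + 1))).indicator (fun _ => H (grid a b n l)) r)
    (fun k hk => hH.adapted _ (grid_mem hab (hk.le.trans hi))) hP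
    fun k hk r hr => sum_indicator_Ioc_eq (grid_mono n) _ hk hr
  rw [grid_zero] at hrel
  refine ⟨∑ k ∈ Finset.range i, P k, ?_, ?_⟩
  · refine (Lp.coeFn_finsetSum _ _).trans ?_
    have h1 : ∀ᵐ ω ∂μ, ∀ k, k < i → P k ω = H (grid a b n k) ω *
        (W (grid a b n (k + 1)) ω - W (grid a b n k) ω) :=
      ae_all_iff.2 fun k => by
        by_cases hk : k < i
        · filter_upwards [hP k hk] with ω h _ using h
        · exact ae_of_all _ fun ω h => absurd h hk
    have h2 : ∀ᵐ ω ∂μ, ∀ k, k < i → H (grid a b n k) ω = Hf (grid a b n k) ω :=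
      ae_all_iff.2 fun k => by
        by_cases hk : k < i
        · filter_upwards [hH.rep _ (grid_mem hab (hk.le.trans hi))] with ω h _ using h
        · exact ae_of_all _ fun ω h => absurd h hk
    filter_upwards [h1, h2] with ω h1 h2
    rw [Finset.sum_apply]
    refine Finset.sum_congr rfl fun k hk => ?_
    rw [h1 k (Finset.mem_range.1 hk), h2 k (Finset.mem_range.1 hk)]
  · have hgi := grid_mem hab hi
    refine ((hrel.sub hJ).norm_le hW hgi.1 hη0.le fun r hr => ?_).trans ?_
    · obtain ⟨k, hk, hrk⟩ := exists_grid_cell hab hn0 ⟨hr.1, hr.2.trans hgi.2⟩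
      have hki : k < i := by
        by_contra hc
        exact absurd (hrk.1.trans_le hr.2) (not_lt.2 (grid_mono n (not_lt.1 hc)))
      rw [sum_indicator_Ioc_eq (grid_mono n) _ hki hrk, ← dist_eq_norm]
      exact (hn₀ n hn hn0 k hk r (Set.Ioc_subset_Icc_self hrk)).le
    · have h1 : √(((grid a b n i : ℝ≥0) : ℝ) - a) ≤ √((b : ℝ) - a) := by
        refine Real.sqrt_le_sqrt (sub_le_sub_right ?_ _)
        exact_mod_cast hgi.2
      calc η * √(((grid a b n i : ℝ≥0) : ℝ) - a) ≤ η * (√((b : ℝ) - a) + 1) := by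
            gcongr
            linarith
        _ = ε := div_mul_cancel₀ _ hs.ne'

end ItoIntegral

/-! ### Continuous versions of Itô integrals -/

section ContinuousVersion

variable {Ω : Type*} {mΩ : MeasurableSpace Ω} {μ : Measure Ω} {𝓕 : Filtration ℝ≥0 mΩ}
  {W : ℝ≥0 → Ω → ℝ} {a b c : ℝ≥0}

variable [IsProbabilityMeasure μ]

/-- The maximal inequality for stochastic integrals along a finite sequence of times. -/
theorem maximal_inequality (hW : IsDriver μ 𝓕 W) {t : ℕ → ℝ≥0} {K : ℝ≥0 → Lp ℝ 2 μ}
    {D : ℕ → Lp ℝ 2 μ} {n : ℕ} (hD : ∀ k ≤ n, AEStronglyMeasurable[𝓕 (t k)] (D k) μ)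
    (hinc : ∀ k < n, ItoRel μ 𝓕 W (t k) (t (k + 1)) K (D (k + 1) - D k))
    (ht : Monotone t) {ε : ℝ} (hε : 0 < ε) :
    μ.real {ω | ∃ k ≤ n, ε ≤ |D k ω|} * ε ^ 2 ≤ ‖D n‖ ^ 2 := by
  choose! g hg hDg using fun k (hk : k ≤ n) => hD k hk
  set A : ℕ → Set Ω := fun i => {ω | ∃ k ≤ i, ε ≤ |g k ω|} with hA
  have hAm : ∀ i ≤ n, MeasurableSet[𝓕 (t i)] (A i) := fun i hi => by
    have : A i = ⋃ k ∈ Finset.range (i + 1), {ω | ε ≤ |g k ω|} := by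
      ext ω
      simp [hA]
    rw [this]
    refine Finset.measurableSet_biUnion _ fun k hk => ?_
    have hki : k ≤ i := Nat.lt_succ_iff.1 (Finset.mem_range.1 hk)
    have hgk := (hg k (hki.trans hi)).mono (𝓕.mono (ht hki))
    have h2 : StronglyMeasurable[𝓕 (t i)] fun ω => |g k ω| := hgk.norm
    exact measurableSet_le measurable_const h2.measurable
  have hg2 : ∀ k ≤ n, MemLp (g k) 2 μ := fun k hk => (memLp_congr_ae (hDg k hk)).1 (Lp.memLp _)
  have main : ∀ i ≤ n, μ.real (A i) * ε ^ 2 ≤ ∫ ω in A i, g i ω ^ 2 ∂μ := by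
    intro i
    induction i with
    | zero =>
      intro hi
      have h1 := setIntegral_ge_of_const_le_real (μ := μ) (s := A 0) (f := fun ω => g 0 ω ^ 2)
        (c := ε ^ 2) ((𝓕.le _) _ (hAm 0 hi)) (by simp) (fun ω hω => by
          obtain ⟨k, hk, h⟩ := hω
          obtain rfl : k = 0 := by omega
          rw [← sq_abs (g 0 ω)]
          exact pow_le_pow_left₀ hε.le h 2) ((hg2 0 hi).integrable_sq.integrableOn)
      linarith
    | succ i ih =>
      intro hi
      have hi' : i ≤ n := by omega
      have hmi : MeasurableSet (A i) := (𝓕.le _) _ (hAm i hi')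
      have hmi1 : MeasurableSet (A (i + 1)) := (𝓕.le _) _ (hAm (i + 1) hi)
      have hsub : A i ⊆ A (i + 1) := fun ω ⟨k, hk, h⟩ => ⟨k, by omega, h⟩
      have hsq : ∀ k ≤ n, Integrable (fun ω => g k ω ^ 2) μ := fun k hk => (hg2 k hk).integrable_sq
      have hprod : Integrable (fun ω => g i ω * (g (i + 1) ω - g i ω)) μ :=
        (hg2 i hi').integrable_mul ((hg2 _ hi).sub (hg2 i hi'))
      have h1 : ∫ ω in A i, g i ω ^ 2 ∂μ ≤ ∫ ω in A i, g (i + 1) ω ^ 2 ∂μ := by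
        have horth : ∫ ω in A i, g i ω * (g (i + 1) ω - g i ω) ∂μ = 0 := by
          have h2 : AEStronglyMeasurable[𝓕 (t i)] ((A i).indicator (g i)) μ :=
            ((hg i hi').indicator (hAm i hi')).aestronglyMeasurable
          have h3 := (hinc i (by omega)).orth hW h2 ((hg2 i hi').indicator hmi)
          rw [← integral_indicator hmi, ← h3]
          refine integral_congr_ae ?_
          filter_upwards [hDg i hi', hDg _ hi, Lp.coeFn_sub (D (i + 1)) (D i)] with ω h4 h5 h6
          rw [h6, Pi.sub_apply, h4, h5]
          by_cases hω : ω ∈ A i <;> simp [hω]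
        have h4 : ∫ ω in A i, (g i ω ^ 2 + 2 * (g i ω * (g (i + 1) ω - g i ω))) ∂μ ≤
            ∫ ω in A i, g (i + 1) ω ^ 2 ∂μ := by
          refine setIntegral_mono
            (((hsq i hi').add (hprod.const_mul 2)).integrableOn) (hsq _ hi).integrableOn
            fun ω => ?_
          nlinarith [sq_nonneg (g (i + 1) ω - g i ω)]
        rw [integral_add (hsq i hi').integrableOn (hprod.const_mul 2).integrableOn,
          integral_const_mul, horth, mul_zero, add_zero] at h4
        exact h4
      have h2 : μ.real (A (i + 1) \ A i) * ε ^ 2 ≤ ∫ ω in A (i + 1) \ A i, g (i + 1) ω ^ 2 ∂μ := by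
        have h1 := setIntegral_ge_of_const_le_real (μ := μ) (s := A (i + 1) \ A i)
          (f := fun ω => g (i + 1) ω ^ 2)
          (c := ε ^ 2) (hmi1.diff hmi) (by simp) (fun ω hω => by
            obtain ⟨⟨k, hk, h⟩, hn⟩ := hω
            have hki : k = i + 1 := by
              by_contra hne
              exact hn ⟨k, by omega, h⟩
            subst hki
            rw [← sq_abs (g (i + 1) ω)]
            exact pow_le_pow_left₀ hε.le h 2) ((hsq _ hi).integrableOn)
        linarith
      have h3 : ∫ ω in A (i + 1), g (i + 1) ω ^ 2 ∂μ = ∫ ω in A i, g (i + 1) ω ^ 2 ∂μ +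
          ∫ ω in A (i + 1) \ A i, g (i + 1) ω ^ 2 ∂μ := by
        rw [← setIntegral_union Set.disjoint_sdiff_right (hmi1.diff hmi)
          (hsq _ hi).integrableOn (hsq _ hi).integrableOn, Set.union_sdiff_cancel hsub]
      have h4 : μ.real (A (i + 1)) = μ.real (A i) + μ.real (A (i + 1) \ A i) := by
        rw [← measureReal_union Set.disjoint_sdiff_right (hmi1.diff hmi),
          Set.union_sdiff_cancel hsub]
      rw [h3, h4, add_mul]
      exact add_le_add ((ih hi').trans h1) h2
  have hae : {ω | ∃ k ≤ n, ε ≤ |D k ω|} =ᵐ[μ] A n := by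
    have : ∀ᵐ ω ∂μ, ∀ k, k ≤ n → D k ω = g k ω := ae_all_iff.2 fun k => by
      by_cases hk : k ≤ n
      · filter_upwards [hDg k hk] with ω h _ using h
      · exact ae_of_all _ fun ω h => absurd h hk
    filter_upwards [this] with ω hω
    refine propext ⟨fun ⟨k, hk, h⟩ => ⟨k, hk, ?_⟩, fun ⟨k, hk, h⟩ => ⟨k, hk, ?_⟩⟩
    · rwa [← hω k hk]
    · rwa [hω k hk]
  rw [measureReal_congr hae]
  refine (main n le_rfl).trans ?_
  have hn2 : ‖D n‖ ^ 2 = ∫ ω, g n ω ^ 2 ∂μ := by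
    rw [← real_inner_self_eq_norm_sq, L2.inner_def]
    refine integral_congr_ae ?_
    filter_upwards [hDg n le_rfl] with ω h
    rw [h, real_inner_self_eq_norm_sq, Real.norm_eq_abs, sq_abs]
  rw [hn2]
  exact setIntegral_le_integral (hg2 n le_rfl).integrable_sq (ae_of_all _ fun ω => sq_nonneg _)

/-- The elementary integral process `u ↦ ∑ ξₖ (W_{u ∧ tₖ₊₁} - W_{u ∧ tₖ})`. -/
def elemProcess (W : ℝ≥0 → Ω → ℝ) (t : ℕ → ℝ≥0) (ξ : ℕ → Ω → ℝ) (n : ℕ) (u : ℝ≥0) (ω : Ω) : ℝ :=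
  ∑ k ∈ Finset.range n, ξ k ω * (W (min u (t (k + 1))) ω - W (min u (t k)) ω)

theorem elemProcess_itoRel (hW : IsDriver μ 𝓕 W) {t : ℕ → ℝ≥0} (ht : Monotone t)
    {ξ : ℕ → Lp ℝ 2 μ} {K : ℝ≥0 → Lp ℝ 2 μ} {n : ℕ}
    (hξ : ∀ k < n, AEStronglyMeasurable[𝓕 (t k)] (ξ k) μ)
    (hK : ∀ k < n, ∀ r ∈ Set.Ioc (t k) (t (k + 1)), K r = ξ k) {u v : ℝ≥0} (hu : t 0 ≤ u)
    (huv : u ≤ v) (hv : v ≤ t n) :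
    ∃ D : Lp ℝ 2 μ, (D =ᵐ[μ] fun ω => elemProcess W t (fun k => ξ k) n v ω -
      elemProcess W t (fun k => ξ k) n u ω) ∧ ItoRel μ 𝓕 W u v K D := by
  induction n generalizing u v with
  | zero =>
    obtain rfl : u = v := le_antisymm huv (hv.trans hu)
    refine ⟨0, ?_, ItoRel.refl_zero⟩
    filter_upwards [Lp.coeFn_zero ℝ 2 μ] with ω h
    simp
  | succ n ih =>
    have ih' := fun {u v : ℝ≥0} => ih (u := u) (v := v) (fun k hk => hξ k (by omega))
      fun k hk => hK k (by omega)
    have htn := ht (Nat.le_succ n)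
    have early : ∀ {u v : ℝ≥0}, t 0 ≤ u → u ≤ v → v ≤ t n → ∃ D : Lp ℝ 2 μ,
        (D =ᵐ[μ] fun ω => elemProcess W t (fun k => ξ k) (n + 1) v ω -
        elemProcess W t (fun k => ξ k) (n + 1) u ω) ∧ ItoRel μ 𝓕 W u v K D := by
      intro u v hu huv hv
      obtain ⟨D, hD, hrel⟩ := ih' hu huv hv
      refine ⟨D, hD.trans (ae_of_all _ fun ω => ?_), hrel⟩
      simp only [elemProcess, Finset.sum_range_succ, min_eq_left hv, min_eq_left (hv.trans htn),
        min_eq_left (huv.trans hv), min_eq_left (huv.trans (hv.trans htn)), sub_self, mul_zero,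
        add_zero]
    have late : ∀ {u v : ℝ≥0}, t n ≤ u → u ≤ v → v ≤ t (n + 1) → ∃ D : Lp ℝ 2 μ,
        (D =ᵐ[μ] fun ω => elemProcess W t (fun k => ξ k) (n + 1) v ω -
        elemProcess W t (fun k => ξ k) (n + 1) u ω) ∧ ItoRel μ 𝓕 W u v K D := by
      intro u v hu huv hv
      have hξu := (hξ n (by omega)).mono (𝓕.mono hu)
      have hm := hW.memLp_piece huv hξu (Lp.memLp _)
      refine ⟨hm.toLp _, hm.coeFn_toLp.trans (ae_of_all _ fun ω => ?_),
        (ItoRel.piece huv hξu hm.coeFn_toLp).congr fun r hr =>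
          (hK n (by omega) r ⟨hu.trans_lt hr.1, hr.2.trans hv⟩).symm⟩
      have hsame : ∀ x : ℝ≥0, t n ≤ x → ∑ k ∈ Finset.range n,
          ξ k ω * (W (min x (t (k + 1))) ω - W (min x (t k)) ω) =
          ∑ k ∈ Finset.range n, ξ k ω * (W (t (k + 1)) ω - W (t k) ω) := fun x hx =>
        Finset.sum_congr rfl fun k hk => by
          have h1 : t (k + 1) ≤ x := (ht (Finset.mem_range.1 hk)).trans hx
          rw [min_eq_right h1, min_eq_right ((ht (Nat.le_succ k)).trans h1)]
      simp only [elemProcess, Finset.sum_range_succ]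
      rw [hsame u hu, hsame v (hu.trans huv), min_eq_left hv, min_eq_left (huv.trans hv),
        min_eq_right hu, min_eq_right (hu.trans huv)]
      ring
    rcases le_total v (t n) with h1 | h1
    · exact early hu huv h1
    rcases le_total (t n) u with h2 | h2
    · exact late h2 huv hv
    obtain ⟨D, hD, hrel⟩ := early hu h2 le_rfl
    obtain ⟨D', hD', hrel'⟩ := late le_rfl h1 hv
    refine ⟨D + D', ?_, hrel.concat hrel' h2 h1⟩
    filter_upwards [hD, hD', Lp.coeFn_add D D'] with ω h3 h4 h5
    rw [h5, Pi.add_apply, h3, h4]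
    ring

/-- A continuous path that exceeds the level `ε` somewhere on `[a, b]` exceeds it at a point of
every sufficiently fine uniform grid. -/
theorem eventually_exists_grid {f : ℝ≥0 → ℝ} (hf : Continuous f) (hab : a ≤ b) {ε : ℝ}
    {u : ℝ≥0} (hu : u ∈ Set.Icc a b) (h : ε < |f u|) :
    ∀ᶠ n in atTop, ∃ k ≤ n, ε ≤ |f (grid a b n k)| := by
  obtain ⟨n₀, hn₀⟩ := exists_grid_modulus (H := f) hf.continuousOn hab (ε := |f u| - ε)
    (by linarith)
  filter_upwards [eventually_ge_atTop n₀, eventually_ne_atTop 0] with n hn hn0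
  rcases eq_or_lt_of_le hu.1 with rfl | hau
  · exact ⟨0, Nat.zero_le _, by rw [grid_zero]; exact h.le⟩
  · obtain ⟨k, hk, hr⟩ := exists_grid_cell hab hn0 ⟨hau, hu.2⟩
    refine ⟨k, hk.le, ?_⟩
    have h1 := hn₀ n hn hn0 k hk u (Set.Ioc_subset_Icc_self hr)
    rw [Real.dist_eq] at h1
    have h2 := abs_sub_abs_le_abs_sub (f u) (f (grid a b n k))
    rw [abs_sub_comm] at h2
    linarith

/-- The maximal inequality over a time interval, for processes with continuous paths. -/
theorem maximal_inequality_Icc (hW : IsDriver μ 𝓕 W) {K : ℝ≥0 → Lp ℝ 2 μ} {f : ℝ≥0 → Ω → ℝ}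
    (hab : a ≤ b) (hf : ∀ᵐ ω ∂μ, Continuous fun u => f u ω)
    (hinc : ∀ u v, a ≤ u → u ≤ v → v ≤ b → ∃ D : Lp ℝ 2 μ,
      (D =ᵐ[μ] fun ω => f v ω - f u ω) ∧ ItoRel μ 𝓕 W u v K D)
    (h0 : ∀ ω, f a ω = 0) {ε C : ℝ} (hε : 0 < ε)
    (hC : ∀ r ∈ Set.Ioc a b, ‖K r‖ ≤ C) :
    μ {ω | ∃ u ∈ Set.Icc a b, ε < |f u ω|} ≤
      ENNReal.ofReal (C ^ 2 * ((b : ℝ) - a) / ε ^ 2) := by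
  have hb : ∀ n, n ≠ 0 → μ {ω | ∃ k ≤ n, ε ≤ |f (grid a b n k) ω|} ≤
      ENNReal.ofReal (C ^ 2 * ((b : ℝ) - a) / ε ^ 2) := by
    intro n hn
    choose! D hD hrel using fun k (hk : k ≤ n) => hinc a (grid a b n k) le_rfl
      (grid_mem hab hk).1 (grid_mem hab hk).2
    have hD' : ∀ k ≤ n, D k =ᵐ[μ] f (grid a b n k) := fun k hk =>
      (hD k hk).trans (ae_of_all _ fun ω => by simp [h0])
    have h1 := maximal_inequality (μ := μ) hW (t := grid a b n) (K := K) (D := D) (n := n)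
      (fun k hk => (hrel k hk).aesm hW) (fun k hk => by
        obtain ⟨D', h2, h3⟩ := hinc _ _ (grid_mem hab hk.le).1 (grid_mono n (Nat.le_succ k))
          (grid_mem hab hk).2
        have : D (k + 1) - D k = D' := by
          refine Lp.ext ((Lp.coeFn_sub _ _).trans ?_)
          filter_upwards [hD' k hk.le, hD' (k + 1) hk, h2] with ω h4 h5 h6
          rw [Pi.sub_apply, h4, h5, h6]
        rwa [this]) (grid_mono n) hε
    have h2 : ‖D n‖ ^ 2 ≤ C ^ 2 * ((b : ℝ) - a) := by
      have h3 := hrel n le_rfl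
      rw [grid_self hab hn] at h3
      exact h3.norm_sq_le hW hab hC
    have hae : {ω | ∃ k ≤ n, ε ≤ |D k ω|} =ᵐ[μ]
        ({ω | ∃ k ≤ n, ε ≤ |f (grid a b n k) ω|} : Set Ω) := by
      have : ∀ᵐ ω ∂μ, ∀ k, k ≤ n → D k ω = f (grid a b n k) ω := ae_all_iff.2 fun k => by
        by_cases hk : k ≤ n
        · filter_upwards [hD' k hk] with ω h _ using h
        · exact ae_of_all _ fun ω h => absurd h hk
      filter_upwards [this] with ω hω
      refine propext ⟨fun ⟨k, hk, h⟩ => ⟨k, hk, ?_⟩, fun ⟨k, hk, h⟩ => ⟨k, hk, ?_⟩⟩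
      · rwa [← hω k hk]
      · rwa [hω k hk]
    rw [← measure_congr hae, ← ofReal_measureReal]
    refine ENNReal.ofReal_le_ofReal ?_
    rw [le_div_iff₀ (by positivity)]
    exact h1.trans h2
  set A : ℕ → Set Ω := fun j => ⋂ n ≥ j + 1, {ω | ∃ k ≤ n, ε ≤ |f (grid a b n k) ω|} with hA
  have hmono : Monotone A := fun i j hij =>
    Set.biInter_subset_biInter_left fun n (hn : n ≥ j + 1) => show n ≥ i + 1 by omega
  have hsub : {ω | ∃ u ∈ Set.Icc a b, ε < |f u ω|} ≤ᵐ[μ] (⋃ j, A j : Set Ω) := by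
    filter_upwards [hf] with ω hω
    rintro ⟨u, hu, h⟩
    obtain ⟨j, hj⟩ := eventually_atTop.1 (eventually_exists_grid hω hab hu h)
    exact Set.mem_iUnion.2 ⟨j, Set.mem_iInter₂.2 fun n hn => hj n (by omega)⟩
  refine (measure_mono_ae hsub).trans ?_
  rw [hmono.measure_iUnion]
  exact iSup_le fun j => (measure_mono (Set.biInter_subset_of_mem 
    (Set.mem_Ici.2 (le_refl (j + 1))))).trans (hb (j + 1) (by omega))

theorem exists_elemProcess_approx (hW : IsDriver μ 𝓕 W) {H : ℝ≥0 → Lp ℝ 2 μ} {Hf : ℝ≥0 → Ω → ℝ}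
    (hab : a ≤ b) (hH : IsIntegrand μ 𝓕 a b Hf H) {δ : ℝ} (hδ : 0 < δ) :
    ∃ (K : ℝ≥0 → Lp ℝ 2 μ) (E : ℝ≥0 → Ω → ℝ), (∀ r ∈ Set.Ioc a b, ‖K r - H r‖ ≤ δ) ∧
      (∀ ω, E a ω = 0) ∧ (∀ᵐ ω ∂μ, Continuous fun u => E u ω) ∧
      ∀ u v, a ≤ u → u ≤ v → v ≤ b → ∃ D : Lp ℝ 2 μ,
        (D =ᵐ[μ] fun ω => E v ω - E u ω) ∧ ItoRel μ 𝓕 W u v K D := by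
  obtain ⟨n₀, hn₀⟩ := exists_grid_modulus hH.cont hab hδ
  set n := n₀ + 1 with hn
  have hn0 : n ≠ 0 := Nat.succ_ne_zero _
  set K : ℝ≥0 → Lp ℝ 2 μ := fun r => ∑ l ∈ Finset.range n,
    (Set.Ioc (grid a b n l) (grid a b n (l + 1))).indicator (fun _ => H (grid a b n l)) r with hK
  have hKr : ∀ k < n, ∀ r ∈ Set.Ioc (grid a b n k) (grid a b n (k + 1)),
      K r = H (grid a b n k) := fun k hk r hr =>
    sum_indicator_Ioc_eq (grid_mono n) (fun l => H (grid a b n l)) hk hr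
  refine ⟨K, elemProcess W (grid a b n) (fun k => H (grid a b n k)) n, fun r hr => ?_,
    fun ω => ?_, ?_, fun u v hu huv hv => ?_⟩
  · obtain ⟨k, hk, hr'⟩ := exists_grid_cell hab hn0 hr
    rw [hKr k hk r hr', ← dist_eq_norm]
    exact (hn₀ n (Nat.le_succ _) hn0 k hk r (Set.Ioc_subset_Icc_self hr')).le
  · have : ∀ k, min a (grid a b n k) = a := fun k =>
      min_eq_left ((grid_zero n).symm.le.trans (grid_mono n (Nat.zero_le k)))
    simp [elemProcess, this]
  · filter_upwards [hW.cont] with ω hω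
    unfold elemProcess
    have h1 : ∀ x : ℝ≥0, Continuous fun u => W (min u x) ω := fun x =>
      hω.comp (continuous_id.min continuous_const)
    exact continuous_finsetSum _ fun k _ => continuous_const.mul ((h1 _).sub (h1 _))
  · refine elemProcess_itoRel hW (grid_mono n) (fun k hk => ?_) hKr
      ((grid_zero n).le.trans hu) huv (hv.trans (grid_self hab hn0).ge)
    exact hH.adapted _ (grid_mem hab hk.le)

/-- A sequence of continuous paths with geometrically small increments on the intervals
`[a, a + n]` converges on `[a, ∞)` to a continuous path. -/
theorem exists_continuous_limit {e : ℕ → ℝ≥0 → ℝ} (he : ∀ n, Continuous (e n)) {n₀ : ℕ}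
    (h : ∀ n ≥ n₀, ∀ u ∈ Set.Icc a (a + n), |e (n + 1) u - e n u| ≤ (1 / 2) ^ n) :
    ∃ f : ℝ≥0 → ℝ, Continuous f ∧ ∀ u ≥ a, Tendsto (fun n => e n u) atTop (𝓝 (f u)) := by
  have hd : ∀ n₁ ≥ n₀, ∀ u ∈ Set.Icc a (a + n₁), ∀ k,
      dist (e (n₁ + k) u) (e (n₁ + (k + 1)) u) ≤ (1 / 2) ^ n₁ * (1 / 2) ^ k := by
    intro n₁ hn₁ u hu k
    rw [dist_comm, Real.dist_eq, ← pow_add]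
    refine h (n₁ + k) (by omega) u ⟨hu.1, hu.2.trans ?_⟩
    push_cast
    gcongr
    exact le_self_add
  have hlim : ∀ u ≥ a, ∃ y, Tendsto (fun n => e n u) atTop (𝓝 y) := by
    intro u hu
    obtain ⟨n₂, hn₂⟩ := exists_nat_ge u
    have hc := cauchySeq_of_le_geometric (1 / 2) _ (by norm_num) (hd (max n₀ n₂) (le_max_left _ _) u
      ⟨hu, hn₂.trans (le_add_left (by exact_mod_cast le_max_right n₀ n₂))⟩)
    obtain ⟨y, hy⟩ := cauchySeq_tendsto_of_complete hc
    exact ⟨y, (tendsto_add_atTop_iff_nat (max n₀ n₂)).1 (by simpa [add_comm] using hy)⟩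
  choose! f hf using hlim
  refine ⟨fun u => f (max u a), ?_, fun u hu => by simpa [max_eq_left hu] using hf u hu⟩
  have hloc : TendstoLocallyUniformly (fun n u => e n (max u a)) (fun u => f (max u a)) atTop := by
    rw [Metric.tendstoLocallyUniformly_iff]
    intro ε hε u
    obtain ⟨n₂, hn₂⟩ := exists_nat_ge (u + 1)
    have hpow : Tendsto (fun n : ℕ => ((1 / 2 : ℝ)) ^ n * 2) atTop (𝓝 0) := by
      simpa using (tendsto_pow_atTop_nhds_zero_of_lt_one (r := (1 / 2 : ℝ)) (by norm_num)
        (by norm_num)).mul_const 2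
    refine ⟨Set.Iio (u + 1), Iio_mem_nhds (by simp), ?_⟩
    filter_upwards [eventually_ge_atTop (max n₀ n₂), hpow.eventually (gt_mem_nhds hε)]
      with n hn hn' v hv
    have hn2 : (n₂ : ℝ≥0) ≤ n := by exact_mod_cast (le_max_right n₀ n₂).trans hn
    have hmem : max v a ∈ Set.Icc a (a + n) :=
      ⟨le_max_right _ _, max_le (((le_of_lt hv).trans (hn₂.trans hn2)).trans le_add_self)
        le_self_add⟩
    have h1 := dist_le_of_le_geometric_of_tendsto (1 / 2) _ (by norm_num)
      (hd n ((le_max_left _ _).trans hn) _ hmem) (by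
        have := (tendsto_add_atTop_iff_nat n).2 (hf _ (le_max_right v a))
        simpa [add_comm] using this) 0
    rw [dist_comm]
    refine lt_of_le_of_lt h1 (lt_of_le_of_lt (le_of_eq ?_) hn')
    ring
  exact hloc.continuous (Frequently.of_forall fun n => (he n).comp (by fun_prop))

/-- Stochastic integrals of `L²`-continuous adapted integrands have continuous versions. -/
theorem exists_isItoProcess (hW : IsDriver μ 𝓕 W) {H : ℝ≥0 → Lp ℝ 2 μ} {Hf : ℝ≥0 → Ω → ℝ}
    (hH : ∀ b, IsIntegrand μ 𝓕 a b Hf H) : ∃ J, IsItoProcess μ 𝓕 W Hf a J := by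
  -- the accuracy of the `n`-th approximation on `[a, a + n]`; the factor `n + 1` compensates for the
  -- length of the interval, so that the exceptional sets have summable probabilities
  set δ : ℕ → ℝ := fun n => (1 / 4) ^ n / (2 * (n + 1)) with hδ
  have hδ0 : ∀ n, 0 < δ n := fun n => by positivity
  have hδanti : ∀ n, δ (n + 1) ≤ δ n := fun n => by
    simp only [hδ, pow_succ]
    push_cast
    gcongr
    · have : (0 : ℝ) ≤ (1 / 4) ^ n := by positivity
      linarith
    · linarith
  have hδlim : Tendsto δ atTop (𝓝 0) := by
    refine squeeze_zero (fun n => (hδ0 n).le) (fun n => ?_)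
      (tendsto_pow_atTop_nhds_zero_of_lt_one (r := (1 / 4 : ℝ)) (by norm_num) (by norm_num))
    refine div_le_self (by positivity) ?_
    have : (0 : ℝ) ≤ n := n.cast_nonneg
    linarith
  choose K E hKH hE0 hEc hinc using fun n : ℕ => exists_elemProcess_approx (b := a + n) hW
    le_self_add (hH (a + n)) (hδ0 n)
  have hbad : ∀ n : ℕ, μ {ω | ∃ u ∈ Set.Icc a (a + n), (1 / 2 : ℝ) ^ n < |E (n + 1) u ω - E n u ω|} ≤
      ENNReal.ofReal ((1 / 4) ^ n) := by
    intro n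
    have hle : a + (n : ℝ≥0) ≤ a + ((n + 1 : ℕ) : ℝ≥0) := by gcongr; simp
    refine (maximal_inequality_Icc hW (K := fun r => K (n + 1) r - K n r)
      (f := fun u ω => E (n + 1) u ω - E n u ω) (C := 2 * δ n) le_self_add ?_ ?_ ?_
      (by positivity) ?_).trans (ENNReal.ofReal_le_ofReal ?_)
    · filter_upwards [hEc n, hEc (n + 1)] with ω h1 h2 using h2.sub h1
    · intro u v hu huv hv
      obtain ⟨D, h1, h2⟩ := hinc n u v hu huv hv
      obtain ⟨D', h1', h2'⟩ := hinc (n + 1) u v hu huv (hv.trans hle)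
      refine ⟨D' - D, ?_, h2'.sub h2⟩
      filter_upwards [h1, h1', Lp.coeFn_sub D' D] with ω h3 h4 h5
      rw [h5, Pi.sub_apply, h3, h4]
      ring
    · intro ω
      simp [hE0]
    · intro r hr
      have h1 := hKH n r hr
      have h2 := hKH (n + 1) r ⟨hr.1, hr.2.trans hle⟩
      have h3 := norm_sub_le (K (n + 1) r - H r) (K n r - H r)
      rw [sub_sub_sub_cancel_right] at h3
      linarith [hδanti n]
    · have h1 : ((a + (n : ℝ≥0) : ℝ≥0) : ℝ) - a = n := by push_cast; ring
      rw [h1, div_le_iff₀ (by positivity), hδ]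
      have h2 : (2 * ((1 / 4 : ℝ) ^ n / (2 * (n + 1)))) ^ 2 * n =
          (1 / 4) ^ n * (1 / 4) ^ n * (n / (n + 1) ^ 2) := by
        field_simp
      have h3 : ((1 / 2 : ℝ) ^ n) ^ 2 = (1 / 4) ^ n := by
        rw [← pow_mul, mul_comm, pow_mul]; norm_num
      rw [h2, h3]
      refine mul_le_of_le_one_right (by positivity) ?_
      rw [div_le_one (by positivity)]
      nlinarith [(n.cast_nonneg : (0 : ℝ) ≤ n)]
  have hsum : ∑' n : ℕ, μ {ω | ∃ u ∈ Set.Icc a (a + n),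
      (1 / 2 : ℝ) ^ n < |E (n + 1) u ω - E n u ω|} ≠ ∞ := by
    refine ne_top_of_le_ne_top ?_ (ENNReal.tsum_le_tsum hbad)
    exact (summable_geometric_of_lt_one (r := (1 / 4 : ℝ)) (by norm_num)
      (by norm_num)).tsum_ofReal_ne_top
  -- by the Borel–Cantelli lemma the paths converge locally uniformly
  have hgood : ∀ᵐ ω ∂μ, ∃ f : ℝ≥0 → ℝ, Continuous f ∧
      ∀ u ≥ a, Tendsto (fun n => E n u ω) atTop (𝓝 (f u)) := by
    filter_upwards [ae_eventually_notMem hsum, ae_all_iff.2 hEc] with ω h1 h2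
    obtain ⟨n₀, hn₀⟩ := eventually_atTop.1 h1
    refine exists_continuous_limit h2 (n₀ := n₀) fun n hn u hu => ?_
    by_contra h
    exact hn₀ n hn ⟨u, hu, not_le.1 h⟩
  have hex : ∀ ω, ∃ f : ℝ≥0 → ℝ, Continuous f ∧ ((∃ f : ℝ≥0 → ℝ, Continuous f ∧
      ∀ u ≥ a, Tendsto (fun n => E n u ω) atTop (𝓝 (f u))) →
      ∀ u ≥ a, Tendsto (fun n => E n u ω) atTop (𝓝 (f u))) := fun ω => by
    by_cases h : ∃ f : ℝ≥0 → ℝ, Continuous f ∧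
      ∀ u ≥ a, Tendsto (fun n => E n u ω) atTop (𝓝 (f u))
    · obtain ⟨f, hf, hf'⟩ := h
      exact ⟨f, hf, fun _ => hf'⟩
    · exact ⟨0, continuous_const, fun h' => absurd h' h⟩
  choose f hfc hf using hex
  refine ⟨fun u ω => f ω u, hfc, fun t ht => ?_⟩
  obtain ⟨n₁, hn₁⟩ := exists_nat_ge t
  have htn : ∀ n, t ≤ a + ((n + n₁ : ℕ) : ℝ≥0) := fun n =>
    hn₁.trans (by push_cast; exact le_add_left (le_add_left le_rfl))
  choose D hD hrel using fun n => hinc (n + n₁) a t le_rfl ht (htn n)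
  obtain ⟨I, hI, hDI⟩ := exists_itoRel_of_approx hW ht (hH t).cont hrel
    ((tendsto_add_atTop_iff_nat n₁).2 hδlim) (fun n => (hδ0 _).le)
    fun n r hr => hKH _ r ⟨hr.1, hr.2.trans (htn n)⟩
  refine hI.isItoIntegral hW (hH t) ht ?_
  obtain ⟨ns, hns, hlim⟩ := (tendstoInMeasure_of_tendsto_Lp hDI).exists_seq_tendsto_ae
  filter_upwards [hlim, hgood, ae_all_iff.2 hD] with ω h1 h2 h3
  have h4 := ((tendsto_add_atTop_iff_nat n₁).2 (hf ω h2 t ht)).comp hns.tendsto_atTop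
  refine tendsto_nhds_unique h1 (h4.congr fun n => ?_)
  simp [h3, hE0]

theorem itoProcess_spec (hW : IsDriver μ 𝓕 W) {H : ℝ≥0 → Lp ℝ 2 μ} {Hf : ℝ≥0 → Ω → ℝ}
    (hH : ∀ b, IsIntegrand μ 𝓕 a b Hf H) :
    IsItoProcess μ 𝓕 W Hf a (itoProcess μ 𝓕 W Hf a) := by
  have h := exists_isItoProcess hW hH
  rw [itoProcess, dif_pos h]
  exact h.choose_spec

end ContinuousVersion

/-! ### The signal as an Itô diffusion -/

section Diffusion

variable {Ω : Type*} {mΩ : MeasurableSpace Ω} {μ : Measure Ω} {𝓕 : Filtration ℝ≥0 mΩ}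
  {N d : ℕ} {β : Fin N → StateSpace N → ℝ} {σ : Fin d → Fin N → StateSpace N → ℝ}
  {B : Fin d → ℝ≥0 → Ω → ℝ} {x : StateSpace N} {X : ℝ≥0 → Ω → StateSpace N}

/-- `X` solves `dX^l = β_l(X) dt + ∑ᵢ σ_{i,l}(X) dBⁱ`, `X₀ = x`, with everywhere continuous paths,
adapted up to null sets. The equation is written for increments, with the stochastic integrals in
the sense of `ItoRel`. -/
structure IsDiffusion (μ : Measure Ω) (𝓕 : Filtration ℝ≥0 mΩ) (β : Fin N → StateSpace N → ℝ)
    (σ : Fin d → Fin N → StateSpace N → ℝ) (B : Fin d → ℝ≥0 → Ω → ℝ) (x : StateSpace N)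
    (X : ℝ≥0 → Ω → StateSpace N) : Prop where
  measurable : ∀ t, StronglyMeasurable (X t)
  adapted : ∀ t, AEStronglyMeasurable[𝓕 t] (X t) μ
  cont : ∀ ω, Continuous fun t => X t ω
  init : ∀ᵐ ω ∂μ, X 0 ω = x
  incr : ∀ (r δ : ℝ≥0) (l : Fin N) (H : Fin d → ℝ≥0 → Lp ℝ 2 μ),
    (∀ i v, H i v =ᵐ[μ] fun ω => σ i l (X v ω)) → ∃ I : Fin d → Lp ℝ 2 μ,
      (∀ i, ItoRel μ 𝓕 (B i) r (r + δ) (H i) (I i)) ∧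
      ∀ᵐ ω ∂μ, X (r + δ) ω l - X r ω l =
        (∫ v in (r : ℝ)..(r + δ : ℝ≥0), β l (X v.toNNReal ω)) + ∑ i, I i ω

theorem norm_sq_eq_integral_sq (F : Lp ℝ 2 μ) {f : Ω → ℝ} (hf : F =ᵐ[μ] f) :
    ‖F‖ ^ 2 = ∫ ω, f ω ^ 2 ∂μ := by
  rw [← real_inner_self_eq_norm_sq, L2.inner_def]
  refine integral_congr_ae ?_
  filter_upwards [hf] with ω h
  rw [h, real_inner_self_eq_norm_sq, Real.norm_eq_abs, sq_abs]

variable [IsProbabilityMeasure μ]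

theorem memLp_comp_of_bound {Z : Ω → StateSpace N} (hZ : AEStronglyMeasurable Z μ)
    {g : StateSpace N → ℝ} (hg : Continuous g) {K : ℝ} (hK : ∀ y, |g y| ≤ K) (p : ℝ≥0∞) :
    MemLp (fun ω => g (Z ω)) p μ :=
  MemLp.of_bound (hg.comp_aestronglyMeasurable hZ) K (ae_of_all _ fun _ => hK _)

/-- Bounded continuous functions of a continuous adapted process are integrands. -/
theorem isIntegrand_comp {X : ℝ≥0 → Ω → StateSpace N}
    (hX : ∀ t, AEStronglyMeasurable[𝓕 t] (X t) μ) (hXc : ∀ᵐ ω ∂μ, Continuous fun t => X t ω)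
    {g : StateSpace N → ℝ} (hg : Continuous g) {K : ℝ} (hK : ∀ y, |g y| ≤ K)
    {H : ℝ≥0 → Lp ℝ 2 μ} (hH : ∀ t, H t =ᵐ[μ] fun ω => g (X t ω)) (a b : ℝ≥0) :
    IsIntegrand μ 𝓕 a b (fun t ω => g (X t ω)) H where
  cont := by
    refine Continuous.continuousOn (continuous_iff_continuousAt.2 fun t₀ => ?_)
    have hXm : ∀ t, AEStronglyMeasurable (X t) μ := fun t => (hX t).mono (𝓕.le t)
    have h1 : ∀ t, ‖H t - H t₀‖ ^ 2 = ∫ ω, (g (X t ω) - g (X t₀ ω)) ^ 2 ∂μ := fun t => by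
      refine norm_sq_eq_integral_sq _ ((Lp.coeFn_sub _ _).trans ?_)
      filter_upwards [hH t, hH t₀] with ω h h'
      rw [Pi.sub_apply, h, h']
    have h2 : Tendsto (fun t => ∫ ω, (g (X t ω) - g (X t₀ ω)) ^ 2 ∂μ) (𝓝 t₀) (𝓝 0) := by
      have h3 : (0 : ℝ) = ∫ _, (0 : ℝ) ∂μ := by simp
      rw [h3]
      refine tendsto_integral_filter_of_dominated_convergence (fun _ => (2 * K) ^ 2)
        (Eventually.of_forall fun t => ?_) (Eventually.of_forall fun t => ae_of_all _ fun ω => ?_)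
        (integrable_const _) ?_
      · exact ((hg.comp_aestronglyMeasurable (hXm t)).sub
          (hg.comp_aestronglyMeasurable (hXm t₀))).pow 2
      · rw [norm_pow, Real.norm_eq_abs]
        refine pow_le_pow_left₀ (abs_nonneg _) ?_ 2
        have := abs_sub (g (X t ω)) (g (X t₀ ω))
        linarith [hK (X t ω), hK (X t₀ ω)]
      · filter_upwards [hXc] with ω hω
        have : Continuous fun t => (g (X t ω) - g (X t₀ ω)) ^ 2 := by fun_prop
        simpa using this.tendsto t₀
    rw [ContinuousAt, tendsto_iff_norm_sub_tendsto_zero]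
    have h4 := h2.sqrt
    rw [Real.sqrt_zero] at h4
    refine h4.congr fun t => ?_
    rw [← h1, Real.sqrt_sq (norm_nonneg _)]
  adapted r _ := (hg.comp_aestronglyMeasurable (hX r)).congr (hH r).symm
  rep r _ := hH r

theorem intervalIntegrable_path {p : ℝ≥0 → StateSpace N} (hp : Continuous p)
    {g : StateSpace N → ℝ} (hg : Continuous g) (u v : ℝ) :
    IntervalIntegrable (fun r : ℝ => g (p r.toNNReal)) volume u v :=
  Continuous.intervalIntegrable (by fun_prop) _ _

/-- The signal has a version that is a diffusion in the sense of `IsDiffusion`. -/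
theorem IsSignal.exists_isDiffusion {d₁ : ℕ} {V₀ : StateSpace N → StateSpace N}
    {V : Fin d₁ → StateSpace N → StateSpace N} {B : Fin d₁ → ℝ≥0 → Ω → ℝ}
    {X : StateSpace N → ℝ≥0 → Ω → StateSpace N} (hX : IsSignal μ 𝓕 V₀ V B X)
    (hB : ∀ i, IsDriver μ 𝓕 (B i)) {K : ℝ} (hV : ∀ i l, Continuous fun y => V i y l)
    (hVK : ∀ i l y, |V i y l| ≤ K) (hb : ∀ l, Continuous fun y => itoDrift V₀ V y l)
    (x : StateSpace N) :
    ∃ X' : ℝ≥0 → Ω → StateSpace N, IsDiffusion μ 𝓕 (fun l y => itoDrift V₀ V y l)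
      (fun i l y => V i y l) B x X' ∧ ∀ t, X' t =ᵐ[μ] X x t := by
  obtain ⟨S, hS, hSm, hS0⟩ := exists_measurable_superset_of_null (ae_iff.1 (hX.continuous x))
  classical
  set X' : ℝ≥0 → Ω → StateSpace N := fun t => Sᶜ.piecewise (X x t) fun _ => x with hX'
  have hgood : ∀ᵐ ω ∂μ, ω ∈ Sᶜ := measure_eq_zero_iff_ae_notMem.1 hS0
  have hXX : ∀ᵐ ω ∂μ, ∀ t, X' t ω = X x t ω := by
    filter_upwards [hgood] with ω hω t
    exact Set.piecewise_eq_of_mem _ _ _ hω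
  have hXX' : ∀ t, X' t =ᵐ[μ] X x t := fun t => hXX.mono fun ω hω => hω t
  have hint : ∀ i l (H : ℝ≥0 → Lp ℝ 2 μ), (∀ v, H v =ᵐ[μ] fun ω => V i (X' v ω) l) → ∀ a b,
      IsIntegrand μ 𝓕 a b (fun v ω => V i (X x v ω) l) H := fun i l H hH a b =>
    isIntegrand_comp (fun t => (hX.adapted x t).aestronglyMeasurable) (hX.continuous x) (hV i l)
      (hVK i l) (fun t => (hH t).trans <| by
        filter_upwards [hXX' t] with ω h
        rw [h]) a b
  have hLp : ∀ i l, ∃ H : ℝ≥0 → Lp ℝ 2 μ, ∀ v, H v =ᵐ[μ] fun ω => V i (X' v ω) l := fun i l => by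
    have : ∀ v, MemLp (fun ω => V i (X' v ω) l) 2 μ := fun v =>
      memLp_comp_of_bound (Z := X' v) (((hX.adapted x v).mono (𝓕.le v)).aestronglyMeasurable.congr
        (hXX' v).symm) (hV i l) (hVK i l) 2
    exact ⟨fun v => (this v).toLp _, fun v => (this v).coeFn_toLp⟩
  refine ⟨X', ⟨fun t => ?_, fun t => ?_, fun ω => ?_, ?_, fun r δ l H hH => ?_⟩, hXX'⟩
  · exact ((hX.adapted x t).mono (𝓕.le t)).piecewise hSm.compl stronglyMeasurable_const
  · exact (hX.adapted x t).aestronglyMeasurable.congr (hXX' t).symm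
  · by_cases hω : ω ∈ S
    · have : ∀ t, X' t ω = x := fun t => by simp [hX', hω]
      simp only [this]
      exact continuous_const
    · have : ∀ t, X' t ω = X x t ω := fun t => by simp [hX', hω]
      simp only [this]
      by_contra h
      exact hω (hS h)
  · have h0 : ∀ i l, itoIntegral μ 𝓕 (B i) (fun r ω' => V i (X x r ω') l) 0 0 =ᵐ[μ] 0 := by
      intro i l
      obtain ⟨H, hH⟩ := hLp i l
      obtain ⟨I, h1, h2⟩ := (hint i l H hH 0 0).exists_itoRel (hB i) le_rfl
      rw [h2.unique (hB i) ItoRel.refl_zero] at h1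
      exact h1.symm.trans (Lp.coeFn_zero _ _ _)
    filter_upwards [hXX' 0, ae_all_iff.2 fun l => hX.equation x 0 l,
      ae_all_iff.2 fun i => ae_all_iff.2 (h0 i)] with ω h1 h2 h3
    rw [h1]
    ext l
    rw [h2 l]
    simp [h3]
  · choose J hJ hJr using fun i => (hint i l (H i) (hH i) 0 r).exists_itoRel (hB i) zero_le
    choose J' hJ' hJr' using fun i =>
      (hint i l (H i) (hH i) 0 (r + δ)).exists_itoRel (hB i) zero_le
    choose I hI hIr using fun i =>
      (hint i l (H i) (hH i) r (r + δ)).exists_itoRel (hB i) le_self_add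
    refine ⟨I, hIr, ?_⟩
    have hadd : ∀ i, J i + I i = J' i := fun i =>
      ((hJr i).concat (hIr i) zero_le le_self_add).unique (hB i) (hJr' i)
    filter_upwards [hXX, hX.equation x r l, hX.equation x (r + δ) l, ae_all_iff.2 hJ,
      ae_all_iff.2 hJ', ae_all_iff.2 fun i => Lp.coeFn_add (J i) (I i), hX.continuous x]
      with ω h1 h2 h3 h4 h5 h6 h7
    have hc := fun u v => intervalIntegrable_path h7 (hb l) u v
    simp only [h1, h2, h3, ← h4, ← h5, ← hadd, h6, Pi.add_apply, Finset.sum_add_distrib]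
    linarith [intervalIntegral.integral_interval_sub_left (hc 0 (r + δ : ℝ≥0)) (hc 0 r)]

/-- Bounds for the coefficients of the diffusion and their first derivatives. -/
structure CoeffBound (K : ℝ) (β : Fin N → StateSpace N → ℝ)
    (σ : Fin d → Fin N → StateSpace N → ℝ) : Prop where
  smooth_drift : ∀ l, ContDiff ℝ (⊤ : ℕ∞) (β l)
  drift : ∀ l, BddBy 1 K (β l)
  smooth_diff : ∀ i l, ContDiff ℝ (⊤ : ℕ∞) (σ i l)
  diff : ∀ i l, BddBy 1 K (σ i l)
  nonneg : 0 ≤ K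

theorem sq_add_sum_le {d : ℕ} (a : ℝ) (b : Fin d → ℝ) :
    (a + ∑ i, b i) ^ 2 ≤ (d + 1) * (a ^ 2 + ∑ i, b i ^ 2) := by
  have := sq_sum_le_card_mul_sum_sq (s := (Finset.univ : Finset (Option (Fin d))))
    (f := fun o => o.elim a b)
  simpa [Fintype.sum_option] using this

theorem integral_sq_add_sum_le {d : ℕ} {a : Ω → ℝ} {b : Fin d → Ω → ℝ} (ha : MemLp a 2 μ)
    (hb : ∀ i, MemLp (b i) 2 μ) {α : ℝ} (ha2 : ∫ ω, a ω ^ 2 ∂μ ≤ α) {γ : ℝ}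
    (hb2 : ∀ i, ∫ ω, b i ω ^ 2 ∂μ ≤ γ) :
    ∫ ω, (a ω + ∑ i, b i ω) ^ 2 ∂μ ≤ (d + 1) * (α + d * γ) := by
  have h1 : Integrable (fun ω => ∑ i, b i ω ^ 2) μ :=
    integrable_finsetSum _ fun i _ => (hb i).integrable_sq
  have h2 : ∫ ω, (a ω + ∑ i, b i ω) ^ 2 ∂μ ≤ ∫ ω, (d + 1) * (a ω ^ 2 + ∑ i, b i ω ^ 2) ∂μ :=
    integral_mono (ha.add (memLp_finsetSum (f := b) _ fun i _ => hb i)).integrable_sq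
      ((ha.integrable_sq.add h1).const_mul _) fun ω => sq_add_sum_le _ _
  rw [integral_const_mul, integral_add ha.integrable_sq h1,
    integral_finsetSum _ fun i _ => (hb i).integrable_sq] at h2
  refine h2.trans ?_
  have h3 : ∑ i, ∫ ω, b i ω ^ 2 ∂μ ≤ d * γ := by
    have := Finset.sum_le_card_nsmul Finset.univ _ γ fun i _ => hb2 i
    simpa using this
  gcongr

namespace IsDiffusion

variable {K : ℝ}

theorem aesm (hX : IsDiffusion μ 𝓕 β σ B x X) (t : ℝ≥0) : AEStronglyMeasurable (X t) μ :=
  (hX.measurable t).aestronglyMeasurable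

theorem exists_lp (hX : IsDiffusion μ 𝓕 β σ B x X) {g : StateSpace N → ℝ} (hg : Continuous g)
    {G : ℝ} (hG : ∀ y, |g y| ≤ G) :
    ∃ H : ℝ≥0 → Lp ℝ 2 μ, ∀ v, H v =ᵐ[μ] fun ω => g (X v ω) :=
  ⟨fun v => (memLp_comp_of_bound (hX.aesm v) hg hG 2).toLp _,
    fun v => (memLp_comp_of_bound (hX.aesm v) hg hG 2).coeFn_toLp⟩

theorem abs_drift_le (hc : CoeffBound K β σ) (r δ : ℝ≥0)
    (l : Fin N) (ω : Ω) :
    |∫ v in (r : ℝ)..(r + δ : ℝ≥0), β l (X v.toNNReal ω)| ≤ K * δ := by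
  have h := intervalIntegral.norm_integral_le_of_norm_le_const (a := (r : ℝ))
    (b := ((r + δ : ℝ≥0) : ℝ)) (f := fun v => β l (X v.toNNReal ω)) (C := K)
    fun v _ => (hc.drift l).abs_le _
  rw [Real.norm_eq_abs] at h
  simpa using h

/-- The increments of the diffusion in terms of their drift and of stochastic integrals. -/
theorem exists_incr (hX : IsDiffusion μ 𝓕 β σ B x X) (hc : CoeffBound K β σ) (r δ : ℝ≥0)
    (l : Fin N) : ∃ (A : Ω → ℝ) (H : Fin d → ℝ≥0 → Lp ℝ 2 μ) (I : Fin d → Lp ℝ 2 μ),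
      (∀ ω, A ω = ∫ v in (r : ℝ)..(r + δ : ℝ≥0), β l (X v.toNNReal ω)) ∧ MemLp A 2 μ ∧
      (∀ ω, |A ω| ≤ K * δ) ∧ (∀ i v, H i v =ᵐ[μ] fun ω => σ i l (X v ω)) ∧
      (∀ i, ItoRel μ 𝓕 (B i) r (r + δ) (H i) (I i)) ∧
      ∀ᵐ ω ∂μ, X (r + δ) ω l - X r ω l = A ω + ∑ i, I i ω := by
  choose H hH using fun i => hX.exists_lp (hc.smooth_diff i l).continuous (hc.diff i l).abs_le
  obtain ⟨I, hI, heq⟩ := hX.incr r δ l H hH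
  refine ⟨_, H, I, fun ω => rfl, ?_, abs_drift_le hc r δ l, hH, hI, heq⟩
  refine MemLp.of_bound ?_ (K * δ) (ae_of_all _ (abs_drift_le hc r δ l))
  have h1 : AEStronglyMeasurable (fun ω => X (r + δ) ω l - X r ω l - ∑ i, I i ω) μ := by
    have h2 : ∀ t, AEStronglyMeasurable (fun ω => X t ω l) μ := fun t =>
      (by fun_prop : Continuous fun y : StateSpace N => y l).comp_aestronglyMeasurable (hX.aesm t)
    exact ((h2 _).sub (h2 _)).sub
      (Finset.aestronglyMeasurable_fun_sum _ fun i _ => Lp.aestronglyMeasurable (I i))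
  refine h1.congr ?_
  filter_upwards [heq] with ω h
  rw [h]
  ring

theorem incr_sq (hX : IsDiffusion μ 𝓕 β σ B x X) (hB : ∀ i, IsDriver μ 𝓕 (B i))
    (hc : CoeffBound K β σ) (r δ : ℝ≥0) (hδ : δ ≤ 1) (l : Fin N) :
    MemLp (fun ω => X (r + δ) ω l - X r ω l) 2 μ ∧
      ∫ ω, (X (r + δ) ω l - X r ω l) ^ 2 ∂μ ≤ ((d + 1) * K) ^ 2 * δ := by
  obtain ⟨A, H, I, -, hA, hAK, hH, hI, heq⟩ := hX.exists_incr hc r δ l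
  have hδ' : (δ : ℝ) ≤ 1 := by exact_mod_cast hδ
  refine ⟨(memLp_congr_ae heq).2 (hA.add (memLp_finsetSum (f := fun i ω => I i ω) _
    fun i _ => Lp.memLp (I i))), ?_⟩
  have h1 : ∫ ω, (X (r + δ) ω l - X r ω l) ^ 2 ∂μ = ∫ ω, (A ω + ∑ i, I i ω) ^ 2 ∂μ := by
    refine integral_congr_ae ?_
    filter_upwards [heq] with ω h
    rw [h]
  rw [h1]
  refine (integral_sq_add_sum_le (b := fun i ω => I i ω) hA (fun i => Lp.memLp (I i))
    (α := K ^ 2 * δ) (γ := K ^ 2 * δ) ?_ fun i => ?_).trans (le_of_eq (by ring))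
  · have h2 : ∫ ω, A ω ^ 2 ∂μ ≤ ∫ _, (K * δ) ^ 2 ∂μ :=
      integral_mono hA.integrable_sq (integrable_const _) fun ω => by
        rw [← sq_abs (A ω)]
        exact pow_le_pow_left₀ (abs_nonneg _) (hAK ω) 2
    refine h2.trans ?_
    simp only [integral_const, probReal_univ, one_smul]
    have : K ^ 2 * δ * δ ≤ K ^ 2 * δ * 1 := by gcongr
    nlinarith
  · rw [← norm_sq_eq_integral_sq (I i) (Filter.EventuallyEq.refl _ _)]
    refine ((hI i).norm_sq_le (hB i) le_self_add (C := K) fun v _ => ?_).trans (le_of_eq ?_)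
    · refine (pow_le_pow_iff_left₀ (norm_nonneg _) hc.nonneg two_ne_zero).1 ?_
      rw [norm_sq_eq_integral_sq _ (hH i v)]
      have := integral_mono (μ := μ) (f := fun ω => σ i l (X v ω) ^ 2) (g := fun _ => K ^ 2)
        (memLp_comp_of_bound (hX.aesm v) (hc.smooth_diff i l).continuous
          (hc.diff i l).abs_le 2).integrable_sq (integrable_const _) fun ω => by
        show σ i l (X v ω) ^ 2 ≤ K ^ 2
        rw [← sq_abs (σ i l _)]
        exact pow_le_pow_left₀ (abs_nonneg _) ((hc.diff i l).abs_le _) 2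
      simpa using this
    · push_cast; ring

/-- Time regularity in mean square of functions of the diffusion. -/
theorem comp_sq (hX : IsDiffusion μ 𝓕 β σ B x X) (hB : ∀ i, IsDriver μ 𝓕 (B i))
    (hc : CoeffBound K β σ) (r δ : ℝ≥0) (hδ : δ ≤ 1) {g : StateSpace N → ℝ}
    (hg : ContDiff ℝ (⊤ : ℕ∞) g) {G : ℝ} (hG : BddBy 1 G g) :
    ∫ ω, (g (X (r + δ) ω) - g (X r ω)) ^ 2 ∂μ ≤ G ^ 2 * (N * (d + 1) * K) ^ 2 * δ := by
  have h1 : ∀ ω, (g (X (r + δ) ω) - g (X r ω)) ^ 2 ≤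
      G ^ 2 * (N * ∑ l, (X (r + δ) ω l - X r ω l) ^ 2) := fun ω => by
    have h2 := taylor_one hg hG (X r ω) (X (r + δ) ω - X r ω)
    rw [add_sub_cancel] at h2
    have h3 : l1 (X (r + δ) ω - X r ω) ^ 2 ≤ N * ∑ l, (X (r + δ) ω l - X r ω l) ^ 2 := by
      have := sq_sum_le_card_mul_sum_sq (s := (Finset.univ : Finset (Fin N)))
        (f := fun l => |(X (r + δ) ω - X r ω) l|)
      simpa [l1] using this
    rw [← sq_abs]
    refine (pow_le_pow_left₀ (abs_nonneg _) h2 2).trans ?_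
    rw [mul_pow, mul_comm]
    gcongr
  have h2 : ∀ l, Integrable (fun ω => (X (r + δ) ω l - X r ω l) ^ 2) μ := fun l =>
    (hX.incr_sq hB hc r δ hδ l).1.integrable_sq
  refine (integral_mono (((memLp_comp_of_bound (hX.aesm _) hg.continuous hG.abs_le 2).sub
    (memLp_comp_of_bound (hX.aesm _) hg.continuous hG.abs_le 2)).integrable_sq)
    (((integrable_finsetSum _ fun l _ => h2 l).const_mul _).const_mul _) h1).trans ?_
  rw [integral_const_mul, integral_const_mul, integral_finsetSum _ fun l _ => h2 l]
  have h3 := Finset.sum_le_card_nsmul Finset.univ _ _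
    fun l _ => (hX.incr_sq hB hc r δ hδ l).2
  simp only [Finset.card_univ, Fintype.card_fin, nsmul_eq_mul] at h3
  calc G ^ 2 * ((N : ℝ) * ∑ l, ∫ ω, (X (r + δ) ω l - X r ω l) ^ 2 ∂μ)
      ≤ G ^ 2 * (N * (N * (((d + 1) * K) ^ 2 * δ))) := by gcongr
    _ = _ := by ring

/-- Over a short time interval, the increment of the diffusion is the increment of the driving
Brownian motion, up to an error of the order of the length of the interval. -/
theorem exists_decomp (hX : IsDiffusion μ 𝓕 β σ B x X) (hB : ∀ i, IsDriver μ 𝓕 (B i))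
    (hc : CoeffBound K β σ) (r δ : ℝ≥0) (hδ : δ ≤ 1) (l : Fin N) :
    ∃ ρ : Ω → ℝ, MemLp ρ 2 μ ∧
      ∫ ω, ρ ω ^ 2 ∂μ ≤ (d + 1) * (K ^ 2 + d * (K ^ 2 * (N * (d + 1) * K) ^ 2)) * δ ^ 2 ∧
      ∀ᵐ ω ∂μ, X (r + δ) ω l - X r ω l =
        ∑ i, σ i l (X r ω) * (B i (r + δ) ω - B i r ω) + ρ ω := by
  obtain ⟨A, H, I, -, hA, hAK, hH, hI, heq⟩ := hX.exists_incr hc r δ l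
  have hδ' : (δ : ℝ) ≤ 1 := by exact_mod_cast hδ
  have hHa : ∀ i, AEStronglyMeasurable[𝓕 r] (H i r) μ := fun i =>
    ((hc.smooth_diff i l).continuous.comp_aestronglyMeasurable (hX.adapted r)).congr (hH i r).symm
  have hpm : ∀ i, MemLp (fun ω => H i r ω * (B i (r + δ) ω - B i r ω)) 2 μ := fun i =>
    (hB i).memLp_piece le_self_add (hHa i) (Lp.memLp _)
  set P : Fin d → Lp ℝ 2 μ := fun i => (hpm i).toLp _ with hP
  have hPr : ∀ i, ItoRel μ 𝓕 (B i) r (r + δ) (fun v => H i v - H i r) (I i - P i) := fun i =>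
    (hI i).sub (ItoRel.piece le_self_add (hHa i) (hpm i).coeFn_toLp)
  refine ⟨fun ω => A ω + ∑ i, (I i - P i : Lp ℝ 2 μ) ω, hA.add (memLp_finsetSum
    (f := fun i ω => (I i - P i : Lp ℝ 2 μ) ω) _ fun i _ => Lp.memLp _), ?_, ?_⟩
  · refine (integral_sq_add_sum_le (b := fun i ω => (I i - P i : Lp ℝ 2 μ) ω) hA
      (fun i => Lp.memLp _) (α := K ^ 2 * δ ^ 2) (γ := K ^ 2 * (N * (d + 1) * K) ^ 2 * δ ^ 2)
      ?_ fun i => ?_).trans (le_of_eq (by ring))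
    · have h2 : ∫ ω, A ω ^ 2 ∂μ ≤ ∫ _, (K * δ) ^ 2 ∂μ :=
        integral_mono hA.integrable_sq (integrable_const _) fun ω => by
          rw [← sq_abs (A ω)]
          exact pow_le_pow_left₀ (abs_nonneg _) (hAK ω) 2
      refine h2.trans ?_
      simp only [integral_const, probReal_univ, one_smul]
      rw [mul_pow]
    · rw [← norm_sq_eq_integral_sq (I i - P i) (Filter.EventuallyEq.refl _ _)]
      refine ((hPr i).norm_sq_le (hB i) le_self_add
        (C := √(K ^ 2 * (N * (d + 1) * K) ^ 2 * δ)) fun v hv => ?_).trans (le_of_eq ?_)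
      · refine Real.le_sqrt_of_sq_le ?_
        have h3 : v = r + (v - r) := (add_tsub_cancel_of_le hv.1.le).symm
        have h4 : v - r ≤ δ := tsub_le_iff_left.2 hv.2
        have h5 := hX.comp_sq hB hc r (v - r) (h4.trans hδ) (hc.smooth_diff i l) (hc.diff i l)
        rw [← h3] at h5
        rw [norm_sq_eq_integral_sq (H i v - H i r)
          (f := fun ω => σ i l (X v ω) - σ i l (X r ω))]
        · exact h5.trans (by gcongr)
        · filter_upwards [Lp.coeFn_sub (H i v) (H i r), hH i v, hH i r] with ω h6 h7 h8
          rw [h6, Pi.sub_apply, h7, h8]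
      · rw [Real.sq_sqrt (by positivity)]
        push_cast
        ring
  · filter_upwards [heq, ae_all_iff.2 fun i => Lp.coeFn_sub (I i) (P i),
      ae_all_iff.2 fun i => (hpm i).coeFn_toLp, ae_all_iff.2 fun i => hH i r] with ω h1 h2 h3 h4
    have h5 : ∀ i, (I i - P i : Lp ℝ 2 μ) ω =
        I i ω - σ i l (X r ω) * (B i (r + δ) ω - B i r ω) := fun i => by
      rw [h2, Pi.sub_apply, ← h4 i]
      exact congrArg (I i ω - ·) (h3 i)
    rw [h1]
    simp only [h5, Finset.sum_sub_distrib]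
    ring

end IsDiffusion

end Diffusion

/-! ### Moments of Brownian increments -/

section Increments

variable {Ω : Type*} {mΩ : MeasurableSpace Ω} {μ : Measure Ω} {𝓕 : Filtration ℝ≥0 mΩ}
  {d : ℕ} {B : Fin d → ℝ≥0 → Ω → ℝ}

/-- The third absolute moment of a Brownian increment. -/
theorem IsFiltrationBrownian.abs_cube_incr (hB : IsFiltrationBrownian μ 𝓕 B) (i : Fin d)
    (r δ : ℝ≥0) :
    Integrable (fun ω => |B i (r + δ) ω - B i r ω| ^ 3) μ ∧
      ∫ ω, |B i (r + δ) ω - B i r ω| ^ 3 ∂μ =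
        δ * √δ * ∫ y, |y| ^ 3 ∂gaussianReal 0 1 := by
  have h := (hB.brownian i).hasLaw_sub (r + δ) r
  have hd : nndist ((r + δ : ℝ≥0) : ℝ) r = δ := by
    ext
    rw [coe_nndist, Real.dist_eq]
    simp
  change HasLaw _ (gaussianReal 0 (nndist ((r + δ : ℝ≥0) : ℝ) r)) μ at h
  rw [hd] at h
  have hs : gaussianReal 0 δ = (gaussianReal 0 1).map (√δ * ·) := by
    rw [gaussianReal_map_const_mul]
    congr 1
    · simp
    · ext
      simp
  have hi : Integrable (fun y : ℝ => |y| ^ 3) (gaussianReal 0 1) := by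
    have := (memLp_id_gaussianReal (μ := 0) (v := 1) 3).integrable_norm_pow (by norm_num)
    simpa using this
  constructor
  · have h1 : Integrable (fun y : ℝ => |y| ^ 3) (gaussianReal 0 δ) := by
      rw [hs, integrable_map_measure (by fun_prop) (by fun_prop)]
      simp only [Function.comp_def, abs_mul, mul_pow]
      exact hi.const_mul _
    rw [← h.map_eq] at h1
    exact h1.comp_aemeasurable h.aemeasurable
  · have h1 : ∫ ω, |B i (r + δ) ω - B i r ω| ^ 3 ∂μ = ∫ y, |y| ^ 3 ∂gaussianReal 0 δ :=
      h.integral_comp (f := fun y : ℝ => |y| ^ 3) (by fun_prop)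
    rw [h1, hs, integral_map (by fun_prop) (by fun_prop)]
    simp only [abs_mul, mul_pow, integral_const_mul, abs_of_nonneg (Real.sqrt_nonneg _)]
    congr 1
    have : √(δ : ℝ) ^ 3 = √δ ^ 2 * √δ := by ring
    rw [this, Real.sq_sqrt δ.coe_nonneg]

/-- Increments of different coordinates are uncorrelated, conditionally on the past. -/
theorem IsFiltrationBrownian.integral_mul_incr_mul_incr_of_ne [IsProbabilityMeasure μ]
    (hB : IsFiltrationBrownian μ 𝓕 B) {i j : Fin d} (hij : i ≠ j) (r δ : ℝ≥0) {g : Ω → ℝ}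
    (hg : AEStronglyMeasurable[𝓕 r] g μ) :
    ∫ ω, g ω * ((B i (r + δ) ω - B i r ω) * (B j (r + δ) ω - B j r ω)) ∂μ = 0 := by
  have hm : ∀ k t, AEStronglyMeasurable (B k t) μ := fun k t =>
    (((hB.isDriver k).adapted t).mono (𝓕.le t)).aestronglyMeasurable
  have hinc : ∀ k, AEStronglyMeasurable (fun ω => B k (r + δ) ω - B k r ω) μ := fun k =>
    (hm k _).sub (hm k _)
  have hind : IndepFun g
      (fun ω => (B i (r + δ) ω - B i r ω) * (B j (r + δ) ω - B j r ω)) μ := by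
    obtain ⟨g', hg', hgg'⟩ := hg
    have h : IndepFun g'
        (fun ω => (B i (r + δ) ω - B i r ω) * (B j (r + δ) ω - B j r ω)) μ := by
      have h1 := indep_of_indep_of_le_left (hB.indep_past r (r + δ) le_self_add).symm
        (measurable_iff_comap_le.1 hg'.measurable)
      refine indep_of_indep_of_le_right h1 (measurable_iff_comap_le.1 ?_)
      have h2 := comap_measurable (m := MeasurableSpace.pi)
        fun ω (i : Fin d) => B i (r + δ) ω - B i r ω
      exact ((measurable_pi_apply i).comp h2).mul ((measurable_pi_apply j).comp h2)
    exact h.congr hgg'.symm EventuallyEq.rfl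
  have hind2 : IndepFun (fun ω => B i (r + δ) ω - B i r ω)
      (fun ω => B j (r + δ) ω - B j r ω) μ :=
    (hB.indep_coord.indepFun hij).comp
      (φ := fun f : ℝ≥0 → ℝ => f (r + δ) - f r) (ψ := fun f : ℝ≥0 → ℝ => f (r + δ) - f r)
      (by fun_prop) (by fun_prop)
  rw [hind.integral_fun_mul_eq_mul_integral (hg.mono (𝓕.le r)) ((hinc i).mul (hinc j)),
    hind2.integral_fun_mul_eq_mul_integral (hinc i) (hinc j), (hB.isDriver i).mean]
  simp

end Increments

/-! ### Short-time behaviour of the signal -/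

section OneStep

variable {Ω : Type*} {mΩ : MeasurableSpace Ω} {μ : Measure Ω} {𝓕 : Filtration ℝ≥0 mΩ}
  {N d : ℕ} {β : Fin N → StateSpace N → ℝ} {σ : Fin d → Fin N → StateSpace N → ℝ}
  {B : Fin d → ℝ≥0 → Ω → ℝ} {x : StateSpace N} {X : ℝ≥0 → Ω → StateSpace N} {K : ℝ}
  [IsProbabilityMeasure μ]

namespace IsDiffusion

/-- The mean of an increment, tested against the past. -/
theorem mean_incr (hX : IsDiffusion μ 𝓕 β σ B x X) (hB : ∀ i, IsDriver μ 𝓕 (B i))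
    (hc : CoeffBound K β σ) (r δ : ℝ≥0) (hδ : δ ≤ 1) (l : Fin N) {g : StateSpace N → ℝ}
    (hg : Continuous g) {G : ℝ} (hG : ∀ y, |g y| ≤ G) :
    |∫ ω, g (X r ω) * (X (r + δ) ω l - X r ω l) ∂μ - δ * ∫ ω, g (X r ω) * β l (X r ω) ∂μ| ≤
      G * (1 + K ^ 2 * (N * (d + 1) * K) ^ 2) * (δ * √δ) := by
  obtain ⟨A, H, I, hAeq, hA, hAK, hH, hI, heq⟩ := hX.exists_incr hc r δ l
  have hG0 : 0 ≤ G := (abs_nonneg _).trans (hG 0)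
  have hg2 : MemLp (fun ω => g (X r ω)) 2 μ := memLp_comp_of_bound (hX.aesm r) hg hG 2
  have hβc := (hc.smooth_drift l).continuous
  have hβ : ∀ v, MemLp (fun ω => β l (X v ω)) 2 μ := fun v =>
    memLp_comp_of_bound (hX.aesm v) hβc (hc.drift l).abs_le 2
  set S : ℝ := K ^ 2 * (N * (d + 1) * K) ^ 2 with hS
  have hS0 : 0 ≤ S := by positivity
  have h1 : ∫ ω, g (X r ω) * (X (r + δ) ω l - X r ω l) ∂μ = ∫ ω, g (X r ω) * A ω ∂μ := by
    have h2 : ∫ ω, g (X r ω) * (X (r + δ) ω l - X r ω l) ∂μ =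
        ∫ ω, (g (X r ω) * A ω + ∑ i, g (X r ω) * I i ω) ∂μ := by
      refine integral_congr_ae ?_
      filter_upwards [heq] with ω h
      rw [h, mul_add, Finset.mul_sum]
    have h3 : ∀ i, Integrable (fun ω => g (X r ω) * I i ω) μ := fun i =>
      hg2.integrable_mul (Lp.memLp (I i))
    have h4 : ∀ i, ∫ ω, g (X r ω) * I i ω ∂μ = 0 := fun i =>
      (hI i).orth (hB i) (hg.comp_aestronglyMeasurable (hX.adapted r)) hg2
    have hgA : Integrable (fun ω => g (X r ω) * A ω) μ := hg2.integrable_mul hA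
    rw [h2, integral_add hgA (integrable_finsetSum _ fun i _ => h3 i),
      integral_finsetSum _ fun i _ => h3 i]
    simp [h4]
  set D : ℝ → Ω → ℝ := fun v ω => β l (X v.toNNReal ω) - β l (X r ω) with hD
  have hDm : Measurable (Function.uncurry D) := by
    refine measurable_uncurry_of_continuous_of_measurable (fun ω => ?_) fun v => ?_
    · exact (hβc.comp ((hX.cont ω).comp continuous_real_toNNReal)).sub continuous_const
    · exact (hβc.measurable.comp (hX.measurable _).measurable).sub
        (hβc.measurable.comp (hX.measurable _).measurable)
  have hDb : ∀ v ω, |D v ω| ≤ 2 * K := fun v ω => by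
    have := abs_sub (β l (X v.toNNReal ω)) (β l (X r ω))
    linarith [(hc.drift l).abs_le (X v.toNNReal ω), (hc.drift l).abs_le (X r ω)]
  have hAD : ∀ ω, A ω - δ * β l (X r ω) = ∫ v in Set.Ioc (r : ℝ) (r + δ : ℝ≥0), D v ω := by
    intro ω
    have hle : (r : ℝ) ≤ (r + δ : ℝ≥0) := by exact_mod_cast le_self_add
    rw [← intervalIntegral.integral_of_le hle, hD, hAeq, intervalIntegral.integral_sub
      (intervalIntegrable_path (hX.cont ω) hβc _ _) (by simp)]
    simp
  have hDi : Integrable (Function.uncurry fun ω v => |D v ω|)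
      (μ.prod (volume.restrict (Set.Ioc (r : ℝ) (r + δ : ℝ≥0)))) := by
    refine Integrable.of_bound ?_ (2 * K) (ae_of_all _ fun p => ?_)
    · exact ((hDm.comp measurable_swap).norm).aestronglyMeasurable
    · simpa [Function.uncurry] using hDb p.2 p.1
  have hDE : ∀ v ∈ Set.Ioc (r : ℝ) (r + δ : ℝ≥0), ∫ ω, |D v ω| ∂μ ≤ (1 + S) * √δ := by
    intro v hv
    have hv' := toNNReal_mem_Ioc hv
    have h3 : v.toNNReal = r + (v.toNNReal - r) := (add_tsub_cancel_of_le hv'.1.le).symm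
    have h4 : v.toNNReal - r ≤ δ := tsub_le_iff_left.2 hv'.2
    have h5 := hX.comp_sq hB hc r _ (h4.trans hδ) (hc.smooth_drift l) (hc.drift l)
    rw [← h3, ← hS] at h5
    have h6 : Integrable (fun ω => D v ω ^ 2) μ := ((hβ _).sub (hβ _)).integrable_sq
    have hδpos : (0 : ℝ) < δ := by
      have : (0 : ℝ≥0) < δ := by
        by_contra h
        have h0 : δ = 0 := by simpa using h
        rw [h0, add_zero] at hv'
        exact absurd hv'.1 (not_lt.2 hv'.2)
      exact_mod_cast this
    have hsq : (0 : ℝ) < √δ := Real.sqrt_pos.2 hδpos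
    have hDi : Integrable (fun ω => |D v ω|) μ := by
      have : MemLp (fun ω => D v ω) 2 μ := (hβ _).sub (hβ _)
      exact (this.integrable (by norm_num)).abs
    have h7 : ∫ ω, |D v ω| ∂μ ≤ ∫ ω, (√δ + D v ω ^ 2 / √δ) ∂μ := by
      refine integral_mono hDi ((integrable_const _).add (h6.div_const _)) fun ω => ?_
      show |D v ω| ≤ √δ + D v ω ^ 2 / √δ
      rw [← sub_nonneg]
      have : √(δ : ℝ) + D v ω ^ 2 / √δ - |D v ω| =
          ((√δ - |D v ω|) ^ 2 + √δ * |D v ω|) / √δ := by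
        field_simp
        rw [← sq_abs (D v ω)]
        ring
      rw [this]
      positivity
    rw [integral_add (integrable_const _) (h6.div_const _), integral_div] at h7
    simp only [integral_const, probReal_univ, one_smul] at h7
    refine h7.trans ?_
    have h8 : (∫ ω, D v ω ^ 2 ∂μ) / √δ ≤ S * √δ := by
      rw [div_le_iff₀ hsq, mul_assoc, Real.mul_self_sqrt δ.coe_nonneg]
      refine h5.trans ?_
      gcongr
    linarith
  have h9 : ∫ ω, |A ω - δ * β l (X r ω)| ∂μ ≤ (1 + S) * (δ * √δ) := by
    calc ∫ ω, |A ω - δ * β l (X r ω)| ∂μ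
        ≤ ∫ ω, (∫ v in Set.Ioc (r : ℝ) (r + δ : ℝ≥0), |D v ω|) ∂μ := by
          refine integral_mono_of_nonneg (ae_of_all _ fun ω => abs_nonneg _) hDi.integral_prod_left
            (ae_of_all _ fun ω => ?_)
          show |A ω - δ * β l (X r ω)| ≤ _
          rw [hAD]
          exact abs_integral_le_integral_abs
      _ = ∫ v in Set.Ioc (r : ℝ) (r + δ : ℝ≥0), ∫ ω, |D v ω| ∂μ := integral_integral_swap hDi
      _ ≤ ∫ v in Set.Ioc (r : ℝ) (r + δ : ℝ≥0), (1 + S) * √δ := by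
          refine setIntegral_mono_on hDi.integral_prod_right ?_ measurableSet_Ioc hDE
          exact integrableOn_const (by simp)
      _ = (1 + S) * (δ * √δ) := by
          rw [setIntegral_const, Measure.real, Real.volume_Ioc, NNReal.coe_add, add_sub_cancel_left,
            ENNReal.toReal_ofReal δ.coe_nonneg, smul_eq_mul]
          ring
  have hgA : Integrable (fun ω => g (X r ω) * A ω) μ := hg2.integrable_mul hA
  have hgβ : Integrable (fun ω => g (X r ω) * β l (X r ω)) μ := hg2.integrable_mul (hβ r)
  rw [h1, ← integral_const_mul, ← integral_sub hgA (hgβ.const_mul _)]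
  refine abs_integral_le_integral_abs.trans ?_
  calc ∫ ω, |g (X r ω) * A ω - δ * (g (X r ω) * β l (X r ω))| ∂μ
      ≤ ∫ ω, G * |A ω - δ * β l (X r ω)| ∂μ := by
        refine integral_mono_of_nonneg (ae_of_all _ fun ω => abs_nonneg _)
          ((((hA.sub ((hβ r).const_mul _)).integrable (by norm_num)).abs).const_mul _)
          (ae_of_all _ fun ω => ?_)
        have : g (X r ω) * A ω - δ * (g (X r ω) * β l (X r ω)) =
          g (X r ω) * (A ω - δ * β l (X r ω)) := by ring
        show |g (X r ω) * A ω - δ * (g (X r ω) * β l (X r ω))| ≤ G * |A ω - δ * β l (X r ω)|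
        rw [this, abs_mul]
        gcongr
        exact hG _
    _ ≤ _ := by
        rw [integral_const_mul, mul_assoc]
        gcongr

theorem quad_var (hX : IsDiffusion μ 𝓕 β σ B x X) (hB : IsFiltrationBrownian μ 𝓕 B)
    (hc : CoeffBound K β σ) (r δ : ℝ≥0) (l m : Fin N) {g : StateSpace N → ℝ}
    (hg : Continuous g) {G : ℝ} (hG : ∀ y, |g y| ≤ G) :
    Integrable (fun ω => g (X r ω) * ((∑ i, σ i l (X r ω) * (B i (r + δ) ω - B i r ω)) *
      ∑ i, σ i m (X r ω) * (B i (r + δ) ω - B i r ω))) μ ∧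
    ∫ ω, g (X r ω) * ((∑ i, σ i l (X r ω) * (B i (r + δ) ω - B i r ω)) *
      ∑ i, σ i m (X r ω) * (B i (r + δ) ω - B i r ω)) ∂μ =
      δ * ∫ ω, g (X r ω) * ∑ i, σ i l (X r ω) * σ i m (X r ω) ∂μ := by
  set c : Fin d → Fin d → StateSpace N → ℝ := fun i j y => g y * (σ i l y * σ j m y) with hcdef
  have hcc : ∀ i j, Continuous (c i j) := fun i j =>
    hg.mul ((hc.smooth_diff i l).continuous.mul (hc.smooth_diff j m).continuous)
  have hG0 : 0 ≤ G := (abs_nonneg _).trans (hG 0)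
  have hcb : ∀ i j y, |c i j y| ≤ G * (K * K) := fun i j y => by
    rw [abs_mul, abs_mul]
    have := hc.nonneg
    gcongr
    exacts [hG y, (hc.diff i l).abs_le y, (hc.diff j m).abs_le y]
  have hpi : ∀ i j, Integrable (fun ω => c i j (X r ω) *
      ((B i (r + δ) ω - B i r ω) * (B j (r + δ) ω - B j r ω))) μ := fun i j =>
    (((hB.isDriver i).memLp_incr r (r + δ)).integrable_mul
      ((hB.isDriver j).memLp_incr r (r + δ))).bdd_mul (c := G * (K * K))
      ((hcc i j).comp_aestronglyMeasurable (hX.aesm r)) (ae_of_all _ fun ω => hcb i j _)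
  have hci : ∀ i j, Integrable (fun ω => c i j (X r ω)) μ := fun i j =>
    memLp_one_iff_integrable.1 (memLp_comp_of_bound (hX.aesm r) (hcc i j) (hcb i j) 1)
  have hexp : ∀ ω, g (X r ω) * ((∑ i, σ i l (X r ω) * (B i (r + δ) ω - B i r ω)) *
      ∑ i, σ i m (X r ω) * (B i (r + δ) ω - B i r ω)) = ∑ i, ∑ j, c i j (X r ω) *
      ((B i (r + δ) ω - B i r ω) * (B j (r + δ) ω - B j r ω)) := fun ω => by
    rw [Finset.sum_mul_sum, Finset.mul_sum]
    refine Finset.sum_congr rfl fun i _ => ?_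
    rw [Finset.mul_sum]
    refine Finset.sum_congr rfl fun j _ => ?_
    simp only [hcdef]
    ring
  simp only [hexp]
  refine ⟨integrable_finsetSum _ fun i _ => integrable_finsetSum _ fun j _ => hpi i j, ?_⟩
  rw [integral_finsetSum _ fun i _ => integrable_finsetSum _ fun j _ => hpi i j]
  have hd : ∀ i j, ∫ ω, c i j (X r ω) *
      ((B i (r + δ) ω - B i r ω) * (B j (r + δ) ω - B j r ω)) ∂μ =
      if i = j then δ * ∫ ω, c i j (X r ω) ∂μ else 0 := fun i j => by
    have hca : AEStronglyMeasurable[𝓕 r] (fun ω => c i j (X r ω)) μ :=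
      (hcc i j).comp_aestronglyMeasurable (hX.adapted r)
    split_ifs with hij
    · subst hij
      have := (hB.isDriver i).integral_mul_incr_sq (t := r + δ) le_self_add hca
      simp only [← pow_two]
      rw [this]
      push_cast
      ring
    · exact hB.integral_mul_incr_mul_incr_of_ne hij r δ hca
  have hsum : ∀ ω, g (X r ω) * ∑ i, σ i l (X r ω) * σ i m (X r ω) = ∑ i, c i i (X r ω) :=
    fun ω => Finset.mul_sum _ _ _
  rw [integral_congr_ae (ae_of_all _ hsum), integral_finsetSum _ fun i _ => hci i i, Finset.mul_sum]
  refine Finset.sum_congr rfl fun i _ => ?_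
  rw [integral_finsetSum _ fun j _ => hpi i j]
  simp only [hd, Finset.sum_ite_eq, Finset.mem_univ, if_true]

end IsDiffusion

/-- Taylor's formula for an increment `z + ρ` with a small part `ρ`, where only `z` is kept in the
second order term. -/
theorem taylor_remainder_le {f : StateSpace N → ℝ} (hf : ContDiff ℝ (⊤ : ℕ∞) f) {M : ℝ}
    (hM : BddBy 3 M f) (y v z ρ : StateSpace N) (hv : v = z + ρ) {ε : ℝ} (hε : 0 < ε) :
    |f (y + v) - f y - ∑ l, v l * pd l f y -
      1 / 2 * ∑ l, ∑ m, pd m (pd l f) y * (z l * z m)| ≤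
      M * (8 * l1 z ^ 3 + 9 * l1 ρ ^ 2 + ε * l1 z ^ 2 + l1 ρ ^ 2 / ε) := by
  have hM0 := hM.nonneg
  have hz := l1_nonneg z
  have hρ := l1_nonneg ρ
  have hl1v := l1_nonneg v
  have hvz : l1 v ≤ l1 z + l1 ρ := hv ▸ l1_add_le z ρ
  have h2 : ∀ l m, |pd m (pd l f) y| ≤ M := fun l m => ((hM.2 l).2 m).abs_le y
  have hquad : ∀ u : StateSpace N,
      |∑ l, u l * ∑ m, u m * pd m (pd l f) y| ≤ l1 u * (l1 u * M) := fun u =>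
    abs_sum_mul_le u fun l => abs_sum_mul_le u fun m => h2 l m
  have hR : |f (y + v) - f y - ∑ l, v l * pd l f y -
      1 / 2 * ∑ l, v l * ∑ m, v m * pd m (pd l f) y| ≤ M * (8 * l1 z ^ 3 + 8 * l1 ρ ^ 2) := by
    rcases le_total (l1 ρ) (l1 z) with h | h
    · refine (taylor_three hf hM y v).trans ?_
      have h3 : l1 v ^ 3 ≤ (2 * l1 z) ^ 3 := pow_le_pow_left₀ hl1v (by linarith) 3
      have h4 : l1 v ^ 3 * M ≤ (2 * l1 z) ^ 3 * M := by gcongr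
      nlinarith [mul_nonneg hM0 (sq_nonneg (l1 ρ))]
    · have h3 : l1 v ^ 2 ≤ (2 * l1 ρ) ^ 2 := pow_le_pow_left₀ hl1v (by linarith) 2
      have h4 := taylor_two hf hM.of_succ y v
      have h5 := hquad v
      have h6 : l1 v ^ 2 * M ≤ (2 * l1 ρ) ^ 2 * M := by gcongr
      have h7 : 0 ≤ M * l1 z ^ 3 := by positivity
      rw [abs_le] at h4 h5 ⊢
      constructor <;> nlinarith
  have hcross : |∑ l, v l * ∑ m, v m * pd m (pd l f) y -
      ∑ l, ∑ m, pd m (pd l f) y * (z l * z m)| ≤ M * (2 * l1 z * l1 ρ + l1 ρ ^ 2) := by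
    have h3 : ∑ l, v l * ∑ m, v m * pd m (pd l f) y -
        ∑ l, ∑ m, pd m (pd l f) y * (z l * z m) = ∑ l, z l * ∑ m, ρ m * pd m (pd l f) y +
        ∑ l, ρ l * ∑ m, v m * pd m (pd l f) y := by
      rw [← Finset.sum_sub_distrib, ← Finset.sum_add_distrib]
      refine Finset.sum_congr rfl fun l _ => ?_
      have h4 : ∑ m, v m * pd m (pd l f) y = ∑ m, z m * pd m (pd l f) y +
          ∑ m, ρ m * pd m (pd l f) y := by
        rw [← Finset.sum_add_distrib]
        exact Finset.sum_congr rfl fun m _ => by rw [hv, PiLp.add_apply]; ring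
      have h5 : ∑ m, pd m (pd l f) y * (z l * z m) = z l * ∑ m, z m * pd m (pd l f) y := by
        rw [Finset.mul_sum]
        exact Finset.sum_congr rfl fun m _ => by ring
      have h6 : v l = z l + ρ l := by rw [hv, PiLp.add_apply]
      rw [h5, h4, h6]
      ring
    rw [h3]
    refine (abs_add_le _ _).trans ?_
    have h4 := abs_sum_mul_le z fun l => abs_sum_mul_le ρ fun m => h2 l m
    have h5 := abs_sum_mul_le ρ fun l => abs_sum_mul_le v fun m => h2 l m
    have h6 : l1 ρ * (l1 v * M) ≤ l1 ρ * ((l1 z + l1 ρ) * M) := by gcongr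
    nlinarith
  have hAM : 2 * l1 z * l1 ρ ≤ ε * l1 z ^ 2 + l1 ρ ^ 2 / ε := by
    have : ε * l1 z ^ 2 + l1 ρ ^ 2 / ε - 2 * l1 z * l1 ρ = (ε * l1 z - l1 ρ) ^ 2 / ε := by
      field_simp
      ring
    have h0 : 0 ≤ (ε * l1 z - l1 ρ) ^ 2 / ε := by positivity
    linarith
  have hAM' : M * (2 * l1 z * l1 ρ) ≤ M * (ε * l1 z ^ 2 + l1 ρ ^ 2 / ε) := by gcongr
  have hpos : 0 ≤ M * (ε * l1 z ^ 2 + l1 ρ ^ 2 / ε) := by positivity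
  have hpos' : 0 ≤ M * l1 ρ ^ 2 := by positivity
  rw [abs_le] at hR hcross ⊢
  constructor <;> nlinarith

/-- The generator of the diffusion in coordinates. -/
noncomputable def diffusionGen (β : Fin N → StateSpace N → ℝ)
    (σ : Fin d → Fin N → StateSpace N → ℝ) (f : StateSpace N → ℝ) (y : StateSpace N) : ℝ :=
  ∑ l, β l y * pd l f y +
    1 / 2 * ∑ l, ∑ m, (∑ i, σ i l y * σ i m y) * pd m (pd l f) y

end OneStep

/-! ### The one-step estimate -/

section OneStepMain

variable {Ω : Type*} {mΩ : MeasurableSpace Ω} {μ : Measure Ω} {𝓕 : Filtration ℝ≥0 mΩ}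
  {N d : ℕ} {β : Fin N → StateSpace N → ℝ} {σ : Fin d → Fin N → StateSpace N → ℝ}
  {B : Fin d → ℝ≥0 → Ω → ℝ} {x : StateSpace N} {X : ℝ≥0 → Ω → StateSpace N} {K : ℝ}
  [IsProbabilityMeasure μ]

/-- The one step estimate: the generator describes the evolution of expectations over a short
time, with an error of order `3/2` that is controlled by three derivatives. -/
theorem exists_one_step (hB : IsFiltrationBrownian μ 𝓕 B) (hc : CoeffBound K β σ) :
    ∃ C : ℝ, 0 ≤ C ∧ ∀ (x : StateSpace N) (X : ℝ≥0 → Ω → StateSpace N),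
      IsDiffusion μ 𝓕 β σ B x X → ∀ r δ : ℝ≥0, δ ≤ 1 → ∀ f : StateSpace N → ℝ,
      ContDiff ℝ (⊤ : ℕ∞) f → ∀ M, BddBy 3 M f →
      |∫ ω, f (X (r + δ) ω) ∂μ - ∫ ω, f (X r ω) ∂μ - δ * ∫ ω, diffusionGen β σ f (X r ω) ∂μ| ≤
        C * M * (δ * √δ) := by
  have hK := hc.nonneg
  set c₃ : ℝ := ∫ y, |y| ^ 3 ∂gaussianReal 0 1 with hc₃
  have hc₃0 : 0 ≤ c₃ := integral_nonneg fun y => by positivity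
  set R : ℝ := (d + 1) * (K ^ 2 + d * (K ^ 2 * (N * (d + 1) * K) ^ 2)) with hR
  have hR0 : 0 ≤ R := by positivity
  refine ⟨N * (1 + K ^ 2 * (N * (d + 1) * K) ^ 2) +
    (8 * ((N * K) ^ 3 * (d ^ 2 * (d * c₃))) + 9 * (N * (N * R)) + (N * K) ^ 2 * (d * d) +
      N * (N * R)), by positivity, fun x X hX r δ hδ f hf M hM => ?_⟩
  have hM0 := hM.nonneg
  rcases eq_or_lt_of_le (zero_le (a := δ)) with rfl | hδ0
  · simp
  have hδ0' : (0 : ℝ) < δ := by exact_mod_cast hδ0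
  have hδ1 : (δ : ℝ) ≤ 1 := by exact_mod_cast hδ
  set ε : ℝ := √δ with hε
  have hε0 : 0 < ε := Real.sqrt_pos.2 hδ0'
  have hεδ : ε * ε = δ := Real.mul_self_sqrt hδ0'.le
  have hε1 : ε ≤ 1 := by nlinarith
  have hBd := fun i => hB.isDriver i
  choose ρ hρ2 hρ hdec using fun l => hX.exists_decomp hBd hc r δ hδ l
  set Z : Ω → StateSpace N := fun ω => WithLp.toLp 2 fun l =>
    ∑ i, σ i l (X r ω) * (B i (r + δ) ω - B i r ω) with hZ
  set ρv : Ω → StateSpace N := fun ω => WithLp.toLp 2 fun l => ρ l ω with hρv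
  have hfc : ∀ l, Continuous (pd l f) := fun l => (contDiff_pd hf l).continuous
  have hfc2 : ∀ l m, Continuous (pd m (pd l f)) := fun l m =>
    (contDiff_pd (contDiff_pd hf l) m).continuous
  have hfb : ∀ l y, |pd l f y| ≤ M := fun l => (hM.2 l).abs_le
  have hfb2 : ∀ l m y, |pd m (pd l f) y| ≤ M := fun l m => ((hM.2 l).2 m).abs_le
  have hfi : ∀ t, Integrable (fun ω => f (X t ω)) μ := fun t =>
    memLp_one_iff_integrable.1 (memLp_comp_of_bound (hX.aesm t) hf.continuous hM.abs_le 1)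
  have hli : ∀ l, Integrable (fun ω => pd l f (X r ω) * (X (r + δ) ω l - X r ω l)) μ := fun l =>
    (memLp_comp_of_bound (hX.aesm r) (hfc l) (hfb l) 2).integrable_mul
      (hX.incr_sq hBd hc r δ hδ l).1
  have hqv := fun l m => hX.quad_var hB hc r δ l m (hfc2 l m) (hfb2 l m)
  have hρi : ∀ l, Integrable (fun ω => ρ l ω ^ 2) μ := fun l => (hρ2 l).integrable_sq
  have hBi : ∀ i, Integrable (fun ω => (B i (r + δ) ω - B i r ω) ^ 2) μ := fun i =>
    ((hBd i).memLp_incr r (r + δ)).integrable_sq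
  have hB3 := fun i => hB.abs_cube_incr i r δ
  -- the remainder of Taylor's formula and an integrable bound for it
  set D : Ω → ℝ := fun ω => f (X (r + δ) ω) - f (X r ω) -
    ∑ l, pd l f (X r ω) * (X (r + δ) ω l - X r ω l) -
    1 / 2 * ∑ l, ∑ m, pd m (pd l f) (X r ω) * (Z ω l * Z ω m) with hD
  set W : Ω → ℝ := fun ω => M * (8 * ((N * K) ^ 3 * (d ^ 2 *
    ∑ i, |B i (r + δ) ω - B i r ω| ^ 3)) + 9 * (N * ∑ l, ρ l ω ^ 2) +
    ε * ((N * K) ^ 2 * (d * ∑ i, (B i (r + δ) ω - B i r ω) ^ 2)) +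
    (N * ∑ l, ρ l ω ^ 2) / ε) with hW
  have hDW : ∀ᵐ ω ∂μ, |D ω| ≤ W ω := by
    filter_upwards [ae_all_iff.2 hdec] with ω hω
    have hv : X (r + δ) ω - X r ω = Z ω + ρv ω := by
      ext l
      simpa using hω l
    have h1 := taylor_remainder_le hf hM (X r ω) _ _ _ hv hε0
    rw [add_sub_cancel] at h1
    have hzl : l1 (Z ω) ≤ N * K * ∑ i, |B i (r + δ) ω - B i r ω| := by
      have h2 : ∀ l, |Z ω l| ≤ K * ∑ i, |B i (r + δ) ω - B i r ω| := fun l => by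
        rw [Finset.mul_sum]
        show |∑ i, σ i l (X r ω) * (B i (r + δ) ω - B i r ω)| ≤ _
        refine (Finset.abs_sum_le_sum_abs _ _).trans (Finset.sum_le_sum fun i _ => ?_)
        rw [abs_mul]
        gcongr
        exact (hc.diff i l).abs_le _
      have := Finset.sum_le_card_nsmul Finset.univ _ _ fun l _ => h2 l
      simp only [Finset.card_univ, Fintype.card_fin, nsmul_eq_mul] at this
      rw [mul_assoc]
      exact this
    have hz2 : l1 (Z ω) ^ 2 ≤ (N * K) ^ 2 * (d * ∑ i, (B i (r + δ) ω - B i r ω) ^ 2) := by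
      refine (pow_le_pow_left₀ (l1_nonneg _) hzl 2).trans ?_
      rw [mul_pow]
      have := sq_sum_le_card_mul_sum_sq (s := (Finset.univ : Finset (Fin d)))
        (f := fun i => |B i (r + δ) ω - B i r ω|)
      simp only [sq_abs, Finset.card_univ, Fintype.card_fin] at this
      gcongr
    have hz3 : l1 (Z ω) ^ 3 ≤ (N * K) ^ 3 * (d ^ 2 * ∑ i, |B i (r + δ) ω - B i r ω| ^ 3) := by
      refine (pow_le_pow_left₀ (l1_nonneg _) hzl 3).trans ?_
      rw [mul_pow]
      have := pow_sum_le_card_mul_sum_pow (s := (Finset.univ : Finset (Fin d)))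
        (f := fun i => |B i (r + δ) ω - B i r ω|) (fun i _ => abs_nonneg _) 2
      simp only [Finset.card_univ, Fintype.card_fin] at this
      gcongr
    have hρ2 : l1 (ρv ω) ^ 2 ≤ N * ∑ l, ρ l ω ^ 2 := by
      have := sq_sum_le_card_mul_sum_sq (s := (Finset.univ : Finset (Fin N)))
        (f := fun l => |ρ l ω|)
      simpa [l1, hρv] using this
    have h2 : D ω = f (X (r + δ) ω) - f (X r ω) -
        ∑ l, (X (r + δ) ω - X r ω) l * pd l f (X r ω) -
        1 / 2 * ∑ l, ∑ m, pd m (pd l f) (X r ω) * (Z ω l * Z ω m) := by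
      simp only [hD, PiLp.sub_apply]
      congr 2
      exact Finset.sum_congr rfl fun l _ => mul_comm _ _
    rw [h2]
    refine h1.trans ?_
    simp only [hW]
    gcongr
  have hWi : Integrable W μ := by
    have h1 : Integrable (fun ω => ∑ l, ρ l ω ^ 2) μ := integrable_finsetSum _ fun l _ => hρi l
    exact ((((((integrable_finsetSum _ fun i _ => (hB3 i).1).const_mul _).const_mul _).const_mul
      _).add ((h1.const_mul _).const_mul _)).add
      ((((integrable_finsetSum _ fun i _ => hBi i).const_mul _).const_mul _).const_mul _)
      |>.add ((h1.const_mul _).div_const _)).const_mul _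
  have hWint : ∫ ω, W ω ∂μ ≤ M * ((8 * ((N * K) ^ 3 * (d ^ 2 * (d * c₃))) + 9 * (N * (N * R)) +
      (N * K) ^ 2 * (d * d) + N * (N * R)) * (δ * ε)) := by
    have h1 : Integrable (fun ω => ∑ l, ρ l ω ^ 2) μ := integrable_finsetSum _ fun l _ => hρi l
    have h2 : Integrable (fun ω => ∑ i, |B i (r + δ) ω - B i r ω| ^ 3) μ :=
      integrable_finsetSum _ fun i _ => (hB3 i).1
    have h3 : Integrable (fun ω => ∑ i, (B i (r + δ) ω - B i r ω) ^ 2) μ :=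
      integrable_finsetSum _ fun i _ => hBi i
    have e1 : ∫ ω, ∑ l, ρ l ω ^ 2 ∂μ ≤ N * (R * δ ^ 2) := by
      rw [integral_finsetSum _ fun l _ => hρi l]
      have := Finset.sum_le_card_nsmul Finset.univ _ _ fun l _ => hρ l
      simpa using this
    have e2 : ∫ ω, ∑ i, |B i (r + δ) ω - B i r ω| ^ 3 ∂μ = d * (δ * ε * c₃) := by
      rw [integral_finsetSum _ fun i _ => (hB3 i).1]
      simp [(hB3 _).2, hε, hc₃]
    have e3 : ∫ ω, ∑ i, (B i (r + δ) ω - B i r ω) ^ 2 ∂μ = d * δ := by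
      rw [integral_finsetSum _ fun i _ => hBi i]
      simp [(hBd _).variance r (r + δ) le_self_add]
    simp only [hW]
    rw [integral_const_mul, integral_add, integral_add, integral_add, integral_const_mul,
      integral_const_mul, integral_const_mul, integral_const_mul, integral_const_mul,
      integral_const_mul, integral_const_mul, integral_const_mul, integral_div,
      integral_const_mul, e2, e3]
    rotate_left
    · exact ((h2.const_mul _).const_mul _).const_mul _
    · exact (h1.const_mul _).const_mul _
    · exact (((h2.const_mul _).const_mul _).const_mul _).add ((h1.const_mul _).const_mul _)
    · exact ((h3.const_mul _).const_mul _).const_mul _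
    · exact ((((h2.const_mul _).const_mul _).const_mul _).add ((h1.const_mul _).const_mul _)).add
        (((h3.const_mul _).const_mul _).const_mul _)
    · exact (h1.const_mul _).div_const _
    refine mul_le_mul_of_nonneg_left ?_ hM0
    set S : ℝ := ∫ ω, ∑ l, ρ l ω ^ 2 ∂μ with hS
    have f1 : (N : ℝ) * S ≤ N * (N * R) * (δ * ε) := by
      have : (δ : ℝ) ^ 2 ≤ δ * ε := by nlinarith
      calc (N : ℝ) * S ≤ N * (N * (R * δ ^ 2)) := by gcongr
        _ ≤ N * (N * (R * (δ * ε))) := by gcongr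
        _ = _ := by ring
    have f2 : (N : ℝ) * S / ε ≤ N * (N * R) * (δ * ε) := by
      rw [div_le_iff₀ hε0]
      calc (N : ℝ) * S ≤ N * (N * (R * δ ^ 2)) := by gcongr
        _ = N * (N * R) * (δ * ε) * ε := by rw [← hεδ]; ring
    nlinarith
  -- the terms of the expansion
  set a : Fin N → ℝ := fun l =>
    ∫ ω, pd l f (X r ω) * (X (r + δ) ω l - X r ω l) ∂μ with ha
  set a' : Fin N → ℝ := fun l => ∫ ω, pd l f (X r ω) * β l (X r ω) ∂μ with ha'
  set q : Fin N → Fin N → ℝ := fun l m => ∫ ω, pd m (pd l f) (X r ω) *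
    ∑ i, σ i l (X r ω) * σ i m (X r ω) ∂μ with hq
  have hmean : ∀ l, |a l - δ * a' l| ≤ M * (1 + K ^ 2 * (N * (d + 1) * K) ^ 2) * (δ * ε) :=
    fun l => hX.mean_incr hBd hc r δ hδ l (hfc l) (hfb l)
  have hgen : ∫ ω, diffusionGen β σ f (X r ω) ∂μ = ∑ l, a' l + 1 / 2 * ∑ l, ∑ m, q l m := by
    have h1 : ∀ l, Integrable (fun ω => pd l f (X r ω) * β l (X r ω)) μ := fun l =>
      (memLp_comp_of_bound (hX.aesm r) (hfc l) (hfb l) 2).integrable_mul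
        (memLp_comp_of_bound (hX.aesm r) (hc.smooth_drift l).continuous (hc.drift l).abs_le 2)
    have h2 : ∀ l m, Integrable (fun ω => pd m (pd l f) (X r ω) *
        ∑ i, σ i l (X r ω) * σ i m (X r ω)) μ := fun l m =>
      (memLp_comp_of_bound (hX.aesm r) (hfc2 l m) (hfb2 l m) 2).integrable_mul
        (memLp_finsetSum (f := fun i ω => σ i l (X r ω) * σ i m (X r ω)) _ fun i _ =>
          memLp_comp_of_bound (g := fun y => σ i l y * σ i m y) (hX.aesm r)
            ((hc.smooth_diff i l).continuous.mul (hc.smooth_diff i m).continuous)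
            (K := K * K) (fun y => by
              rw [abs_mul]
              gcongr
              exacts [(hc.diff i l).abs_le y, (hc.diff i m).abs_le y]) 2)
    simp only [diffusionGen, mul_comm (β _ _), mul_comm (∑ i, σ i _ _ * σ i _ _)]
    rw [integral_add (integrable_finsetSum _ fun l _ => h1 l)
      ((integrable_finsetSum _ fun l _ => integrable_finsetSum _ fun m _ => h2 l m).const_mul _),
      integral_finsetSum _ fun l _ => h1 l, integral_const_mul,
      integral_finsetSum _ fun l _ => integrable_finsetSum _ fun m _ => h2 l m]
    simp only [hq, ha', integral_finsetSum _ fun m _ => h2 _ m]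
  have hDint : ∫ ω, D ω ∂μ = ∫ ω, f (X (r + δ) ω) ∂μ - ∫ ω, f (X r ω) ∂μ - ∑ l, a l -
      1 / 2 * ∑ l, ∑ m, δ * q l m := by
    have h1 : Integrable (fun ω => ∑ l, pd l f (X r ω) * (X (r + δ) ω l - X r ω l)) μ :=
      integrable_finsetSum _ fun l _ => hli l
    have h2 : ∀ l, Integrable (fun ω => ∑ m, pd m (pd l f) (X r ω) * (Z ω l * Z ω m)) μ :=
      fun l => integrable_finsetSum _ fun m _ => (hqv l m).1
    have h3 : Integrable (fun ω => f (X (r + δ) ω) - f (X r ω)) μ := (hfi _).sub (hfi _)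
    have h4 : Integrable (fun ω => f (X (r + δ) ω) - f (X r ω) -
        ∑ l, pd l f (X r ω) * (X (r + δ) ω l - X r ω l)) μ := h3.sub h1
    simp only [hD]
    rw [integral_sub h4 ((integrable_finsetSum _ fun l _ => h2 l).const_mul _),
      integral_sub h3 h1, integral_sub (hfi _) (hfi _), integral_finsetSum _ fun l _ => hli l,
      integral_const_mul, integral_finsetSum _ fun l _ => h2 l]
    congr 2
    refine Finset.sum_congr rfl fun l _ => ?_
    rw [integral_finsetSum _ fun m _ => (hqv l m).1]
    exact Finset.sum_congr rfl fun m _ => (hqv l m).2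
  have hkey : ∫ ω, f (X (r + δ) ω) ∂μ - ∫ ω, f (X r ω) ∂μ -
      δ * ∫ ω, diffusionGen β σ f (X r ω) ∂μ = ∫ ω, D ω ∂μ + ∑ l, (a l - δ * a' l) := by
    rw [hDint, hgen, Finset.sum_sub_distrib]
    simp only [← Finset.mul_sum]
    ring
  rw [hkey]
  have h1 : |∫ ω, D ω ∂μ| ≤ ∫ ω, W ω ∂μ :=
    abs_integral_le_integral_abs.trans
      (integral_mono_of_nonneg (ae_of_all _ fun ω => abs_nonneg _) hWi hDW)
  have h2 : |∑ l, (a l - δ * a' l)| ≤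
      N * (M * (1 + K ^ 2 * (N * (d + 1) * K) ^ 2) * (δ * ε)) := by
    refine (Finset.abs_sum_le_sum_abs _ _).trans ?_
    have := Finset.sum_le_card_nsmul Finset.univ _ _ fun l _ => hmean l
    simpa using this
  refine (abs_add_le _ _).trans ((add_le_add (h1.trans hWint) h2).trans (le_of_eq ?_))
  ring

end OneStepMain

/-! ### Calculus along the half-line -/

section HalfLine

variable {a b : ℝ≥0}

/-- Riemann–Stieltjes sums converge, for continuous `J` against the primitive of `ζ`. -/
theorem tendsto_sum_mul_integral_grid {J : ℝ≥0 → ℝ} (hJ : Continuous J) (hab : a ≤ b) {ζ : ℝ → ℝ}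
    (hζ : IntervalIntegrable ζ volume a b) {p : ℕ → ℕ → ℝ≥0}
    (hp : ∀ n k, k < n → p n k ∈ Set.Icc (grid a b n k) (grid a b n (k + 1))) :
    Tendsto (fun n => ∑ k ∈ Finset.range n, J (p n k) *
      ∫ v in (grid a b n k : ℝ)..grid a b n (k + 1), ζ v) atTop
      (𝓝 (∫ v in (a : ℝ)..b, J v.toNNReal * ζ v)) := by
  have hab' : (a : ℝ) ≤ b := by exact_mod_cast hab
  have hJζ : IntervalIntegrable (fun v => J v.toNNReal * ζ v) volume a b :=
    hζ.continuousOn_mul (by fun_prop)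
  rw [Metric.tendsto_atTop]
  intro ε hε
  set L : ℝ := ∫ v in (a : ℝ)..b, |ζ v| with hL
  have hL0 : 0 ≤ L := intervalIntegral.integral_nonneg hab' fun v _ => abs_nonneg _
  set η := ε / (2 * (L + 1)) with hη
  have hη0 : 0 < η := by positivity
  obtain ⟨n₀, hn₀⟩ := exists_grid_modulus hJ.continuousOn hab hη0
  refine ⟨n₀ + 1, fun n hn => ?_⟩
  have hn0 : n ≠ 0 := by omega
  have hcell : ∀ k, (grid a b n k : ℝ) ≤ grid a b n (k + 1) := fun k => by
    exact_mod_cast grid_mono n (Nat.le_succ k)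
  have hsubset : ∀ k < n, Set.uIcc (grid a b n k : ℝ) (grid a b n (k + 1)) ⊆
      Set.uIcc (a : ℝ) b := fun k hk => by
    rw [Set.uIcc_of_le (hcell k), Set.uIcc_of_le hab']
    exact Set.Icc_subset_Icc (by exact_mod_cast (grid_mem hab hk.le).1)
      (by exact_mod_cast (grid_mem hab hk).2)
  have hsplit : ∀ {g : ℝ → ℝ}, IntervalIntegrable g volume a b →
      ∫ v in (a : ℝ)..b, g v =
        ∑ k ∈ Finset.range n, ∫ v in (grid a b n k : ℝ)..grid a b n (k + 1), g v := by
    intro g hg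
    have := intervalIntegral.sum_integral_adjacent_intervals (f := g) (μ := volume)
      (a := fun k => (grid a b n k : ℝ)) (n := n) fun k hk => hg.mono_set (hsubset k hk)
    rw [this, grid_zero, grid_self hab hn0]
  rw [Real.dist_eq, hsplit hJζ, ← Finset.sum_sub_distrib]
  have hterm : ∀ k ∈ Finset.range n, |J (p n k) * (∫ v in (grid a b n k : ℝ)..grid a b n (k + 1),
      ζ v) - ∫ v in (grid a b n k : ℝ)..grid a b n (k + 1), J v.toNNReal * ζ v| ≤
      2 * η * ∫ v in (grid a b n k : ℝ)..grid a b n (k + 1), |ζ v| := by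
    intro k hk
    have hk := Finset.mem_range.1 hk
    have h1 := hζ.mono_set (hsubset k hk)
    have h2 := hJζ.mono_set (hsubset k hk)
    rw [← intervalIntegral.integral_const_mul, ← intervalIntegral.integral_sub (h1.const_mul _) h2,
      ← intervalIntegral.integral_const_mul]
    refine intervalIntegral.abs_integral_le_integral_abs (hcell k) |>.trans ?_
    refine intervalIntegral.integral_mono_on (hcell k) ((h1.const_mul _).sub h2).abs
      (h1.abs.const_mul _) fun v hv => ?_
    have hv' : v.toNNReal ∈ Set.Icc (grid a b n k) (grid a b n (k + 1)) := by
      have h0 : 0 ≤ v := (grid a b n k).coe_nonneg.trans hv.1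
      rw [Set.mem_Icc, ← NNReal.coe_le_coe, ← NNReal.coe_le_coe, Real.coe_toNNReal _ h0]
      exact hv
    rw [← sub_mul, abs_mul]
    gcongr
    have h3 := hn₀ n (by omega) hn0 k hk _ hv'
    have h4 := hn₀ n (by omega) hn0 k hk _ (hp n k hk)
    rw [← Real.dist_eq]
    have := dist_triangle_left (J (p n k)) (J v.toNNReal) (J (grid a b n k))
    linarith
  calc _ ≤ ∑ k ∈ Finset.range n, 2 * η * ∫ v in (grid a b n k : ℝ)..grid a b n (k + 1), |ζ v| :=
        (Finset.abs_sum_le_sum_abs _ _).trans (Finset.sum_le_sum hterm)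
    _ = 2 * η * L := by rw [← Finset.mul_sum, ← hsplit hζ.abs]
    _ < ε := by
        rw [hη]
        have : 2 * (ε / (2 * (L + 1))) * L = ε * (L / (L + 1)) := by field_simp
        rw [this]
        have h5 : L / (L + 1) < 1 := by rw [div_lt_one (by positivity)]; linarith
        nlinarith

theorem grid_sub_grid (hab : a ≤ b) (n k : ℕ) :
    ((grid a b n (k + 1) : ℝ≥0) : ℝ) - grid a b n k = ((b : ℝ) - a) / n := by
  rw [grid_succ, NNReal.coe_add, NNReal.coe_div, NNReal.coe_sub hab]
  simp

theorem tendsto_riemann_sum {J : ℝ≥0 → ℝ} (hJ : Continuous J) (hab : a ≤ b) :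
    Tendsto (fun n : ℕ => ∑ k ∈ Finset.range n, ((b : ℝ) - a) / n * J (grid a b n k)) atTop
      (𝓝 (∫ v in (a : ℝ)..b, J v.toNNReal)) := by
  have h := tendsto_sum_mul_integral_grid hJ hab (ζ := fun _ => 1) (by simp)
    (p := fun n k => grid a b n k) fun n k _ => ⟨le_rfl, grid_mono n (Nat.le_succ k)⟩
  simpa [grid_sub_grid hab, mul_comm] using h

/-- A function whose increments are approximated by a continuous function `z` up to an error of
order `3/2` is a primitive of `z`. -/
theorem sub_eq_integral_of_increments {y z : ℝ≥0 → ℝ} (hab : a ≤ b) (hz : Continuous z) {C : ℝ}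
    (h : ∀ r δ : ℝ≥0, a ≤ r → r + δ ≤ b → δ ≤ 1 →
      |y (r + δ) - y r - δ * z r| ≤ C * (δ * √δ)) :
    y b - y a = ∫ v in (a : ℝ)..b, z v.toNNReal := by
  have hab' : (a : ℝ) ≤ b := by exact_mod_cast hab
  have hC : 0 ≤ |C| := abs_nonneg C
  -- the same estimate with real times
  have h' : ∀ u v : ℝ, (a : ℝ) ≤ u → u ≤ v → v ≤ b → v - u ≤ 1 →
      |y v.toNNReal - y u.toNNReal - (v - u) * z u.toNNReal| ≤ |C| * ((v - u) * √(v - u)) := by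
    intro u v hu huv hv h1
    have hu0 : 0 ≤ u := a.coe_nonneg.trans hu
    have hd0 : 0 ≤ v - u := sub_nonneg.2 huv
    have e : v.toNNReal = u.toNNReal + (v - u).toNNReal := by
      rw [← Real.toNNReal_add hu0 hd0, add_sub_cancel]
    have h2 := h u.toNNReal (v - u).toNNReal (NNReal.le_toNNReal_of_coe_le hu)
      (by rw [← e]; exact Real.toNNReal_le_iff_le_coe.2 hv)
      (Real.toNNReal_le_iff_le_coe.2 (by simpa using h1))
    rw [← e, Real.coe_toNNReal _ hd0] at h2
    refine h2.trans ?_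
    gcongr
    exact le_abs_self C
  obtain ⟨K, hK⟩ := (isCompact_Icc (a := a) (b := b)).exists_bound_of_continuousOn hz.continuousOn
  have hK' : ∀ u : ℝ, (a : ℝ) ≤ u → u ≤ b → |z u.toNNReal| ≤ |K| := fun u hu hv =>
    (hK _ ⟨NNReal.le_toNNReal_of_coe_le hu, Real.toNNReal_le_iff_le_coe.2 hv⟩).trans (le_abs_self K)
  have hlip : ∀ u v : ℝ, (a : ℝ) ≤ u → u ≤ v → v ≤ b → v - u ≤ 1 →
      |y v.toNNReal - y u.toNNReal| ≤ (|K| + |C|) * (v - u) := by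
    intro u v hu huv hv h1
    have hd0 : 0 ≤ v - u := sub_nonneg.2 huv
    have h2 := h' u v hu huv hv h1
    have h3 : |(v - u) * z u.toNNReal| ≤ (v - u) * |K| := by
      rw [abs_mul, abs_of_nonneg hd0]
      exact mul_le_mul_of_nonneg_left (hK' u hu (huv.trans hv)) hd0
    have h4 : √(v - u) ≤ 1 := Real.sqrt_le_one.2 h1
    have h5 : |C| * ((v - u) * √(v - u)) ≤ |C| * ((v - u) * 1) := by gcongr
    rw [abs_le] at h2 h3 ⊢
    constructor <;> linarith
  have hcont : ContinuousOn (fun v : ℝ => y v.toNNReal) (Set.Icc (a : ℝ) b) := by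
    rw [Metric.continuousOn_iff]
    intro u hu ε hε
    have hL : 0 < |K| + |C| + 1 := by positivity
    refine ⟨min 1 (ε / (|K| + |C| + 1)), by positivity, fun v hv hd => ?_⟩
    rw [lt_min_iff, Real.dist_eq, lt_div_iff₀ hL] at hd
    have hle : |y v.toNNReal - y u.toNNReal| ≤ (|K| + |C|) * |v - u| := by
      rcases le_total u v with huv | huv
      · have := hlip u v hu.1 huv hv.2 ((le_abs_self _).trans hd.1.le)
        rwa [abs_of_nonneg (sub_nonneg.2 huv)]
      · have := hlip v u hv.1 huv hu.2 (by
          rw [abs_sub_comm] at hd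
          exact (le_abs_self _).trans hd.1.le)
        rw [abs_sub_comm, abs_sub_comm v u, abs_of_nonneg (sub_nonneg.2 huv)]
        exact this
    rw [Real.dist_eq]
    nlinarith [abs_nonneg (v - u)]
  have hder : ∀ u ∈ Set.Ioo (a : ℝ) b,
      HasDerivWithinAt (fun v : ℝ => y v.toNNReal) (z u.toNNReal) (Set.Ioi u) u := by
    intro u hu
    rw [hasDerivWithinAt_iff_tendsto_slope' (by simp), tendsto_iff_norm_sub_tendsto_zero]
    have hb0 : Tendsto (fun v : ℝ => |C| * √(v - u)) (𝓝[>] u) (𝓝 0) := by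
      have : Continuous fun v : ℝ => |C| * √(v - u) := by fun_prop
      simpa using (this.tendsto u).mono_left nhdsWithin_le_nhds
    refine squeeze_zero' (Eventually.of_forall fun _ => norm_nonneg _) ?_ hb0
    have h1 : ∀ᶠ v in 𝓝[>] u, v < min (b : ℝ) (u + 1) :=
      mem_nhdsWithin_of_mem_nhds (Iio_mem_nhds (lt_min hu.2 (lt_add_one u)))
    filter_upwards [h1, self_mem_nhdsWithin] with v hv huv
    have huv' : (0 : ℝ) < v - u := sub_pos.2 huv
    rw [lt_min_iff] at hv
    have h2 := h' u v hu.1.le huv.le hv.1.le (by linarith)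
    rw [slope_def_field, Real.norm_eq_abs]
    have h3 : (y v.toNNReal - y u.toNNReal) / (v - u) - z u.toNNReal =
        (y v.toNNReal - y u.toNNReal - (v - u) * z u.toNNReal) / (v - u) := by
      field_simp
    rw [h3, abs_div, abs_of_pos huv', div_le_iff₀ huv']
    linarith
  have hzi : IntervalIntegrable (fun v : ℝ => z v.toNNReal) volume a b :=
    Continuous.intervalIntegrable (by fun_prop) _ _
  have := intervalIntegral.integral_eq_sub_of_hasDeriv_right_of_le hab' hcont hder hzi
  simpa using this.symm

variable {N : ℕ}

/-- Integration over time of a family of functions does not lose derivatives. -/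
theorem bddBy_integral {g : ℝ≥0 → StateSpace N → ℝ}
    (hg : UnifCb fun v : Set.Iic b => g v) (hgc : ∀ x, Continuous fun v => g v x) :
    CbFun (fun x => ∫ v in (0 : ℝ)..b, g v.toNNReal x) ∧
      ∀ k M, (∀ v ≤ b, BddBy k M (g v)) →
        BddBy k (b * M) fun x => ∫ v in (0 : ℝ)..b, g v.toNNReal x := by
  set f : ℕ → StateSpace N → ℝ := fun n x =>
    ∑ k ∈ Finset.range n, ((b : ℝ) / n) * g (grid 0 b n k) x with hf
  have hmem : ∀ {n k}, k ∈ Finset.range n → grid 0 b n k ≤ b := fun {n k} hk =>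
    (grid_mem zero_le (Finset.mem_range.1 hk).le).2
  have hbdd : ∀ k M, (∀ v ≤ b, BddBy k M (g v)) → ∀ n, BddBy k (b * M) (f n) := by
    intro k M hM n
    have hM0 : 0 ≤ M := (hM 0 zero_le).nonneg
    have hsmooth : ∀ m ≤ n, BddBy k ((m : ℝ) * ((b : ℝ) / n * M)) (fun x =>
        ∑ k ∈ Finset.range m, ((b : ℝ) / n) * g (grid 0 b n k) x) ∧
        ContDiff ℝ (⊤ : ℕ∞) (fun x =>
        ∑ k ∈ Finset.range m, ((b : ℝ) / n) * g (grid 0 b n k) x) := by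
      intro m
      induction m with
      | zero =>
        intro _
        simp only [Finset.range_zero, Finset.sum_empty, Nat.cast_zero, zero_mul]
        exact ⟨by simpa using BddBy.const (N := N) k 0, contDiff_const⟩
      | succ m ih =>
        intro hm
        obtain ⟨h1, h2⟩ := ih (by omega)
        have hle := hmem (Finset.mem_range.2 hm)
        have h3 := hg.1 ⟨_, hle⟩
        have h4 := (hM _ hle).const_mul h3 ((b : ℝ) / n)
        rw [abs_of_nonneg (by positivity)] at h4
        simp only [Finset.sum_range_succ]
        refine ⟨(h1.add h2 (contDiff_const.mul h3) h4).mono (le_of_eq ?_),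
          h2.add (contDiff_const.mul h3)⟩
        push_cast
        ring
    rcases Nat.eq_zero_or_pos n with rfl | hn
    · have := (hsmooth 0 le_rfl).1
      exact this.mono (by simp; positivity)
    · refine ((hsmooth n le_rfl).1).mono (le_of_eq ?_)
      have : (n : ℝ) ≠ 0 := by positivity
      field_simp
  have hfU : UnifCb f := by
    refine ⟨fun n => ContDiff.sum fun k hk => contDiff_const.mul (hg.1 ⟨_, hmem hk⟩), fun k => ?_⟩
    obtain ⟨M, hM⟩ := hg.2 k
    exact ⟨b * M, hbdd k M fun v hv => hM ⟨v, hv⟩⟩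
  have hlim : ∀ x, Tendsto (fun n => f n x) atTop (𝓝 (∫ v in (0 : ℝ)..b, g v.toNNReal x)) :=
    fun x => by simpa using tendsto_riemann_sum (hgc x) (zero_le (a := b))
  refine ⟨⟨(hfU.lim hlim).1, fun k => ?_⟩, fun k M hM => hfU.bddBy_lim hlim (hbdd k M hM)⟩
  obtain ⟨M, hM⟩ := hfU.2 k
  exact ⟨M, hfU.bddBy_lim hlim hM⟩

end HalfLine

/-! ### Consistency of the averaging scheme -/

section Scheme

variable {N d : ℕ} {β : Fin N → StateSpace N → ℝ} {σ : Fin d → Fin N → StateSpace N → ℝ} {K : ℝ}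

/-- The directions of the scheme: `±√(d+1) σᵢ`, together with two vanishing directions that keep
the number of directions positive, also for `d = 0`. They average to `0`, and their covariance is
`∑ᵢ σᵢ σᵢᵀ`: the factor `√(d+1)` makes up for the uniform weights. -/
noncomputable def schemeDir (σ : Fin d → Fin N → StateSpace N → ℝ) :
    Option (Fin d) × Bool → Fin N → StateSpace N → ℝ
  | (none, _) => fun _ _ => 0
  | (some i, true) => fun l y => √(d + 1) * σ i l y
  | (some i, false) => fun l y => -√(d + 1) * σ i l y

/-- The weights of the scheme: the uniform distribution on the `2 (d + 1)` directions. -/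
noncomputable def schemeWeight (d : ℕ) : Option (Fin d) × Bool → ℝ := fun _ => 1 / (2 * (d + 1))

theorem schemeWeight_nonneg (j : Option (Fin d) × Bool) : 0 ≤ schemeWeight d j := by
  unfold schemeWeight; positivity

theorem sum_schemeWeight : ∑ j, schemeWeight d j = 1 := by
  have : (d : ℝ) + 1 ≠ 0 := by positivity
  simp [schemeWeight, Fintype.card_option]
  field_simp

theorem sum_schemeWeight_mul_schemeDir (l : Fin N) (y : StateSpace N) :
    ∑ j, schemeWeight d j * schemeDir σ j l y = 0 := by
  simp [Fintype.sum_prod_type, Fintype.sum_option, schemeWeight, schemeDir]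

theorem sum_schemeWeight_mul_schemeDir_mul (l m : Fin N) (y : StateSpace N) :
    ∑ j, schemeWeight d j * (schemeDir σ j l y * schemeDir σ j m y) =
      ∑ i, σ i l y * σ i m y := by
  have h0 : (d : ℝ) + 1 ≠ 0 := by positivity
  have h1 : √((d : ℝ) + 1) * √((d : ℝ) + 1) = d + 1 := Real.mul_self_sqrt (by positivity)
  have h2 : ∀ i, 1 / (2 * ((d : ℝ) + 1)) * (√(d + 1) * σ i l y * (√(d + 1) * σ i m y)) +
      1 / (2 * ((d : ℝ) + 1)) * (-√(d + 1) * σ i l y * (-√(d + 1) * σ i m y)) =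
      σ i l y * σ i m y := fun i => by
    have : ∀ c u v : ℝ, c * (√((d : ℝ) + 1) * u * (√(d + 1) * v)) +
        c * (-√((d : ℝ) + 1) * u * (-√(d + 1) * v)) =
        2 * c * (√((d : ℝ) + 1) * √(d + 1)) * (u * v) := fun c u v => by ring
    rw [this, h1]
    field_simp
  simp only [Fintype.sum_prod_type, Fintype.sum_option, schemeWeight, schemeDir, Fintype.sum_bool,
    mul_zero, add_zero, zero_add, h2]

theorem cbFun_schemeDir (hσ : ∀ i l, CbFun (σ i l)) (j : Option (Fin d) × Bool) (l : Fin N) :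
    CbFun (schemeDir σ j l) := by
  obtain ⟨_ | i, _ | _⟩ := j
  · exact CbFun.const 0
  · exact CbFun.const 0
  · exact (hσ i l).const_mul _
  · exact (hσ i l).const_mul _

/-- One step of the scheme, of time length `ε²`, has the same expansion of first order in time as
the diffusion. -/
theorem exists_stepOp_expansion (hc : CoeffBound K β σ) :
    ∃ C : ℝ, 0 ≤ C ∧ ∀ ε : ℝ, 0 < ε → ε ≤ 1 → ∀ f : StateSpace N → ℝ,
      ContDiff ℝ (⊤ : ℕ∞) f → ∀ M, BddBy 3 M f → ∀ y,
      |stepOp (schemeDir σ) β (schemeWeight d) ε f y - f y - ε ^ 2 * diffusionGen β σ f y| ≤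
        C * M * ε ^ 3 := by
  have hK := hc.nonneg
  set L : ℝ := N * (√(d + 1) * K) with hL
  set L' : ℝ := N * K with hL'
  refine ⟨8 * L ^ 3 + 9 * L' ^ 2 + L ^ 2 + L' ^ 2, by positivity, fun ε hε hε1 f hf M hM y => ?_⟩
  have hM0 := hM.nonneg
  set p := schemeWeight d with hp
  set V := schemeDir σ with hV
  set z : Option (Fin d) × Bool → StateSpace N := fun j => WithLp.toLp 2 fun l => ε * V j l y
    with hz
  set ρ : StateSpace N := WithLp.toLp 2 fun l => ε ^ 2 * β l y with hρ
  have hmap : ∀ j, stepMap V β ε j y = y + (z j + ρ) := fun j => by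
    simp only [stepMap, hz, hρ]
    congr 1
  have hVb : ∀ j l, |V j l y| ≤ √(d + 1) * K := by
    have hσ := fun i l => (hc.diff i l).abs_le y
    rintro ⟨_ | i, _ | _⟩ l
    · simp only [hV, schemeDir, abs_zero]; positivity
    · simp only [hV, schemeDir, abs_zero]; positivity
    · simp only [hV, schemeDir, abs_mul, abs_neg, abs_of_nonneg (Real.sqrt_nonneg _)]
      gcongr
      exact hσ i l
    · simp only [hV, schemeDir, abs_mul, abs_of_nonneg (Real.sqrt_nonneg _)]
      gcongr
      exact hσ i l
  have hlz : ∀ j, l1 (z j) ≤ ε * L := fun j => by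
    have h1 : ∀ l, |z j l| ≤ ε * (√(d + 1) * K) := fun l => by
      simp only [hz, abs_mul, abs_of_pos hε]
      gcongr
      exact hVb j l
    have := Finset.sum_le_card_nsmul Finset.univ _ _ fun l _ => h1 l
    simp only [Finset.card_univ, Fintype.card_fin, nsmul_eq_mul] at this
    refine this.trans (le_of_eq ?_)
    ring
  have hlρ : l1 ρ ≤ ε ^ 2 * L' := by
    have h1 : ∀ l, |ρ l| ≤ ε ^ 2 * K := fun l => by
      simp only [hρ, abs_mul, abs_of_pos (pow_pos hε 2)]
      gcongr
      exact (hc.drift l).abs_le y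
    have := Finset.sum_le_card_nsmul Finset.univ _ _ fun l _ => h1 l
    simp only [Finset.card_univ, Fintype.card_fin, nsmul_eq_mul] at this
    refine this.trans (le_of_eq ?_)
    ring
  set E : Option (Fin d) × Bool → ℝ := fun j => f (y + (z j + ρ)) - f y -
    ∑ l, (z j + ρ) l * pd l f y - 1 / 2 * ∑ l, ∑ m, pd m (pd l f) y * (z j l * z j m) with hE
  have hEb : ∀ j, |E j| ≤ (8 * L ^ 3 + 9 * L' ^ 2 + L ^ 2 + L' ^ 2) * M * ε ^ 3 := fun j => by
    refine (taylor_remainder_le hf hM y _ _ _ rfl hε).trans ?_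
    have h1 : l1 (z j) ^ 3 ≤ (ε * L) ^ 3 := pow_le_pow_left₀ (l1_nonneg _) (hlz j) 3
    have h2 : l1 (z j) ^ 2 ≤ (ε * L) ^ 2 := pow_le_pow_left₀ (l1_nonneg _) (hlz j) 2
    have h3 : l1 ρ ^ 2 ≤ (ε ^ 2 * L') ^ 2 := pow_le_pow_left₀ (l1_nonneg _) hlρ 2
    have h4 : l1 ρ ^ 2 / ε ≤ ε ^ 3 * L' ^ 2 := by
      rw [div_le_iff₀ hε]
      exact h3.trans (le_of_eq (by ring))
    have h5 : l1 ρ ^ 2 ≤ ε ^ 3 * L' ^ 2 := by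
      refine h3.trans ?_
      have : ε ^ 4 ≤ ε ^ 3 := pow_le_pow_of_le_one hε.le hε1 (by norm_num)
      calc (ε ^ 2 * L') ^ 2 = ε ^ 4 * L' ^ 2 := by ring
        _ ≤ _ := by gcongr
    have h6 : ε * l1 (z j) ^ 2 ≤ ε * (ε * L) ^ 2 := by gcongr
    calc M * (8 * l1 (z j) ^ 3 + 9 * l1 ρ ^ 2 + ε * l1 (z j) ^ 2 + l1 ρ ^ 2 / ε)
        ≤ M * (8 * (ε * L) ^ 3 + 9 * (ε ^ 3 * L' ^ 2) + ε * (ε * L) ^ 2 + ε ^ 3 * L' ^ 2) := by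
          gcongr
      _ = _ := by ring
  have hp1 : ∑ j, p j = 1 := sum_schemeWeight
  have hsum : stepOp V β p ε f y - f y - ε ^ 2 * diffusionGen β σ f y = ∑ j, p j * E j := by
    have e1 : ∑ j, p j * ∑ l, (z j + ρ) l * pd l f y = ε ^ 2 * ∑ l, β l y * pd l f y := by
      simp only [Finset.mul_sum]
      rw [Finset.sum_comm]
      refine Finset.sum_congr rfl fun l _ => ?_
      have : ∀ j, p j * ((z j + ρ) l * pd l f y) =
          ε * pd l f y * (p j * V j l y) + ε ^ 2 * β l y * pd l f y * p j := fun j => by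
        simp only [PiLp.add_apply, hz, hρ]
        ring
      simp only [this, Finset.sum_add_distrib, ← Finset.mul_sum, hp1]
      rw [sum_schemeWeight_mul_schemeDir]
      ring
    have e2 : ∑ j, p j * ∑ l, ∑ m, pd m (pd l f) y * (z j l * z j m) =
        ε ^ 2 * ∑ l, ∑ m, (∑ i, σ i l y * σ i m y) * pd m (pd l f) y := by
      simp only [Finset.mul_sum]
      rw [Finset.sum_comm]
      refine Finset.sum_congr rfl fun l _ => ?_
      rw [Finset.sum_comm]
      refine Finset.sum_congr rfl fun m _ => ?_
      rw [← sum_schemeWeight_mul_schemeDir_mul, Finset.sum_mul, Finset.mul_sum]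
      refine Finset.sum_congr rfl fun j _ => ?_
      simp only [hz]
      ring
    simp only [hE, mul_sub, Finset.sum_sub_distrib, e1, mul_left_comm _ (1 / 2 : ℝ),
      ← Finset.mul_sum _ _ (1 / 2 : ℝ), e2, ← Finset.sum_mul, hp1, stepOp, hmap, diffusionGen]
    ring
  rw [hsum]
  calc |∑ j, p j * E j| ≤ ∑ j, p j * |E j| := by
        refine (Finset.abs_sum_le_sum_abs _ _).trans (le_of_eq ?_)
        exact Finset.sum_congr rfl fun j _ => by
          rw [abs_mul, abs_of_nonneg (schemeWeight_nonneg j)]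
    _ ≤ ∑ j, p j * ((8 * L ^ 3 + 9 * L' ^ 2 + L ^ 2 + L' ^ 2) * M * ε ^ 3) :=
        Finset.sum_le_sum fun j _ =>
          mul_le_mul_of_nonneg_left (hEb j) (schemeWeight_nonneg j)
    _ = _ := by rw [← Finset.sum_mul, hp1, one_mul]

end Scheme

/-! ### The scheme compared with the diffusion -/

section Comparison

variable {Ω : Type*} {mΩ : MeasurableSpace Ω} {μ : Measure Ω} {𝓕 : Filtration ℝ≥0 mΩ}
  {N d : ℕ} {β : Fin N → StateSpace N → ℝ} {σ : Fin d → Fin N → StateSpace N → ℝ}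
  {B : Fin d → ℝ≥0 → Ω → ℝ} {K : ℝ} [IsProbabilityMeasure μ]

/-- `n` steps of the scheme, each of time length `δ` and hence of spatial size `√δ`. -/
noncomputable def scheme (β : Fin N → StateSpace N → ℝ) (σ : Fin d → Fin N → StateSpace N → ℝ)
    (δ : ℝ≥0) (n : ℕ) (f : StateSpace N → ℝ) : StateSpace N → ℝ :=
  stepIter (schemeDir σ) β (schemeWeight d) (List.replicate n (√δ)) f

theorem exists_bddBy_scheme (hσ : ∀ i l, CbFun (σ i l)) (hβ : ∀ l, CbFun (β l)) (k : ℕ) (T : ℝ) :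
    ∃ C : ℝ, 0 ≤ C ∧ ∀ (δ : ℝ≥0) (n : ℕ), δ ≤ 1 → n * (δ : ℝ) ≤ T → ∀ f : StateSpace N → ℝ,
      ContDiff ℝ (⊤ : ℕ∞) f → ∀ M, BddBy k M f → BddBy k (C * M) (scheme β σ δ n f) := by
  obtain ⟨C, hC, h⟩ := exists_bddBy_stepIter (V := schemeDir σ) (b := β) schemeWeight_nonneg
    sum_schemeWeight (cbFun_schemeDir hσ) hβ
    (fun l x => sum_schemeWeight_mul_schemeDir l x) k T
  refine ⟨C, hC, fun δ n hδ hn f hf M hM => h _ (fun ε hε => ?_) ?_ f hf M hM⟩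
  · rw [List.eq_of_mem_replicate hε]
    exact ⟨Real.sqrt_nonneg _, Real.sqrt_le_one.2 (by exact_mod_cast hδ)⟩
  · simpa using hn

theorem contDiff_scheme (hσ : ∀ i l, CbFun (σ i l)) (hβ : ∀ l, CbFun (β l)) (δ : ℝ≥0) (n : ℕ)
    {f : StateSpace N → ℝ} (hf : ContDiff ℝ (⊤ : ℕ∞) f) :
    ContDiff ℝ (⊤ : ℕ∞) (scheme β σ δ n f) :=
  contDiff_stepIter (cbFun_schemeDir hσ) hβ _ hf

/-- The scheme approximates the expectations of the diffusion. The errors of the `n` steps add up,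
since the scheme is stable in `C³`. -/
theorem exists_scheme_error (hB : IsFiltrationBrownian μ 𝓕 B) (hc : CoeffBound K β σ)
    (hσ : ∀ i l, CbFun (σ i l)) (hβ : ∀ l, CbFun (β l)) (T : ℝ) :
    ∃ C : ℝ, 0 ≤ C ∧ ∀ (x : StateSpace N) (X : ℝ≥0 → Ω → StateSpace N),
      IsDiffusion μ 𝓕 β σ B x X → ∀ (δ : ℝ≥0) (n : ℕ), δ ≤ 1 → n * (δ : ℝ) ≤ T →
      ∀ (r : ℝ≥0) (f : StateSpace N → ℝ), ContDiff ℝ (⊤ : ℕ∞) f → ∀ M, BddBy 3 M f →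
      |∫ ω, f (X (r + n * δ) ω) ∂μ - ∫ ω, scheme β σ δ n f (X r ω) ∂μ| ≤
        C * M * (n * (δ * √δ)) := by
  obtain ⟨C₁, hC₁, h₁⟩ := exists_one_step hB hc
  obtain ⟨C₂, hC₂, h₂⟩ := exists_stepOp_expansion hc
  obtain ⟨C₃, hC₃, h₃⟩ := exists_bddBy_scheme hσ hβ 3 T
  refine ⟨(C₁ + C₂) * C₃, by positivity, fun x X hX δ n hδ => ?_⟩
  induction n with
  | zero => intro _ r f _ M _; simp [scheme, stepIter]
  | succ n ih =>
    intro hn r f hf M hM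
    have hM0 := hM.nonneg
    have hn' : (n : ℝ) * δ ≤ T := by
      refine le_trans ?_ hn
      push_cast
      nlinarith [δ.coe_nonneg]
    have hi := ih hn' (r + δ) f hf M hM
    set F := scheme β σ δ n f with hF
    have hFs : ContDiff ℝ (⊤ : ℕ∞) F := contDiff_scheme hσ hβ δ n hf
    have hFb : BddBy 3 (C₃ * M) F := h₃ δ n hδ hn' f hf M hM
    have e1 : r + ((n + 1 : ℕ) : ℝ≥0) * δ = r + δ + n * δ := by push_cast; ring
    have e2 : scheme β σ δ (n + 1) f = stepOp (schemeDir σ) β (schemeWeight d) (√δ) F := rfl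
    rw [e1, e2]
    rcases eq_or_lt_of_le (zero_le (a := δ)) with rfl | hδ0
    · have e3 : stepOp (schemeDir σ) β (schemeWeight d) (√((0 : ℝ≥0) : ℝ)) F = F := by
        funext y
        have : ∀ j : Option (Fin d) × Bool, stepMap (schemeDir σ) β 0 j y = y := fun j => by
          ext l; simp [stepMap]
        simp [stepOp, this, ← Finset.sum_mul, sum_schemeWeight]
      rw [e3]
      simpa using hi
    have hs0 : 0 < √(δ : ℝ) := Real.sqrt_pos.2 (by exact_mod_cast hδ0)
    have hs1 : √(δ : ℝ) ≤ 1 := Real.sqrt_le_one.2 (by exact_mod_cast hδ)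
    have hone := h₁ x X hX r δ hδ F hFs _ hFb
    have hexp := h₂ (√δ) hs0 hs1 F hFs _ hFb
    rw [Real.sq_sqrt δ.coe_nonneg] at hexp
    have hcube : √(δ : ℝ) ^ 3 = δ * √δ := by
      rw [pow_succ, Real.sq_sqrt δ.coe_nonneg]
    have hFi : Integrable (fun ω => F (X r ω)) μ :=
      memLp_one_iff_integrable.1 (memLp_comp_of_bound (hX.aesm r) hFs.continuous hFb.abs_le 1)
    have hQc : Continuous (stepOp (schemeDir σ) β (schemeWeight d) (√δ) F) :=
      (contDiff_stepOp (cbFun_schemeDir hσ) hβ _ hFs).continuous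
    have hQi : Integrable (fun ω => stepOp (schemeDir σ) β (schemeWeight d) (√δ) F (X r ω)) μ :=
      memLp_one_iff_integrable.1 (memLp_comp_of_bound (hX.aesm r) hQc
        (h₃ δ (n + 1) hδ hn f hf M hM).abs_le 1)
    have hAb : ∀ y, |δ * diffusionGen β σ F y| ≤
        |stepOp (schemeDir σ) β (schemeWeight d) (√δ) F y - F y| + C₂ * (C₃ * M) * √δ ^ 3 :=
      fun y => by
        have := hexp y
        have h4 := abs_sub_abs_le_abs_sub (δ * diffusionGen β σ F y)
          (stepOp (schemeDir σ) β (schemeWeight d) (√δ) F y - F y)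
        rw [abs_sub_comm (δ * diffusionGen β σ F y)] at h4
        linarith
    have hAc : Continuous (diffusionGen β σ F) := by
      unfold diffusionGen
      have h5 : ∀ l, Continuous (pd l F) := fun l => (contDiff_pd hFs l).continuous
      have h6 : ∀ l m, Continuous (pd m (pd l F)) := fun l m =>
        (contDiff_pd (contDiff_pd hFs l) m).continuous
      have h7 : ∀ l, Continuous (β l) := fun l => (hβ l).1.continuous
      have h8 : ∀ i l, Continuous (σ i l) := fun i l => (hσ i l).1.continuous
      fun_prop
    have hAi : Integrable (fun ω => δ * diffusionGen β σ F (X r ω)) μ := by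
      refine ((hQi.sub hFi).abs.add (integrable_const (C₂ * (C₃ * M) * √δ ^ 3))).mono'
        ((continuous_const.mul hAc).comp_aestronglyMeasurable (hX.aesm r))
        (ae_of_all _ fun ω => hAb _)
    have hdiff : |∫ ω, stepOp (schemeDir σ) β (schemeWeight d) (√δ) F (X r ω) ∂μ -
        ∫ ω, F (X r ω) ∂μ - δ * ∫ ω, diffusionGen β σ F (X r ω) ∂μ| ≤
        C₂ * (C₃ * M) * √δ ^ 3 := by
      rw [← integral_const_mul, ← integral_sub hQi hFi, ← integral_sub _ hAi]
      · rw [← Real.norm_eq_abs]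
        refine (norm_integral_le_of_norm_le_const (C := C₂ * (C₃ * M) * √δ ^ 3)
          (ae_of_all _ fun ω => ?_)).trans (by simp)
        rw [Real.norm_eq_abs]
        exact hexp (X r ω)
      · exact hQi.sub hFi
    rw [hcube] at hdiff
    push_cast
    rw [abs_le] at hi hone hdiff ⊢
    constructor <;> nlinarith

end Comparison

/-! ### Regularity of the semigroup -/

section Semigroup

variable {N d : ℕ}

/-- A semigroup of operators on `C_b^∞` that is locally bounded in every `C^k`-seminorm, with
generator `A` of second order. The field `dynkin` is the Kolmogorov equation in integrated form. -/
structure CbSemigroup (P : ℝ≥0 → FunOp N) (A : FunOp N) : Prop where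
  cb : ∀ {φ}, CbFun φ → ∀ t, CbFun (P t φ)
  bdd : ∀ (k : ℕ) (T : ℝ≥0), ∃ C : ℝ, 0 ≤ C ∧ ∀ t ≤ T, ∀ φ M, CbFun φ → BddBy k M φ →
    BddBy k (C * M) (P t φ)
  add : ∀ {φ ψ}, CbFun φ → CbFun ψ → ∀ t, P t (fun y => φ y + ψ y) = fun y => P t φ y + P t ψ y
  smul : ∀ (c : ℝ) (φ t), P t (fun y => c * φ y) = fun y => c * P t φ y
  zero : ∀ φ, P 0 φ = φ
  semigroup : ∀ {φ}, CbFun φ → ∀ s t, P (s + t) φ = P s (P t φ)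
  gen_cb : ∀ {φ}, CbFun φ → CbFun (A φ)
  gen_bdd : ∀ k : ℕ, ∃ C : ℝ, 0 ≤ C ∧ ∀ φ M, CbFun φ → BddBy (k + 2) M φ → BddBy k (C * M) (A φ)
  gen_cont : ∀ {φ}, CbFun φ → ∀ x, Continuous fun t => P t φ x
  dynkin : ∀ {φ}, CbFun φ → ∀ x (t : ℝ≥0), P t φ x - φ x =
    ∫ v in (0 : ℝ)..t, P v.toNNReal (A φ) x

variable {β : Fin N → StateSpace N → ℝ} {σ : Fin d → Fin N → StateSpace N → ℝ}

theorem cbFun_diffusionGen (hβ : ∀ l, CbFun (β l)) (hσ : ∀ i l, CbFun (σ i l))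
    {φ : StateSpace N → ℝ} (hφ : CbFun φ) : CbFun (diffusionGen β σ φ) := by
  unfold diffusionGen
  refine (CbFun.sum fun l _ => (hβ l).mul (hφ.pderiv l)).add (CbFun.const_mul ?_ _)
  exact CbFun.sum fun l _ => CbFun.sum fun m _ =>
    (CbFun.sum fun i _ => (hσ i l).mul (hσ i m)).mul ((hφ.pderiv l).pderiv m)

theorem BddBy.fin_sum {ι : Type*} (s : Finset ι) {k : ℕ} {M : ℝ} {f : ι → StateSpace N → ℝ}
    (hf : ∀ i, ContDiff ℝ (⊤ : ℕ∞) (f i)) (h : ∀ i, BddBy k M (f i)) :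
    BddBy k (s.card * M) fun x => ∑ i ∈ s, f i x := by
  classical
  induction s using Finset.induction_on with
  | empty => simpa using BddBy.const (N := N) k 0
  | insert a s ha ih =>
    simp only [Finset.sum_insert ha, Finset.card_insert_of_notMem ha]
    refine ((h a).add (hf a) (ContDiff.sum fun i _ => hf i) ih).mono (le_of_eq ?_)
    push_cast
    ring

theorem exists_bddBy_diffusionGen (hβ : ∀ l, CbFun (β l)) (hσ : ∀ i l, CbFun (σ i l)) (k : ℕ) :
    ∃ C : ℝ, 0 ≤ C ∧ ∀ φ M, CbFun φ → BddBy (k + 2) M φ → BddBy k (C * M) (diffusionGen β σ φ) := by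
  choose b hb using fun l => (hβ l).2 k
  have hσσ : ∀ l m, CbFun fun y => ∑ i, σ i l y * σ i m y := fun l m =>
    CbFun.sum fun i _ => (hσ i l).mul (hσ i m)
  choose q hq using fun l m => (hσσ l m).2 k
  have hb0 : ∀ l, 0 ≤ b l := fun l => (hb l).nonneg
  have hq0 : ∀ l m, 0 ≤ q l m := fun l m => (hq l m).nonneg
  set S : ℝ := ∑ l, b l + ∑ l, ∑ m, q l m with hS
  have hS0 : 0 ≤ S := add_nonneg (Finset.sum_nonneg fun l _ => hb0 l)
    (Finset.sum_nonneg fun l _ => Finset.sum_nonneg fun m _ => hq0 l m)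
  have hbS : ∀ l, b l ≤ S := fun l =>
    (Finset.single_le_sum (fun l _ => hb0 l) (Finset.mem_univ l)).trans
      (le_add_of_nonneg_right (Finset.sum_nonneg fun l _ => Finset.sum_nonneg fun m _ => hq0 l m))
  have hqS : ∀ l m, q l m ≤ S := fun l m =>
    ((Finset.single_le_sum (f := fun m => q l m) (fun m _ => hq0 l m) (Finset.mem_univ m)).trans
      (Finset.single_le_sum (f := fun l => ∑ m, q l m)
        (fun l _ => Finset.sum_nonneg fun m _ => hq0 l m)
        (Finset.mem_univ l))).trans
      (le_add_of_nonneg_left (Finset.sum_nonneg fun l _ => hb0 l))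
  refine ⟨N * (2 ^ k * S) + 1 / 2 * (N * (N * (2 ^ k * S))), by positivity,
    fun φ M hφ hM => ?_⟩
  have hM0 := hM.nonneg
  have h1 : ∀ l, BddBy k (2 ^ k * (S * M)) fun y => β l y * pd l φ y := fun l =>
    BddBy.mul (hβ l).1 (hφ.pderiv l).1 ((hb l).mono (hbS l)) ((hM.2 l).of_le (by omega))
  have h2 : ∀ l m, BddBy k (2 ^ k * (S * M))
      fun y => (∑ i, σ i l y * σ i m y) * pd m (pd l φ) y := fun l m =>
    BddBy.mul (hσσ l m).1 ((hφ.pderiv l).pderiv m).1 ((hq l m).mono (hqS l m)) ((hM.2 l).2 m)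
  have c1 : ∀ l, ContDiff ℝ (⊤ : ℕ∞) fun y => β l y * pd l φ y := fun l =>
    ((hβ l).mul (hφ.pderiv l)).1
  have c2 : ∀ l m, ContDiff ℝ (⊤ : ℕ∞) fun y => (∑ i, σ i l y * σ i m y) * pd m (pd l φ) y :=
    fun l m => ((hσσ l m).mul ((hφ.pderiv l).pderiv m)).1
  have h3 := BddBy.fin_sum Finset.univ c1 h1
  have c3 := fun l => ContDiff.sum (s := Finset.univ) fun m _ => c2 l m
  have h4 := BddBy.fin_sum Finset.univ c3 fun l => BddBy.fin_sum Finset.univ (c2 l) (h2 l)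
  have c4 := ContDiff.sum (s := Finset.univ) fun l _ => c3 l
  have h5 := h4.const_mul c4 (1 / 2)
  have h6 := h3.add (ContDiff.sum fun l _ => c1 l) (contDiff_const.mul c4) h5
  refine h6.mono (le_of_eq ?_)
  simp only [Finset.card_univ, Fintype.card_fin]
  rw [abs_of_pos (by norm_num : (0 : ℝ) < 1 / 2)]
  ring

variable {Ω : Type*} {mΩ : MeasurableSpace Ω} {μ : Measure Ω} {𝓕 : Filtration ℝ≥0 mΩ}
  {B : Fin d → ℝ≥0 → Ω → ℝ} {K : ℝ} [IsProbabilityMeasure μ]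

theorem CbFun.coeffBound (hβ : ∀ l, CbFun (β l)) (hσ : ∀ i l, CbFun (σ i l)) :
    ∃ K, CoeffBound K β σ := by
  choose b hb using fun l => (hβ l).2 1
  choose q hq using fun i l => (hσ i l).2 1
  have hb0 : ∀ l, 0 ≤ b l := fun l => (hb l).nonneg
  have hq0 : ∀ i l, 0 ≤ q i l := fun i l => (hq i l).nonneg
  refine ⟨∑ l, b l + ∑ i, ∑ l, q i l, fun l => (hβ l).1, fun l => (hb l).mono ?_,
    fun i l => (hσ i l).1, fun i l => (hq i l).mono ?_, ?_⟩
  · exact (Finset.single_le_sum (fun l _ => hb0 l) (Finset.mem_univ l)).trans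
      (le_add_of_nonneg_right (Finset.sum_nonneg fun i _ => Finset.sum_nonneg fun l _ => hq0 i l))
  · exact ((Finset.single_le_sum (f := fun l => q i l) (fun l _ => hq0 i l)
      (Finset.mem_univ l)).trans (Finset.single_le_sum (f := fun i => ∑ l, q i l)
        (fun i _ => Finset.sum_nonneg fun l _ => hq0 i l) (Finset.mem_univ i))).trans
      (le_add_of_nonneg_left (Finset.sum_nonneg fun l _ => hb0 l))
  · exact add_nonneg (Finset.sum_nonneg fun l _ => hb0 l)
      (Finset.sum_nonneg fun i _ => Finset.sum_nonneg fun l _ => hq0 i l)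

/-- The transition operators of a diffusion with `C_b^∞` coefficients form a semigroup on
`C_b^∞`. -/
theorem cbSemigroup_of_isDiffusion (hB : IsFiltrationBrownian μ 𝓕 B) (hβ : ∀ l, CbFun (β l))
    (hσ : ∀ i l, CbFun (σ i l)) {X : StateSpace N → ℝ≥0 → Ω → StateSpace N}
    (hX : ∀ x, IsDiffusion μ 𝓕 β σ B x (X x)) :
    CbSemigroup (signalSemigroup μ X) (diffusionGen β σ) := by
  obtain ⟨K, hc⟩ := CbFun.coeffBound hβ hσ
  have hint : ∀ {φ}, CbFun φ → ∀ x t, Integrable (fun ω => φ (X x t ω)) μ := fun {φ} hφ x t => by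
    obtain ⟨M, hM⟩ := hφ.2 0
    exact memLp_one_iff_integrable.1
      (memLp_comp_of_bound ((hX x).aesm t) hφ.1.continuous hM.abs_le 1)
  -- the time step of the scheme with `n` steps
  have hstep : ∀ t : ℝ≥0, ∀ n : ℕ, t ≤ n → n ≠ 0 → t / n ≤ 1 ∧ (n : ℝ≥0) * (t / n) = t := by
    intro t n ht hn
    have hn' : (n : ℝ≥0) ≠ 0 := by exact_mod_cast hn
    exact ⟨(div_le_one (by positivity)).2 ht, mul_div_cancel₀ t hn'⟩
  have herr0 : ∀ t : ℝ≥0, ∀ C : ℝ, Tendsto (fun n : ℕ =>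
      C * (n * (((t / n : ℝ≥0) : ℝ) * √((t / n : ℝ≥0) : ℝ)))) atTop (𝓝 0) := by
    intro t C
    have h1 : Tendsto (fun n : ℕ => C * ((t : ℝ) * √((t : ℝ) / n))) atTop (𝓝 0) := by
      have h2 : Tendsto (fun n : ℕ => √((t : ℝ) / n)) atTop (𝓝 0) := by
        simpa using (tendsto_const_div_atTop_nhds_zero_nat (t : ℝ)).sqrt
      simpa using (h2.const_mul (t : ℝ)).const_mul C
    refine h1.congr' ?_
    filter_upwards [eventually_ne_atTop 0] with n hn
    have : (n : ℝ) ≠ 0 := by exact_mod_cast hn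
    rw [NNReal.coe_div, NNReal.coe_natCast]
    field_simp
  -- convergence for an arbitrary initial time `r` is what the semigroup property needs
  have hconv : ∀ {φ}, CbFun φ → ∀ (x : StateSpace N) (r t : ℝ≥0),
      Tendsto (fun n : ℕ => ∫ ω, scheme β σ (t / n) n φ (X x r ω) ∂μ) atTop
        (𝓝 (∫ ω, φ (X x (r + t) ω) ∂μ)) := by
    intro φ hφ x r t
    obtain ⟨C, hC, h⟩ := exists_scheme_error hB hc hσ hβ t
    obtain ⟨M, hM⟩ := hφ.2 3
    rw [tendsto_iff_norm_sub_tendsto_zero]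
    refine squeeze_zero' (Eventually.of_forall fun _ => norm_nonneg _) ?_ (herr0 t (C * M))
    obtain ⟨n₀, hn₀⟩ := exists_nat_ge t
    filter_upwards [eventually_ge_atTop n₀, eventually_ne_atTop 0] with n hn hn0
    obtain ⟨h1, h2⟩ := hstep t n (hn₀.trans (by exact_mod_cast hn)) hn0
    have h3 := h x (X x) (hX x) (t / n) n h1 (by exact_mod_cast h2.le) r φ hφ.1 M hM
    rw [h2] at h3
    rw [norm_sub_rev]
    exact h3
  have hinit : ∀ (f : StateSpace N → ℝ) x, ∫ ω, f (X x 0 ω) ∂μ = f x := fun f x => by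
    have : (fun ω => f (X x 0 ω)) =ᵐ[μ] fun _ => f x := by
      filter_upwards [(hX x).init] with ω h
      rw [h]
    rw [integral_congr_ae this]
    simp
  have hlim : ∀ {φ}, CbFun φ → ∀ t x,
      Tendsto (fun n : ℕ => scheme β σ (t / n) n φ x) atTop (𝓝 (signalSemigroup μ X t φ x)) := by
    intro φ hφ t x
    have := hconv hφ x 0 t
    simp only [hinit, zero_add] at this
    exact this
  have hbdd : ∀ (k : ℕ) (T : ℝ≥0), ∃ C : ℝ, 0 ≤ C ∧ ∀ t ≤ T, ∀ n : ℕ, t ≤ n → n ≠ 0 →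
      ∀ φ, CbFun φ → ∀ M, BddBy k M φ → BddBy k (C * M) (scheme β σ (t / n) n φ) := by
    intro k T
    obtain ⟨C, hC, h⟩ := exists_bddBy_scheme hσ hβ k T
    refine ⟨C, hC, fun t ht n hn hn0 φ hφ M hM => ?_⟩
    obtain ⟨h1, h2⟩ := hstep t n hn hn0
    exact h _ n h1 (by exact_mod_cast h2.le.trans ht) φ hφ.1 M hM
  -- the bounds of the scheme hold as soon as its steps are at most `1`, hence the shift by `n₀`
  have hshift : ∀ {φ} (_ : CbFun φ) (t : ℝ≥0), ∃ n₀ : ℕ, UnifCb (fun n : ℕ =>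
      scheme β σ (t / (n + n₀ : ℕ)) (n + n₀) φ) ∧ ∀ n, t ≤ (n + n₀ : ℕ) ∧ n + n₀ ≠ 0 := by
    intro φ hφ t
    obtain ⟨n₀, hn₀⟩ := exists_nat_ge t
    have hn : ∀ n, t ≤ ((n + (n₀ + 1) : ℕ) : ℝ≥0) ∧ n + (n₀ + 1) ≠ 0 := fun n =>
      ⟨hn₀.trans (by exact_mod_cast (by omega : n₀ ≤ n + (n₀ + 1))), by omega⟩
    refine ⟨n₀ + 1, ⟨fun n => contDiff_scheme hσ hβ _ _ hφ.1, fun k => ?_⟩, hn⟩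
    obtain ⟨C, hC, h⟩ := hbdd k t
    obtain ⟨M, hM⟩ := hφ.2 k
    exact ⟨C * M, fun n => h t le_rfl _ (hn n).1 (hn n).2 φ hφ M hM⟩
  have hPb : ∀ (k : ℕ) (T : ℝ≥0), ∃ C : ℝ, 0 ≤ C ∧ ∀ t ≤ T, ∀ φ M, CbFun φ → BddBy k M φ →
      BddBy k (C * M) (signalSemigroup μ X t φ) := by
    intro k T
    obtain ⟨C, hC, h⟩ := hbdd k T
    refine ⟨C, hC, fun t ht φ M hφ hM => ?_⟩
    obtain ⟨n₀, hU, hn⟩ := hshift hφ t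
    exact hU.bddBy_lim (fun x => (hlim hφ t x).comp (tendsto_add_atTop_nat n₀)) fun n =>
      h t ht _ (hn n).1 (hn n).2 φ hφ M hM
  have hPcb : ∀ {φ}, CbFun φ → ∀ t, CbFun (signalSemigroup μ X t φ) := by
    intro φ hφ t
    obtain ⟨n₀, hU, hn⟩ := hshift hφ t
    refine ⟨(hU.lim fun x => (hlim hφ t x).comp (tendsto_add_atTop_nat n₀)).1, fun k => ?_⟩
    obtain ⟨C, hC, h⟩ := hPb k t
    obtain ⟨M, hM⟩ := hφ.2 k
    exact ⟨C * M, h t le_rfl φ M hφ hM⟩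
  have hcont : ∀ {φ}, CbFun φ → ∀ x, Continuous fun t => signalSemigroup μ X t φ x := by
    intro φ hφ x
    obtain ⟨M, hM⟩ := hφ.2 0
    refine continuous_of_dominated (bound := fun _ => M) (fun t => (hint hφ x t).1)
      (fun t => ae_of_all _ fun ω => hM.abs_le _) (integrable_const _) (ae_of_all _ fun ω => ?_)
    exact hφ.1.continuous.comp ((hX x).cont ω)
  refine ⟨hPcb, hPb, fun hφ hψ t => ?_, fun c φ t => ?_, fun φ => ?_, fun {φ} hφ s t => ?_,
    cbFun_diffusionGen hβ hσ, exists_bddBy_diffusionGen hβ hσ, hcont, fun {φ} hφ x t => ?_⟩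
  · funext x
    exact integral_add (hint hφ x t) (hint hψ x t)
  · funext x
    exact integral_const_mul _ _
  · funext x
    exact hinit φ x
  -- `P_{s+t} φ` and `P_s P_t φ` are limits of `E[(scheme φ)(X_s)]` with the steps taken over `t`
  · funext x
    have h1 := hconv hφ x s t
    refine tendsto_nhds_unique h1 ?_
    obtain ⟨n₀, hU, hn⟩ := hshift hφ t
    obtain ⟨M, hM⟩ := hU.2 0
    rw [← tendsto_add_atTop_iff_nat n₀]
    refine tendsto_integral_of_dominated_convergence (fun _ => M)
      (fun n => ((contDiff_scheme hσ hβ _ _ hφ.1).continuous.comp_aestronglyMeasurable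
        ((hX x).aesm s))) (integrable_const _) (fun n => ae_of_all _ fun ω => (hM n).abs_le _)
      (ae_of_all _ fun ω => ?_)
    exact (hlim hφ t (X x s ω)).comp (tendsto_add_atTop_nat n₀)
  -- the Kolmogorov equation, from the one-step estimate at all times
  · obtain ⟨C, hC, h⟩ := exists_one_step hB hc
    obtain ⟨M, hM⟩ := hφ.2 3
    have h2 := sub_eq_integral_of_increments (y := fun r => signalSemigroup μ X r φ x)
      (z := fun r => signalSemigroup μ X r (diffusionGen β σ φ) x) (a := 0) (b := t) zero_le
      (hcont (cbFun_diffusionGen hβ hσ hφ) x) (C := C * M) fun r δ _ _ hδ =>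
        h x (X x) (hX x) r δ hδ φ hφ.1 M hM
    have h0 : signalSemigroup μ X 0 φ x = φ x := hinit φ x
    simpa [h0] using h2

end Semigroup

/-! ### Operators on smooth functions -/

section CbOp

variable {N : ℕ}

/-- A linear operator on `C_b^∞` that is continuous with respect to the `C^k`-seminorms. -/
structure CbOp (T : FunOp N) : Prop where
  cb : ∀ {φ}, CbFun φ → CbFun (T φ)
  bdd : ∀ k : ℕ, ∃ (l : ℕ) (C : ℝ), 0 ≤ C ∧ ∀ φ M, CbFun φ → BddBy l M φ → BddBy k (C * M) (T φ)
  add : ∀ {φ ψ}, CbFun φ → CbFun ψ → T (fun y => φ y + ψ y) = fun y => T φ y + T ψ y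
  smul : ∀ (c : ℝ) {φ}, CbFun φ → T (fun y => c * φ y) = fun y => c * T φ y

namespace CbOp

variable {T S : FunOp N}

theorem sub (hT : CbOp T) {φ ψ : StateSpace N → ℝ} (hφ : CbFun φ) (hψ : CbFun ψ) :
    T (fun y => φ y - ψ y) = fun y => T φ y - T ψ y := by
  have h := hT.add hφ (hψ.const_mul (-1))
  rw [hT.smul (-1) hψ] at h
  simpa [sub_eq_add_neg] using h

theorem comp (hT : CbOp T) (hS : CbOp S) : CbOp (T ∘ S) where
  cb hφ := hT.cb (hS.cb hφ)
  bdd k := by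
    obtain ⟨l, C, hC, h⟩ := hT.bdd k
    obtain ⟨l', C', hC', h'⟩ := hS.bdd l
    refine ⟨l', C * C', by positivity, fun φ M hφ hM => ?_⟩
    rw [mul_assoc]
    exact h _ _ (hS.cb hφ) (h' φ M hφ hM)
  add hφ hψ := by
    simp only [Function.comp_apply, hS.add hφ hψ, hT.add (hS.cb hφ) (hS.cb hψ)]
  smul c φ hφ := by
    simp only [Function.comp_apply, hS.smul c hφ, hT.smul c (hS.cb hφ)]

theorem sum_op (hT : CbOp T) (hS : CbOp S) : CbOp fun φ y => T φ y + S φ y where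
  cb hφ := (hT.cb hφ).add (hS.cb hφ)
  bdd k := by
    obtain ⟨l, C, hC, h⟩ := hT.bdd k
    obtain ⟨l', C', hC', h'⟩ := hS.bdd k
    refine ⟨max l l', C + C', by positivity, fun φ M hφ hM => ?_⟩
    rw [add_mul]
    exact (h φ M hφ (hM.of_le (le_max_left _ _))).add (hT.cb hφ).1 (hS.cb hφ).1
      (h' φ M hφ (hM.of_le (le_max_right _ _)))
  add hφ hψ := by
    funext y
    rw [hT.add hφ hψ, hS.add hφ hψ]
    ring
  smul c φ hφ := by
    funext y
    rw [hT.smul c hφ, hS.smul c hφ]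
    ring

theorem id : CbOp (fun φ : StateSpace N → ℝ => φ) :=
  ⟨fun h => h, fun k => ⟨k, 1, zero_le_one, fun φ M _ hM => by rwa [one_mul]⟩,
    fun _ _ => rfl, fun _ _ _ => rfl⟩

theorem mul_left {g : StateSpace N → ℝ} (hg : CbFun g) : CbOp fun φ y => g y * φ y where
  cb hφ := hg.mul hφ
  bdd k := by
    obtain ⟨G, hG⟩ := hg.2 k
    have hG0 := hG.nonneg
    refine ⟨k, 2 ^ k * G, by positivity, fun φ M hφ hM => ?_⟩
    rw [mul_assoc]
    exact BddBy.mul hg.1 hφ.1 hG hM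
  add _ _ := by funext y; ring
  smul _ _ _ := by funext y; ring

theorem pderiv (i : Fin N) : CbOp (pd i) where
  cb hφ := hφ.pderiv i
  bdd k := ⟨k + 1, 1, zero_le_one, fun φ M _ hM => by rw [one_mul]; exact hM.2 i⟩
  add hφ hψ := pd_add hφ.1 hψ.1 i
  smul c _ hφ := pd_const_mul hφ.1 c i

theorem zero_op : CbOp (fun (_ : StateSpace N → ℝ) _ => 0) where
  cb _ := CbFun.const 0
  bdd k := ⟨0, 1, zero_le_one, fun φ M _ hM =>
    (BddBy.const k 0).mono (by simpa using hM.nonneg)⟩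
  add _ _ := by simp
  smul _ _ _ := by simp

theorem finset_sum {ι : Type*} (s : Finset ι) {T : ι → FunOp N} (hT : ∀ i ∈ s, CbOp (T i)) :
    CbOp fun φ y => ∑ i ∈ s, T i φ y := by
  classical
  induction s using Finset.induction_on with
  | empty => simpa using zero_op (N := N)
  | insert a s ha ih =>
    simp only [Finset.sum_insert ha]
    exact (hT a (Finset.mem_insert_self a s)).sum_op
      (ih fun i hi => hT i (Finset.mem_insert_of_mem hi))

theorem const_mul (hT : CbOp T) (c : ℝ) : CbOp fun φ y => c * T φ y :=
  (mul_left (CbFun.const c)).comp hT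

theorem vectorField {W : StateSpace N → StateSpace N} (hW : ∀ l, CbFun fun y => W y l) :
    CbOp (vectorFieldDeriv W) := by
  have : vectorFieldDeriv W = fun φ y => ∑ l, W y l * pd l φ y := by
    funext φ y
    rw [vectorFieldDeriv, fderiv_eq_sum_pd]
  rw [this]
  exact finset_sum _ fun l _ => (mul_left (hW l)).comp (pderiv l)

end CbOp

/-! ### The generator and the operators `Φ` and `Ψ` -/

section Generator

variable {d₁ d₂ : ℕ} {V₀ : StateSpace N → StateSpace N} {V : Fin d₁ → StateSpace N → StateSpace N}
  {h : Fin d₂ → StateSpace N → ℝ}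

theorem cbFun_itoDrift (hV₀ : IsCbSmooth V₀) (hV : ∀ i, IsCbSmooth (V i)) (l : Fin N) :
    CbFun fun y => itoDrift V₀ V y l := by
  have h1 : ∀ y, itoDrift V₀ V y l = V₀ y l +
      (1 / 2) * ∑ i, ∑ m, V i y m * pd m (fun z => V i z l) y := fun y => by
    simp only [itoDrift, PiLp.add_apply, PiLp.smul_apply, smul_eq_mul, WithLp.ofLp_sum,
      Finset.sum_apply]
    congr 2
    refine Finset.sum_congr rfl fun i _ => ?_
    rw [← fderiv_eq_sum_pd]
    have h2 := ((EuclideanSpace.proj l : StateSpace N →L[ℝ] ℝ).hasFDerivAt.comp y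
      ((hV i).1.differentiable (by simp) y).hasFDerivAt).fderiv
    have h3 : (fun z => V i z l) = (EuclideanSpace.proj l : StateSpace N →L[ℝ] ℝ) ∘ V i := rfl
    rw [h3, h2]
    rfl
  simp only [h1]
  exact (hV₀.cbFun_apply l).add (CbFun.const_mul (CbFun.sum fun i _ => CbFun.sum fun m _ =>
    ((hV i).cbFun_apply m).mul (((hV i).cbFun_apply l).pderiv m)) _)

theorem signalGenerator_eq_diffusionGen (hV : ∀ i, IsCbSmooth (V i)) {φ : StateSpace N → ℝ}
    (hφ : CbFun φ) : signalGenerator V₀ V φ =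
      diffusionGen (fun l y => itoDrift V₀ V y l) (fun i l y => V i y l) φ := by
  funext y
  have hvf : ∀ (W : StateSpace N → StateSpace N) (f : StateSpace N → ℝ),
      vectorFieldDeriv W f = fun y => ∑ l, W y l * pd l f y := fun W f => by
    funext y
    rw [vectorFieldDeriv, fderiv_eq_sum_pd]
  have hVl : ∀ i l, CbFun fun z => V i z l := fun i l => (hV i).cbFun_apply l
  have h2 : ∀ i, vectorFieldDeriv (V i) (vectorFieldDeriv (V i) φ) y =
      ∑ l, (∑ m, V i y m * pd m (fun z => V i z l) y) * pd l φ y +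
      ∑ l, ∑ m, (V i y l * V i y m) * pd m (pd l φ) y := fun i => by
    rw [hvf, hvf]
    have h3 : ∀ m, pd m (fun y => ∑ l, V i y l * pd l φ y) y =
        ∑ l, (pd m (fun z => V i z l) y * pd l φ y + V i y l * pd m (pd l φ) y) := fun m => by
      rw [pd_sum fun l _ => ((hVl i l).mul (hφ.pderiv l)).1]
      exact Finset.sum_congr rfl fun l _ => congrFun (pd_mul (hVl i l).1 (hφ.pderiv l).1 m) y
    simp only [h3, Finset.mul_sum, Finset.sum_mul]
    rw [Finset.sum_comm, ← Finset.sum_add_distrib]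
    refine Finset.sum_congr rfl fun l _ => ?_
    rw [← Finset.sum_add_distrib]
    exact Finset.sum_congr rfl fun m _ => by ring
  have hdrift : ∀ l, itoDrift V₀ V y l = V₀ y l +
      (1 / 2) * ∑ i, ∑ m, V i y m * pd m (fun z => V i z l) y := fun l => by
    simp only [itoDrift, PiLp.add_apply, PiLp.smul_apply, smul_eq_mul, WithLp.ofLp_sum,
      Finset.sum_apply]
    congr 2
    refine Finset.sum_congr rfl fun i _ => ?_
    rw [← fderiv_eq_sum_pd]
    have h2 := ((EuclideanSpace.proj l : StateSpace N →L[ℝ] ℝ).hasFDerivAt.comp y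
      ((hV i).1.differentiable (by simp) y).hasFDerivAt).fderiv
    have h3 : (fun z => V i z l) = (EuclideanSpace.proj l : StateSpace N →L[ℝ] ℝ) ∘ V i := rfl
    rw [h3, h2]
    rfl
  simp only [signalGenerator, h2, diffusionGen, hdrift]
  rw [hvf, Finset.sum_add_distrib]
  have e1 : ∑ i, ∑ l, (∑ m, V i y m * pd m (fun z => V i z l) y) * pd l φ y =
      ∑ l, (∑ i, ∑ m, V i y m * pd m (fun z => V i z l) y) * pd l φ y := by
    rw [Finset.sum_comm]
    exact Finset.sum_congr rfl fun l _ => (Finset.sum_mul _ _ _).symm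
  have e2 : ∑ i, ∑ l, ∑ m, (V i y l * V i y m) * pd m (pd l φ) y =
      ∑ l, ∑ m, (∑ i, V i y l * V i y m) * pd m (pd l φ) y := by
    rw [Finset.sum_comm]
    refine Finset.sum_congr rfl fun l _ => ?_
    rw [Finset.sum_comm]
    exact Finset.sum_congr rfl fun m _ => (Finset.sum_mul _ _ _).symm
  rw [e1, e2]
  simp only [add_mul, Finset.sum_add_distrib, mul_add, mul_assoc, ← Finset.mul_sum]
  ring

theorem cbOp_signalGenerator (hV₀ : IsCbSmooth V₀) (hV : ∀ i, IsCbSmooth (V i)) :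
    CbOp (signalGenerator V₀ V) := by
  have h1 := fun i => CbOp.vectorField (hV i).cbFun_apply
  exact (CbOp.vectorField hV₀.cbFun_apply).sum_op
    ((CbOp.finset_sum Finset.univ fun i _ => (h1 i).comp (h1 i)).const_mul _)

theorem vectorFieldDeriv_mul {W : StateSpace N → StateSpace N} {f g : StateSpace N → ℝ}
    (hf : CbFun f) (hg : CbFun g) : vectorFieldDeriv W (fun y => f y * g y) =
      fun y => vectorFieldDeriv W f y * g y + f y * vectorFieldDeriv W g y := by
  funext y
  have h := fderiv_fun_mul (smooth_differentiable hf.1 y) (smooth_differentiable hg.1 y)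
  simp only [vectorFieldDeriv, h]
  simp only [add_apply, smul_apply, smul_eq_mul]
  ring

/-- The carré du champ identity for the generator. -/
theorem signalGenerator_mul (hV : ∀ i, IsCbSmooth (V i))
    {f g : StateSpace N → ℝ} (hf : CbFun f) (hg : CbFun g) (y : StateSpace N) :
    signalGenerator V₀ V (fun y => f y * g y) y = f y * signalGenerator V₀ V g y +
      (signalGenerator V₀ V f y * g y +
        ∑ i, vectorFieldDeriv (V i) f y * vectorFieldDeriv (V i) g y) := by
  have h1 := fun i => CbOp.vectorField (hV i).cbFun_apply
  have h2 : ∀ i, vectorFieldDeriv (V i) (vectorFieldDeriv (V i) fun y => f y * g y) y =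
      vectorFieldDeriv (V i) (vectorFieldDeriv (V i) f) y * g y +
      2 * (vectorFieldDeriv (V i) f y * vectorFieldDeriv (V i) g y) +
      f y * vectorFieldDeriv (V i) (vectorFieldDeriv (V i) g) y := fun i => by
    rw [vectorFieldDeriv_mul hf hg, (h1 i).add (((h1 i).cb hf).mul hg) (hf.mul ((h1 i).cb hg)),
      vectorFieldDeriv_mul ((h1 i).cb hf) hg, vectorFieldDeriv_mul hf ((h1 i).cb hg)]
    ring
  simp only [signalGenerator, h2]
  rw [vectorFieldDeriv_mul (W := V₀) hf hg]
  simp only [Finset.sum_add_distrib, ← Finset.mul_sum, ← Finset.sum_mul]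
  ring

theorem cbFun_wordProd (hh : ∀ i, CbFun (h i)) (w : List (Fin d₂)) : CbFun (wordProd h w) := by
  induction w with
  | nil =>
    have : wordProd h [] = fun _ => 1 := by funext x; simp [wordProd]
    rw [this]
    exact CbFun.const 1
  | cons i w ih =>
    have : wordProd h (i :: w) = fun x => h i x * wordProd h w x := by
      funext x; simp [wordProd]
    rw [this]
    exact (hh i).mul ih

theorem cbOp_opPhi (hh : ∀ i, CbFun (h i)) (w : List (Fin d₂)) : CbOp (opPhi h w) :=
  CbOp.mul_left (cbFun_wordProd hh w)

theorem cbOp_opPsi (hV₀ : IsCbSmooth V₀) (hV : ∀ i, IsCbSmooth (V i)) (hh : ∀ i, CbFun (h i))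
    (w : List (Fin d₂)) : CbOp (opPsi V₀ V h w) := by
  have hw := cbFun_wordProd hh w
  have h1 := fun i => CbOp.vectorField (hV i).cbFun_apply
  exact (CbOp.mul_left ((cbOp_signalGenerator hV₀ hV).cb hw)).sum_op
    (CbOp.finset_sum _ fun i _ => (CbOp.mul_left ((h1 i).cb hw)).comp (h1 i))

theorem cbOp_of_mem_opGamma (hV₀ : IsCbSmooth V₀) (hV : ∀ i, IsCbSmooth (V i))
    (hh : ∀ i, CbFun (h i)) {w : List (Fin d₂)} {T : FunOp N} (hT : T ∈ opGamma V₀ V h w) :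
    CbOp T := by
  rcases hT with (rfl | rfl) | ⟨u, v, -, -, -, rfl⟩
  · exact cbOp_opPhi hh w
  · exact cbOp_opPsi hV₀ hV hh w
  · exact (cbOp_opPsi hV₀ hV hh u).comp (cbOp_opPhi hh v)

theorem opPhi_append (u v : List (Fin d₂)) (φ : StateSpace N → ℝ) :
    opPhi h u (opPhi h v φ) = opPhi h (u ++ v) φ := by
  funext x
  simp [opPhi, wordProd, mul_assoc]

/-- Multiplication by `h_v` on the right does not lead out of the sets `Γ`. -/
theorem comp_opPhi_mem_opGamma {u v : List (Fin d₂)} (hu : u ≠ []) (hv : v ≠ []) {T : FunOp N}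
    (hT : T ∈ opGamma V₀ V h u) : T ∘ opPhi h v ∈ opGamma V₀ V h (u ++ v) := by
  rcases hT with (rfl | rfl) | ⟨u', v', hu', hv', rfl, rfl⟩
  · refine Or.inl (Or.inl ?_)
    funext φ
    exact opPhi_append u v φ
  · exact Or.inr ⟨u, v, hu, hv, rfl, rfl⟩
  · refine Or.inr ⟨u', v' ++ v, hu', by simp [hv'], by simp, ?_⟩
    funext φ
    simp only [Function.comp_apply, opPhi_append]

end Generator

end CbOp

/-! ### Increments of the semigroup and the kernels -/

section Kernel

variable {N : ℕ} {P : ℝ≥0 → FunOp N} {A : FunOp N}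

theorem CbSemigroup.cbOp (hP : CbSemigroup P A) (t : ℝ≥0) : CbOp (P t) where
  cb hφ := hP.cb hφ t
  bdd k := by
    obtain ⟨C, hC, h⟩ := hP.bdd k t
    exact ⟨k, C, hC, fun φ M hφ hM => h t le_rfl φ M hφ hM⟩
  add hφ hψ := hP.add hφ hψ t
  smul c φ _ := hP.smul c φ t

theorem CbSemigroup.unifCb (hP : CbSemigroup P A) {φ : StateSpace N → ℝ} (hφ : CbFun φ) (T : ℝ≥0) :
    UnifCb fun v : Set.Iic T => P v φ := by
  refine ⟨fun v => (hP.cb hφ v).1, fun k => ?_⟩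
  obtain ⟨C, hC, h⟩ := hP.bdd k T
  obtain ⟨M, hM⟩ := hφ.2 k
  exact ⟨C * M, fun v => h v v.2 φ M hφ hM⟩

theorem CbSemigroup.sub_self_bdd (hP : CbSemigroup P A) (k : ℕ) : ∃ C : ℝ, 0 ≤ C ∧
    ∀ δ ≤ (1 : ℝ≥0), ∀ φ M, CbFun φ → BddBy (k + 2) M φ →
      BddBy k (C * M * δ) fun x => P δ φ x - φ x := by
  obtain ⟨C₁, hC₁, h₁⟩ := hP.bdd k 1
  obtain ⟨C₂, hC₂, h₂⟩ := hP.gen_bdd k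
  refine ⟨C₁ * C₂, by positivity, fun δ hδ φ M hφ hM => ?_⟩
  simp only [hP.dynkin hφ]
  have h := (bddBy_integral (hP.unifCb (hP.gen_cb hφ) δ) (hP.gen_cont (hP.gen_cb hφ))).2 k
    (C₁ * (C₂ * M)) fun v hv => h₁ v (hv.trans hδ) _ _ (hP.gen_cb hφ) (h₂ φ M hφ hM)
  exact h.mono (le_of_eq (by ring))

/-- The semigroup is differentiable in every `C^k`-seminorm, with a remainder of second order that
is controlled by four more derivatives. -/
theorem CbSemigroup.sub_sub_gen_bdd (hP : CbSemigroup P A) (k : ℕ) : ∃ C : ℝ, 0 ≤ C ∧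
    ∀ δ ≤ (1 : ℝ≥0), ∀ φ M, CbFun φ → BddBy (k + 4) M φ →
      BddBy k (C * M * (δ * δ)) fun x => P δ φ x - φ x - δ * A φ x := by
  obtain ⟨C₁, hC₁, h₁⟩ := hP.sub_self_bdd k
  obtain ⟨C₂, hC₂, h₂⟩ := hP.gen_bdd (k + 2)
  refine ⟨C₁ * C₂, by positivity, fun δ hδ φ M hφ hM => ?_⟩
  have hA := hP.gen_cb hφ
  have hM0 := hM.nonneg
  have he : ∀ x, P δ φ x - φ x - δ * A φ x =
      ∫ v in (0 : ℝ)..δ, (P v.toNNReal (A φ) x - A φ x) := fun x => by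
    have hi : IntervalIntegrable (fun v : ℝ => P v.toNNReal (A φ) x) volume 0 δ :=
      ((hP.gen_cont hA x).comp continuous_real_toNNReal).intervalIntegrable _ _
    rw [intervalIntegral.integral_sub hi intervalIntegrable_const, ← hP.dynkin hφ]
    simp
  simp only [he]
  have hu : UnifCb fun v : Set.Iic δ => fun x => P v (A φ) x - A φ x := by
    obtain h := (hP.unifCb hA δ)
    refine ⟨fun v => (h.1 v).sub hA.1, fun j => ?_⟩
    obtain ⟨M₁, hM₁⟩ := h.2 j
    obtain ⟨M₂, hM₂⟩ := hA.2 j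
    exact ⟨M₁ + M₂, fun v => (hM₁ v).sub (h.1 v) hA.1 hM₂⟩
  have h := (bddBy_integral hu fun x => (hP.gen_cont hA x).sub continuous_const).2 k
    (C₁ * (C₂ * M) * δ) fun v hv => (h₁ v (hv.trans hδ) _ _ hA (h₂ φ M hφ hM)).mono
      (by gcongr)
  exact h.mono (le_of_eq (by ring))

/-! ### Continuity in all seminorms -/

/-- A family of `C_b^∞` functions that depends continuously on its parameter in every
`C^k`-seminorm. -/
def CbCont {α : Type*} [TopologicalSpace α] (F : α → StateSpace N → ℝ) : Prop :=
  (∀ a, CbFun (F a)) ∧ ∀ k a₀, ∀ ε > (0 : ℝ), ∀ᶠ a in 𝓝 a₀, BddBy k ε fun x => F a x - F a₀ x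

variable {α : Type*} [TopologicalSpace α] {F : α → StateSpace N → ℝ}

theorem CbCont.const {φ : StateSpace N → ℝ} (hφ : CbFun φ) : CbCont fun _ : α => φ :=
  ⟨fun _ => hφ, fun k _ ε hε => Eventually.of_forall fun _ => by
    simpa using (BddBy.const (N := N) k 0).mono (by simpa using hε.le)⟩

theorem CbCont.op (hF : CbCont F) {T : FunOp N} (hT : CbOp T) : CbCont fun a => T (F a) := by
  refine ⟨fun a => hT.cb (hF.1 a), fun k a₀ ε hε => ?_⟩
  obtain ⟨l, C, hC, h⟩ := hT.bdd k
  filter_upwards [hF.2 l a₀ (ε / (C + 1)) (by positivity)] with a ha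
  have h' := h _ _ ((hF.1 a).sub (hF.1 a₀)) ha
  rw [hT.sub (hF.1 a) (hF.1 a₀)] at h'
  refine h'.mono ?_
  rw [mul_div_assoc', div_le_iff₀ (by positivity)]
  nlinarith

theorem CbCont.continuous_eval (hF : CbCont F) (x : StateSpace N) : Continuous fun a => F a x := by
  rw [continuous_iff_continuousAt]
  intro a₀
  rw [ContinuousAt, Metric.tendsto_nhds]
  intro ε hε
  filter_upwards [hF.2 0 a₀ (ε / 2) (by positivity)] with a ha
  rw [Real.dist_eq]
  exact (ha x).trans_lt (by linarith)

theorem CbSemigroup.sub_bdd (hP : CbSemigroup P A) {φ : StateSpace N → ℝ} (hφ : CbFun φ) (k : ℕ)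
    (T : ℝ≥0) : ∃ C : ℝ, 0 ≤ C ∧ ∀ u v : ℝ≥0, u ≤ v → v ≤ T → v ≤ u + 1 →
      BddBy k (C * ((v : ℝ) - u)) fun x => P v φ x - P u φ x := by
  obtain ⟨C₁, hC₁, h₁⟩ := hP.bdd k T
  obtain ⟨C₂, hC₂, h₂⟩ := hP.sub_self_bdd k
  obtain ⟨M, hM⟩ := hφ.2 (k + 2)
  have hM0 := hM.nonneg
  refine ⟨C₁ * (C₂ * M), by positivity, fun u v huv hv hv1 => ?_⟩
  obtain ⟨δ, rfl⟩ := exists_add_of_le huv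
  have hδ : δ ≤ 1 := by simpa using hv1
  have hφ' : CbFun (P δ φ) := hP.cb hφ δ
  have h := h₁ u (huv.trans hv) _ _ (hφ'.sub hφ) (h₂ δ hδ φ M hφ hM)
  rw [(hP.cbOp u).sub hφ' hφ, ← hP.semigroup hφ] at h
  refine h.mono (le_of_eq ?_)
  push_cast
  ring

theorem CbCont.semigroup (hF : CbCont F) (hP : CbSemigroup P A) {t : α → ℝ≥0}
    (ht : Continuous t) : CbCont fun a => P (t a) (F a) := by
  refine ⟨fun a => hP.cb (hF.1 a) _, fun k a₀ ε hε => ?_⟩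
  obtain ⟨C₁, hC₁, h₁⟩ := hP.bdd k (t a₀ + 1)
  obtain ⟨C₂, hC₂, h₂⟩ := hP.sub_bdd (hF.1 a₀) k (t a₀ + 1)
  have hε' : 0 < min 1 (ε / 2 / (C₂ + 1)) := by positivity
  have ht' : ∀ᶠ a in 𝓝 a₀, |(t a : ℝ) - t a₀| < min 1 (ε / 2 / (C₂ + 1)) := by
    have := Metric.tendsto_nhds.1 (ht.tendsto a₀) _ hε'
    simpa only [NNReal.dist_eq] using this
  filter_upwards [hF.2 k a₀ (ε / 2 / (C₁ + 1)) (by positivity), ht'] with a ha hta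
  have hle1 : |(t a : ℝ) - t a₀| ≤ 1 := hta.le.trans (min_le_left _ _)
  have hle2 : |(t a : ℝ) - t a₀| ≤ ε / 2 / (C₂ + 1) := hta.le.trans (min_le_right _ _)
  have hT : t a ≤ t a₀ + 1 := by
    rw [← NNReal.coe_le_coe]
    push_cast
    linarith [(abs_le.1 hle1).2]
  have hT' : t a₀ ≤ t a + 1 := by
    rw [← NNReal.coe_le_coe]
    push_cast
    linarith [(abs_le.1 hle1).1]
  have b1 := h₁ (t a) hT _ _ ((hF.1 a).sub (hF.1 a₀)) ha
  rw [(hP.cbOp (t a)).sub (hF.1 a) (hF.1 a₀)] at b1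
  have b2 : BddBy k (C₂ * |(t a : ℝ) - t a₀|) fun x => P (t a) (F a₀) x - P (t a₀) (F a₀) x := by
    rcases le_total (t a₀) (t a) with hle | hle
    · refine (h₂ _ _ hle hT hT).mono ?_
      gcongr
      exact le_abs_self _
    · have := h₂ _ _ hle (by simp) hT'
      have h3 := BddBy.const_mul (((hP.cb (hF.1 a₀) _).sub (hP.cb (hF.1 a₀) _)).1) this (-1)
      have h4 := h3.mono (M' := C₂ * |(t a : ℝ) - t a₀|) (by
        rw [abs_neg, abs_one, one_mul, abs_sub_comm (t a : ℝ)]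
        gcongr
        exact le_abs_self _)
      convert h4 using 2
      ring
  have b3 := BddBy.add ((hP.cb (hF.1 a) _).sub (hP.cb (hF.1 a₀) _)).1
    ((hP.cb (hF.1 a₀) _).sub (hP.cb (hF.1 a₀) _)).1 b1 b2
  have b4 := b3.mono (M' := ε) (by
    have e1 : C₁ * (ε / 2 / (C₁ + 1)) ≤ ε / 2 := by
      rw [mul_div_assoc', div_le_iff₀ (by positivity)]
      nlinarith
    have e2 : C₂ * |(t a : ℝ) - t a₀| ≤ ε / 2 := by
      calc _ ≤ C₂ * (ε / 2 / (C₂ + 1)) := by gcongr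
        _ ≤ ε / 2 := by
          rw [mul_div_assoc', div_le_iff₀ (by positivity)]
          nlinarith
    linarith)
  convert b4 using 2
  ring

theorem CbCont.kernelOp (hP : CbSemigroup P A) (s : ℝ≥0) : ∀ (k : ℕ) {T : Fin k → FunOp N}
    (_ : ∀ p, CbOp (T p)) {τ : α → Fin k → ℝ≥0} (_ : Continuous τ) {t : α → ℝ≥0}
    (_ : Continuous t) {F : α → StateSpace N → ℝ} (_ : CbCont F),
    CbCont fun a => kernelOp P s k T (τ a) (t a) (F a)
  | 0, _, _, _, _, _, ht, _, hF => hF.semigroup hP (ht.sub continuous_const)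
  | k + 1, T, hT, τ, hτ, t, ht, F, hF => by
    have hl : Continuous fun a => τ a (Fin.last k) :=
      (continuous_apply (Fin.last k)).comp hτ
    refine CbCont.kernelOp (τ := fun a => Fin.init (τ a)) hP s k (T := Fin.init T)
      (fun p => hT p.castSucc) ?_ hl ((hF.semigroup hP (ht.sub hl)).op (hT _))
    exact continuous_pi fun p => (continuous_apply p.castSucc).comp hτ

theorem CbSemigroup.cbOp_kernelOp (hP : CbSemigroup P A) (s : ℝ≥0) : ∀ (k : ℕ)
    {T : Fin k → FunOp N} (_ : ∀ p, CbOp (T p)) (τ : Fin k → ℝ≥0) (t : ℝ≥0),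
    CbOp (kernelOp P s k T τ t)
  | 0, _, _, _, _ => hP.cbOp _
  | k + 1, T, hT, _, _ =>
    (hP.cbOp_kernelOp s k (T := Fin.init T) (fun p => hT p.castSucc) _ _).comp
      ((hT _).comp (hP.cbOp _))

/-! ### The derivative in the position of a multiplication operator -/

/-- Moving multiplication by `g` through the semigroup: since `A (g ψ) = g A ψ + Ψ ψ`, the
derivative of `r ↦ P_{r-a} (g P_{t-r} φ)` is `P_{r-a} Ψ P_{t-r} φ`. -/
theorem CbSemigroup.sub_eq_integral (hP : CbSemigroup P A) {L Ψ : FunOp N} (hL : CbOp L)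
    (hΨ : CbOp Ψ) {g : StateSpace N → ℝ} (hg : CbFun g)
    (hgΨ : ∀ ψ, CbFun ψ → ∀ x, A (fun y => g y * ψ y) x = g x * A ψ x + Ψ ψ x)
    {φ : StateSpace N → ℝ} (hφ : CbFun φ) (x : StateSpace N) {a b c t : ℝ≥0} (hab : a ≤ b)
    (hbc : b ≤ c) (hct : c ≤ t) :
    L (P (c - a) fun y => g y * P (t - c) φ y) x - L (P (b - a) fun y => g y * P (t - b) φ y) x =
      ∫ v in (b : ℝ)..c, L (P (v.toNNReal - a) (Ψ (P (t - v.toNNReal) φ))) x := by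
  have hcont : Continuous fun v : ℝ≥0 => L (P (v - a) (Ψ (P (t - v) φ))) x :=
    ((((CbCont.const hφ).semigroup hP (continuous_const.sub continuous_id)).op hΨ).semigroup hP
      (continuous_id.sub continuous_const)).op hL |>.continuous_eval x
  obtain ⟨l₀, C₀, hC₀, h₀⟩ := hL.bdd 0
  obtain ⟨C₁, hC₁, h₁⟩ := hP.bdd l₀ t
  obtain ⟨C₂, hC₂, h₂⟩ := hP.sub_sub_gen_bdd l₀
  obtain ⟨l₃, C₃, hC₃, h₃⟩ := hΨ.bdd l₀
  obtain ⟨C₄, hC₄, h₄⟩ := hP.sub_self_bdd l₃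
  -- `D` bounds all the functions `P_u φ` and `g P_u φ`, `u ≤ t`, in the seminorms in question
  obtain ⟨k, hk₁, hk₂⟩ : ∃ k, l₀ + 4 ≤ k ∧ l₃ + 2 ≤ k :=
    ⟨max (l₀ + 4) (l₃ + 2), le_max_left _ _, le_max_right _ _⟩
  obtain ⟨D₁, hD₁⟩ := (hP.unifCb hφ t).2 k
  obtain ⟨G, hG⟩ := hg.2 k
  have hD0 : 0 ≤ D₁ := (hD₁ ⟨0, zero_le (a := t)⟩).nonneg
  have hG0 : 0 ≤ G := hG.nonneg
  -- it suffices to expand the increment over `[r, r + δ]` up to an error of order `δ²`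
  refine sub_eq_integral_of_increments (C := C₀ * (C₁ *
    (C₂ * (2 ^ k * (G * D₁)) + 2 ^ l₀ * (G * (C₂ * D₁)) + C₃ * (C₄ * D₁))))
    (y := fun v => L (P (v - a) fun y => g y * P (t - v) φ y) x) hbc hcont
    fun r δ hr hrδ hδ => ?_
  have hrt : r + δ ≤ t := hrδ.trans hct
  set u : ℝ≥0 := t - (r + δ) with hu
  have hut : u ≤ t := tsub_le_self
  set ψ : StateSpace N → ℝ := P u φ with hψdef
  have hψ : CbFun ψ := hP.cb hφ u
  have hgψ : CbFun fun y => g y * ψ y := hg.mul hψ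
  have e1 : P (t - r) φ = P δ ψ := by
    rw [hψdef, ← hP.semigroup hφ]
    congr 1
    rw [hu, ← NNReal.coe_inj, NNReal.coe_sub (le_self_add.trans hrt), NNReal.coe_add,
      NNReal.coe_sub hrt]
    push_cast
    ring
  have e2 : (r + δ) - a = (r - a) + δ := tsub_add_eq_add_tsub (hab.trans hr) |>.symm
  have e3 : P ((r + δ) - a) (fun y => g y * ψ y) = P (r - a) (P δ fun y => g y * ψ y) := by
    rw [e2, hP.semigroup hgψ]
  have hPδ : CbFun (P δ ψ) := hP.cb hψ δ
  -- the three remainders: of `P_δ (g ψ)`, of `g P_δ ψ` and of replacing `Ψ P_δ ψ` by `Ψ ψ`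
  have b1 := h₂ δ hδ _ _ hgψ ((BddBy.mul hg.1 hψ.1 hG (hD₁ ⟨u, hut⟩)).of_le hk₁)
  have b2 := h₂ δ hδ _ _ hψ ((hD₁ ⟨u, hut⟩).of_le hk₁)
  have b3 := h₃ _ _ (hPδ.sub hψ) (h₄ δ hδ _ _ hψ ((hD₁ ⟨u, hut⟩).of_le hk₂))
  have c1 : CbFun fun y => P δ (fun y => g y * ψ y) y - g y * ψ y - δ * A (fun y => g y * ψ y) y :=
    ((hP.cb hgψ δ).sub hgψ).sub ((hP.gen_cb hgψ).const_mul _)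
  have c2 : CbFun fun y => P δ ψ y - ψ y - δ * A ψ y :=
    (hPδ.sub hψ).sub ((hP.gen_cb hψ).const_mul _)
  have c3 : CbFun (Ψ fun y => P δ ψ y - ψ y) := hΨ.cb (hPδ.sub hψ)
  have b2' := BddBy.mul hg.1 c2.1 (hG.of_le (le_self_add.trans hk₁)) b2
  have b3' := BddBy.const_mul c3.1 b3 (δ : ℝ)
  have b4 := BddBy.sub (c1.sub (hg.mul c2)).1 (c3.const_mul (δ : ℝ)).1
    (BddBy.sub c1.1 (hg.mul c2).1 b1 b2') b3'
  have cE := (c1.sub (hg.mul c2)).sub (c3.const_mul (δ : ℝ))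
  have b5 := h₀ _ _ (hP.cb cE (r - a)) (h₁ (r - a) (tsub_le_self.trans (le_self_add.trans hrt)) _ _
    cE b4)
  have hop := hL.comp (hP.cbOp (r - a))
  have hΨδ : CbFun fun y => (δ : ℝ) * Ψ (P δ ψ) y := (hΨ.cb hPδ).const_mul _
  have key : L (P ((r + δ) - a) fun y => g y * P (t - (r + δ)) φ y) x -
      L (P (r - a) fun y => g y * P (t - r) φ y) x - δ * L (P (r - a) (Ψ (P (t - r) φ))) x =
      L (P (r - a) fun y => P δ (fun y => g y * ψ y) y - g y * ψ y - δ * A (fun y => g y * ψ y) y -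
        g y * (P δ ψ y - ψ y - δ * A ψ y) - δ * Ψ (fun y => P δ ψ y - ψ y) y) x := by
    have e4 : (fun y => P δ (fun y => g y * ψ y) y - g y * ψ y - δ * A (fun y => g y * ψ y) y -
        g y * (P δ ψ y - ψ y - δ * A ψ y) - δ * Ψ (fun y => P δ ψ y - ψ y) y) =
        fun y => (P δ (fun y => g y * ψ y) y - g y * P δ ψ y) - δ * Ψ (P δ ψ) y := by
      funext y
      rw [hΨ.sub hPδ hψ, hgΨ ψ hψ]
      ring
    rw [e4]
    have e5 := hop.sub ((hP.cb hgψ δ).sub (hg.mul hPδ)) hΨδ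
    simp only [Function.comp_apply] at e5
    have e6 := hop.sub (hP.cb hgψ δ) (hg.mul hPδ)
    simp only [Function.comp_apply] at e6
    have e7 := hop.smul (δ : ℝ) (hΨ.cb hPδ)
    simp only [Function.comp_apply] at e7
    rw [e5, e6, e7, e1]
    simp only [← hu, ← hψdef, e3]
  rw [key]
  refine (b5 x).trans (le_of_eq_of_le ?_ (mul_le_mul_of_nonneg_left
    (show (δ : ℝ) * δ ≤ δ * √δ from ?_) (by positivity)))
  · rw [abs_of_nonneg δ.coe_nonneg]
    ring
  · have hδ1 : (δ : ℝ) ≤ 1 := by exact_mod_cast hδ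
    refine mul_le_mul_of_nonneg_left ?_ δ.coe_nonneg
    exact Real.le_sqrt_of_sq_le (by nlinarith [δ.coe_nonneg])

end Kernel

/-! ### Iterated Itô integrals -/

section IteratedIto

variable {Ω : Type*} {mΩ : MeasurableSpace Ω} {μ : Measure Ω} {𝓕 : Filtration ℝ≥0 mΩ}
  {W : ℝ≥0 → Ω → ℝ} {a b : ℝ≥0} {H : ℝ≥0 → Lp ℝ 2 μ} {Hf : ℝ≥0 → Ω → ℝ}

variable [IsProbabilityMeasure μ]

theorem IsIntegrand.norm_increment_le (hW : IsDriver μ 𝓕 W) (hH : IsIntegrand μ 𝓕 a b Hf H)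
    {r : ℝ≥0} (har : a ≤ r) (hrb : r ≤ b) {I J : Lp ℝ 2 μ} (hI : ItoRel μ 𝓕 W a r H I)
    (hJ : ItoRel μ 𝓕 W a b H J) {C : ℝ} (hC0 : 0 ≤ C) (hC : ∀ v ∈ Set.Ioc r b, ‖H v‖ ≤ C) :
    ‖J - I‖ ≤ C * √((b : ℝ) - r) := by
  obtain ⟨K, -, hK⟩ := (hH.mono har le_rfl).exists_itoRel hW hrb
  rw [hJ.unique hW (hI.concat hK har hrb), add_sub_cancel_left]
  exact hK.norm_le hW hrb hC0 hC

/-- A stochastic integral process is itself an admissible integrand. -/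
theorem IsItoProcess.exists_isIntegrand (hW : IsDriver μ 𝓕 W)
    (hH : ∀ b, IsIntegrand μ 𝓕 a b Hf H) {J : ℝ≥0 → Ω → ℝ} (hJ : IsItoProcess μ 𝓕 W Hf a J) :
    ∃ K : ℝ≥0 → Lp ℝ 2 μ, ∀ b, IsIntegrand μ 𝓕 a b J K := by
  have hex : ∀ t : ℝ≥0, ∃ K : Lp ℝ 2 μ, a ≤ t → K =ᵐ[μ] J t ∧ ItoRel μ 𝓕 W a t H K := fun t => by
    by_cases hat : a ≤ t
    · obtain ⟨K, h1, h2⟩ := (hJ.2 t hat).exists_itoRel hW (hH t)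
      exact ⟨K, fun _ => ⟨h1, h2⟩⟩
    · exact ⟨0, fun h => absurd h hat⟩
  choose K hK using hex
  refine ⟨K, fun b => ⟨?_, fun r hr => (hK r hr.1).2.aesm hW, fun r hr => (hK r hr.1).1⟩⟩
  obtain ⟨C, hC⟩ := isCompact_Icc.exists_bound_of_continuousOn (hH b).cont
  rcases le_or_gt a b with hab | hab
  swap
  · rw [Set.Icc_eq_empty (not_le.2 hab)]
    exact continuousOn_empty _
  have hC0 : 0 ≤ C := (norm_nonneg _).trans (hC a ⟨le_rfl, hab⟩)
  have hinc : ∀ r ∈ Set.Icc a b, ∀ t ∈ Set.Icc a b, r ≤ t →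
      ‖K t - K r‖ ≤ C * √((t : ℝ) - r) := fun r hr t ht hrt =>
    (hH t).norm_increment_le hW hr.1 hrt (hK r hr.1).2 (hK t ht.1).2 hC0 fun v hv =>
      hC v ⟨hr.1.trans hv.1.le, hv.2.trans ht.2⟩
  have hinc' : ∀ r ∈ Set.Icc a b, ∀ t ∈ Set.Icc a b, ‖K t - K r‖ ≤ C * √|(t : ℝ) - r| :=
    fun r hr t ht => by
      rcases le_total r t with h | h
      · rw [abs_of_nonneg (sub_nonneg.2 (by exact_mod_cast h))]
        exact hinc r hr t ht h
      · rw [norm_sub_rev, abs_sub_comm (t : ℝ),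
          abs_of_nonneg (sub_nonneg.2 (by exact_mod_cast h))]
        exact hinc t ht r hr h
  intro r hr
  rw [ContinuousWithinAt, tendsto_iff_norm_sub_tendsto_zero]
  refine squeeze_zero' (Eventually.of_forall fun _ => norm_nonneg _)
    (eventually_mem_nhdsWithin.mono fun t ht => hinc' r hr t ht) ?_
  have hc : Continuous fun t : ℝ≥0 => C * √|(t : ℝ) - r| := by fun_prop
  have := hc.tendsto r
  simp only [sub_self, abs_zero, Real.sqrt_zero, mul_zero] at this
  exact this.mono_left nhdsWithin_le_nhds

variable {d₂ : ℕ} {Y : Fin d₂ → ℝ≥0 → Ω → ℝ}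

theorem exists_isIntegrand_iterQ (hY : ∀ i, IsDriver μ 𝓕 (Y i)) (s : ℝ≥0) : ∀ (n : ℕ)
    (w : Fin n → Fin d₂), ∃ K : ℝ≥0 → Lp ℝ 2 μ, ∀ b, IsIntegrand μ 𝓕 s b (iterQ μ 𝓕 Y s n w) K
  | 0, _ => ⟨fun _ => (memLp_const 1).toLp (fun _ => 1), fun b => ⟨continuousOn_const,
      fun r _ => ⟨fun _ => 1, stronglyMeasurable_const, MemLp.coeFn_toLp _⟩,
      fun r _ => MemLp.coeFn_toLp _⟩⟩
  | n + 1, w => by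
    obtain ⟨K, hK⟩ := exists_isIntegrand_iterQ hY s n (Fin.init w)
    exact (itoProcess_spec (hY _) hK).exists_isIntegrand (hY _) hK

theorem isItoProcess_iterQ (hY : ∀ i, IsDriver μ 𝓕 (Y i)) (s : ℝ≥0) (n : ℕ)
    (w : Fin (n + 1) → Fin d₂) :
    IsItoProcess μ 𝓕 (Y (w (Fin.last n))) (iterQ μ 𝓕 Y s n (Fin.init w)) s
      (iterQ μ 𝓕 Y s (n + 1) w) := by
  obtain ⟨K, hK⟩ := exists_isIntegrand_iterQ hY s n (Fin.init w)
  exact itoProcess_spec (hY _) hK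

theorem continuous_iterQ (hY : ∀ i, IsDriver μ 𝓕 (Y i)) (s : ℝ≥0) (n : ℕ) (w : Fin n → Fin d₂)
    (ω : Ω) : Continuous fun t => iterQ μ 𝓕 Y s n w t ω := by
  cases n with
  | zero => exact continuous_const
  | succ n => exact (isItoProcess_iterQ hY s n w).1 ω

open scoped Classical in
/-- The iterated Itô integral as an element of `L²`. -/
noncomputable def iterLp (μ : Measure Ω) (𝓕 : Filtration ℝ≥0 mΩ) (Y : Fin d₂ → ℝ≥0 → Ω → ℝ)
    (s : ℝ≥0) (m : ℕ) (ι : Fin m → Fin d₂) (K : (Fin m → ℝ≥0) → ℝ) (t : ℝ≥0) : Lp ℝ 2 μ :=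
  if h : MemLp (iteratedIto μ 𝓕 Y s m ι K t) 2 μ then h.toLp _ else 0

/-- The properties of the iterated Itô integrals of order `m` with continuous kernels: existence,
measurability, and estimates in `L²` by the supremum of the kernel over `τᵢ ≤ t`. They are proved
together by induction on `m`; the last two make an iterated integral continuous in its kernel and
in its upper limit, so that it can be integrated once more. -/
structure IterSpec (μ : Measure Ω) (𝓕 : Filtration ℝ≥0 mΩ) (Y : Fin d₂ → ℝ≥0 → Ω → ℝ)
    (s : ℝ≥0) (m : ℕ) (ι : Fin m → Fin d₂) : Prop where
  exists_integral : ∀ {K}, Continuous K → ∀ {t}, s ≤ t → IteratedItoExists μ 𝓕 Y s m ι K t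
  coe : ∀ {K}, Continuous K → ∀ {t}, s ≤ t →
    iterLp μ 𝓕 Y s m ι K t =ᵐ[μ] iteratedIto μ 𝓕 Y s m ι K t
  aesm : ∀ {K}, Continuous K → ∀ {t}, s ≤ t →
    AEStronglyMeasurable[𝓕 t] (iterLp μ 𝓕 Y s m ι K t) μ
  norm_le : ∀ {K}, Continuous K → ∀ {t}, s ≤ t → ∀ {C : ℝ}, 0 ≤ C →
    (∀ τ, (∀ i, τ i ≤ t) → |K τ| ≤ C) → ‖iterLp μ 𝓕 Y s m ι K t‖ ≤ C * √((t : ℝ) - s) ^ m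
  norm_sub_le : ∀ {K K'}, Continuous K → Continuous K' → ∀ {t}, s ≤ t → ∀ {C : ℝ}, 0 ≤ C →
    (∀ τ, (∀ i, τ i ≤ t) → |K τ - K' τ| ≤ C) →
    ‖iterLp μ 𝓕 Y s m ι K t - iterLp μ 𝓕 Y s m ι K' t‖ ≤ C * √((t : ℝ) - s) ^ m
  norm_increment_le : ∀ {K}, Continuous K → ∀ {r t}, s ≤ r → r ≤ t → ∀ {C : ℝ}, 0 ≤ C →
    (∀ τ, (∀ i, τ i ≤ t) → |K τ| ≤ C) →
    ‖iterLp μ 𝓕 Y s m ι K t - iterLp μ 𝓕 Y s m ι K r‖ ≤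
      C * (1 + √((t : ℝ) - s)) ^ m * √((t : ℝ) - r)

theorem isCompact_le (m : ℕ) (t : ℝ≥0) : IsCompact {τ : Fin m → ℝ≥0 | ∀ i, τ i ≤ t} := by
  have : {τ : Fin m → ℝ≥0 | ∀ i, τ i ≤ t} = Set.Icc 0 fun _ => t := by
    ext τ
    exact ⟨fun h => ⟨fun _ => zero_le, h⟩, fun h => h.2⟩
  rw [this]
  exact isCompact_Icc

/-- An iterated integral whose kernel depends continuously on its upper limit is an admissible
integrand. -/
theorem IterSpec.isIntegrand {s : ℝ≥0} {m : ℕ} {ι : Fin m → Fin d₂} (h : IterSpec μ 𝓕 Y s m ι)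
    {K : ℝ≥0 → (Fin m → ℝ≥0) → ℝ} (hK : Continuous fun p : ℝ≥0 × (Fin m → ℝ≥0) => K p.1 p.2)
    (b : ℝ≥0) :
    IsIntegrand μ 𝓕 s b (fun r => iteratedIto μ 𝓕 Y s m ι (K r) r)
      (fun r => iterLp μ 𝓕 Y s m ι (K r) r) := by
  have hKr : ∀ r, Continuous (K r) := fun r =>
    hK.comp (by fun_prop : Continuous fun τ : Fin m → ℝ≥0 => (r, τ))
  refine ⟨?_, fun r hr => h.aesm (hKr r) hr.1, fun r hr => h.coe (hKr r) hr.1⟩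
  have hcomp : IsCompact (Set.Icc s b ×ˢ {τ : Fin m → ℝ≥0 | ∀ i, τ i ≤ b}) :=
    isCompact_Icc.prod (isCompact_le m b)
  obtain ⟨C, hC⟩ := hcomp.exists_bound_of_continuousOn hK.continuousOn
  have huc := hcomp.uniformContinuousOn_of_continuous hK.continuousOn
  rw [Metric.uniformContinuousOn_iff] at huc
  set D : ℝ := (1 + √((b : ℝ) - s)) ^ m with hD
  have hD0 : 0 < D := by positivity
  intro r₀ hr₀
  have hC0 : 0 ≤ C := (norm_nonneg _).trans (hC (r₀, fun _ => 0) ⟨hr₀, fun _ => zero_le⟩)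
  have hdec : ∀ t ∈ Set.Icc s b, √((t : ℝ) - s) ^ m ≤ D ∧ (1 + √((t : ℝ) - s)) ^ m ≤ D :=
    fun t ht => by
      have h1 : √((t : ℝ) - s) ≤ √((b : ℝ) - s) := by
        have : (t : ℝ) ≤ b := by exact_mod_cast ht.2
        gcongr
      constructor <;> rw [hD] <;> gcongr
      linarith
  -- change the kernel first, at the smaller of the two times, then the upper limit
  have hstep : ∀ r ∈ Set.Icc s b, ∀ t ∈ Set.Icc s b, r ≤ t → ∀ e, 0 ≤ e →
      (∀ τ, (∀ i, τ i ≤ b) → |K t τ - K r τ| ≤ e) →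
      ‖iterLp μ 𝓕 Y s m ι (K t) t - iterLp μ 𝓕 Y s m ι (K r) r‖ ≤
        C * D * √((t : ℝ) - r) + e * D := fun r hr t ht hrt e he hd => by
    have b1 := h.norm_increment_le (hKr t) hr.1 hrt hC0 fun τ hτ =>
      hC (t, τ) ⟨ht, fun i => (hτ i).trans ht.2⟩
    have b2 := h.norm_sub_le (hKr t) (hKr r) hr.1 he fun τ hτ => hd τ fun i => (hτ i).trans hr.2
    have e1 : iterLp μ 𝓕 Y s m ι (K t) t - iterLp μ 𝓕 Y s m ι (K r) r =
      (iterLp μ 𝓕 Y s m ι (K t) t - iterLp μ 𝓕 Y s m ι (K t) r) +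
      (iterLp μ 𝓕 Y s m ι (K t) r - iterLp μ 𝓕 Y s m ι (K r) r) := by abel
    rw [e1]
    refine (norm_add_le _ _).trans (add_le_add (b1.trans ?_) (b2.trans ?_))
    · gcongr
      exact (hdec t ht).2
    · gcongr
      exact (hdec r hr).1
  rw [ContinuousWithinAt, Metric.tendsto_nhds]
  intro ε hε
  obtain ⟨δ, hδ, hunif⟩ := huc (ε / (3 * D)) (by positivity)
  have hc : Continuous fun t : ℝ≥0 => C * D * √|(t : ℝ) - r₀| := by fun_prop
  have hc0 := hc.tendsto r₀
  simp only [sub_self, abs_zero, Real.sqrt_zero, mul_zero] at hc0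
  filter_upwards [eventually_mem_nhdsWithin,
    mem_nhdsWithin_of_mem_nhds (Metric.ball_mem_nhds r₀ hδ),
    nhdsWithin_le_nhds (hc0.eventually_lt_const (show (0 : ℝ) < ε / 3 by positivity))]
    with t ht htδ htc
  have hd : ∀ τ : Fin m → ℝ≥0, (∀ i, τ i ≤ b) → |K t τ - K r₀ τ| ≤ ε / (3 * D) := fun τ hτ => by
    have := hunif (t, τ) ⟨ht, hτ⟩ (r₀, τ) ⟨hr₀, hτ⟩ (by
      rw [Prod.dist_eq, dist_self]
      exact max_lt htδ hδ)
    exact this.le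
  have e0 : ε / (3 * D) * D = ε / 3 := by field_simp
  rw [dist_eq_norm]
  rcases le_total r₀ t with hle | hle
  · have := hstep r₀ hr₀ t ht hle _ (by positivity) hd
    rw [abs_of_nonneg (sub_nonneg.2 (by exact_mod_cast hle))] at htc
    rw [e0] at this
    linarith
  · have := hstep t ht r₀ hr₀ hle (ε / (3 * D)) (by positivity) fun τ hτ => by
      rw [abs_sub_comm]
      exact hd τ hτ
    rw [abs_sub_comm, abs_of_nonneg (sub_nonneg.2 (by exact_mod_cast hle))] at htc
    rw [e0, norm_sub_rev] at this
    linarith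

theorem continuous_snoc_prod (m : ℕ) : Continuous fun p : ℝ≥0 × (Fin m → ℝ≥0) =>
    (Fin.snoc (α := fun _ => ℝ≥0) p.2 p.1 : Fin (m + 1) → ℝ≥0) :=
  Continuous.finSnoc (A := fun _ => ℝ≥0) continuous_snd continuous_fst

/-- Iterated Itô integrals with continuous kernels exist. -/
theorem iterSpec (hY : ∀ i, IsDriver μ 𝓕 (Y i)) (s : ℝ≥0) : ∀ (m : ℕ) (ι : Fin m → Fin d₂),
    IterSpec μ 𝓕 Y s m ι
  | 0, ι => by
    have hm : ∀ (K : (Fin 0 → ℝ≥0) → ℝ) t, MemLp (iteratedIto μ 𝓕 Y s 0 ι K t) 2 μ :=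
      fun K t => memLp_const _
    have he : ∀ (K : (Fin 0 → ℝ≥0) → ℝ) t,
        iterLp μ 𝓕 Y s 0 ι K t = (memLp_const (K ![])).toLp (fun _ => K ![]) := fun K t => by
      rw [iterLp, dif_pos (hm K t)]
      rfl
    have hn : ∀ c : ℝ, ‖(memLp_const (p := 2) (μ := μ) c).toLp (fun _ => c)‖ = |c| := fun c => by
      rw [Lp.norm_toLp, eLpNorm_const c (by simp) (NeZero.ne μ)]
      simp
    refine ⟨fun _ _ _ => trivial, fun {K} _ {t} _ => ?_, fun {K} _ {t} _ => ?_,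
      fun {K} _ {t} _ C hC h => ?_, fun {K K'} _ _ {t} _ C hC h => ?_,
      fun {K} _ {r t} _ _ C hC h => ?_⟩
    · rw [he]
      exact MemLp.coeFn_toLp _
    · rw [he]
      exact ⟨fun _ => K ![], stronglyMeasurable_const, MemLp.coeFn_toLp _⟩
    · rw [he, hn, pow_zero, mul_one]
      exact h _ fun i => i.elim0
    · have : iterLp μ 𝓕 Y s 0 ι K t - iterLp μ 𝓕 Y s 0 ι K' t =
          (memLp_const (K ![] - K' ![])).toLp (fun _ => K ![] - K' ![]) := by
        rw [he, he]
        rfl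
      rw [this, hn, pow_zero, mul_one]
      exact h _ fun i => i.elim0
    · rw [he, he, sub_self, norm_zero]
      positivity
  | m + 1, ι => by
    have ih := iterSpec hY s m (Fin.init ι)
    have hKc : ∀ {K : (Fin (m + 1) → ℝ≥0) → ℝ}, Continuous K →
        Continuous fun p : ℝ≥0 × (Fin m → ℝ≥0) => K (Fin.snoc (α := fun _ => ℝ≥0) p.2 p.1) :=
      fun hK => hK.comp (continuous_snoc_prod m)
    have hKr : ∀ {K : (Fin (m + 1) → ℝ≥0) → ℝ}, Continuous K → ∀ r,
        Continuous fun τ : Fin m → ℝ≥0 => K (Fin.snoc (α := fun _ => ℝ≥0) τ r) :=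
      fun hK r => (hKc hK).comp (by fun_prop : Continuous fun τ : Fin m → ℝ≥0 => (r, τ))
    have hint := fun {K : (Fin (m + 1) → ℝ≥0) → ℝ} (hK : Continuous K) (t : ℝ≥0) =>
      ih.isIntegrand (K := fun r τ => K (Fin.snoc (α := fun _ => ℝ≥0) τ r)) (hKc hK) t
    have hIto := fun {K : (Fin (m + 1) → ℝ≥0) → ℝ} (hK : Continuous K) {t : ℝ≥0} (ht : s ≤ t) =>
      (hint hK t).isItoIntegral (hY (ι (Fin.last m))) ht
    have hcoe : ∀ {K : (Fin (m + 1) → ℝ≥0) → ℝ}, Continuous K → ∀ {t}, s ≤ t →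
        iterLp μ 𝓕 Y s (m + 1) ι K t =ᵐ[μ] iteratedIto μ 𝓕 Y s (m + 1) ι K t :=
      fun {K} hK {t} ht => by
        have hmem : MemLp (iteratedIto μ 𝓕 Y s (m + 1) ι K t) 2 μ := (hIto hK ht).1
        rw [iterLp, dif_pos hmem]
        exact MemLp.coeFn_toLp _
    have hrel : ∀ {K : (Fin (m + 1) → ℝ≥0) → ℝ}, Continuous K → ∀ {t}, s ≤ t →
        ItoRel μ 𝓕 (Y (ι (Fin.last m))) s t (fun r => iterLp μ 𝓕 Y s m (Fin.init ι)
          (fun τ => K (Fin.snoc (α := fun _ => ℝ≥0) τ r)) r)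
          (iterLp μ 𝓕 Y s (m + 1) ι K t) := fun {K} hK {t} ht => by
      obtain ⟨I, h1, h2⟩ := (hint hK t).exists_itoRel (hY (ι (Fin.last m))) ht
      rwa [← Lp.ext (h1.trans (hcoe hK ht).symm)]
    have hsnoc : ∀ {r t : ℝ≥0}, r ≤ t → ∀ τ : Fin m → ℝ≥0, (∀ i, τ i ≤ r) →
        ∀ i, (Fin.snoc (α := fun _ => ℝ≥0) τ r : Fin (m + 1) → ℝ≥0) i ≤ t := fun hrt τ hτ i => by
      refine Fin.lastCases ?_ (fun j => ?_) i
      · simpa using hrt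
      · simpa using (hτ j).trans hrt
    have hmono : ∀ {r t : ℝ≥0}, r ≤ t → √((r : ℝ) - s) ≤ √((t : ℝ) - s) := fun hrt => by
      have : (_ : ℝ) ≤ _ := NNReal.coe_le_coe.2 hrt
      gcongr
    refine ⟨fun {K} hK {t} ht => ⟨fun r hsr hrt => ih.exists_integral (hKr hK r) hsr, hIto hK ht⟩,
      hcoe, fun {K} hK {t} ht => (hrel hK ht).aesm (hY _), fun {K} hK {t} ht C hC h => ?_,
      fun {K K'} hK hK' {t} ht C hC h => ?_, fun {K} hK {r t} hr hrt C hC h => ?_⟩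
    · rw [pow_succ, ← mul_assoc]
      refine (hrel hK ht).norm_le (hY _) ht (by positivity) fun v hv => ?_
      refine (ih.norm_le (hKr hK v) hv.1.le hC fun τ hτ => h _ (hsnoc hv.2 τ hτ)).trans ?_
      gcongr
      exact hv.2
    · rw [pow_succ, ← mul_assoc]
      refine ((hrel hK ht).sub (hrel hK' ht)).norm_le (hY _) ht (by positivity) fun v hv => ?_
      refine (ih.norm_sub_le (hKr hK v) (hKr hK' v) hv.1.le hC
        fun τ hτ => h _ (hsnoc hv.2 τ hτ)).trans ?_
      gcongr
      exact hv.2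
    · refine ((hint hK t).norm_increment_le (hY _) hr hrt (hrel hK hr) (hrel hK (hr.trans hrt))
        (C := C * (1 + √((t : ℝ) - s)) ^ (m + 1)) (by positivity) fun v hv => ?_)
      refine (ih.norm_le (hKr hK v) (hr.trans hv.1.le) hC
        fun τ hτ => h _ (hsnoc hv.2 τ hτ)).trans ?_
      gcongr
      calc √((v : ℝ) - s) ^ m ≤ (1 + √((t : ℝ) - s)) ^ m := by
            gcongr
            linarith [hmono hv.2]
        _ ≤ _ := pow_le_pow_right₀ (by linarith [Real.sqrt_nonneg ((t : ℝ) - s)]) (Nat.le_succ m)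

end IteratedIto

/-! ### Integration by parts against paths of bounded variation -/

section IntegrationByParts

/-- The left-point Riemann sum of `∫ Q dW` over the first `i` cells of the grid of `[s, t]`. -/
noncomputable def riemannSum {Ω : Type*} (Q W : ℝ≥0 → Ω → ℝ) (s t : ℝ≥0) (n i : ℕ) (ω : Ω) : ℝ :=
  ∑ k ∈ Finset.range i, Q (grid s t n k) ω * (W (grid s t n (k + 1)) ω - W (grid s t n k) ω)

/-- Summation by parts: Riemann sums of `∫ Q Z dW` for a path `Z` with bounded derivative `ζ`,
where `J` is meant to be `∫ Q dW`. -/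
theorem abs_sum_mul_increment_sub_le {s t : ℝ≥0} (hst : s ≤ t) {M Z : ℕ → ℝ} {J : ℝ≥0 → ℝ}
    {ζ : ℝ → ℝ} {C : ℝ} (hC : ∀ v ∈ Set.Ioc (s : ℝ) t, |ζ v| ≤ C) {n : ℕ} (hn : n ≠ 0)
    (hM0 : M 0 = 0)
    (hZ : ∀ k < n, Z (k + 1) - Z k = ∫ v in (grid s t n k : ℝ)..grid s t n (k + 1), ζ v) :
    |∑ k ∈ Finset.range n, Z k * (M (k + 1) - M k) - (J t * Z n -
      ∑ k ∈ Finset.range n, J (grid s t n (k + 1)) *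
        ∫ v in (grid s t n k : ℝ)..grid s t n (k + 1), ζ v)| ≤
      |Z n| * |M n - J t| + C * ((t : ℝ) - s) *
        ((n : ℝ)⁻¹ * ∑ k ∈ Finset.range n, |M (k + 1) - J (grid s t n (k + 1))|) := by
  have habel : ∀ j, ∑ k ∈ Finset.range j, Z k * (M (k + 1) - M k) =
      Z j * M j - ∑ k ∈ Finset.range j, M (k + 1) * (Z (k + 1) - Z k) := fun j => by
    induction j with
    | zero => simp [hM0]
    | succ j ih =>
      rw [Finset.sum_range_succ, Finset.sum_range_succ, ih]
      ring
  have hcell : ∀ k < n, |∫ v in (grid s t n k : ℝ)..grid s t n (k + 1), ζ v| ≤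
      C * (((t : ℝ) - s) / n) := fun k hk => by
    have hle : (grid s t n k : ℝ) ≤ grid s t n (k + 1) :=
      NNReal.coe_le_coe.2 (grid_mono n (Nat.le_succ k))
    have h := intervalIntegral.norm_integral_le_of_norm_le_const (f := ζ) (C := C)
      (a := (grid s t n k : ℝ)) (b := grid s t n (k + 1)) fun v hv => by
        rw [Set.uIoc_of_le hle] at hv
        have h1 : (s : ℝ) ≤ grid s t n k := NNReal.coe_le_coe.2 (grid_mem hst hk.le).1
        have h2 : (grid s t n (k + 1) : ℝ) ≤ t := NNReal.coe_le_coe.2 (grid_mem hst hk).2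
        exact hC v ⟨h1.trans_lt hv.1, hv.2.trans h2⟩
    rwa [grid_sub_grid hst, abs_of_nonneg (div_nonneg (sub_nonneg.2 (by exact_mod_cast hst))
      (Nat.cast_nonneg n)), Real.norm_eq_abs] at h
  have e1 : ∑ k ∈ Finset.range n, Z k * (M (k + 1) - M k) - (J t * Z n -
      ∑ k ∈ Finset.range n, J (grid s t n (k + 1)) *
        ∫ v in (grid s t n k : ℝ)..grid s t n (k + 1), ζ v) =
      Z n * (M n - J t) - ∑ k ∈ Finset.range n, (M (k + 1) - J (grid s t n (k + 1))) *
        ∫ v in (grid s t n k : ℝ)..grid s t n (k + 1), ζ v := by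
    rw [habel]
    have : ∑ k ∈ Finset.range n, M (k + 1) * (Z (k + 1) - Z k) =
        ∑ k ∈ Finset.range n, M (k + 1) *
          ∫ v in (grid s t n k : ℝ)..grid s t n (k + 1), ζ v :=
      Finset.sum_congr rfl fun k hk => by rw [hZ k (Finset.mem_range.1 hk)]
    simp only [this, sub_mul, Finset.sum_sub_distrib]
    ring
  rw [e1]
  refine (abs_sub _ _).trans (add_le_add (abs_mul _ _).le ?_)
  refine (Finset.abs_sum_le_sum_abs _ _).trans ?_
  rw [Finset.mul_sum, Finset.mul_sum]
  refine Finset.sum_le_sum fun k hk => ?_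
  rw [abs_mul]
  calc _ ≤ |M (k + 1) - J (grid s t n (k + 1))| * (C * (((t : ℝ) - s) / n)) := by
        gcongr
        exact hcell k (Finset.mem_range.1 hk)
    _ = _ := by
      field_simp

variable {Ω : Type*} {mΩ : MeasurableSpace Ω} {μ : Measure Ω} {𝓕 : Filtration ℝ≥0 mΩ}
  {W : ℝ≥0 → Ω → ℝ} {s t : ℝ≥0}

variable [IsProbabilityMeasure μ]

theorem IsIntegrand.eLpNorm_riemannSum_sub_le (hW : IsDriver μ 𝓕 W) {Q J : ℝ≥0 → Ω → ℝ}
    {K : ℝ≥0 → Lp ℝ 2 μ} (hQ : IsIntegrand μ 𝓕 s t Q K) (hst : s ≤ t)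
    (hJ : ∀ r ∈ Set.Icc s t, IsItoIntegral μ 𝓕 W Q s r (J r)) {ε : ℝ} (hε : 0 < ε) :
    ∃ n₀ : ℕ, ∀ n ≥ n₀, n ≠ 0 → ∀ i ≤ n,
      AEStronglyMeasurable (fun ω => riemannSum Q W s t n i ω - J (grid s t n i) ω) μ ∧
      eLpNorm (fun ω => riemannSum Q W s t n i ω - J (grid s t n i) ω) 2 μ ≤ ENNReal.ofReal ε := by
  obtain ⟨n₀, h⟩ := hQ.riemann_sum hW hst hε
  refine ⟨n₀, fun n hn hn0 i hi => ?_⟩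
  have hg := grid_mem hst hi
  obtain ⟨I, hI, hrel⟩ := (hJ _ hg).exists_itoRel hW (hQ.mono le_rfl hg.2)
  obtain ⟨R, hR, hle⟩ := h n hn hn0 i hi I hrel
  have he : (R - I : Lp ℝ 2 μ) =ᵐ[μ] fun ω => riemannSum Q W s t n i ω - J (grid s t n i) ω := by
    filter_upwards [Lp.coeFn_sub R I, hR, hI] with ω h1 h2 h3
    rw [h1, Pi.sub_apply, h2, h3]
    rfl
  refine ⟨(Lp.aestronglyMeasurable _).congr he, ?_⟩
  rw [← eLpNorm_congr_ae he, ← Lp.enorm_def, ← ofReal_norm]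
  exact ENNReal.ofReal_le_ofReal hle

/-- Integration by parts: if `R = ∑ Qⱼ Zⱼ`, where `Jⱼ = ∫ Qⱼ dW` and the paths of `Zⱼ` are
primitives of the bounded functions `ζⱼ`, then `∫ R dW = ∑ (Jⱼ Zⱼ - ∫ Jⱼ ζⱼ)`. The processes `Zⱼ`
and `ζⱼ` are not required to be adapted or to have moments. -/
theorem itoIntegral_ae_eq_sum {κ : Type*} [Fintype κ] (hW : IsDriver μ 𝓕 W) (hst : s ≤ t)
    {Q J : κ → ℝ≥0 → Ω → ℝ} {K : κ → ℝ≥0 → Lp ℝ 2 μ}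
    (hQ : ∀ j, IsIntegrand μ 𝓕 s t (Q j) (K j)) (hJ : ∀ j, IsItoProcess μ 𝓕 W (Q j) s (J j))
    {Z : κ → ℝ≥0 → Ω → ℝ} {ζ : κ → ℝ → Ω → ℝ}
    (hζi : ∀ ω j, IntervalIntegrable (fun v => ζ j v ω) volume s t)
    (hζb : ∀ ω j, ∃ C, ∀ v ∈ Set.Ioc (s : ℝ) t, |ζ j v ω| ≤ C)
    (hZ : ∀ ω j, ∀ r ∈ Set.Icc s t, Z j r ω - Z j s ω = ∫ v in (s : ℝ)..r, ζ j v ω)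
    {R : ℝ≥0 → Ω → ℝ} {KR : ℝ≥0 → Lp ℝ 2 μ} (hR : IsIntegrand μ 𝓕 s t R KR)
    (hRZ : ∀ r ∈ Set.Icc s t, R r =ᵐ[μ] fun ω => ∑ j, Q j r ω * Z j r ω) :
    itoIntegral μ 𝓕 W R s t =ᵐ[μ] fun ω =>
      ∑ j, (J j t ω * Z j t ω - ∫ v in (s : ℝ)..t, J j v.toNNReal ω * ζ j v ω) := by
  set I : ℝ≥0 → Ω → ℝ := fun r => itoIntegral μ 𝓕 W R s r with hIdef
  have hI : ∀ r ∈ Set.Icc s t, IsItoIntegral μ 𝓕 W R s r (I r) := fun r hr =>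
    (hR.mono le_rfl hr.2).isItoIntegral hW hr.1
  -- grids on which all Riemann sums are accurate
  have hpos : ∀ n : ℕ, (0 : ℝ) < 1 / ((n : ℝ) + 1) := fun n => by positivity
  choose nR hnR using fun n : ℕ => hR.eLpNorm_riemannSum_sub_le hW hst hI (hpos n)
  choose nQ hnQ using fun (n : ℕ) (j : κ) =>
    (hQ j).eLpNorm_riemannSum_sub_le hW hst (fun r hr => (hJ j).2 r hr.1) (hpos n)
  set L : ℕ → ℕ := fun n => n + 1 + nR n + ∑ j, nQ n j with hL
  have hL0 : ∀ n, L n ≠ 0 := fun n => by simp only [hL]; omega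
  have hLR : ∀ n, nR n ≤ L n := fun n => by simp only [hL]; omega
  have hLQ : ∀ n j, nQ n j ≤ L n := fun n j => by
    have := Finset.single_le_sum (f := fun j => nQ n j) (fun _ _ => Nat.zero_le _)
      (Finset.mem_univ j)
    simp only [hL]
    omega
  have hLt : Tendsto L atTop atTop := tendsto_atTop_mono
    (fun n => show n ≤ L n by simp only [hL]; omega) tendsto_id
  have hgr : ∀ n, grid s t (L n) (L n) = t := fun n => grid_self hst (hL0 n)
  -- the total error; it tends to `0` in `L²`, hence almost surely along a subsequence
  set E : ℕ → Ω → ℝ := fun n ω => ‖riemannSum R W s t (L n) (L n) ω - I (grid s t (L n) (L n)) ω‖ +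
    ∑ j, (‖riemannSum (Q j) W s t (L n) (L n) ω - J j (grid s t (L n) (L n)) ω‖ +
      ((L n : ℝ)⁻¹ * ∑ k ∈ Finset.range (L n),
        ‖riemannSum (Q j) W s t (L n) (k + 1) ω - J j (grid s t (L n) (k + 1)) ω‖)) with hE
  have hR1 := fun n => hnR n (L n) (hLR n) (hL0 n) (L n) le_rfl
  have hQ1 := fun n j => hnQ n j (L n) (hLQ n j) (hL0 n)
  have hsm : ∀ n j, AEStronglyMeasurable (fun ω => ∑ k ∈ Finset.range (L n),
      ‖riemannSum (Q j) W s t (L n) (k + 1) ω - J j (grid s t (L n) (k + 1)) ω‖) μ := fun n j =>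
    Finset.aestronglyMeasurable_fun_sum _ fun k hk =>
      (hQ1 n j (k + 1) (Finset.mem_range.1 hk)).1.norm
  have hjm : ∀ n j, AEStronglyMeasurable (fun ω =>
      ‖riemannSum (Q j) W s t (L n) (L n) ω - J j (grid s t (L n) (L n)) ω‖ +
      ((L n : ℝ)⁻¹ * ∑ k ∈ Finset.range (L n),
        ‖riemannSum (Q j) W s t (L n) (k + 1) ω - J j (grid s t (L n) (k + 1)) ω‖)) μ := fun n j =>
    (hQ1 n j (L n) le_rfl).1.norm.add ((hsm n j).const_mul _)
  have hEm : ∀ n, AEStronglyMeasurable (E n) μ := fun n =>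
    (hR1 n).1.norm.add (Finset.aestronglyMeasurable_fun_sum _ fun j _ => hjm n j)
  have hEb : ∀ n, eLpNorm (E n) 2 μ ≤
      (1 + 2 * Fintype.card κ) * ENNReal.ofReal (1 / ((n : ℝ) + 1)) := fun n => by
    set e := ENNReal.ofReal (1 / ((n : ℝ) + 1)) with he
    have hs1 : ∀ j, eLpNorm (fun ω => (L n : ℝ)⁻¹ * ∑ k ∈ Finset.range (L n),
        ‖riemannSum (Q j) W s t (L n) (k + 1) ω - J j (grid s t (L n) (k + 1)) ω‖) 2 μ ≤ e :=
      fun j => by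
        have h1 : eLpNorm (fun ω => ∑ k ∈ Finset.range (L n), ‖riemannSum (Q j) W s t (L n) (k + 1) ω
            - J j (grid s t (L n) (k + 1)) ω‖) 2 μ ≤ L n * e := by
          have h2 := eLpNorm_sum_le (μ := μ) (p := 2) (s := Finset.range (L n))
            (f := fun k ω => ‖riemannSum (Q j) W s t (L n) (k + 1) ω -
              J j (grid s t (L n) (k + 1)) ω‖)
            (fun k hk => (hQ1 n j (k + 1) (Finset.mem_range.1 hk)).1.norm) (by norm_num)
          have h3 : (fun ω => ∑ k ∈ Finset.range (L n), ‖riemannSum (Q j) W s t (L n) (k + 1) ω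
            - J j (grid s t (L n) (k + 1)) ω‖) = ∑ k ∈ Finset.range (L n), fun ω =>
              ‖riemannSum (Q j) W s t (L n) (k + 1) ω - J j (grid s t (L n) (k + 1)) ω‖ := by
            funext ω
            rw [Finset.sum_apply]
          rw [h3]
          refine h2.trans ((Finset.sum_le_card_nsmul _ _ e fun k hk => ?_).trans_eq (by simp))
          rw [eLpNorm_norm]
          exact (hQ1 n j (k + 1) (Finset.mem_range.1 hk)).2
        have h4 := eLpNorm_const_smul_le (c := (L n : ℝ)⁻¹) (p := 2) (μ := μ)
          (f := fun ω => ∑ k ∈ Finset.range (L n), ‖riemannSum (Q j) W s t (L n) (k + 1) ω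
            - J j (grid s t (L n) (k + 1)) ω‖)
        refine h4.trans ((mul_le_mul_right h1 _).trans ?_)
        have hLn : (0 : ℝ) < L n := by exact_mod_cast Nat.pos_of_ne_zero (hL0 n)
        have h5 : ‖(L n : ℝ)⁻¹‖ₑ = (L n : ℝ≥0∞)⁻¹ := by
          rw [Real.enorm_eq_ofReal (by positivity), ENNReal.ofReal_inv_of_pos hLn,
            ENNReal.ofReal_natCast]
        rw [h5, ← mul_assoc, ENNReal.inv_mul_cancel (by exact_mod_cast hL0 n) (by simp), one_mul]
    have hs2 : ∀ j, eLpNorm (fun ω =>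
        ‖riemannSum (Q j) W s t (L n) (L n) ω - J j (grid s t (L n) (L n)) ω‖ +
        ((L n : ℝ)⁻¹ * ∑ k ∈ Finset.range (L n),
          ‖riemannSum (Q j) W s t (L n) (k + 1) ω - J j (grid s t (L n) (k + 1)) ω‖)) 2 μ ≤
        2 * e := fun j => by
      refine (eLpNorm_add_le (hQ1 n j (L n) le_rfl).1.norm ((hsm n j).const_mul _)
        (by norm_num)).trans ?_
      rw [two_mul, eLpNorm_norm]
      exact add_le_add (hQ1 n j (L n) le_rfl).2 (hs1 j)
    refine (eLpNorm_add_le (hR1 n).1.norm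
      (Finset.aestronglyMeasurable_fun_sum _ fun j _ => hjm n j) (by norm_num)).trans ?_
    rw [eLpNorm_norm, add_mul, one_mul]
    refine add_le_add (hR1 n).2 ?_
    have h2 := eLpNorm_sum_le (μ := μ) (p := 2) (s := Finset.univ) (f := fun j ω =>
      ‖riemannSum (Q j) W s t (L n) (L n) ω - J j (grid s t (L n) (L n)) ω‖ +
        ((L n : ℝ)⁻¹ * ∑ k ∈ Finset.range (L n),
          ‖riemannSum (Q j) W s t (L n) (k + 1) ω - J j (grid s t (L n) (k + 1)) ω‖))
      (fun j _ => hjm n j) (by norm_num)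
    have h3 : (fun ω => ∑ j, (‖riemannSum (Q j) W s t (L n) (L n) ω -
        J j (grid s t (L n) (L n)) ω‖ + ((L n : ℝ)⁻¹ * ∑ k ∈ Finset.range (L n),
          ‖riemannSum (Q j) W s t (L n) (k + 1) ω - J j (grid s t (L n) (k + 1)) ω‖))) =
        ∑ j, fun ω => (‖riemannSum (Q j) W s t (L n) (L n) ω -
        J j (grid s t (L n) (L n)) ω‖ + ((L n : ℝ)⁻¹ * ∑ k ∈ Finset.range (L n),
          ‖riemannSum (Q j) W s t (L n) (k + 1) ω - J j (grid s t (L n) (k + 1)) ω‖)) := by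
      funext ω
      rw [Finset.sum_apply]
    rw [h3]
    refine h2.trans ((Finset.sum_le_card_nsmul _ _ (2 * e) fun j _ => hs2 j).trans_eq ?_)
    rw [Finset.card_univ, nsmul_eq_mul]
    ring
  have hE0 : Tendsto (fun n => eLpNorm (E n - 0) 2 μ) atTop (𝓝 0) := by
    simp only [sub_zero]
    refine tendsto_of_tendsto_of_tendsto_of_le_of_le tendsto_const_nhds ?_ (fun _ => zero_le) hEb
    have h1 := ENNReal.tendsto_ofReal (tendsto_one_div_add_atTop_nhds_zero_nat (𝕜 := ℝ))
    have h2 := ENNReal.Tendsto.const_mul (a := (1 + 2 * Fintype.card κ : ℝ≥0∞)) h1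
      (Or.inr (by simp [ENNReal.mul_eq_top]))
    simpa using h2
  obtain ⟨ns, hns, hae⟩ := (tendstoInMeasure_of_tendsto_eLpNorm two_ne_zero hEm
    aestronglyMeasurable_zero hE0).exists_seq_tendsto_ae
  have hRZ' : ∀ᵐ ω ∂μ, ∀ n k : ℕ, k ≤ n →
      R (grid s t n k) ω = ∑ j, Q j (grid s t n k) ω * Z j (grid s t n k) ω := by
    refine ae_all_iff.2 fun n => ae_all_iff.2 fun k => ?_
    by_cases hk : k ≤ n
    · filter_upwards [hRZ _ (grid_mem hst hk)] with ω h _ using h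
    · exact ae_of_all _ fun ω h => absurd h hk
  filter_upwards [hae, hRZ'] with ω hω hRω
  choose C hC using hζb ω
  -- the Riemann sums of `∫ R dW`, rearranged
  set A : ℕ → ℝ := fun n => ∑ j, (J j t ω * Z j t ω - ∑ k ∈ Finset.range (L n),
    J j (grid s t (L n) (k + 1)) ω *
      ∫ v in (grid s t (L n) k : ℝ)..grid s t (L n) (k + 1), ζ j v ω) with hA
  have hAlim : Tendsto A atTop (𝓝 (∑ j, (J j t ω * Z j t ω -
      ∫ v in (s : ℝ)..t, J j v.toNNReal ω * ζ j v ω))) := by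
    refine tendsto_finsetSum _ fun j _ => tendsto_const_nhds.sub ?_
    exact (tendsto_sum_mul_integral_grid ((hJ j).1 ω) hst (hζi ω j)
      (p := fun n k => grid s t n (k + 1)) fun n k _ => ⟨grid_mono n (Nat.le_succ k), le_rfl⟩).comp
      hLt
  have hZt : ∀ j n, Z j (grid s t (L n) (L n)) ω = Z j t ω := fun j n => by rw [hgr]
  set D : ℝ := 1 + ∑ j, (|Z j t ω| + |C j| * ((t : ℝ) - s)) with hD
  have hts : 0 ≤ (t : ℝ) - s := sub_nonneg.2 (by exact_mod_cast hst)
  have hbound : ∀ n, |A n - I t ω| ≤ D * E n ω := fun n => by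
    have hRs : riemannSum R W s t (L n) (L n) ω = ∑ j, ∑ k ∈ Finset.range (L n),
        Z j (grid s t (L n) k) ω * (riemannSum (Q j) W s t (L n) (k + 1) ω -
          riemannSum (Q j) W s t (L n) k ω) := by
      rw [riemannSum, Finset.sum_comm]
      refine Finset.sum_congr rfl fun k hk => ?_
      rw [hRω _ _ (Finset.mem_range.1 hk).le, Finset.sum_mul]
      refine Finset.sum_congr rfl fun j _ => ?_
      rw [riemannSum, riemannSum, Finset.sum_range_succ]
      ring
    have hj : ∀ j, |∑ k ∈ Finset.range (L n), Z j (grid s t (L n) k) ω *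
        (riemannSum (Q j) W s t (L n) (k + 1) ω - riemannSum (Q j) W s t (L n) k ω) -
        (J j t ω * Z j t ω - ∑ k ∈ Finset.range (L n), J j (grid s t (L n) (k + 1)) ω *
          ∫ v in (grid s t (L n) k : ℝ)..grid s t (L n) (k + 1), ζ j v ω)| ≤
        (|Z j t ω| + |C j| * ((t : ℝ) - s)) * E n ω := fun j => by
      have h := abs_sum_mul_increment_sub_le hst (M := fun k => riemannSum (Q j) W s t (L n) k ω)
        (Z := fun k => Z j (grid s t (L n) k) ω) (J := fun r => J j r ω) (ζ := fun v => ζ j v ω)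
        (C := |C j|) (fun v hv => (hC j v hv).trans (le_abs_self _)) (hL0 n)
        (by simp [riemannSum]) fun k hk => by
          have h1 := hZ ω j _ (grid_mem hst (Nat.succ_le_of_lt hk))
          have h2 := hZ ω j _ (grid_mem hst hk.le)
          have hi : ∀ r ∈ Set.Icc s t, IntervalIntegrable (fun v => ζ j v ω) volume s r :=
            fun r hr => (hζi ω j).mono_set (by
              have e1 : (s : ℝ) ≤ r := by exact_mod_cast hr.1
              have e2 : (r : ℝ) ≤ t := by exact_mod_cast hr.2
              rw [Set.uIcc_of_le e1, Set.uIcc_of_le (e1.trans e2)]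
              exact Set.Icc_subset_Icc_right e2)
          rw [← intervalIntegral.integral_interval_sub_left
            (hi _ (grid_mem hst (Nat.succ_le_of_lt hk))) (hi _ (grid_mem hst hk.le)), ← h1, ← h2]
          ring
      simp only [hZt] at h
      refine h.trans ?_
      have hEj : ‖riemannSum (Q j) W s t (L n) (L n) ω - J j (grid s t (L n) (L n)) ω‖ +
          ((L n : ℝ)⁻¹ * ∑ k ∈ Finset.range (L n),
            ‖riemannSum (Q j) W s t (L n) (k + 1) ω - J j (grid s t (L n) (k + 1)) ω‖) ≤ E n ω := by
        refine (Finset.single_le_sum (f := fun j =>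
          ‖riemannSum (Q j) W s t (L n) (L n) ω - J j (grid s t (L n) (L n)) ω‖ +
          ((L n : ℝ)⁻¹ * ∑ k ∈ Finset.range (L n),
            ‖riemannSum (Q j) W s t (L n) (k + 1) ω - J j (grid s t (L n) (k + 1)) ω‖))
          (fun j _ => by positivity) (Finset.mem_univ j)).trans ?_
        exact le_add_of_nonneg_left (norm_nonneg _)
      rw [hgr] at hEj
      simp only [Real.norm_eq_abs] at hEj
      have p1 := abs_nonneg (riemannSum (Q j) W s t (L n) (L n) ω - J j t ω)
      have p2 : 0 ≤ (L n : ℝ)⁻¹ * ∑ k ∈ Finset.range (L n),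
        |riemannSum (Q j) W s t (L n) (k + 1) ω - J j (grid s t (L n) (k + 1)) ω| := by positivity
      rw [add_mul]
      exact add_le_add (mul_le_mul_of_nonneg_left (by linarith) (abs_nonneg _))
        (mul_le_mul_of_nonneg_left (by linarith) (by positivity))
    have hE1 : |riemannSum R W s t (L n) (L n) ω - I t ω| ≤ E n ω := by
      have : ‖riemannSum R W s t (L n) (L n) ω - I (grid s t (L n) (L n)) ω‖ ≤ E n ω :=
        le_add_of_nonneg_right (Finset.sum_nonneg fun j _ => by positivity)
      rwa [hgr, Real.norm_eq_abs] at this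
    have e1 : A n - I t ω = (riemannSum R W s t (L n) (L n) ω - I t ω) -
        ∑ j, (∑ k ∈ Finset.range (L n), Z j (grid s t (L n) k) ω *
        (riemannSum (Q j) W s t (L n) (k + 1) ω - riemannSum (Q j) W s t (L n) k ω) -
        (J j t ω * Z j t ω - ∑ k ∈ Finset.range (L n), J j (grid s t (L n) (k + 1)) ω *
          ∫ v in (grid s t (L n) k : ℝ)..grid s t (L n) (k + 1), ζ j v ω)) := by
      rw [Finset.sum_sub_distrib, ← hRs, hA]
      ring
    rw [e1, hD, add_mul, one_mul, Finset.sum_mul]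
    refine (abs_sub _ _).trans (add_le_add hE1 ((Finset.abs_sum_le_sum_abs _ _).trans ?_))
    exact Finset.sum_le_sum fun j _ => hj j
  have hlim2 : Tendsto (fun n => A (ns n)) atTop (𝓝 (I t ω)) := by
    rw [tendsto_iff_norm_sub_tendsto_zero]
    refine squeeze_zero (fun _ => norm_nonneg _) (fun n => hbound (ns n)) ?_
    simpa using hω.const_mul D
  exact tendsto_nhds_unique hlim2 (hAlim.comp hns.tendsto_atTop)

end IntegrationByParts

/-! ### Integrals over simplices -/

section Simplex

theorem measurableSet_openSimplex (k : ℕ) (s t : ℝ≥0) : MeasurableSet (openSimplex k s t) := by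
  have h : openSimplex k s t = (⋂ (i : Fin k) (j : Fin k) (_ : i < j), {τ | τ i < τ j}) ∩
      ⋂ i : Fin k, {τ | (s : ℝ) < τ i ∧ τ i < (t : ℝ)} := by
    ext τ
    simp [openSimplex, StrictMono]
  rw [h]
  refine MeasurableSet.inter (MeasurableSet.iInter fun i => MeasurableSet.iInter fun j =>
    MeasurableSet.iInter fun _ => measurableSet_lt (measurable_pi_apply i) (measurable_pi_apply j))
    (MeasurableSet.iInter fun i => (measurableSet_lt measurable_const (measurable_pi_apply i)).inter
      (measurableSet_lt (measurable_pi_apply i) measurable_const))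

theorem openSimplex_subset (k : ℕ) (s t : ℝ≥0) :
    openSimplex k s t ⊆ Set.Icc (fun _ => (s : ℝ)) fun _ => (t : ℝ) :=
  fun _ h => ⟨fun i => (h.2 i).1.le, fun i => (h.2 i).2.le⟩

theorem simplexIntegrable_of_continuous {k : ℕ} {F : (Fin k → ℝ≥0) → ℝ} (hF : Continuous F)
    (s t : ℝ≥0) : SimplexIntegrable k s t F := by
  have hc : Continuous fun τ : Fin k → ℝ => F fun i => (τ i).toNNReal := by fun_prop
  exact (hc.continuousOn.integrableOn_compact isCompact_Icc).mono_set (openSimplex_subset k s t)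

/-- The region `{(v, τ) : s < v < r, s < τ₁ < ⋯ < τₖ < v}`. -/
def simplexRegion (k : ℕ) (s r : ℝ≥0) : Set (ℝ × (Fin k → ℝ)) :=
  {p | (s : ℝ) < p.1 ∧ p.1 < r ∧ p.2 ∈ openSimplex k s p.1.toNNReal}

theorem mem_simplexRegion_iff {k : ℕ} {s r : ℝ≥0} {p : ℝ × (Fin k → ℝ)} :
    p ∈ simplexRegion k s r ↔ (s : ℝ) < p.1 ∧ p.1 < r ∧ StrictMono p.2 ∧
      ∀ i, (s : ℝ) < p.2 i ∧ p.2 i < p.1 := by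
  refine and_congr_right fun h => ?_
  rw [openSimplex, Set.mem_ofPred_eq, Real.coe_toNNReal _ (s.coe_nonneg.trans h.le)]

theorem snoc_mem_openSimplex {k : ℕ} {s r : ℝ≥0} {v : ℝ} {τ : Fin k → ℝ} :
    (Fin.snoc (α := fun _ => ℝ) τ v : Fin (k + 1) → ℝ) ∈ openSimplex (k + 1) s r ↔
      (v, τ) ∈ simplexRegion k s r := by
  rw [mem_simplexRegion_iff, openSimplex, Set.mem_ofPred_eq, Fin.forall_fin_succ']
  simp only [Fin.snoc_castSucc, Fin.snoc_last]
  constructor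
  · rintro ⟨hm, h1, h2⟩
    have hlt : ∀ i, τ i < v := fun i => by
      simpa using hm (Fin.castSucc_lt_last i)
    refine ⟨h2.1, h2.2, fun i j hij => ?_, fun i => ⟨(h1 i).1, hlt i⟩⟩
    simpa using hm (Fin.castSucc_lt_castSucc_iff.2 hij)
  · rintro ⟨h1, h2, hm, h3⟩
    refine ⟨fun i j hij => ?_, fun i => ⟨(h3 i).1, (h3 i).2.trans h2⟩, h1, h2⟩
    induction j using Fin.lastCases with
    | last =>
      obtain ⟨i, rfl⟩ := Fin.exists_castSucc_eq.2 hij.ne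
      simpa using (h3 i).2
    | cast j =>
      obtain ⟨i, rfl⟩ := Fin.exists_castSucc_eq.2 (hij.trans (Fin.castSucc_lt_last j)).ne
      simpa using hm (Fin.castSucc_lt_castSucc_iff.1 hij)

theorem measurePreserving_snoc (k : ℕ) : MeasurePreserving
    (fun p : ℝ × (Fin k → ℝ) => (Fin.snoc (α := fun _ => ℝ) p.2 p.1 : Fin (k + 1) → ℝ))
    volume volume := by
  have h := (volume_preserving_piFinSuccAbove (fun _ : Fin (k + 1) => ℝ) (Fin.last k)).symm
  have he : (MeasurableEquiv.piFinSuccAbove (fun _ : Fin (k + 1) => ℝ) (Fin.last k)).symm =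
      fun p : ℝ × (Fin k → ℝ) => (Fin.snoc (α := fun _ => ℝ) p.2 p.1 : Fin (k + 1) → ℝ) := by
    funext p
    simp [MeasurableEquiv.piFinSuccAbove_symm_apply, Fin.insertNthEquiv]
  rwa [he] at h

theorem measurableEmbedding_snoc (k : ℕ) : MeasurableEmbedding
    (fun p : ℝ × (Fin k → ℝ) => (Fin.snoc (α := fun _ => ℝ) p.2 p.1 : Fin (k + 1) → ℝ)) := by
  have h := (MeasurableEquiv.piFinSuccAbove (fun _ : Fin (k + 1) => ℝ)
    (Fin.last k)).symm.measurableEmbedding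
  convert h using 1
  funext p
  simp [MeasurableEquiv.piFinSuccAbove_symm_apply, Fin.insertNthEquiv]

variable {k : ℕ} {F : (Fin (k + 1) → ℝ≥0) → ℝ}

/-- The integrand over the simplex region. -/
noncomputable def regionFun (F : (Fin (k + 1) → ℝ≥0) → ℝ) (s r : ℝ≥0) : ℝ × (Fin k → ℝ) → ℝ :=
  (simplexRegion k s r).indicator fun p =>
    F (Fin.snoc (α := fun _ => ℝ≥0) (fun i => (p.2 i).toNNReal) p.1.toNNReal)

theorem snoc_toNNReal (p : ℝ × (Fin k → ℝ)) :
    (fun i => ((Fin.snoc (α := fun _ => ℝ) p.2 p.1 : Fin (k + 1) → ℝ) i).toNNReal) =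
      (Fin.snoc (α := fun _ => ℝ≥0) (fun i => (p.2 i).toNNReal) p.1.toNNReal :
        Fin (k + 1) → ℝ≥0) := by
  funext i
  induction i using Fin.lastCases <;> simp

theorem simplexIntegral_succ_eq_region (F : (Fin (k + 1) → ℝ≥0) → ℝ) (s r : ℝ≥0) :
    simplexIntegral (k + 1) s r F = ∫ p, regionFun F s r p := by
  rw [simplexIntegral, ← integral_indicator (measurableSet_openSimplex _ _ _),
    ← (measurePreserving_snoc k).integral_comp (measurableEmbedding_snoc k)]
  refine integral_congr_ae (Eventually.of_forall fun p => ?_)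
  by_cases hp : p ∈ simplexRegion k s r
  · simp only [regionFun, Set.indicator_of_mem hp]
    rw [Set.indicator_of_mem (snoc_mem_openSimplex.2 hp), snoc_toNNReal]
  · simp only [regionFun, Set.indicator_of_notMem hp]
    rw [Set.indicator_of_notMem fun h => hp (snoc_mem_openSimplex.1 h)]

theorem integrable_regionFun (hF : Continuous F) (s r : ℝ≥0) : Integrable (regionFun F s r) := by
  have h : IntegrableOn (fun τ : Fin (k + 1) → ℝ => F fun i => (τ i).toNNReal)
      (openSimplex (k + 1) s r) volume := simplexIntegrable_of_continuous hF s r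
  rw [← integrable_indicator_iff (measurableSet_openSimplex _ _ _),
    ← (measurePreserving_snoc k).integrable_comp_emb (measurableEmbedding_snoc k)] at h
  refine h.congr (Eventually.of_forall fun p => ?_)
  by_cases hp : p ∈ simplexRegion k s r
  · simp only [regionFun, Set.indicator_of_mem hp, Function.comp_apply]
    rw [Set.indicator_of_mem (snoc_mem_openSimplex.2 hp), snoc_toNNReal]
  · simp only [regionFun, Set.indicator_of_notMem hp, Function.comp_apply]
    rw [Set.indicator_of_notMem fun h => hp (snoc_mem_openSimplex.1 h)]

theorem integral_regionFun_left (s r : ℝ≥0) (v : ℝ) : ∫ τ, regionFun F s r (v, τ) =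
    (Set.Ioo (s : ℝ) r).indicator (fun v => simplexIntegral k s v.toNNReal fun τ =>
      F (Fin.snoc (α := fun _ => ℝ≥0) τ v.toNNReal)) v := by
  by_cases hv : v ∈ Set.Ioo (s : ℝ) r
  · rw [Set.indicator_of_mem hv, simplexIntegral,
      ← integral_indicator (measurableSet_openSimplex _ _ _)]
    refine integral_congr_ae (Eventually.of_forall fun τ => ?_)
    by_cases hτ : τ ∈ openSimplex k s v.toNNReal
    · have : (v, τ) ∈ simplexRegion k s r := ⟨hv.1, hv.2, hτ⟩
      simp only [regionFun, Set.indicator_of_mem this, Set.indicator_of_mem hτ]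
    · have : (v, τ) ∉ simplexRegion k s r := fun h => hτ h.2.2
      simp only [regionFun, Set.indicator_of_notMem this, Set.indicator_of_notMem hτ]
  · rw [Set.indicator_of_notMem hv]
    have : ∀ τ, (v, τ) ∉ simplexRegion k s r := fun τ h => hv ⟨h.1, h.2.1⟩
    simp [regionFun, this]

theorem intervalIntegrable_simplexIntegral (hF : Continuous F) {s r : ℝ≥0} (hsr : s ≤ r) :
    IntervalIntegrable (fun v => simplexIntegral k s v.toNNReal fun τ =>
      F (Fin.snoc (α := fun _ => ℝ≥0) τ v.toNNReal)) volume s r := by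
  rw [intervalIntegrable_iff_integrableOn_Ioo_of_le (by exact_mod_cast hsr),
    ← integrable_indicator_iff measurableSet_Ioo]
  have h := (integrable_regionFun hF s r).integral_prod_left
  exact h.congr (Eventually.of_forall fun v => integral_regionFun_left s r v)

/-- Integration over the simplex with the last variable outermost. -/
theorem simplexIntegral_succ (hF : Continuous F) {s r : ℝ≥0} (hsr : s ≤ r) :
    simplexIntegral (k + 1) s r F = ∫ v in (s : ℝ)..r, simplexIntegral k s v.toNNReal fun τ =>
      F (Fin.snoc (α := fun _ => ℝ≥0) τ v.toNNReal) := by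
  rw [simplexIntegral_succ_eq_region, Measure.volume_eq_prod,
    integral_prod _ (integrable_regionFun hF s r),
    intervalIntegral.integral_of_le (by exact_mod_cast hsr),
    integral_Ioc_eq_integral_Ioo, ← integral_indicator measurableSet_Ioo]
  exact integral_congr_ae (Eventually.of_forall fun v => integral_regionFun_left s r v)

/-- Integration over the simplex with the last variable innermost. -/
theorem simplexIntegral_succ' {F : (Fin (k + 2) → ℝ≥0) → ℝ} (hF : Continuous F) (s r : ℝ≥0) :
    simplexIntegral (k + 2) s r F = simplexIntegral (k + 1) s r fun τ =>
      ∫ v in (τ (Fin.last k) : ℝ)..r, F (Fin.snoc (α := fun _ => ℝ≥0) τ v.toNNReal) := by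
  rw [simplexIntegral_succ_eq_region, Measure.volume_eq_prod,
    integral_prod_symm _ (integrable_regionFun hF s r), simplexIntegral,
    ← integral_indicator (measurableSet_openSimplex _ _ _)]
  refine integral_congr_ae (Eventually.of_forall fun τ => ?_)
  by_cases hτ : τ ∈ openSimplex (k + 1) s r
  · have h0 : (0 : ℝ) ≤ τ (Fin.last k) := s.coe_nonneg.trans (hτ.2 _).1.le
    simp only [Set.indicator_of_mem hτ]
    rw [Real.coe_toNNReal _ h0, intervalIntegral.integral_of_le (hτ.2 _).2.le,
      integral_Ioc_eq_integral_Ioo, ← integral_indicator measurableSet_Ioo]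
    refine integral_congr_ae (Eventually.of_forall fun v => ?_)
    have hiff : (v, τ) ∈ simplexRegion (k + 1) s r ↔ v ∈ Set.Ioo (τ (Fin.last k)) r := by
      rw [mem_simplexRegion_iff]
      refine ⟨fun h => ⟨(h.2.2.2 _).2, h.2.1⟩, fun h => ⟨(hτ.2 _).1.trans h.1, h.2, hτ.1,
        fun i => ⟨(hτ.2 i).1, (hτ.1.monotone (Fin.le_last i)).trans_lt h.1⟩⟩⟩
    by_cases hv : v ∈ Set.Ioo (τ (Fin.last k)) r
    · simp only [regionFun, Set.indicator_of_mem (hiff.2 hv), Set.indicator_of_mem hv]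
    · simp only [regionFun, Set.indicator_of_notMem fun h => hv (hiff.1 h),
        Set.indicator_of_notMem hv]
  · simp only [Set.indicator_of_notMem hτ]
    have : ∀ v, (v, τ) ∉ simplexRegion (k + 1) s r := fun v h => by
      rw [mem_simplexRegion_iff] at h
      exact hτ ⟨h.2.2.1, fun i => ⟨(h.2.2.2 i).1, (h.2.2.2 i).2.trans h.2.1⟩⟩
    simp [regionFun, this]

theorem simplexIntegral_self {k : ℕ} (s : ℝ≥0) (F : (Fin (k + 1) → ℝ≥0) → ℝ) :
    simplexIntegral (k + 1) s s F = 0 := by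
  have : openSimplex (k + 1) s s = ∅ := by
    ext τ
    simp only [openSimplex, Set.mem_ofPred_eq, Set.mem_empty_iff_false, iff_false, not_and]
    exact fun _ h => lt_asymm (h 0).1 (h 0).2
  rw [simplexIntegral, this, setIntegral_empty]

theorem exists_abs_simplexIntegral_le {k : ℕ} {F : (Fin (k + 1) → ℝ≥0) → ℝ} (hF : Continuous F)
    (s t : ℝ≥0) : ∃ C, ∀ v ∈ Set.Ioc (s : ℝ) t, |simplexIntegral k s v.toNNReal fun τ =>
      F (Fin.snoc (α := fun _ => ℝ≥0) τ v.toNNReal)| ≤ C := by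
  obtain ⟨C, hC⟩ := (isCompact_le (k + 1) t).exists_bound_of_continuousOn hF.continuousOn
  have hC0 : 0 ≤ C := (norm_nonneg _).trans (hC (fun _ => 0) fun _ => zero_le)
  have hfin : volume (Set.Icc (fun _ : Fin k => (s : ℝ)) fun _ => (t : ℝ)) < ∞ :=
    isCompact_Icc.measure_lt_top
  refine ⟨C * volume.real (Set.Icc (fun _ : Fin k => (s : ℝ)) fun _ => (t : ℝ)), fun v hv => ?_⟩
  have hv' := toNNReal_mem_Ioc hv
  have hsub : openSimplex k s v.toNNReal ⊆ Set.Icc (fun _ : Fin k => (s : ℝ)) fun _ => (t : ℝ) :=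
    (openSimplex_subset _ _ _).trans (Set.Icc_subset_Icc_right fun _ =>
      NNReal.coe_le_coe.2 hv'.2)
  have h1 := norm_setIntegral_le_of_norm_le_const (μ := volume) (s := openSimplex k s v.toNNReal)
    (f := fun τ : Fin k → ℝ => F (Fin.snoc (α := fun _ => ℝ≥0) (fun i => (τ i).toNNReal)
      v.toNNReal)) (C := C) ((measure_mono hsub).trans_lt hfin) fun τ hτ => by
      refine hC _ fun i => ?_
      induction i using Fin.lastCases with
      | last => simpa using hv'.2
      | cast i =>
        rw [Fin.snoc_castSucc]
        exact Real.toNNReal_le_iff_le_coe.2 (((hτ.2 i).2.le.trans (NNReal.coe_le_coe.2 hv'.2)))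
  refine h1.trans ?_
  gcongr
  exact hfin.ne

end Simplex

/-! ### Polynomials in iterated integrals -/

section Theta

variable {Ω : Type*} {mΩ : MeasurableSpace Ω} {μ : Measure Ω} {𝓕 : Filtration ℝ≥0 mΩ}
  {d₂ : ℕ} {Y : Fin d₂ → ℝ≥0 → Ω → ℝ} {k deg : ℕ} {b : ℝ≥0 → (Fin k → ℝ≥0) → Ω → ℝ}

theorem continuous_of_mem_thetaSpace [IsProbabilityMeasure μ] (hY : ∀ i, IsDriver μ 𝓕 (Y i))
    (hb : b ∈ thetaSpace μ 𝓕 Y k deg) (s : ℝ≥0) (ω : Ω) : Continuous fun τ => b s τ ω := by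
  induction hb using Submodule.span_induction with
  | mem f hf =>
    obtain ⟨r, n, w, σ, -, -, rfl⟩ := hf
    exact continuous_finsetProd _ fun i _ =>
      (continuous_iterQ hY s (n i) (w i) ω).comp (continuous_apply (σ i))
  | zero => exact continuous_const
  | add f g _ _ hf hg => exact hf.add hg
  | smul c f _ hf => exact hf.const_smul c

theorem thetaSpace_comp {k' : ℕ} (hb : b ∈ thetaSpace μ 𝓕 Y k deg) (ρ : Fin k → Fin k') :
    (fun s τ ω => b s (fun i => τ (ρ i)) ω) ∈ thetaSpace μ 𝓕 Y k' deg := by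
  induction hb using Submodule.span_induction with
  | mem f hf =>
    obtain ⟨r, n, w, σ, h1, h2, rfl⟩ := hf
    exact Submodule.subset_span ⟨r, n, w, fun i => ρ (σ i), h1, h2, rfl⟩
  | zero => exact Submodule.zero_mem _
  | add f g _ _ hf hg => exact Submodule.add_mem _ hf hg
  | smul c f _ hf => exact Submodule.smul_mem _ c hf

theorem iterQ_mem_thetaSpace {n : ℕ} (hn : 0 < n) (w : Fin n → Fin d₂) (p : Fin k) :
    (fun s τ ω => iterQ μ 𝓕 Y s n w (τ p) ω) ∈ thetaSpace μ 𝓕 Y k n :=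
  Submodule.subset_span ⟨1, fun _ => n, fun _ => w, fun _ => p, fun _ => hn, by simp, by simp⟩

theorem iterQ_mul_mem_thetaSpace (hb : b ∈ thetaSpace μ 𝓕 Y k deg) {n : ℕ} (hn : 0 < n)
    (w : Fin n → Fin d₂) (p : Fin k) :
    (fun s τ ω => iterQ μ 𝓕 Y s n w (τ p) ω * b s τ ω) ∈ thetaSpace μ 𝓕 Y k (n + deg) := by
  induction hb using Submodule.span_induction with
  | mem f hf =>
    obtain ⟨r, n', w', σ, h1, h2, rfl⟩ := hf
    refine Submodule.subset_span ⟨r + 1, Fin.cons n n', Fin.cons w w', Fin.cons p σ, ?_, ?_, ?_⟩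
    · exact Fin.cases hn h1
    · rw [Fin.sum_univ_succ, Fin.cons_zero]
      simp only [Fin.cons_succ, h2]
    · funext s τ ω
      rw [Fin.prod_univ_succ]
      rfl
  | zero =>
    simp only [Pi.zero_apply, mul_zero]
    exact Submodule.zero_mem _
  | add f g _ _ hf hg =>
    simp only [Pi.add_apply, mul_add]
    exact Submodule.add_mem _ hf hg
  | smul c f _ hf =>
    simp only [Pi.smul_apply, mul_smul_comm]
    exact Submodule.smul_mem _ c hf

end Theta

/-! ### The terms of the representation -/

section Terms

/-- The data of a term
`q^w_{s,t}(Y) ∫ b_{s,τ}(Y) P_{τ₀-s} T₀ P_{τ₁-τ₀} ⋯ Tₖ P_{t-τₖ} φ dτ` of the representation: `k + 1`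
is the number of times, `words` is the decomposition of the word, `deg` is the degree of `b`, and
`len` is the length of `w`. The case `len = 0`, in which the factor in front is `1`, is allowed. -/
structure RepTerm (Ω : Type*) (N d₂ : ℕ) where
  k : ℕ
  len : ℕ
  deg : ℕ
  w : Fin len → Fin d₂
  words : Fin (k + 1) → List (Fin d₂)
  T : Fin (k + 1) → FunOp N
  b : ℝ≥0 → (Fin (k + 1) → ℝ≥0) → Ω → ℝ

namespace RepTerm

variable {Ω : Type*} {mΩ : MeasurableSpace Ω} {μ : Measure Ω} {𝓕 : Filtration ℝ≥0 mΩ}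
  {N d₁ d₂ : ℕ} {Y : Fin d₂ → ℝ≥0 → Ω → ℝ} {V₀ : StateSpace N → StateSpace N}
  {V : Fin d₁ → StateSpace N → StateSpace N} {h : Fin d₂ → StateSpace N → ℝ}
  {P : ℝ≥0 → FunOp N} {A : FunOp N} {word : List (Fin d₂)}

/-- The conditions on the data of a term for the given word: the words `words p` decompose it, the
operators belong to the corresponding sets `Γ`, and the total degree is its length. -/
structure IsValid (μ : Measure Ω) (𝓕 : Filtration ℝ≥0 mΩ) (Y : Fin d₂ → ℝ≥0 → Ω → ℝ)
    (V₀ : StateSpace N → StateSpace N) (V : Fin d₁ → StateSpace N → StateSpace N)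
    (h : Fin d₂ → StateSpace N → ℝ) (word : List (Fin d₂)) (D : RepTerm Ω N d₂) : Prop where
  words_ne : ∀ p, D.words p ≠ []
  flatten : (List.ofFn D.words).flatten = word
  gamma : ∀ p, D.T p ∈ opGamma V₀ V h (D.words p)
  theta : D.b ∈ thetaSpace μ 𝓕 Y (D.k + 1) D.deg
  deg_pos : 0 < D.deg
  len_add_deg : D.len + D.deg = word.length

/-- The integrand of a term. -/
def integrand (P : ℝ≥0 → FunOp N) (D : RepTerm Ω N d₂) (s t : ℝ≥0) (φ : StateSpace N → ℝ)
    (x : StateSpace N) (ω : Ω) (τ : Fin (D.k + 1) → ℝ≥0) : ℝ :=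
  D.b s τ ω * kernelOp P s (D.k + 1) D.T τ t φ x

/-- The value of a term: the simplex integral times the iterated integral in front. -/
noncomputable def value (μ : Measure Ω) (𝓕 : Filtration ℝ≥0 mΩ) (Y : Fin d₂ → ℝ≥0 → Ω → ℝ)
    (P : ℝ≥0 → FunOp N) (D : RepTerm Ω N d₂) (s t : ℝ≥0) (φ : StateSpace N → ℝ)
    (x : StateSpace N) (ω : Ω) : ℝ :=
  iterQ μ 𝓕 Y s D.len D.w t ω * simplexIntegral (D.k + 1) s t (D.integrand P s t φ x ω)

/-- Multiplication by `h_i` is absorbed by the last operator. -/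
def merge (h : Fin d₂ → StateSpace N → ℝ) (D : RepTerm Ω N d₂) (i : Fin d₂) : RepTerm Ω N d₂ :=
  ⟨D.k, D.len + 1, D.deg, Fin.snoc (α := fun _ => Fin d₂) D.w i,
    Fin.snoc (α := fun _ => List (Fin d₂)) (Fin.init D.words) (D.words (Fin.last D.k) ++ [i]),
    Fin.snoc (α := fun _ => FunOp N) (Fin.init D.T) (D.T (Fin.last D.k) ∘ opPhi h [i]), D.b⟩

/-- A new operator `Ψ_i` at a new last time. -/
noncomputable def extend (V₀ : StateSpace N → StateSpace N) (V : Fin d₁ → StateSpace N → StateSpace N)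
    (h : Fin d₂ → StateSpace N → ℝ) (D : RepTerm Ω N d₂) (i : Fin d₂) : RepTerm Ω N d₂ :=
  ⟨D.k + 1, D.len + 1, D.deg, Fin.snoc (α := fun _ => Fin d₂) D.w i,
    Fin.snoc (α := fun _ => List (Fin d₂)) D.words [i],
    Fin.snoc (α := fun _ => FunOp N) D.T (opPsi V₀ V h [i]),
    fun s τ ω => D.b s (fun p => τ p.castSucc) ω⟩

/-- The iterated integral in front is moved into the coefficient, where it is taken at the last
time and with a minus sign. -/
noncomputable def absorb (μ : Measure Ω) (𝓕 : Filtration ℝ≥0 mΩ) (Y : Fin d₂ → ℝ≥0 → Ω → ℝ)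
    (D : RepTerm Ω N d₂) : RepTerm Ω N d₂ :=
  ⟨D.k, 0, D.len + D.deg, Fin.elim0, D.words, D.T,
    fun s τ ω => -(iterQ μ 𝓕 Y s D.len D.w (τ (Fin.last D.k)) ω * D.b s τ ω)⟩

variable {D : RepTerm Ω N d₂}

theorem ofFn_snoc {α : Type*} {n : ℕ} (f : Fin n → α) (a : α) :
    List.ofFn (Fin.snoc (α := fun _ => α) f a : Fin (n + 1) → α) = List.ofFn f ++ [a] := by
  rw [List.ofFn_succ', List.concat_eq_append]
  simp

theorem forall_snoc {α β : Type*} {n : ℕ} {f : Fin n → α} {g : Fin n → β} {a : α} {b : β}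
    {R : α → β → Prop} (hfg : ∀ p, R (f p) (g p)) (hab : R a b) (p : Fin (n + 1)) :
    R (Fin.snoc (α := fun _ => α) f a p) (Fin.snoc (α := fun _ => β) g b p) := by
  induction p using Fin.lastCases with
  | last => simpa using hab
  | cast p => simpa using hfg p

/-- The innermost operator of a kernel can be regarded as part of the function it is applied to. -/
theorem _root_.kernelOp_snoc (P : ℝ≥0 → FunOp N) (s : ℝ≥0) {k : ℕ} (T : Fin k → FunOp N)
    (S : FunOp N) (τ : Fin (k + 1) → ℝ≥0) (t : ℝ≥0) (φ : StateSpace N → ℝ) :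
    kernelOp P s (k + 1) (Fin.snoc (α := fun _ => FunOp N) T S) τ t φ =
      kernelOp P s k T (Fin.init τ) (τ (Fin.last k)) (S (P (t - τ (Fin.last k)) φ)) := by
  rw [kernelOp, Fin.init_snoc, Fin.snoc_last]

/-- Merging stays inside the sets `Γ`, because these are closed under multiplication by a function
`h_i` from the right. -/
theorem IsValid.merge (hD : D.IsValid μ 𝓕 Y V₀ V h word) (i : Fin d₂) :
    (D.merge h i).IsValid μ 𝓕 Y V₀ V h (word ++ [i]) where
  words_ne := forall_snoc (g := Fin.init D.words) (b := []) (R := fun u _ => u ≠ [])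
    (fun p => hD.words_ne p.castSucc) (by simp)
  flatten := by
    rw [← hD.flatten]
    simp only [RepTerm.merge]
    rw [ofFn_snoc, List.ofFn_succ' D.words, List.concat_eq_append]
    simp [Fin.init_def]
  gamma := forall_snoc (R := fun S u => S ∈ opGamma V₀ V h u) (fun p => hD.gamma p.castSucc)
    (comp_opPhi_mem_opGamma (hD.words_ne _) (by simp) (hD.gamma _))
  theta := hD.theta
  deg_pos := hD.deg_pos
  len_add_deg := by
    have := hD.len_add_deg
    simp only [RepTerm.merge, List.length_append, List.length_singleton]
    omega

theorem IsValid.extend (hD : D.IsValid μ 𝓕 Y V₀ V h word) (i : Fin d₂) :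
    (D.extend V₀ V h i).IsValid μ 𝓕 Y V₀ V h (word ++ [i]) where
  words_ne := forall_snoc (g := D.words) (b := []) (R := fun u _ => u ≠ []) hD.words_ne (by simp)
  flatten := by
    rw [← hD.flatten]
    simp only [RepTerm.extend]
    rw [ofFn_snoc]
    simp
  gamma := forall_snoc (R := fun S u => S ∈ opGamma V₀ V h u) hD.gamma (Or.inl (Or.inr rfl))
  theta := thetaSpace_comp hD.theta Fin.castSucc
  deg_pos := hD.deg_pos
  len_add_deg := by
    have := hD.len_add_deg
    simp only [RepTerm.extend, List.length_append, List.length_singleton]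
    omega

theorem IsValid.absorb (hD : D.IsValid μ 𝓕 Y V₀ V h word) (hlen : 0 < D.len) :
    (D.absorb μ 𝓕 Y).IsValid μ 𝓕 Y V₀ V h word where
  words_ne := hD.words_ne
  flatten := hD.flatten
  gamma := hD.gamma
  theta := Submodule.neg_mem _ (iterQ_mul_mem_thetaSpace hD.theta hlen D.w (Fin.last D.k))
  deg_pos := Nat.add_pos_left hlen _
  len_add_deg := (Nat.zero_add _).trans hD.len_add_deg

variable [IsProbabilityMeasure μ]

theorem IsValid.continuous_integrand (hD : D.IsValid μ 𝓕 Y V₀ V h word)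
    (hY : ∀ i, IsDriver μ 𝓕 (Y i)) (hP : CbSemigroup P A) (hV₀ : IsCbSmooth V₀)
    (hV : ∀ i, IsCbSmooth (V i)) (hh : ∀ i, CbFun (h i)) {φ : StateSpace N → ℝ} (hφ : CbFun φ)
    (s t : ℝ≥0) (x : StateSpace N) (ω : Ω) : Continuous (D.integrand P s t φ x ω) :=
  (continuous_of_mem_thetaSpace hY hD.theta s ω).mul
    ((CbCont.kernelOp hP s (D.k + 1) (fun p => cbOp_of_mem_opGamma hV₀ hV hh (hD.gamma p))
      continuous_id continuous_const (CbCont.const hφ)).continuous_eval x)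

theorem simplexIntegral_neg_mul {k : ℕ} (c : ℝ) (s t : ℝ≥0) (F : (Fin k → ℝ≥0) → ℝ) :
    simplexIntegral k s t (fun τ => -(c * F τ)) = -(c * simplexIntegral k s t F) := by
  simp only [simplexIntegral]
  rw [integral_neg, integral_const_mul]

theorem value_absorb (hlen : 0 < D.len) (hD : D.IsValid μ 𝓕 Y V₀ V h word)
    (hY : ∀ i, IsDriver μ 𝓕 (Y i)) (hP : CbSemigroup P A) (hV₀ : IsCbSmooth V₀)
    (hV : ∀ i, IsCbSmooth (V i)) (hh : ∀ i, CbFun (h i)) {φ : StateSpace N → ℝ} (hφ : CbFun φ)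
    {s t : ℝ≥0} (hst : s ≤ t) (x : StateSpace N) (ω : Ω) :
    (D.absorb μ 𝓕 Y).value μ 𝓕 Y P s t φ x ω = -∫ v in (s : ℝ)..t,
      iterQ μ 𝓕 Y s D.len D.w v.toNNReal ω * simplexIntegral D.k s v.toNNReal fun τ =>
        D.integrand P s t φ x ω (Fin.snoc (α := fun _ => ℝ≥0) τ v.toNNReal) := by
  have h1 : simplexIntegral (D.k + 1) s t ((D.absorb μ 𝓕 Y).integrand P s t φ x ω) = _ :=
    simplexIntegral_succ (k := D.k)
    (F := (D.absorb μ 𝓕 Y).integrand P s t φ x ω)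
    ((hD.absorb hlen).continuous_integrand hY hP hV₀ hV hh hφ s t x ω) hst
  have h2 : (D.absorb μ 𝓕 Y).value μ 𝓕 Y P s t φ x ω =
      1 * simplexIntegral (D.k + 1) s t ((D.absorb μ 𝓕 Y).integrand P s t φ x ω) := rfl
  rw [h2, one_mul, h1, ← intervalIntegral.integral_neg]
  congr 1
  funext v
  rw [← simplexIntegral_neg_mul]
  congr 1
  funext τ
  simp only [integrand, absorb, Fin.snoc_last]
  ring

theorem opPhi_singleton (i : Fin d₂) (φ : StateSpace N → ℝ) :
    opPhi h [i] φ = fun y => h i y * φ y := by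
  funext y
  simp [opPhi, wordProd]

/-- Multiplying by `h_i` in the middle of the evolution: the simplex integral splits into the
contributions of the merged and of the extended term. -/
theorem IsValid.simplexIntegral_mul (hD : D.IsValid μ 𝓕 Y V₀ V h word)
    (hY : ∀ i, IsDriver μ 𝓕 (Y i)) (hP : CbSemigroup P A) (hV₀ : IsCbSmooth V₀)
    (hV : ∀ i, IsCbSmooth (V i)) (hh : ∀ i, CbFun (h i))
    (hA : ∀ φ, CbFun φ → A φ = signalGenerator V₀ V φ) (i : Fin d₂)
    {φ : StateSpace N → ℝ} (hφ : CbFun φ) {s r t : ℝ≥0} (hrt : r ≤ t)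
    (x : StateSpace N) (ω : Ω) :
    simplexIntegral (D.k + 1) s r (D.integrand P s r (fun y => h i y * P (t - r) φ y) x ω) =
      simplexIntegral (D.k + 1) s r ((D.merge h i).integrand P s t φ x ω) +
      simplexIntegral (D.k + 2) s r ((D.extend V₀ V h i).integrand P s t φ x ω) := by
  have hT : ∀ p, CbOp (D.T p) := fun p => cbOp_of_mem_opGamma hV₀ hV hh (hD.gamma p)
  have c0 := hD.continuous_integrand hY hP hV₀ hV hh ((hh i).mul (hP.cb hφ (t - r))) s r x ω
  have c1 := (hD.merge i).continuous_integrand hY hP hV₀ hV hh hφ s t x ω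
  have c2 := (hD.extend i).continuous_integrand hY hP hV₀ hV hh hφ s t x ω
  have h2 : simplexIntegral (D.k + 2) s r ((D.extend V₀ V h i).integrand P s t φ x ω) =
      simplexIntegral (D.k + 1) s r fun τ =>
        D.integrand P s r (fun y => h i y * P (t - r) φ y) x ω τ -
          (D.merge h i).integrand P s t φ x ω τ := by
    refine (simplexIntegral_succ' (F := (D.extend V₀ V h i).integrand P s t φ x ω) c2 s r).trans ?_
    refine setIntegral_congr_fun (measurableSet_openSimplex _ _ _) fun τ hτ => ?_
    set τ' : Fin (D.k + 1) → ℝ≥0 := fun i => (τ i).toNNReal with hτ'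
    have hlast : τ' (Fin.last D.k) ≤ r := Real.toNNReal_le_iff_le_coe.2 (hτ.2 _).2.le
    have hL : CbOp (kernelOp P s D.k (Fin.init D.T) (Fin.init τ') (τ' (Fin.last D.k)) ∘
        D.T (Fin.last D.k)) :=
      (hP.cbOp_kernelOp s D.k (fun p => hT p.castSucc) _ _).comp (hT _)
    have hw := cbFun_wordProd hh [i]
    have key := hP.sub_eq_integral hL (cbOp_opPsi hV₀ hV hh [i]) hw (fun ψ hψ y => by
      rw [hA _ (hw.mul hψ), hA _ hψ, signalGenerator_mul hV hw hψ]
      rfl) hφ x (le_refl (τ' (Fin.last D.k))) hlast hrt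
    rw [tsub_self, hP.zero] at key
    have hwp : wordProd h [i] = h i := by funext y; simp [wordProd]
    have e1 : ∀ v : ℝ, (D.extend V₀ V h i).integrand P s t φ x ω
        (Fin.snoc (α := fun _ => ℝ≥0) τ' v.toNNReal) = D.b s τ' ω *
          (kernelOp P s D.k (Fin.init D.T) (Fin.init τ') (τ' (Fin.last D.k)) ∘
            D.T (Fin.last D.k)) (P (v.toNNReal - τ' (Fin.last D.k))
              (opPsi V₀ V h [i] (P (t - v.toNNReal) φ))) x := fun v => by
      have e4 : (D.extend V₀ V h i).integrand P s t φ x ω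
          (Fin.snoc (α := fun _ => ℝ≥0) τ' v.toNNReal) =
          D.b s (Fin.init (Fin.snoc (α := fun _ => ℝ≥0) τ' v.toNNReal)) ω *
          kernelOp P s (D.k + 2) (Fin.snoc (α := fun _ => FunOp N) D.T (opPsi V₀ V h [i]))
            (Fin.snoc (α := fun _ => ℝ≥0) τ' v.toNNReal) t φ x := rfl
      rw [e4, kernelOp_snoc, Fin.init_snoc, Fin.snoc_last]
      rfl
    have e2 : (D.merge h i).integrand P s t φ x ω τ' = D.b s τ' ω *
        (kernelOp P s D.k (Fin.init D.T) (Fin.init τ') (τ' (Fin.last D.k)) ∘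
          D.T (Fin.last D.k)) (fun y => wordProd h [i] y * P (t - τ' (Fin.last D.k)) φ y) x := by
      have e4 : (D.merge h i).integrand P s t φ x ω τ' = D.b s τ' ω *
          kernelOp P s (D.k + 1) (Fin.snoc (α := fun _ => FunOp N) (Fin.init D.T)
            (D.T (Fin.last D.k) ∘ opPhi h [i])) τ' t φ x := rfl
      rw [e4, kernelOp_snoc]
      rfl
    have e3 : D.integrand P s r (fun y => h i y * P (t - r) φ y) x ω τ' = D.b s τ' ω *
        (kernelOp P s D.k (Fin.init D.T) (Fin.init τ') (τ' (Fin.last D.k)) ∘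
          D.T (Fin.last D.k)) (P (r - τ' (Fin.last D.k))
            fun y => wordProd h [i] y * P (t - r) φ y) x := by
      rw [hwp]
      rfl
    have e5 : (fun v : ℝ => (D.extend V₀ V h i).integrand P s t φ x ω
        (Fin.snoc (α := fun _ => ℝ≥0) τ' v.toNNReal)) = _ := funext e1
    refine (congrArg (fun f : ℝ → ℝ => ∫ v in (τ' (Fin.last D.k) : ℝ)..r, f v) e5).trans
      (Eq.trans ?_ (congrArg₂ (· - ·) e3 e2).symm)
    rw [intervalIntegral.integral_const_mul, ← key]
    exact mul_sub _ _ _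
  have h3 : simplexIntegral (D.k + 1) s r (fun τ =>
        D.integrand P s r (fun y => h i y * P (t - r) φ y) x ω τ -
          (D.merge h i).integrand P s t φ x ω τ) =
      simplexIntegral (D.k + 1) s r (D.integrand P s r (fun y => h i y * P (t - r) φ y) x ω) -
      simplexIntegral (D.k + 1) s r ((D.merge h i).integrand P s t φ x ω) :=
    integral_sub (simplexIntegrable_of_continuous c0 s r)
      (simplexIntegrable_of_continuous (k := D.k + 1) c1 s r)
  rw [h2, h3]
  ring

end RepTerm

end Terms

/-! ### The representation of the multiple integrals -/

section Representation

variable {Ω : Type*} {mΩ : MeasurableSpace Ω} {μ : Measure Ω} {𝓕 : Filtration ℝ≥0 mΩ}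
  {N d₁ d₂ : ℕ} {Y : Fin d₂ → ℝ≥0 → Ω → ℝ} {V₀ : StateSpace N → StateSpace N}
  {V : Fin d₁ → StateSpace N → StateSpace N} {h : Fin d₂ → StateSpace N → ℝ}
  {P : ℝ≥0 → FunOp N} {A : FunOp N} {word : List (Fin d₂)} {D : RepTerm Ω N d₂}

/-- The four terms that arise from a term when a further stochastic integral is taken: `h_i` is
merged with the last operator or moved to a new last time, and integration by parts leaves a
boundary term or an integral. -/
noncomputable def RepTerm.children (μ : Measure Ω) (𝓕 : Filtration ℝ≥0 mΩ)
    (Y : Fin d₂ → ℝ≥0 → Ω → ℝ) (V₀ : StateSpace N → StateSpace N)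
    (V : Fin d₁ → StateSpace N → StateSpace N) (h : Fin d₂ → StateSpace N → ℝ)
    (D : RepTerm Ω N d₂) (i : Fin d₂) : Fin 4 → RepTerm Ω N d₂ :=
  ![D.merge h i, D.extend V₀ V h i, (D.merge h i).absorb μ 𝓕 Y, (D.extend V₀ V h i).absorb μ 𝓕 Y]

theorem RepTerm.IsValid.children (hD : D.IsValid μ 𝓕 Y V₀ V h word) (i : Fin d₂) (c : Fin 4) :
    (D.children μ 𝓕 Y V₀ V h i c).IsValid μ 𝓕 Y V₀ V h (word ++ [i]) := by
  fin_cases c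
  · exact hD.merge i
  · exact hD.extend i
  · exact (hD.merge i).absorb (Nat.succ_pos _)
  · exact (hD.extend i).absorb (Nat.succ_pos _)

/-- The term with the operator `Ψ` of the whole word that integration by parts produces from the
leading term: minus the integral of `q_{s,τ}(Y) P_{τ-s} Ψ P_{t-τ} φ` over `τ`. -/
noncomputable def leadTerm (μ : Measure Ω) (𝓕 : Filtration ℝ≥0 mΩ) (Y : Fin d₂ → ℝ≥0 → Ω → ℝ)
    (V₀ : StateSpace N → StateSpace N) (V : Fin d₁ → StateSpace N → StateSpace N)
    (h : Fin d₂ → StateSpace N → ℝ) {m : ℕ} (ι : Fin m → Fin d₂) : RepTerm Ω N d₂ :=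
  ⟨0, 0, m, Fin.elim0, fun _ => List.ofFn ι, fun _ => opPsi V₀ V h (List.ofFn ι),
    fun s τ ω => -iterQ μ 𝓕 Y s m ι (τ 0) ω⟩

theorem isValid_leadTerm {m : ℕ} (hm : 0 < m) (ι : Fin m → Fin d₂) :
    (leadTerm μ 𝓕 Y V₀ V h ι).IsValid μ 𝓕 Y V₀ V h (List.ofFn ι) where
  words_ne _ hn := by
    have := congrArg List.length hn
    simp [leadTerm] at this
    omega
  flatten := by simp [leadTerm]
  gamma _ := Or.inl (Or.inr rfl)
  theta := Submodule.neg_mem _ (iterQ_mem_thetaSpace hm ι (0 : Fin 1))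
  deg_pos := hm
  len_add_deg := by simp [leadTerm]

theorem simplexIntegral_zero (s t : ℝ≥0) (F : (Fin 0 → ℝ≥0) → ℝ) :
    simplexIntegral 0 s t F = F ![] := by
  have hu : openSimplex 0 s t = Set.univ := by
    ext τ
    simp [openSimplex, StrictMono]
  have he : (fun τ : Fin 0 → ℝ => F fun i => (τ i).toNNReal) = fun _ => F ![] := by
    funext τ
    congr 1
    exact Subsingleton.elim _ _
  rw [simplexIntegral, hu, setIntegral_univ, he, integral_const]
  simp [volume_pi, measureReal_def]

variable [IsProbabilityMeasure μ]

theorem value_leadTerm {m : ℕ} (hm : 0 < m) (ι : Fin m → Fin d₂)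
    (hY : ∀ i, IsDriver μ 𝓕 (Y i)) (hP : CbSemigroup P A) (hV₀ : IsCbSmooth V₀)
    (hV : ∀ i, IsCbSmooth (V i)) (hh : ∀ i, CbFun (h i)) {φ : StateSpace N → ℝ} (hφ : CbFun φ)
    {s t : ℝ≥0} (hst : s ≤ t) (x : StateSpace N) (ω : Ω) :
    (leadTerm μ 𝓕 Y V₀ V h ι).value μ 𝓕 Y P s t φ x ω = -∫ v in (s : ℝ)..t,
      iterQ μ 𝓕 Y s m ι v.toNNReal ω *
        P (v.toNNReal - s) (opPsi V₀ V h (List.ofFn ι) (P (t - v.toNNReal) φ)) x := by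
  have h1 : (leadTerm μ 𝓕 Y V₀ V h ι).value μ 𝓕 Y P s t φ x ω =
      1 * simplexIntegral 1 s t ((leadTerm μ 𝓕 Y V₀ V h ι).integrand P s t φ x ω) := rfl
  rw [h1, one_mul]
  refine (simplexIntegral_succ (k := 0)
    (F := (leadTerm μ 𝓕 Y V₀ V h ι).integrand P s t φ x ω)
    ((isValid_leadTerm hm ι).continuous_integrand hY hP hV₀ hV hh hφ s t x ω) hst).trans ?_
  rw [← intervalIntegral.integral_neg]
  congr 1
  funext v
  rw [simplexIntegral_zero]
  exact neg_mul _ _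

/-- The effect of integration by parts on a single term: with `ζ` the derivative of the simplex
integral `r ↦ Z_r`, the expression `J_t Z_t - ∫ J ζ` is the sum of the values of the children, where
`J` is the iterated integral in front, prolonged by the letter `i`. -/
theorem RepTerm.IsValid.sum_children (hD : D.IsValid μ 𝓕 Y V₀ V h word)
    (hY : ∀ i, IsDriver μ 𝓕 (Y i)) (hP : CbSemigroup P A) (hV₀ : IsCbSmooth V₀)
    (hV : ∀ i, IsCbSmooth (V i)) (hh : ∀ i, CbFun (h i))
    (hA : ∀ φ, CbFun φ → A φ = signalGenerator V₀ V φ) (i : Fin d₂)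
    {φ : StateSpace N → ℝ} (hφ : CbFun φ) {s t : ℝ≥0} (hst : s ≤ t)
    (x : StateSpace N) (ω : Ω) : ∃ ζ : ℝ → ℝ, IntervalIntegrable ζ volume s t ∧
      (∃ C, ∀ v ∈ Set.Ioc (s : ℝ) t, |ζ v| ≤ C) ∧
      (∀ r ∈ Set.Icc s t, simplexIntegral (D.k + 1) s r
          (D.integrand P s r (fun y => h i y * P (t - r) φ y) x ω) -
        simplexIntegral (D.k + 1) s s
          (D.integrand P s s (fun y => h i y * P (t - s) φ y) x ω) = ∫ v in (s : ℝ)..r, ζ v) ∧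
      iterQ μ 𝓕 Y s (D.len + 1) (Fin.snoc (α := fun _ => Fin d₂) D.w i) t ω *
          simplexIntegral (D.k + 1) s t
            (D.integrand P s t (fun y => h i y * P (t - t) φ y) x ω) -
        ∫ v in (s : ℝ)..t, iterQ μ 𝓕 Y s (D.len + 1) (Fin.snoc (α := fun _ => Fin d₂) D.w i)
          v.toNNReal ω * ζ v =
        ∑ c, (D.children μ 𝓕 Y V₀ V h i c).value μ 𝓕 Y P s t φ x ω := by
  have c1 : Continuous ((D.merge h i).integrand P s t φ x ω) :=
    (hD.merge i).continuous_integrand hY hP hV₀ hV hh hφ s t x ω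
  have c2 : Continuous ((D.extend V₀ V h i).integrand P s t φ x ω) :=
    (hD.extend i).continuous_integrand hY hP hV₀ hV hh hφ s t x ω
  set ζ₁ : ℝ → ℝ := fun v => simplexIntegral D.k s v.toNNReal fun τ =>
    (D.merge h i).integrand P s t φ x ω (Fin.snoc (α := fun _ => ℝ≥0) τ v.toNNReal) with hζ₁
  set ζ₂ : ℝ → ℝ := fun v => simplexIntegral (D.k + 1) s v.toNNReal fun τ =>
    (D.extend V₀ V h i).integrand P s t φ x ω
      (Fin.snoc (α := fun _ => ℝ≥0) τ v.toNNReal) with hζ₂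
  have i1 : ∀ r, s ≤ r → IntervalIntegrable ζ₁ volume s r := fun r hr =>
    intervalIntegrable_simplexIntegral (k := D.k) c1 hr
  have i2 : ∀ r, s ≤ r → IntervalIntegrable ζ₂ volume s r := fun r hr =>
    intervalIntegrable_simplexIntegral (k := D.k + 1) c2 hr
  have hq := continuous_iterQ hY s (D.len + 1) (Fin.snoc (α := fun _ => Fin d₂) D.w i) ω
  refine ⟨fun v => ζ₁ v + ζ₂ v, (i1 t hst).add (i2 t hst), ?_, fun r hr => ?_, ?_⟩
  · obtain ⟨C₁, hC₁⟩ := exists_abs_simplexIntegral_le (k := D.k) c1 s t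
    obtain ⟨C₂, hC₂⟩ := exists_abs_simplexIntegral_le (k := D.k + 1) c2 s t
    exact ⟨C₁ + C₂, fun v hv => (abs_add_le _ _).trans (add_le_add (hC₁ v hv) (hC₂ v hv))⟩
  · have e1 : simplexIntegral (D.k + 1) s r ((D.merge h i).integrand P s t φ x ω) =
        ∫ v in (s : ℝ)..r, ζ₁ v := simplexIntegral_succ (k := D.k) c1 hr.1
    have e2 : simplexIntegral (D.k + 2) s r ((D.extend V₀ V h i).integrand P s t φ x ω) =
        ∫ v in (s : ℝ)..r, ζ₂ v := simplexIntegral_succ (k := D.k + 1) c2 hr.1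
    rw [simplexIntegral_self, sub_zero,
      hD.simplexIntegral_mul hY hP hV₀ hV hh hA i hφ hr.2 x ω, e1, e2,
      intervalIntegral.integral_add (i1 r hr.1) (i2 r hr.1)]
  · rw [hD.simplexIntegral_mul hY hP hV₀ hV hh hA i hφ le_rfl x ω, Fin.sum_univ_four]
    have v3 := RepTerm.value_absorb (D := D.merge h i) (Nat.succ_pos _) (hD.merge i) hY hP hV₀ hV
      hh hφ hst x ω
    have v4 := RepTerm.value_absorb (D := D.extend V₀ V h i) (Nat.succ_pos _) (hD.extend i) hY hP
      hV₀ hV hh hφ hst x ω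
    change _ = (D.merge h i).value μ 𝓕 Y P s t φ x ω + (D.extend V₀ V h i).value μ 𝓕 Y P s t φ x ω +
      ((D.merge h i).absorb μ 𝓕 Y).value μ 𝓕 Y P s t φ x ω +
      ((D.extend V₀ V h i).absorb μ 𝓕 Y).value μ 𝓕 Y P s t φ x ω
    rw [v3, v4]
    have e3 : (∫ v in (s : ℝ)..t, iterQ μ 𝓕 Y s (D.len + 1)
        (Fin.snoc (α := fun _ => Fin d₂) D.w i) v.toNNReal ω * (ζ₁ v + ζ₂ v)) =
        (∫ v in (s : ℝ)..t, iterQ μ 𝓕 Y s (D.len + 1)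
          (Fin.snoc (α := fun _ => Fin d₂) D.w i) v.toNNReal ω * ζ₁ v) +
        ∫ v in (s : ℝ)..t, iterQ μ 𝓕 Y s (D.len + 1)
          (Fin.snoc (α := fun _ => Fin d₂) D.w i) v.toNNReal ω * ζ₂ v := by
      simp only [mul_add]
      exact intervalIntegral.integral_add ((i1 t hst).continuousOn_mul (by fun_prop))
        ((i2 t hst).continuousOn_mul (by fun_prop))
    rw [e3, mul_add]
    simp only [RepTerm.value]
    change _ = _ + _ + -(∫ v in (s : ℝ)..t, iterQ μ 𝓕 Y s (D.len + 1)
        (Fin.snoc (α := fun _ => Fin d₂) D.w i) v.toNNReal ω * ζ₁ v) +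
      -∫ v in (s : ℝ)..t, iterQ μ 𝓕 Y s (D.len + 1)
        (Fin.snoc (α := fun _ => Fin d₂) D.w i) v.toNNReal ω * ζ₂ v
    rw [sub_add_eq_sub_sub, sub_eq_add_neg, sub_eq_add_neg]
    rfl

theorem continuous_multipleKernel (hP : CbSemigroup P A) (hh : ∀ i, CbFun (h i)) {m : ℕ}
    (ι : Fin m → Fin d₂) (s t : ℝ≥0) {φ : StateSpace N → ℝ} (hφ : CbFun φ) (x : StateSpace N) :
    Continuous (multipleKernel P h ι s t φ x) :=
  (CbCont.kernelOp hP s m (fun p => CbOp.mul_left (hh (ι p))) continuous_id continuous_const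
    (CbCont.const hφ)).continuous_eval x

theorem iteratedItoExists_multipleKernel (hY : ∀ i, IsDriver μ 𝓕 (Y i)) (hP : CbSemigroup P A)
    (hh : ∀ i, CbFun (h i)) {m : ℕ} (ι : Fin m → Fin d₂) {s t : ℝ≥0} (hst : s ≤ t)
    {φ : StateSpace N → ℝ} (hφ : CbFun φ) (x : StateSpace N) :
    IteratedItoExists μ 𝓕 Y s m ι (multipleKernel P h ι s t φ x) t :=
  (iterSpec hY s m ι).exists_integral (continuous_multipleKernel hP hh ι s t hφ x) hst

/-- The representation of `R^{m,ι}_{s,t}(φ)`. By induction on `m`: the integrand of the last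
stochastic integral is `R^{m}_{s,r}(h_i P_{t-r} φ)`, whose representation is a sum of products `Q Z`
of an iterated integral `Q` and a function `Z` of bounded variation, and the integral of each of
these products is computed by integration by parts. -/
theorem exists_representation (hY : ∀ i, IsDriver μ 𝓕 (Y i)) (hP : CbSemigroup P A)
    (hV₀ : IsCbSmooth V₀) (hV : ∀ i, IsCbSmooth (V i)) (hh : ∀ i, CbFun (h i))
    (hA : ∀ φ, CbFun φ → A φ = signalGenerator V₀ V φ) : ∀ (m : ℕ) (ι : Fin m → Fin d₂),
    ∃ (κ : Type) (_ : Fintype κ) (D : κ → RepTerm Ω N d₂),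
      (∀ j, (D j).IsValid μ 𝓕 Y V₀ V h (List.ofFn ι)) ∧
      ∀ φ, CbFun φ → ∀ (x : StateSpace N) (s t : ℝ≥0), s ≤ t →
        multipleR μ 𝓕 Y P h ι s t φ x =ᵐ[μ] fun ω =>
          P (t - s) (opPhi h (List.ofFn ι) φ) x * iterQ μ 𝓕 Y s m ι t ω +
            ∑ j, (D j).value μ 𝓕 Y P s t φ x ω
  | 0, ι => by
    refine ⟨Empty, inferInstance, fun e => e.elim, fun e => e.elim, fun φ _ x s t _ =>
      ae_of_all _ fun ω => ?_⟩
    have : opPhi h (List.ofFn ι) φ = φ := by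
      funext y
      simp [opPhi, wordProd]
    rw [this]
    simp [multipleR, iteratedIto, multipleKernel, kernelOp, iterQ]
  | m + 1, ι => by
    obtain ⟨κ, hκ, D, hD, hrep⟩ := exists_representation hY hP hV₀ hV hh hA m (Fin.init ι)
    set i : Fin d₂ := ι (Fin.last m) with hi
    have hword : List.ofFn ι = List.ofFn (Fin.init ι) ++ [i] := by
      rw [List.ofFn_succ', List.concat_eq_append]
      rfl
    refine ⟨Option (κ × Fin 4), inferInstance,
      fun o => o.elim (leadTerm μ 𝓕 Y V₀ V h ι) fun p => (D p.1).children μ 𝓕 Y V₀ V h i p.2,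
      ?_, fun φ hφ x s t hst => ?_⟩
    · rintro (_ | ⟨j, c⟩)
      · exact isValid_leadTerm (Nat.succ_pos m) ι
      · rw [hword]
        exact (hD j).children i c
    -- the derivative of the coefficient of the leading term
    have hw := cbFun_wordProd hh (List.ofFn ι)
    have hΨ := cbOp_opPsi hV₀ hV hh (List.ofFn ι)
    have hζc : Continuous fun v : ℝ≥0 =>
        P (v - s) (opPsi V₀ V h (List.ofFn ι) (P (t - v) φ)) x :=
      ((((CbCont.const hφ).semigroup hP (continuous_const.sub continuous_id)).op hΨ).semigroup hP
        (continuous_id.sub continuous_const)).continuous_eval x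
    have hlead : ∀ r ∈ Set.Icc s t,
        P (r - s) (fun y => wordProd h (List.ofFn ι) y * P (t - r) φ y) x -
          P (s - s) (fun y => wordProd h (List.ofFn ι) y * P (t - s) φ y) x =
        ∫ v in (s : ℝ)..r, P (v.toNNReal - s)
          (opPsi V₀ V h (List.ofFn ι) (P (t - v.toNNReal) φ)) x := fun r hr =>
      hP.sub_eq_integral CbOp.id hΨ hw (fun ψ hψ y => by
        rw [hA _ (hw.mul hψ), hA _ hψ, signalGenerator_mul hV hw hψ]
        rfl) hφ x le_rfl hr.1 hr.2
    choose ζ hζ1 hζ2 hζ3 hζ4 using fun ω j =>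
      (hD j).sum_children hY hP hV₀ hV hh hA i hφ hst x ω
    -- integration by parts is applied to the leading term and to the terms `D j` together
    set Q : Option κ → ℝ≥0 → Ω → ℝ := fun o => o.elim (iterQ μ 𝓕 Y s m (Fin.init ι))
      fun j => iterQ μ 𝓕 Y s (D j).len (D j).w with hQ
    set J : Option κ → ℝ≥0 → Ω → ℝ := fun o => o.elim (iterQ μ 𝓕 Y s (m + 1) ι)
      fun j => iterQ μ 𝓕 Y s ((D j).len + 1) (Fin.snoc (α := fun _ => Fin d₂) (D j).w i) with hJdef
    set Z : Option κ → ℝ≥0 → Ω → ℝ := fun o => o.elim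
      (fun r _ => P (r - s) (fun y => wordProd h (List.ofFn ι) y * P (t - r) φ y) x)
      fun j r ω => simplexIntegral ((D j).k + 1) s r
        ((D j).integrand P s r (fun y => h i y * P (t - r) φ y) x ω) with hZ
    set ξ : Option κ → ℝ → Ω → ℝ := fun o => o.elim
      (fun v _ => P (v.toNNReal - s) (opPsi V₀ V h (List.ofFn ι) (P (t - v.toNNReal) φ)) x)
      fun j v ω => ζ ω j v with hξ
    have hKex : ∀ o, ∃ K, ∀ b, IsIntegrand μ 𝓕 s b (Q o) K := by
      rintro (_ | j)
      · exact exists_isIntegrand_iterQ hY s m (Fin.init ι)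
      · exact exists_isIntegrand_iterQ hY s (D j).len (D j).w
    choose KQ hKQ using hKex
    have hJ : ∀ o, IsItoProcess μ 𝓕 (Y i) (Q o) s (J o) := by
      rintro (_ | j)
      · exact isItoProcess_iterQ hY s m ι
      · have := isItoProcess_iterQ hY s (D j).len (Fin.snoc (α := fun _ => Fin d₂) (D j).w i)
        rwa [Fin.snoc_last, Fin.init_snoc] at this
    have hξi : ∀ ω o, IntervalIntegrable (fun v => ξ o v ω) volume s t := by
      rintro ω (_ | j)
      · exact (hζc.comp continuous_real_toNNReal).intervalIntegrable _ _
      · exact hζ1 ω j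
    have hξb : ∀ ω o, ∃ C, ∀ v ∈ Set.Ioc (s : ℝ) t, |ξ o v ω| ≤ C := by
      rintro ω (_ | j)
      · obtain ⟨C, hC⟩ := (isCompact_Icc (a := (s : ℝ)) (b := t)).exists_bound_of_continuousOn
          (hζc.comp continuous_real_toNNReal).continuousOn
        exact ⟨C, fun v hv => hC v (Set.Ioc_subset_Icc_self hv)⟩
      · exact hζ2 ω j
    have hξZ : ∀ ω o, ∀ r ∈ Set.Icc s t, Z o r ω - Z o s ω = ∫ v in (s : ℝ)..r, ξ o v ω := by
      rintro ω (_ | j) r hr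
      · exact hlead r hr
      · exact hζ3 ω j r hr
    have hphi : ∀ ψ : StateSpace N → ℝ, opPhi h (List.ofFn (Fin.init ι)) (fun y => h i y * ψ y) =
        fun y => wordProd h (List.ofFn ι) y * ψ y := fun ψ => by
      rw [← RepTerm.opPhi_singleton, opPhi_append, ← hword]
      rfl
    have hker := continuous_multipleKernel hP hh ι s t hφ x
    have hR := (iterSpec hY s m (Fin.init ι)).isIntegrand
      (K := fun r τ => multipleKernel P h ι s t φ x (Fin.snoc (α := fun _ => ℝ≥0) τ r))
      (hker.comp (continuous_snoc_prod m)) t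
    have hRZ : ∀ r ∈ Set.Icc s t, iteratedIto μ 𝓕 Y s m (Fin.init ι)
        (fun τ => multipleKernel P h ι s t φ x (Fin.snoc (α := fun _ => ℝ≥0) τ r)) r =ᵐ[μ]
        fun ω => ∑ o, Q o r ω * Z o r ω := fun r hr => by
      have h1 := hrep _ ((hh i).mul (hP.cb hφ (t - r))) x s r hr.1
      have h2 : (fun τ : Fin m → ℝ≥0 =>
          multipleKernel P h ι s t φ x (Fin.snoc (α := fun _ => ℝ≥0) τ r)) =
          multipleKernel P h (Fin.init ι) s r (fun y => h i y * P (t - r) φ y) x := by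
        funext τ
        rw [multipleKernel, kernelOp, Fin.init_snoc, Fin.snoc_last]
        rfl
      rw [h2]
      filter_upwards [h1] with ω hω
      refine hω.trans ?_
      rw [hphi, Fintype.sum_option, mul_comm]
      rfl
    have hfin := itoIntegral_ae_eq_sum (hY i) hst (fun o => hKQ o t) hJ hξi hξb hξZ hR hRZ
    filter_upwards [hfin] with ω hω
    refine hω.trans ?_
    rw [Fintype.sum_option, Fintype.sum_option, Fintype.sum_prod_type]
    have e1 : ∀ j, J (some j) t ω * Z (some j) t ω -
        ∫ v in (s : ℝ)..t, J (some j) v.toNNReal ω * ξ (some j) v ω =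
        ∑ c, ((D j).children μ 𝓕 Y V₀ V h i c).value μ 𝓕 Y P s t φ x ω := fun j => hζ4 ω j
    have e2 : Z none t ω = P (t - s) (opPhi h (List.ofFn ι) φ) x := by
      change P (t - s) (fun y => wordProd h (List.ofFn ι) y * P (t - t) φ y) x = _
      rw [tsub_self, hP.zero]
      rfl
    have e3 := value_leadTerm (μ := μ) (𝓕 := 𝓕) (Nat.succ_pos m) ι hY hP hV₀ hV hh hφ hst x ω
    rw [Finset.sum_congr rfl fun j _ => e1 j, e2]
    simp only [Option.elim_none, Option.elim_some]
    rw [e3, ← add_assoc]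
    congr 1
    rw [mul_comm, sub_eq_add_neg]
    rfl

end Representation

/-! ### Decompositions of the word and the signal semigroup -/

section Packaging

/-- A decomposition of the word `ι` into non-empty words is given by a composition of its length. -/
theorem exists_composition_wordBlock {d₂ m k : ℕ} (ι : Fin m → Fin d₂)
    (words : Fin k → List (Fin d₂)) (hne : ∀ p, words p ≠ [])
    (hflat : (List.ofFn words).flatten = List.ofFn ι) :
    ∃ (c : Composition m) (hk : c.length = k), ∀ p, wordBlock ι c p = words (Fin.cast hk p) := by
  have hsum : ((List.ofFn words).map List.length).sum = m := by
    rw [← List.length_flatten, hflat, List.length_ofFn]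
  set c : Composition m := ⟨(List.ofFn words).map List.length, fun {i} hi => by
    obtain ⟨u, hu, rfl⟩ := List.mem_map.1 hi
    obtain ⟨p, rfl⟩ := (List.mem_ofFn' _ _).1 hu
    exact List.length_pos_iff.2 (hne p), hsum⟩ with hc
  have hk : c.length = k := by simp [hc, Composition.length]
  refine ⟨c, hk, fun p => ?_⟩
  have hp : (p : ℕ) < (List.ofFn words).length := by
    rw [List.length_ofFn]
    exact hk ▸ p.2
  have h1 := List.drop_take_succ_flatten_eq_getElem (List.ofFn words) p hp
  rw [hflat] at h1
  have h2 : words (Fin.cast hk p) = (List.ofFn words)[(p : ℕ)] := by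
    rw [List.getElem_ofFn]
    rfl
  have h3 : c.blocksFun p = (words (Fin.cast hk p)).length := by
    rw [h2]
    simp [hc, Composition.blocksFun]
  refine List.ext_getElem (by simp [wordBlock, h3]) fun l hl hl' => ?_
  have h4 : (words (Fin.cast hk p))[l] = (List.drop (c.sizeUpTo p)
      (List.take (c.sizeUpTo (p + 1)) (List.ofFn ι)))[l]'(by
        have := congrArg List.length (h1.trans h2.symm)
        rw [← this] at hl'
        exact hl') :=
    List.getElem_of_eq (h2.trans h1.symm) _
  have h5 : (wordBlock ι c p)[l] = ι (c.embedding p ⟨l, by simpa [wordBlock] using hl⟩) := by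
    exact List.getElem_ofFn _
  refine (h5.trans ?_).trans (h4.trans (List.getElem_drop.trans
    (List.getElem_take.trans (List.getElem_ofFn _)))).symm
  exact congrArg ι (Fin.ext (c.coe_embedding p _))

variable {Ω : Type*} {mΩ : MeasurableSpace Ω} {μ : Measure Ω} {𝓕 : Filtration ℝ≥0 mΩ}
  {N d₁ d₂ : ℕ} {Y : Fin d₂ → ℝ≥0 → Ω → ℝ} {V₀ : StateSpace N → StateSpace N}
  {V : Fin d₁ → StateSpace N → StateSpace N} {h : Fin d₂ → StateSpace N → ℝ}

theorem exists_composition_reindex {m k deg : ℕ} {ι : Fin m → Fin d₂}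
    {words : Fin k → List (Fin d₂)} (T : Fin k → FunOp N) {b : ℝ≥0 → (Fin k → ℝ≥0) → Ω → ℝ}
    (hne : ∀ p, words p ≠ []) (hflat : (List.ofFn words).flatten = List.ofFn ι)
    (hT : ∀ p, T p ∈ opGamma V₀ V h (words p)) (hb : b ∈ thetaSpace μ 𝓕 Y k deg) :
    ∃ (c : Composition m) (T' : Fin c.length → FunOp N)
      (b' : ℝ≥0 → (Fin c.length → ℝ≥0) → Ω → ℝ),
      (∀ p, T' p ∈ opGamma V₀ V h (wordBlock ι c p)) ∧ b' ∈ thetaSpace μ 𝓕 Y c.length deg ∧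
      ∀ (P : ℝ≥0 → FunOp N) (s t : ℝ≥0) (φ : StateSpace N → ℝ) (x : StateSpace N) (ω : Ω),
        (SimplexIntegrable k s t (fun τ => b s τ ω * kernelOp P s k T τ t φ x) →
          SimplexIntegrable c.length s t fun τ =>
            b' s τ ω * kernelOp P s c.length T' τ t φ x) ∧
        simplexIntegral k s t (fun τ => b s τ ω * kernelOp P s k T τ t φ x) =
          simplexIntegral c.length s t fun τ =>
            b' s τ ω * kernelOp P s c.length T' τ t φ x := by
  obtain ⟨c, hk, hc⟩ := exists_composition_wordBlock ι words hne hflat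
  subst hk
  exact ⟨c, T, b, fun p => by rw [hc]; exact hT p, hb, fun _ _ _ _ _ _ => ⟨id, rfl⟩⟩

/-- The operators and coefficients of a term, reindexed by the composition that describes the
decomposition of the word. -/
theorem RepTerm.IsValid.exists_composition {m : ℕ} {ι : Fin m → Fin d₂} {D : RepTerm Ω N d₂}
    (hD : D.IsValid μ 𝓕 Y V₀ V h (List.ofFn ι)) :
    ∃ (c : Composition m) (T : Fin c.length → FunOp N)
      (b : ℝ≥0 → (Fin c.length → ℝ≥0) → Ω → ℝ),
      (∀ p, T p ∈ opGamma V₀ V h (wordBlock ι c p)) ∧ b ∈ thetaSpace μ 𝓕 Y c.length D.deg ∧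
      ∀ (P : ℝ≥0 → FunOp N) (s t : ℝ≥0) (φ : StateSpace N → ℝ) (x : StateSpace N) (ω : Ω),
        (SimplexIntegrable (D.k + 1) s t (D.integrand P s t φ x ω) →
          SimplexIntegrable c.length s t fun τ =>
            b s τ ω * kernelOp P s c.length T τ t φ x) ∧
        D.value μ 𝓕 Y P s t φ x ω = iterQ μ 𝓕 Y s D.len D.w t ω *
          simplexIntegral c.length s t fun τ => b s τ ω * kernelOp P s c.length T τ t φ x := by
  obtain ⟨c, T, b, h1, h2, h3⟩ := exists_composition_reindex D.T hD.words_ne hD.flatten hD.gamma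
    hD.theta
  refine ⟨c, T, b, h1, h2, fun P s t φ x ω => ⟨(h3 P s t φ x ω).1, ?_⟩⟩
  rw [← (h3 P s t φ x ω).2]
  rfl

/-- The transition operators of the signal are regular on `C_b^∞`. The generator is written in the
coordinates of the Itô equation; `signalGenerator_eq_diffusionGen` identifies it with `A`. -/
theorem cbSemigroup_signalSemigroup [IsProbabilityMeasure μ] (hV₀ : IsCbSmooth V₀)
    (hV : ∀ i, IsCbSmooth (V i)) {B : Fin d₁ → ℝ≥0 → Ω → ℝ} (hB : IsFiltrationBrownian μ 𝓕 B)
    {X : StateSpace N → ℝ≥0 → Ω → StateSpace N} (hX : IsSignal μ 𝓕 V₀ V B X) :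
    CbSemigroup (signalSemigroup μ X)
      (diffusionGen (fun l y => itoDrift V₀ V y l) (fun i l y => V i y l)) := by
  have hb := cbFun_itoDrift hV₀ hV
  have hVl : ∀ i l, CbFun fun y => V i y l := fun i l => (hV i).cbFun_apply l
  obtain ⟨K, hK⟩ := CbFun.coeffBound (β := fun l y => itoDrift V₀ V y l)
    (σ := fun i l y => V i y l) hb hVl
  choose X' hX' hXX using fun x => hX.exists_isDiffusion hB.isDriver
    (fun i l => (hVl i l).1.continuous) (K := K) (fun i l => (hK.diff i l).abs_le) (fun l => (hb l).1.continuous) x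
  have he : signalSemigroup μ X = signalSemigroup μ X' := by
    funext t φ x
    refine integral_congr_ae ?_
    filter_upwards [hXX x t] with ω hω
    rw [hω]
  rw [he]
  exact cbSemigroup_of_isDiffusion hB hb hVl hX'

end Packaging

theorem mainTheorem5 {Ω : Type*} {mΩ : MeasurableSpace Ω} (μ : Measure Ω)
    [IsProbabilityMeasure μ] (𝓕 : Filtration ℝ≥0 mΩ) {N d₁ d₂ : ℕ}
    (V₀ : StateSpace N → StateSpace N) (V : Fin d₁ → StateSpace N → StateSpace N)
    (hV₀ : IsCbSmooth V₀) (hV : ∀ i, IsCbSmooth (V i))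
    (h : Fin d₂ → StateSpace N → ℝ) (hh : ∀ i, IsCbSmooth (h i))
    (B : Fin d₁ → ℝ≥0 → Ω → ℝ) (hB : IsFiltrationBrownian μ 𝓕 B)
    (X : StateSpace N → ℝ≥0 → Ω → StateSpace N) (hX : IsSignal μ 𝓕 V₀ V B X)
    (Y : Fin d₂ → ℝ≥0 → Ω → ℝ) (hY : IsFiltrationBrownian μ 𝓕 Y)
    {m : ℕ} (hm : 0 < m) (ι : Fin m → Fin d₂) :
    -- the iterated Itô integrals of `Y` exist, with continuous paths
    (∀ (s : ℝ≥0) (n : ℕ) (w : Fin (n + 1) → Fin d₂),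
      IsItoProcess μ 𝓕 (Y (w (Fin.last n))) (iterQ μ 𝓕 Y s n (Fin.init w)) s
        (iterQ μ 𝓕 Y s (n + 1) w)) ∧
    -- for every decomposition `c` of the word `ι` there are finitely many terms `ν`
    ∃ (n₂ n₃ : Composition m → ℕ)
      (Γ₂ : ∀ c, Fin (n₂ c) → Fin c.length → FunOp N)
      (Γ₃ : ∀ c, Fin (n₃ c) → Fin c.length → FunOp N)
      (dega degb : ∀ c, Fin (n₂ c) → ℕ)
      (a : ∀ c, Fin (n₂ c) → ℝ≥0 → (Fin 1 → ℝ≥0) → Ω → ℝ)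
      (b : ∀ c : Composition m, Fin (n₂ c) → ℝ≥0 → (Fin c.length → ℝ≥0) → Ω → ℝ)
      (C : ∀ c : Composition m, Fin (n₃ c) → ℝ≥0 → (Fin c.length → ℝ≥0) → Ω → ℝ),
      -- the operators belong to the sets `Γ` of the words of the decomposition
      (∀ c ν p, Γ₂ c ν p ∈ opGamma V₀ V h (wordBlock ι c p)) ∧
      (∀ c ν p, Γ₃ c ν p ∈ opGamma V₀ V h (wordBlock ι c p)) ∧
      -- the coefficients are polynomials in iterated integrals, of total degree `m`
      (∀ c ν, 0 < dega c ν ∧ 0 < degb c ν ∧ dega c ν + degb c ν = m ∧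
        a c ν ∈ thetaSpace μ 𝓕 Y 1 (dega c ν) ∧
        b c ν ∈ thetaSpace μ 𝓕 Y c.length (degb c ν)) ∧
      (∀ c ν, C c ν ∈ thetaSpace μ 𝓕 Y c.length m) ∧
      -- the pathwise representation
      ∀ φ : StateSpace N → ℝ, IsCbSmooth φ → ∀ (x : StateSpace N) (s t : ℝ≥0), s ≤ t →
        IteratedItoExists μ 𝓕 Y s m ι
          (multipleKernel (signalSemigroup μ X) h ι s t φ x) t ∧
        ∀ᵐ ω ∂μ,
          (∀ c ν, SimplexIntegrable c.length s t fun τ =>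
            b c ν s τ ω *
              kernelOp (signalSemigroup μ X) s c.length (Γ₂ c ν) τ t φ x) ∧
          (∀ c ν, SimplexIntegrable c.length s t fun τ =>
            C c ν s τ ω *
              kernelOp (signalSemigroup μ X) s c.length (Γ₃ c ν) τ t φ x) ∧
          multipleR μ 𝓕 Y (signalSemigroup μ X) h ι s t φ x ω =
            signalSemigroup μ X (t - s) (opPhi h (List.ofFn ι) φ) x * iterQ μ 𝓕 Y s m ι t ω +
            (∑ c : Composition m, ∑ ν : Fin (n₂ c),
              a c ν s (fun _ => t) ω * simplexIntegral c.length s t fun τ =>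
                b c ν s τ ω *
                  kernelOp (signalSemigroup μ X) s c.length (Γ₂ c ν) τ t φ x) +
            ∑ c : Composition m, ∑ ν : Fin (n₃ c),
              simplexIntegral c.length s t fun τ =>
                C c ν s τ ω *
                  kernelOp (signalSemigroup μ X) s c.length (Γ₃ c ν) τ t φ x := by
  have hYd := hY.isDriver
  have hhc : ∀ i, CbFun (h i) := fun i => (hh i).cbFun
  have hP := cbSemigroup_signalSemigroup hV₀ hV hB hX
  refine ⟨fun s n w => isItoProcess_iterQ hYd s n w, ?_⟩
  obtain ⟨κ, hκ, D, hD, hrep⟩ := exists_representation hYd hP hV₀ hV hhc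
    (fun φ hφ => (signalGenerator_eq_diffusionGen hV hφ).symm) m ι
  classical
  choose c T b hT hb hval using fun j => (hD j).exists_composition
  have hS : ∀ (e : Composition m) (j : {j : κ // c j = e}), ∃ (T' : Fin e.length → FunOp N)
      (b' : ℝ≥0 → (Fin e.length → ℝ≥0) → Ω → ℝ),
      (∀ p, T' p ∈ opGamma V₀ V h (wordBlock ι e p)) ∧
      b' ∈ thetaSpace μ 𝓕 Y e.length (D j).deg ∧
      ∀ s t φ x ω, CbFun φ → SimplexIntegrable e.length s t (fun τ =>
          b' s τ ω * kernelOp (signalSemigroup μ X) s e.length T' τ t φ x) ∧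
        (D j).value μ 𝓕 Y (signalSemigroup μ X) s t φ x ω =
          iterQ μ 𝓕 Y s (D j).len (D j).w t ω * simplexIntegral e.length s t fun τ =>
            b' s τ ω * kernelOp (signalSemigroup μ X) s e.length T' τ t φ x := by
    rintro e ⟨j, rfl⟩
    refine ⟨T j, b j, hT j, hb j, fun s t φ x ω hφ => ⟨(hval j _ s t φ x ω).1 ?_,
      (hval j _ s t φ x ω).2⟩⟩
    exact simplexIntegrable_of_continuous
      ((hD j).continuous_integrand hYd hP hV₀ hV hhc hφ s t x ω) s t
  choose T' b' hT' hb' hval' using hS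
  -- for each decomposition, the terms with and without an iterated integral in front
  let S₂ : Composition m → Type := fun e => {j : {j : κ // c j = e} // 0 < (D j).len}
  let S₃ : Composition m → Type := fun e => {j : {j : κ // c j = e} // ¬ 0 < (D j).len}
  let E₂ : ∀ e, Fin (Fintype.card (S₂ e)) ≃ S₂ e := fun e => (Fintype.equivFin (S₂ e)).symm
  let E₃ : ∀ e, Fin (Fintype.card (S₃ e)) ≃ S₃ e := fun e => (Fintype.equivFin (S₃ e)).symm
  have hdeg : ∀ j, (D j).len + (D j).deg = m := fun j => by
    simpa using (hD j).len_add_deg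
  refine ⟨fun e => Fintype.card (S₂ e), fun e => Fintype.card (S₃ e),
    fun e ν => T' e (E₂ e ν).1, fun e ν => T' e (E₃ e ν).1,
    fun e ν => (D (E₂ e ν).1).len, fun e ν => (D (E₂ e ν).1).deg,
    fun e ν s τ ω => iterQ μ 𝓕 Y s (D (E₂ e ν).1).len (D (E₂ e ν).1).w (τ 0) ω,
    fun e ν => b' e (E₂ e ν).1, fun e ν => b' e (E₃ e ν).1,
    fun e ν => hT' e _, fun e ν => hT' e _,
    fun e ν => ⟨(E₂ e ν).2, (hD _).deg_pos, hdeg _,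
      iterQ_mem_thetaSpace (E₂ e ν).2 _ 0, hb' e _⟩, fun e ν => ?_, fun φ hφ x s t hst => ?_⟩
  · have h1 := hb' e (E₃ e ν).1
    have h2 := hdeg (E₃ e ν).1
    rw [Nat.eq_zero_of_not_pos (E₃ e ν).2, Nat.zero_add] at h2
    rwa [h2] at h1
  · refine ⟨iteratedItoExists_multipleKernel hYd hP hhc ι hst hφ.cbFun x, ?_⟩
    filter_upwards [hrep φ hφ.cbFun x s t hst] with ω hω
    refine ⟨fun e ν => (hval' e _ s t φ x ω hφ.cbFun).1,
      fun e ν => (hval' e _ s t φ x ω hφ.cbFun).1, ?_⟩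
    rw [hω, add_assoc]
    congr 1
    rw [← Fintype.sum_fiberwise c, ← Finset.sum_add_distrib]
    refine Finset.sum_congr rfl fun e _ => ?_
    rw [← Fintype.sum_subtype_add_sum_subtype (fun j : {j : κ // c j = e} => 0 < (D j).len)]
    have hone : ∀ n (w : Fin n → Fin d₂), ¬ 0 < n → iterQ μ 𝓕 Y s n w t ω = 1 := by
      intro n w hn
      obtain rfl := Nat.eq_zero_of_not_pos hn
      rfl
    congr 1
    · rw [← (E₂ e).sum_comp]
      exact Finset.sum_congr rfl fun ν _ => (hval' e _ s t φ x ω hφ.cbFun).2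
    · rw [← (E₃ e).sum_comp]
      refine Finset.sum_congr rfl fun ν _ => ?_
      rw [(hval' e _ s t φ x ω hφ.cbFun).2, hone _ _ (E₃ e ν).2, one_mul]
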